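/- **Setting.** Let $P(t)=\{p_1(t),\dots,p_n(t)\}$ be $n$ points moving continuously in the plane, $t\in\mathbb R$, such that any two of them have the same $x$-coordinate at most $s$ times and any three are collinear at most $s$ times. Assume general position: the points are distinct at all times, and at any time there is at most one degeneracy (a pair of points with equal $x$-coordinates or a collinear triple). Order the points from left to right (ties of $x$-coordinates are broken by the $y$-coordinate), and add a dummy point $p_{-\infty}=(-\infty,-\infty)$ before and $p_{\infty}=(\infty,-\infty)$ after all others; the dummy points do not affect upper hulls of the moving points. Draw a uniformly random permutation $\pi$ of the moving points (their priorities), fixed during the motion. *Pseudo-triangulation.* $\mathcal{PT}^+(P(t))$ is obtained recursively, starting with the whole augmented set: for a set $Q$ of consecutive points with leftmost point $a$, rightmost point $c$ and at least one further point, let $b$ be the point of $Q\setminus\{a,c\}$ of minimum priority; output the pseudo-triangle with left endpoint $a$, apex $b$, right endpoint $c$, and recurse on $Q_L$ (the points of $Q$ from $a$ to $b$) and $Q_R$ (those from $b$ to $c$). A kinetic pseudo-triangle $\tau$ is a triple $(a,b,c)$ with a life span $I(\tau)$; it appears if $I(\tau)$ is a maximal connected set of times at which $\mathcal{PT}^+(P(t))$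 contains $(a,b,c)$. *Funnel.* If $b$ is not a vertex of the upper hull of $Q$, the bridge of $\tau$ is the upper common tangent segment of $Q_L$ and $Q_R$; the chains $\mathcal L(\tau)$ and $\mathcal R(\tau)$ are the portions of the upper hulls of $Q_L$ and $Q_R$ below the bridge, and the tails are the remaining portions. Bridge and chains bound the funnel of $\tau$, with base the bridge and apex $b$. If $b$ is a vertex of the upper hull of $Q$, the funnel is empty. *Triangulation.* $\mathcal T(\tau)$ is obtained from the funnel recursively: take the minimum-priority vertex $q$ of the current (sub-)pseudo-triangle other than its apex and the two ends of its base, and add the chord from $q$ to the vertex of the opposite chain that is visible from $q$ within the current pseudo-triangle and farthest from its apex along that chain; recurse on the two pseudo-triangles cut off by the chord. The edges of $\mathcal T(\tau)$ are the edges of the funnel and all chords. *Events.* $E_\tau$ is the number of envelope events, that is, times $t\in I(\tau)$ at which $\mathcal L(\tau)$ or $\mathcal R(\tau)$ contains three collinear points. $V_\tau$ is the number of visibility events, that is, times $t\in I(\tau)$ at which a vertex, other than the apex, of one chain is collinear with an edge of the opposite chain or of the tail that continues it (this includes the times at which the bridge is created or destroyed). $N_\tau$ is the number of moving points other than $b$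 that lie strictly between $a$ and $c$ in the left-to-right order at some time of $I(\tau)$. **Statement.** For every $s$ there is a constant $C$, depending only on $s$, such that for all such motions and every $\tau$ that appears for some $\pi$, the expected number of insertions and deletions of edges in $\mathcal T(\tau)$ during $I(\tau)$ (comparing, at each event, the situations right before and right after it), conditioned on $\tau$ appearing, is at most $$C\bigl((E_\tau+V_\tau)\log N_\tau+N_\tau^2\bigr)\quad\text{if } N_\tau\ge 1,\qquad\text{and at most}\quad C\,(E_\tau+V_\tau)\quad\text{if } N_\tau=0 .$$ -/

import Mathlib

namespace KineticTriangulation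

/-- `n` points moving in the plane: `p i t` is the position of the point `i` at time `t`. -/
abbrev Motion (n : ℕ) := Fin n → ℝ → ℝ × ℝ

/-- The augmented point set: the `n` moving points and the two dummy points
`(-∞, -∞)` and `(∞, -∞)`. -/
inductive APoint (n : ℕ) where
  | negInf : APoint n
  | pt (i : Fin n) : APoint n
  | posInf : APoint n

/-- Twice the signed area of the triangle `u v w`: positive for a left turn, negative for a right
turn, zero iff the three points are collinear. -/
def orient (u v w : ℝ × ℝ) : ℝ :=
  (v.1 - u.1) * (w.2 - u.2) - (v.2 - u.2) * (w.1 - u.1)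

section Motions

variable {n : ℕ} (p : Motion n)

/-- The collinearity/side predicate of three moving points at time `t`. For `i` to the left of `j`,
the point `k` lies on or below the line `ij` iff `turn p t i j k ≤ 0`. -/
def turn (t : ℝ) (i j k : Fin n) : ℝ := orient (p i t) (p j t) (p k t)

/-- Continuous trajectories such that any two points have the same `x`-coordinate at most `s` times
and any three points are collinear at most `s` times. -/
structure PseudoAlgebraic (s : ℕ) : Prop where
  continuous : ∀ i, Continuous (p i)
  pair : ∀ i j, i ≠ j → {t : ℝ | (p i t).1 = (p j t).1}.encard ≤ s
  triple : ∀ i j k, i ≠ j → j ≠ k → i ≠ k → {t : ℝ | turn p t i j k = 0}.encard ≤ s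

/-- The pairs of points with a common `x`-coordinate and the collinear triples, at time `t`. -/
def degeneracies (t : ℝ) : Set (Finset (Fin n)) :=
  {S | S.card = 2 ∧ ∀ i ∈ S, ∀ j ∈ S, (p i t).1 = (p j t).1} ∪
    {S | S.card = 3 ∧ ∀ i ∈ S, ∀ j ∈ S, ∀ k ∈ S, turn p t i j k = 0}

/-- General position of the trajectories: the points are always distinct, and no two
degeneracies occur at the same time. -/
structure GeneralPosition : Prop where
  distinct : ∀ t i j, i ≠ j → p i t ≠ p j t
  separate : ∀ t, (degeneracies p t).Subsingleton

/-- The times at which there is no degeneracy. -/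
def genericTimes : Set ℝ := {t | degeneracies p t = ∅}

/-! ### The pseudo-triangulation of the part of the hull above the chain -/

/-- The left-to-right order of the augmented set at time `t`; ties between `x`-coordinates
are broken by the `y`-coordinate. -/
def Before (t : ℝ) : APoint n → APoint n → Prop
  | .negInf, .negInf => False
  | .negInf, .pt _ => True
  | .negInf, .posInf => True
  | .pt _, .negInf => False
  | .pt i, .pt j => (p i t).1 < (p j t).1 ∨ ((p i t).1 = (p j t).1 ∧ (p i t).2 < (p j t).2)
  | .pt _, .posInf => True
  | .posInf, _ => False

/-- The order of the moving points at time `t`. -/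
def Lt (t : ℝ) (i j : Fin n) : Prop := Before p t (.pt i) (.pt j)

/-- The moving points strictly between `a` and `c` at time `t`. -/
def Between (t : ℝ) (a c : APoint n) : Set (Fin n) :=
  {i | Before p t a (.pt i) ∧ Before p t (.pt i) c}

/-- `b` has minimum priority among the points strictly between `a` and `c`. -/
def IsMid (π : Equiv.Perm (Fin n)) (t : ℝ) (a c : APoint n) (b : Fin n) : Prop :=
  b ∈ Between p t a c ∧ ∀ i ∈ Between p t a c, π b ≤ π i

/-- The recursive construction: `Visits π t a c` says that the recursion visits the set `Q` of
consecutive points with leftmost point `a` and rightmost point `c`. It starts with the whole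
augmented set, and splits each visited set at its minimum priority inner point. -/
inductive Visits (π : Equiv.Perm (Fin n)) (t : ℝ) : APoint n → APoint n → Prop
  | root : Visits π t .negInf .posInf
  | left {a c : APoint n} {b : Fin n} :
      Visits π t a c → IsMid p π t a c b → Visits π t a (.pt b)
  | right {a c : APoint n} {b : Fin n} :
      Visits π t a c → IsMid p π t a c b → Visits π t (.pt b) c

/-- At time `t` the pseudo-triangulation with priorities `π` contains the pseudo-triangle with left
endpoint `a`, apex `b` and right endpoint `c`. -/
def InPT (π : Equiv.Perm (Fin n)) (t : ℝ) (a : APoint n) (b : Fin n) (c : APoint n) : Prop :=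
  Visits p π t a c ∧ IsMid p π t a c b

end Motions

/-- A (candidate) kinetic pseudo-triangle: its endpoints, its apex and its life span. -/
structure PseudoTriangle (n : ℕ) where
  left : APoint n
  apex : Fin n
  right : APoint n
  life : Set ℝ

section Structure

variable {n : ℕ} (p : Motion n) (τ : PseudoTriangle n)

/-- With priorities `π`, `τ` appears in the kinetic pseudo-triangulation, i.e. its life span is a
maximal connected set of times at which its triple is present. -/
def Appears (π : Equiv.Perm (Fin n)) : Prop :=
  Maximal (fun J : Set ℝ => IsConnected J ∧ ∀ t ∈ J, InPT p π t τ.left τ.apex τ.right) τ.life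

/-- The points other than the apex that lie between the two endpoints at some time of the
life span. -/
def innerPoints : Set (Fin n) :=
  {i | i ≠ τ.apex ∧ ∃ t ∈ τ.life, i ∈ Between p t τ.left τ.right}

/-- The number of inner points. -/
noncomputable def numInner : ℕ := (innerPoints p τ).ncard

/-! ### The funnel

The dummy points are never vertices of a funnel, and they do not influence which of the moving
points are vertices of an upper hull. -/

/-- The moving points from the left endpoint to the apex, inclusive. -/
def leftPart (t : ℝ) : Set (Fin n) :=
  {i | (τ.left = .pt i ∨ Before p t τ.left (.pt i)) ∧ (i = τ.apex ∨ Lt p t i τ.apex)}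

/-- The moving points from the apex to the right endpoint, inclusive. -/
def rightPart (t : ℝ) : Set (Fin n) :=
  {i | (i = τ.apex ∨ Lt p t τ.apex i) ∧ (τ.right = .pt i ∨ Before p t (.pt i) τ.right)}

/-- `j` is a vertex of the upper hull of `S` at time `t`. -/
def IsHullVertex (t : ℝ) (S : Set (Fin n)) (j : Fin n) : Prop :=
  j ∈ S ∧ ∀ i ∈ S, ∀ k ∈ S, Lt p t i j → Lt p t j k → turn p t i j k < 0

/-- `i` lies to the left of `j`, and the line `ij` passes on or above all points of `S`. -/
def Supports (t : ℝ) (S : Set (Fin n)) (i j : Fin n) : Prop :=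
  Lt p t i j ∧ ∀ k ∈ S, turn p t i j k ≤ 0

/-- `wu` is the bridge of `τ` at time `t`: an upper common tangent of the two parts whose points of
tangency are different from the apex. (No such segment exists if the apex lies strictly
above all segments that connect the two sides; then the funnel is empty.) -/
def IsBridge (t : ℝ) (w u : Fin n) : Prop :=
  w ∈ leftPart p τ t ∧ w ≠ τ.apex ∧ u ∈ rightPart p τ t ∧ u ≠ τ.apex ∧
    Supports p t (leftPart p τ t ∪ rightPart p τ t) w u

/-- The boundary of a funnel or of a sub-pseudo-triangle, given by its left chain, from the left
end of the base to the apex, and its right chain, from the apex to the right end of the base. -/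
structure Chains (n : ℕ) where
  left : List (Fin n)
  right : List (Fin n)

/-- `ij` is an edge of one of the two chains, or the base. -/
def Chains.IsEdge (σ : Chains n) (i j : Fin n) : Prop :=
  [i, j] <:+: σ.left ∨ [i, j] <:+: σ.right ∨
    (σ.left.head? = some i ∧ σ.right.getLast? = some j)

/-- The boundary as a subset of the plane at time `t`. -/
def Chains.boundary (σ : Chains n) (t : ℝ) : Set (ℝ × ℝ) :=
  {z | ∃ i j, σ.IsEdge i j ∧ z ∈ segment ℝ (p i t) (p j t)}

/-- The vertices other than the two ends of the base and the apex. -/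
def Chains.NonCorner (σ : Chains n) (q : Fin n) : Prop :=
  q ∈ σ.left.tail.dropLast ∨ q ∈ σ.right.tail.dropLast

/-- `q` is the non-corner vertex of minimum priority. -/
def Chains.IsFirst (π : Equiv.Perm (Fin n)) (σ : Chains n) (q : Fin n) : Prop :=
  σ.NonCorner q ∧ ∀ q', σ.NonCorner q' → π q ≤ π q'

/-- `i` and `j` see each other: the segment `ij` meets the boundary only in its endpoints. -/
def Chains.Visible (σ : Chains n) (t : ℝ) (i j : Fin n) : Prop :=
  segment ℝ (p i t) (p j t) ∩ σ.boundary p t ⊆ {p i t, p j t}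

/-- The chains `σ` bound the funnel of `τ` at time `t`: they consist of the portions of the upper
hulls of the two parts below the bridge, listed from left to right. -/
def IsFunnel (t : ℝ) (σ : Chains n) : Prop :=
  ∃ w u, IsBridge p τ t w u ∧
    σ.left.Pairwise (Lt p t) ∧ σ.right.Pairwise (Lt p t) ∧
    (∀ i, i ∈ σ.left ↔ IsHullVertex p t (leftPart p τ t) i ∧ (i = w ∨ Lt p t w i)) ∧
    (∀ i, i ∈ σ.right ↔ IsHullVertex p t (rightPart p τ t) i ∧ (i = u ∨ Lt p t i u))

/-! ### The triangulation of the funnel -/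

/-- The sub-pseudo-triangles that arise in the recursive triangulation of `σ₀` at time `t`. In each
step the non-corner vertex `q` of minimum priority is connected to the vertex `v` of the opposite
chain that is visible from `q` within the current sub-pseudo-triangle and farthest away from
the apex along that chain; the chord `qv` cuts off an upper and a lower sub-pseudo-triangle. -/
inductive SubChains (π : Equiv.Perm (Fin n)) (t : ℝ) (σ₀ : Chains n) : Chains n → Prop
  | self : SubChains π t σ₀ σ₀
  | leftUpper {L₁ L₂ R₁ R₂ : List (Fin n)} {q v : Fin n} :
      SubChains π t σ₀ ⟨L₁ ++ q :: L₂, R₁ ++ v :: R₂⟩ →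
      L₁ ≠ [] → L₂ ≠ [] → R₁ ≠ [] →
      Chains.IsFirst π ⟨L₁ ++ q :: L₂, R₁ ++ v :: R₂⟩ q →
      Chains.Visible p ⟨L₁ ++ q :: L₂, R₁ ++ v :: R₂⟩ t q v →
      (∀ v' ∈ R₂, ¬ Chains.Visible p ⟨L₁ ++ q :: L₂, R₁ ++ v :: R₂⟩ t q v') →
      SubChains π t σ₀ ⟨L₁ ++ [q], q :: v :: R₂⟩
  | leftLower {L₁ L₂ R₁ R₂ : List (Fin n)} {q v : Fin n} :
      SubChains π t σ₀ ⟨L₁ ++ q :: L₂, R₁ ++ v :: R₂⟩ →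
      L₁ ≠ [] → L₂ ≠ [] → R₁ ≠ [] →
      Chains.IsFirst π ⟨L₁ ++ q :: L₂, R₁ ++ v :: R₂⟩ q →
      Chains.Visible p ⟨L₁ ++ q :: L₂, R₁ ++ v :: R₂⟩ t q v →
      (∀ v' ∈ R₂, ¬ Chains.Visible p ⟨L₁ ++ q :: L₂, R₁ ++ v :: R₂⟩ t q v') →
      SubChains π t σ₀ ⟨q :: L₂, R₁ ++ [v]⟩
  | rightUpper {L₁ L₂ R₁ R₂ : List (Fin n)} {q v : Fin n} :
      SubChains π t σ₀ ⟨L₁ ++ v :: L₂, R₁ ++ q :: R₂⟩ →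
      R₁ ≠ [] → R₂ ≠ [] → L₂ ≠ [] →
      Chains.IsFirst π ⟨L₁ ++ v :: L₂, R₁ ++ q :: R₂⟩ q →
      Chains.Visible p ⟨L₁ ++ v :: L₂, R₁ ++ q :: R₂⟩ t q v →
      (∀ v' ∈ L₁, ¬ Chains.Visible p ⟨L₁ ++ v :: L₂, R₁ ++ q :: R₂⟩ t q v') →
      SubChains π t σ₀ ⟨L₁ ++ [v, q], q :: R₂⟩
  | rightLower {L₁ L₂ R₁ R₂ : List (Fin n)} {q v : Fin n} :
      SubChains π t σ₀ ⟨L₁ ++ v :: L₂, R₁ ++ q :: R₂⟩ →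
      R₁ ≠ [] → R₂ ≠ [] → L₂ ≠ [] →
      Chains.IsFirst π ⟨L₁ ++ v :: L₂, R₁ ++ q :: R₂⟩ q →
      Chains.Visible p ⟨L₁ ++ v :: L₂, R₁ ++ q :: R₂⟩ t q v →
      (∀ v' ∈ L₁, ¬ Chains.Visible p ⟨L₁ ++ v :: L₂, R₁ ++ q :: R₂⟩ t q v') →
      SubChains π t σ₀ ⟨v :: L₂, R₁ ++ [q]⟩

/-- All edges of the triangulation of the funnel of `τ` at time `t`: the edges of the funnel and the
chords (each chord is the base of a sub-pseudo-triangle). Empty if the funnel is empty. -/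
def triEdges (π : Equiv.Perm (Fin n)) (t : ℝ) : Set (Sym2 (Fin n)) :=
  {e | ∃ σ₀ σ i j, IsFunnel p τ t σ₀ ∧ SubChains p π t σ₀ σ ∧ σ.IsEdge i j ∧ e = s(i, j)}

open Classical in
/-- The number of edge insertions and deletions in the triangulation of `τ` during its life span.
An edge `e` is inserted or deleted whenever the indicator of `e` being present jumps, so that the
number of its insertions and deletions is the variation of that indicator. The momentary
structure at the degenerate times is disregarded: only what an event changes from right before to
right after it is counted. -/
noncomputable def numChanges (π : Equiv.Perm (Fin n)) : ENNReal :=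
  ∑ e : Sym2 (Fin n),
    eVariationOn (fun t => if e ∈ triEdges p τ π t then (1 : ℝ) else 0)
      (τ.life ∩ genericTimes p)

open Classical in
/-- The expected number of changes for a uniformly random priority permutation, conditioned on the
event that `τ` appears. -/
noncomputable def expectedChanges : ENNReal :=
  (∑ π : Equiv.Perm (Fin n) with Appears p τ π, numChanges p τ π) /
    ((Finset.univ.filter fun π : Equiv.Perm (Fin n) => Appears p τ π).card : ENNReal)

/-! ### Envelope and visibility events -/

/-- One of the two chains of the funnel contains three collinear points. -/
def EnvelopeEvent (t : ℝ) : Prop :=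
  ∃ w u, IsBridge p τ t w u ∧
    ((∃ i ∈ leftPart p τ t, ∃ j ∈ leftPart p τ t, ∃ k ∈ leftPart p τ t,
        (i = w ∨ Lt p t w i) ∧ Lt p t i j ∧ Lt p t j k ∧
        turn p t i j k = 0 ∧ Supports p t (leftPart p τ t) i k) ∨
     (∃ i ∈ rightPart p τ t, ∃ j ∈ rightPart p τ t, ∃ k ∈ rightPart p τ t,
        (k = u ∨ Lt p t k u) ∧ Lt p t i j ∧ Lt p t j k ∧
        turn p t i j k = 0 ∧ Supports p t (rightPart p τ t) i k))

/-- A vertex `q`, other than the apex, of one chain of the funnel is collinear with an edge `ij` of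
the upper hull of the opposite part, that is, of the opposite chain or tail. This includes the
changes of the bridge, and its creation and destruction (where the apex and the two
points of tangency are collinear). -/
def VisibilityEvent (t : ℝ) : Prop :=
  ∃ w u, IsBridge p τ t w u ∧
    ((∃ q, IsHullVertex p t (rightPart p τ t) q ∧ q ≠ τ.apex ∧ (q = u ∨ Lt p t q u) ∧
        ∃ i ∈ leftPart p τ t, ∃ j ∈ leftPart p τ t,
          Supports p t (leftPart p τ t) i j ∧ turn p t i j q = 0) ∨
     (∃ q, IsHullVertex p t (leftPart p τ t) q ∧ q ≠ τ.apex ∧ (q = w ∨ Lt p t w q) ∧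
        ∃ i ∈ rightPart p τ t, ∃ j ∈ rightPart p τ t,
          Supports p t (rightPart p τ t) i j ∧ turn p t i j q = 0))

/-- The number of envelope events during the life span. -/
noncomputable def numEnvelope : ℕ := {t | t ∈ τ.life ∧ EnvelopeEvent p τ t}.ncard

/-- The number of visibility events during the life span. -/
noncomputable def numVisibility : ℕ := {t | t ∈ τ.life ∧ VisibilityEvent p τ t}.ncard

end Structure

end KineticTriangulation

/-! Write N for the number of inner points of τ. Between two degenerate times the order type of the
points is constant, and so is the triangulation. The number of changes is therefore a sum of jumps
over the finitely many degenerate times (`numChanges_le`), and each jump is estimated separately.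

Suppose that two points exchange their x-order. If neither is a corner of τ, the lower one is hidden
by the upper one and nothing changes (`funnelTri_swap`). If one is a corner, the other is an inner
point. There are at most 3Ns times of this kind, and the triangulation has at most 3N + 3 edges, so
these times contribute the N² term.

Suppose that three points become collinear. Then either nothing changes, or the time is an envelope
or visibility event (`FlipAt.dichotomy`). Creating or destroying the funnel costs at most three
edges (`FlipAt.dichotomy_apex`), and moving the bridge past a vertex costs one triangle, that is,
two edges (`Flip.tri_base`). Every other event reduces to the insertion of a vertex m next to i in a
chain (`Flip.ncard_insert_le`). For a visibility event this happens in the upper part, because the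
point of tangency seen from the third vertex moves between m and i, while in the lower part a base
moves past m (`Flip.ncard_flip_le`). In an insertion the recursions before and after the event make
the same choices, and m descends into one of the two parts, until m has minimum priority among the
non-corner vertices of the current sub-pseudo-triangle. Only the edges inside that one can change,
and their number is linear in its number of vertices.

Each further non-corner vertex y of that sub-pseudo-triangle has later priority than m, and no point
earlier than m separates y from the place of m. Hence one of five rules, each selecting at most one
point from a set, selects y from the set consisting of y and the points earlier than m
(`Inv.mem_late`). Exchanging the priorities of m and y makes y the last point of an initial segment
of the random order from which it is selected. In a segment of s points every point is equally
likely to be last, so this has probability at most 1/s, and at most 5 H_N such vertices are expected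
(`sum_ncard_late_le`), where H_N is the harmonic number. Conditioning on the appearance of τ does no
harm, because appearance is preserved when two inner points exchange their priorities
(`Appears.swap`).

These arguments use a recursion on lists, `InTri`, which chooses points of tangency. At generic
times the point of tangency is the farthest visible vertex (`PT.farthest_iff`), so the recursion
produces exactly the edges of the triangulation (`triEdges_eq`). For N = 1 the logarithm vanishes,
and the events are absorbed by the N² term, since the inner points and corners have only (N + 3)³ s
times of collinearity. -/

namespace KineticTriangulation

variable {n : ℕ}

/-! ### Slopes, orientations and the geometry of one pseudo-triangle. -/

/-- A configuration of `n` points in the plane. -/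
abbrev Config (n : ℕ) := Fin n → ℝ × ℝ

/-- The slope of the line through the points `i` and `j`. -/
noncomputable def sl (P : Config n) (i j : Fin n) : ℝ :=
  ((P j).2 - (P i).2) / ((P j).1 - (P i).1)

/-- The reflection of a configuration in a vertical line. -/
def mirror (P : Config n) : Config n := fun i => (-(P i).1, (P i).2)

/-- No two points on a vertical line and no three points on a line. -/
structure Generic (P : Config n) : Prop where
  inj : ∀ i j, i ≠ j → (P i).1 ≠ (P j).1
  ncol : ∀ i j k, i ≠ j → j ≠ k → i ≠ k → orient (P i) (P j) (P k) ≠ 0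

/-- The point `w` lies strictly under the line `qv`. -/
def Under (P : Config n) (q v w : Fin n) : Prop :=
  orient (P q) (P v) (P w) * ((P v).1 - (P q).1) < 0

lemma orient_rev (u v w : ℝ × ℝ) : orient u v w = - orient w v u := by
  unfold orient; ring

lemma orient_rot (u v w : ℝ × ℝ) : orient u v w = orient v w u := by
  unfold orient; ring

lemma orient_swap (u v w : ℝ × ℝ) : orient u v w = - orient u w v := by
  unfold orient; ring

lemma orient_mirror (P : Config n) (i j k : Fin n) :
    orient (mirror P i) (mirror P j) (mirror P k) = - orient (P i) (P j) (P k) := by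
  simp only [orient, mirror]; ring

@[simp] lemma mirror_fst (P : Config n) (i : Fin n) : (mirror P i).1 = - (P i).1 := rfl

@[simp] lemma mirror_snd (P : Config n) (i : Fin n) : (mirror P i).2 = (P i).2 := rfl

@[simp] lemma mirror_mirror (P : Config n) : mirror (mirror P) = P := by
  funext i; simp [mirror]

/-- Reflection negates the orientation and the difference of the x-coordinates alike; this is the
purpose of the second factor in `Under`. Statements about the right chain then follow from those
about the left chain. -/
lemma under_mirror (P : Config n) (q v w : Fin n) :
    Under (mirror P) q v w ↔ Under P q v w := by
  simp only [Under, orient_mirror, mirror_fst]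
  constructor <;> intro h <;> linarith

lemma Generic.mirror {P : Config n} (h : Generic P) : Generic (mirror P) where
  inj i j hij := by simpa using h.inj i j hij
  ncol i j k h1 h2 h3 := by rw [orient_mirror]; simpa using h.ncol i j k h1 h2 h3

lemma orient_eq_sl {P : Config n} {q v w : Fin n} (h1 : (P v).1 ≠ (P q).1)
    (h2 : (P w).1 ≠ (P q).1) :
    orient (P q) (P v) (P w) =
      ((P v).1 - (P q).1) * ((P w).1 - (P q).1) * (sl P q w - sl P q v) := by
  have h1' := sub_ne_zero.2 h1
  have h2' := sub_ne_zero.2 h2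
  unfold orient sl
  field_simp

lemma sl_symm (P : Config n) (i j : Fin n) : sl P i j = sl P j i := by
  unfold sl
  rw [← neg_div_neg_eq]; congr 1 <;> ring

lemma orient_neg_left {P : Config n} {q v w : Fin n} (h1 : (P q).1 < (P v).1)
    (h2 : (P q).1 < (P w).1) :
    orient (P q) (P v) (P w) < 0 ↔ sl P q w < sl P q v := by
  rw [orient_eq_sl h1.ne' h2.ne']
  have : 0 < ((P v).1 - (P q).1) * ((P w).1 - (P q).1) :=
    mul_pos (sub_pos.2 h1) (sub_pos.2 h2)
  constructor <;> intro h
  · nlinarith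
  · nlinarith

/-- For points on one side of `q`, lying under a line through `q` is a comparison of slopes. The
geometry below thus becomes `linarith` on slopes, with `sl_tri` relating the slopes of each triple.
-/
lemma under_left {P : Config n} {q v w : Fin n} (h1 : (P q).1 < (P v).1)
    (h2 : (P q).1 < (P w).1) : Under P q v w ↔ sl P q w < sl P q v := by
  rw [← orient_neg_left h1 h2, Under]
  have := sub_pos.2 h1
  constructor <;> intro h <;> nlinarith

lemma under_right {P : Config n} {q v w : Fin n} (h1 : (P v).1 < (P q).1)
    (h2 : (P w).1 < (P q).1) : Under P q v w ↔ sl P v q < sl P w q := by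
  rw [Under, orient_eq_sl h1.ne h2.ne, sl_symm P v q, sl_symm P w q]
  have a1 : ((P v).1 - (P q).1) < 0 := by linarith
  have a2 : ((P w).1 - (P q).1) < 0 := by linarith
  have : ((P v).1 - (P q).1) * ((P w).1 - (P q).1) * ((P v).1 - (P q).1) < 0 :=
    mul_neg_of_pos_of_neg (mul_pos_of_neg_of_neg a1 a2) a1
  constructor <;> intro h <;> nlinarith

/-- The three slopes determined by three points, listed from left to right, are either strictly
monotone or all equal. -/
lemma sl_tri {P : Config n} {u v w : Fin n} (h1 : (P u).1 < (P v).1) (h2 : (P v).1 < (P w).1) :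
    (sl P u v < sl P u w ∧ sl P u w < sl P v w) ∨ (sl P u v = sl P u w ∧ sl P u w = sl P v w) ∨
      (sl P v w < sl P u w ∧ sl P u w < sl P u v) := by
  have e1 : (P v).2 - (P u).2 = sl P u v * ((P v).1 - (P u).1) := by
    unfold sl; rw [div_mul_cancel₀]; linarith
  have e2 : (P w).2 - (P v).2 = sl P v w * ((P w).1 - (P v).1) := by
    unfold sl; rw [div_mul_cancel₀]; linarith
  have e3 : (P w).2 - (P u).2 = sl P u w * ((P w).1 - (P u).1) := by
    unfold sl; rw [div_mul_cancel₀]; linarith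
  have e : sl P u v * ((P v).1 - (P u).1) + sl P v w * ((P w).1 - (P v).1) =
      sl P u w * ((P v).1 - (P u).1) + sl P u w * ((P w).1 - (P v).1) := by linarith
  -- The slope of `u w` is a weighted mean of the other two; in this form the sign of one difference
  -- determines that of the other.
  have e' : (sl P u v - sl P u w) * ((P v).1 - (P u).1) =
      (sl P u w - sl P v w) * ((P w).1 - (P v).1) := by linarith
  have a := sub_pos.2 h1
  have b := sub_pos.2 h2
  rcases lt_trichotomy (sl P u v) (sl P u w) with h | h | h
  · left; refine ⟨h, ?_⟩
    by_contra hc; push Not at hc; nlinarith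
  · right; left; refine ⟨h, ?_⟩
    rw [h, sub_self, zero_mul] at e'
    rcases mul_eq_zero.1 e'.symm with h | h <;> linarith
  · right; right; refine ⟨?_, h⟩
    by_contra hc; push Not at hc; nlinarith

lemma orient_neg_mid {P : Config n} {u v w : Fin n} (h1 : (P u).1 < (P v).1)
    (h2 : (P v).1 < (P w).1) : orient (P u) (P v) (P w) < 0 ↔ sl P v w < sl P u v := by
  rw [orient_neg_left h1 (h1.trans h2)]
  rcases sl_tri h1 h2 with h | h | h <;> constructor <;> intro h' <;> linarith

/-- The geometric conditions on a sub-pseudo-triangle: `A` and `B` list the vertices of the left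
and of the right chain from the base to the apex `z`, without `z`. Both chains are concave,
and lie below the base. -/
structure PT (P : Config n) (A B : List (Fin n)) (z : Fin n) : Prop where
  neA : A ≠ []
  neB : B ≠ []
  sortA : (A ++ [z]).Pairwise (fun i j => (P i).1 < (P j).1)
  sortB : (B ++ [z]).Pairwise (fun i j => (P j).1 < (P i).1)
  concA : ∀ i ∈ A ++ [z], ∀ j ∈ A ++ [z], ∀ k ∈ A ++ [z], (P i).1 < (P j).1 →
    (P j).1 < (P k).1 → orient (P i) (P j) (P k) < 0
  concB : ∀ i ∈ B ++ [z], ∀ j ∈ B ++ [z], ∀ k ∈ B ++ [z], (P i).1 < (P j).1 →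
    (P j).1 < (P k).1 → orient (P i) (P j) (P k) < 0
  base : ∀ a c, A.head? = some a → B.head? = some c → ∀ y ∈ A ++ B ++ [z], y ≠ a → y ≠ c →
    orient (P a) (P c) (P y) < 0

namespace PT

variable {P : Config n} {A B : List (Fin n)} {z : Fin n}

lemma mirror (h : PT P A B z) : PT (mirror P) B A z where
  neA := h.neB
  neB := h.neA
  sortA := h.sortB.imp (by intro a b hab; simpa using hab)
  sortB := h.sortA.imp (by intro a b hab; simpa using hab)
  concA i hi j hj k hk h1 h2 := by
    rw [orient_mirror, ← orient_rev]
    exact h.concB k hk j hj i hi (by simpa using h2) (by simpa using h1)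
  concB i hi j hj k hk h1 h2 := by
    rw [orient_mirror, ← orient_rev]
    exact h.concA k hk j hj i hi (by simpa using h2) (by simpa using h1)
  base c a hc ha y hy hyc hya := by
    rw [orient_mirror, ← orient_rev, orient_rot, orient_rot]
    have := h.base a c ha hc y (by simp at hy ⊢; tauto) hya hyc
    rw [orient_rot] at this
    unfold orient at *
    linarith

lemma ltA (h : PT P A B z) {x : Fin n} (hx : x ∈ A) : (P x).1 < (P z).1 := by
  have := h.sortA
  rw [List.pairwise_append] at this
  exact this.2.2 x hx z (by simp)

lemma ltB (h : PT P A B z) {x : Fin n} (hx : x ∈ B) : (P z).1 < (P x).1 := by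
  have := h.sortB
  rw [List.pairwise_append] at this
  exact this.2.2 x hx z (by simp)

lemma lt (h : PT P A B z) {x y : Fin n} (hx : x ∈ A) (hy : y ∈ B) : (P x).1 < (P y).1 :=
  (h.ltA hx).trans (h.ltB hy)

lemma pairA (h : PT P A B z) : A.Pairwise (fun i j => (P i).1 < (P j).1) :=
  (List.pairwise_append.1 h.sortA).1

lemma pairB (h : PT P A B z) : B.Pairwise (fun i j => (P j).1 < (P i).1) :=
  (List.pairwise_append.1 h.sortB).1

lemma nodupA (h : PT P A B z) : A.Nodup := h.pairA.imp (by
  intro a b hab e; subst e; exact lt_irrefl _ hab)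

lemma nodupB (h : PT P A B z) : B.Nodup := h.pairB.imp (by
  intro a b hab e; subst e; exact lt_irrefl _ hab)

lemma disj (h : PT P A B z) {x : Fin n} (hx : x ∈ A) : x ∉ B :=
  fun hy => lt_irrefl _ (h.lt hx hy)

lemma ne (h : PT P A B z) {x y : Fin n} (hx : x ∈ A) (hy : y ∈ B) : x ≠ y := by
  rintro rfl; exact h.disj hx hy

lemma exists_head (h : PT P A B z) : ∃ a c, A.head? = some a ∧ B.head? = some c ∧ a ∈ A ∧
    c ∈ B ∧ (∀ x ∈ A, x = a ∨ (P a).1 < (P x).1) ∧ (∀ x ∈ B, x = c ∨ (P x).1 < (P c).1) := by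
  obtain ⟨a, A', rfl⟩ := List.exists_cons_of_ne_nil h.neA
  obtain ⟨c, B', rfl⟩ := List.exists_cons_of_ne_nil h.neB
  refine ⟨a, c, rfl, rfl, by simp, by simp, ?_, ?_⟩
  · intro x hx
    rcases List.mem_cons.1 hx with rfl | hx
    · exact Or.inl rfl
    · exact Or.inr ((List.pairwise_cons.1 h.pairA).1 x hx)
  · intro x hx
    rcases List.mem_cons.1 hx with rfl | hx
    · exact Or.inl rfl
    · exact Or.inr ((List.pairwise_cons.1 h.pairB).1 x hx)

lemma slA (h : PT P A B z) {i j k : Fin n} (hi : i ∈ A ++ [z]) (hj : j ∈ A ++ [z])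
    (hk : k ∈ A ++ [z]) (h1 : (P i).1 < (P j).1) (h2 : (P j).1 < (P k).1) :
    sl P j k < sl P i j := (orient_neg_mid h1 h2).1 (h.concA i hi j hj k hk h1 h2)

lemma slB (h : PT P A B z) {i j k : Fin n} (hi : i ∈ B ++ [z]) (hj : j ∈ B ++ [z])
    (hk : k ∈ B ++ [z]) (h1 : (P i).1 < (P j).1) (h2 : (P j).1 < (P k).1) :
    sl P j k < sl P i j := (orient_neg_mid h1 h2).1 (h.concB i hi j hj k hk h1 h2)

/-- The left end of the base lies above the line through two vertices of the right chain. -/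
lemma head_above (h : PT P A B z) {a r v : Fin n} (ha : A.head? = some a) (hr : r ∈ B)
    (hv : v ∈ B) (hrv : (P r).1 < (P v).1) : Under P a v r := by
  obtain ⟨a', c, ha', hc, haA, hcB, -, hcmax⟩ := h.exists_head
  obtain rfl : a = a' := by rw [ha] at ha'; exact Option.some.inj ha'
  have har := h.lt haA hr
  have hav := h.lt haA hv
  rw [under_left hav har]
  have hrc : r ≠ c := by
    rintro rfl
    rcases hcmax v hv with rfl | h' <;> linarith
  have hra : r ≠ a := by rintro rfl; exact lt_irrefl _ har
  have hbr := h.base a c ha hc r (by simp [hr]) hra hrc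
  rw [orient_neg_left (h.lt haA hcB) har] at hbr
  rcases hcmax v hv with rfl | hvc
  · exact hbr
  · have hva : v ≠ a := by rintro rfl; exact lt_irrefl _ hav
    have hvc' : v ≠ c := by rintro rfl; exact lt_irrefl _ hvc
    have hbv := h.base a c ha hc v (by simp [hv]) hva hvc'
    rw [orient_neg_left (h.lt haA hcB) hav] at hbv
    have s1 := h.slB (List.mem_append_left _ hr) (List.mem_append_left _ hv)
      (List.mem_append_left _ hcB) hrv hvc
    rcases sl_tri hav hvc with t | t | t <;> rcases sl_tri har hrv with t' | t' | t' <;> linarith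

/-- Visibility is monotone: the vertices of the left chain that lie above the line through two
vertices of the right chain form an initial part of the chain. -/
lemma mono (h : PT P A B z) {q' q v r : Fin n} (hq' : q' ∈ A) (hq : q ∈ A) (hv : v ∈ B)
    (hr : r ∈ B) (hqq : (P q').1 < (P q).1) (hrv : (P r).1 < (P v).1) (hu : Under P q v r) :
    Under P q' v r := by
  obtain ⟨a, c, ha, hc, haA, hcB, hamin, hcmax⟩ := h.exists_head
  have hav := h.head_above ha hr hv hrv
  rcases hamin q' hq' with rfl | haq
  · exact hav
  have x1 := h.lt haA hr
  have x2 := h.lt hq' hr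
  have x3 := h.lt hq hr
  rw [under_left (h.lt haA hv) x1] at hav
  rw [under_left (h.lt hq hv) x3] at hu
  rw [under_left (h.lt hq' hv) x2]
  by_contra hcon
  push Not at hcon
  -- `a` and `q` lie above the line `r v`, and `q'` lies between them on a concave chain, hence
  -- above their chord and above that line.
  have s := h.slA (List.mem_append_left _ haA) (List.mem_append_left _ hq')
    (List.mem_append_left _ hq) haq hqq
  rcases sl_tri x1 hrv with t1 | t1 | t1 <;> rcases sl_tri x2 hrv with t2 | t2 | t2 <;>
    rcases sl_tri x3 hrv with t3 | t3 | t3 <;>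
    rcases sl_tri haq (h.lt hq' hv) with t4 | t4 | t4 <;>
    rcases sl_tri hqq (h.lt hq hv) with t5 | t5 | t5 <;> linarith

/-- The apex lies below the line through two other vertices on different chains. -/
lemma apex_under (h : PT P A B z) {x y : Fin n} (hx : x ∈ A) (hy : y ∈ B) :
    Under P x y z := by
  obtain ⟨a, c, ha, hc, haA, hcB, hamin, hcmax⟩ := h.exists_head
  have hxz := h.ltA hx
  have hzy := h.ltB hy
  rw [under_left (h.lt hx hy) hxz]
  by_contra hcon
  push Not at hcon
  have haz := h.ltA haA
  have hzc := h.ltB hcB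
  have hb := h.base a c ha hc z (by simp) (by rintro rfl; exact lt_irrefl _ haz)
    (by rintro rfl; exact lt_irrefl _ hzc)
  rw [orient_neg_left (h.lt haA hcB) haz] at hb
  have t0 := sl_tri hxz hzy
  have t1 := sl_tri haz hzc
  have ez : z ∈ A ++ [z] := by simp
  have ez' : z ∈ B ++ [z] := by simp
  have k1 : sl P x z ≤ sl P a z := by
    rcases hamin x hx with rfl | hax
    · exact le_rfl
    · have s := h.slA (List.mem_append_left _ haA) (List.mem_append_left _ hx) ez hax hxz
      rcases sl_tri hax hxz with t | t | t <;> linarith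
  have k2 : sl P z c ≤ sl P z y := by
    rcases hcmax y hy with rfl | hyc
    · exact le_rfl
    · have s := h.slB ez' (List.mem_append_left _ hy) (List.mem_append_left _ hcB) hzy hyc
      rcases sl_tri hzy hyc with t | t | t <;> linarith
  rcases t0 with t0 | t0 | t0 <;> rcases t1 with t1 | t1 | t1 <;> linarith

end PT

end KineticTriangulation

/-! ### The recursive triangulation as an inductive predicate on lists. -/

namespace KineticTriangulation

variable {n : ℕ}

/-- A step of the recursive triangulation: `q` is the non-corner vertex of minimum priority, it lies
on the chain `A`, and `v` is the point of tangency of the line from `q` to the chain `B`. -/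
structure Pick (P : Config n) (π : Equiv.Perm (Fin n)) (A B A₁ : List (Fin n)) (q : Fin n)
    (A₂ B₁ : List (Fin n)) (v : Fin n) (B₂ : List (Fin n)) : Prop where
  hA : A = A₁ ++ q :: A₂
  hB : B = B₁ ++ v :: B₂
  ne : A₁ ≠ []
  first : ∀ y ∈ A.tail ++ B.tail, π q ≤ π y
  tan : ∀ v' ∈ B, v' ≠ v → Under P q v v'

lemma pick_mirror {P : Config n} {π : Equiv.Perm (Fin n)} {A B A₁ A₂ B₁ B₂ : List (Fin n)}
    {q v : Fin n} (h : Pick P π A B A₁ q A₂ B₁ v B₂) : Pick (mirror P) π A B A₁ q A₂ B₁ v B₂ :=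
  ⟨h.hA, h.hB, h.ne, h.first, fun v' h1 h2 => (under_mirror P q v v').2 (h.tan v' h1 h2)⟩

lemma pick_of_mirror {P : Config n} {π : Equiv.Perm (Fin n)} {A B A₁ A₂ B₁ B₂ : List (Fin n)}
    {q v : Fin n} (h : Pick (mirror P) π A B A₁ q A₂ B₁ v B₂) : Pick P π A B A₁ q A₂ B₁ v B₂ := by
  simpa using pick_mirror h

lemma Pick.mem_tail {P : Config n} {π : Equiv.Perm (Fin n)} {A B A₁ A₂ B₁ B₂ : List (Fin n)}
    {q v : Fin n} (h : Pick P π A B A₁ q A₂ B₁ v B₂) : q ∈ A.tail := by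
  obtain ⟨a, A', h'⟩ := List.exists_cons_of_ne_nil h.ne
  rw [h.hA, h']; simp

lemma Pick.mem {P : Config n} {π : Equiv.Perm (Fin n)} {A B A₁ A₂ B₁ B₂ : List (Fin n)}
    {q v : Fin n} (h : Pick P π A B A₁ q A₂ B₁ v B₂) : q ∈ A := by
  rw [h.hA]; simp

lemma Pick.mem' {P : Config n} {π : Equiv.Perm (Fin n)} {A B A₁ A₂ B₁ B₂ : List (Fin n)}
    {q v : Fin n} (h : Pick P π A B A₁ q A₂ B₁ v B₂) : v ∈ B := by
  rw [h.hB]; simp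

/-- The directed edges of the boundary of a sub-pseudo-triangle, from left to right. -/
def BdEdge (A B : List (Fin n)) (z i j : Fin n) : Prop :=
  [i, j] <:+: A ++ [z] ∨ [j, i] <:+: B ++ [z] ∨ (A.head? = some i ∧ B.head? = some j)

lemma bdEdge_swap {A B : List (Fin n)} {z i j : Fin n} :
    BdEdge A B z i j ↔ BdEdge B A z j i := by
  unfold BdEdge; tauto

/-- The edges of the triangulation of a sub-pseudo-triangle. -/
inductive InTri (P : Config n) (π : Equiv.Perm (Fin n)) :
    List (Fin n) → List (Fin n) → Fin n → Sym2 (Fin n) → Prop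
  | edge {A B z i j} : BdEdge A B z i j → InTri P π A B z s(i, j)
  | leftUp {A B z e A₁ q A₂ B₁ v B₂} : Pick P π A B A₁ q A₂ B₁ v B₂ →
      InTri P π A₁ (B₁ ++ [v]) q e → InTri P π A B z e
  | leftLow {A B z e A₁ q A₂ B₁ v B₂} : Pick P π A B A₁ q A₂ B₁ v B₂ →
      InTri P π (q :: A₂) (v :: B₂) z e → InTri P π A B z e
  | rightUp {A B z e A₁ q A₂ B₁ v B₂} : Pick P π B A B₁ q B₂ A₁ v A₂ →
      InTri P π (A₁ ++ [v]) B₁ q e → InTri P π A B z e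
  | rightLow {A B z e A₁ q A₂ B₁ v B₂} : Pick P π B A B₁ q B₂ A₁ v A₂ →
      InTri P π (v :: A₂) (q :: B₂) z e → InTri P π A B z e

/-- The set of edges of the triangulation of a sub-pseudo-triangle. -/
def tri (P : Config n) (π : Equiv.Perm (Fin n)) (A B : List (Fin n)) (z : Fin n) :
    Set (Sym2 (Fin n)) := {e | InTri P π A B z e}

lemma InTri.swap {P : Config n} {π : Equiv.Perm (Fin n)} {A B : List (Fin n)} {z : Fin n}
    {e : Sym2 (Fin n)} (h : InTri P π A B z e) : InTri (mirror P) π B A z e := by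
  induction h with
  | edge h => rw [Sym2.eq_swap]; exact .edge (bdEdge_swap.1 h)
  | leftUp h _ ih => exact .rightUp (pick_mirror h) ih
  | leftLow h _ ih => exact .rightLow (pick_mirror h) ih
  | rightUp h _ ih => exact .leftUp (pick_mirror h) ih
  | rightLow h _ ih => exact .leftLow (pick_mirror h) ih

lemma tri_mirror (P : Config n) (π : Equiv.Perm (Fin n)) (A B : List (Fin n)) (z : Fin n) :
    tri (mirror P) π B A z = tri P π A B z := by
  ext e
  refine ⟨fun h => ?_, fun h => InTri.swap h⟩
  have := InTri.swap h
  rwa [mirror_mirror] at this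

lemma split_unique {α : Type*} [DecidableEq α] {x : α} {L L₁ L₂ L₁' L₂' : List α} (hL : L.Nodup)
    (h1 : L = L₁ ++ x :: L₂) (h2 : L = L₁' ++ x :: L₂') : L₁ = L₁' ∧ L₂ = L₂' := by
  subst h1
  have n1 : x ∉ L₁ := by
    intro hx
    have := List.nodup_append.1 hL
    exact this.2.2 x hx x (by simp) rfl
  have n2 : x ∉ L₁' := by
    intro hx
    rw [h2] at hL
    have := List.nodup_append.1 hL
    exact this.2.2 x hx x (by simp) rfl
  have := List.append_inj h2 (by
    have e1 : (L₁ ++ x :: L₂).idxOf x = L₁.length := by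
      rw [List.idxOf_append_of_notMem n1]; simp
    have e2 : (L₁' ++ x :: L₂').idxOf x = L₁'.length := by
      rw [List.idxOf_append_of_notMem n2]; simp
    rw [← e1, ← e2, h2])
  exact ⟨this.1, (List.cons.inj this.2).2⟩

lemma infix_split {α : Type*} {i j q : α} {X Y : List α} (h : [i, j] <:+: X ++ q :: Y) :
    [i, j] <:+: X ++ [q] ∨ [i, j] <:+: q :: Y := by
  induction X with
  | nil => right; simpa using h
  | cons x X ih =>
    rw [List.cons_append, List.infix_cons_iff] at h
    rcases h with h | h
    · left
      rw [List.cons_append, List.infix_cons_iff]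
      left
      rw [List.cons_prefix_cons] at h ⊢
      refine ⟨h.1, ?_⟩
      have := h.2
      cases X <;> simp_all
    · rcases ih h with h | h
      · left; exact h.trans (List.infix_cons List.infix_rfl)
      · right; exact h

namespace PT

variable {P : Config n} {A B : List (Fin n)} {z : Fin n} {π : Equiv.Perm (Fin n)}
  {A₁ A₂ B₁ B₂ : List (Fin n)} {q v : Fin n}

/-- Since `q` lies below the base `a c`, the slope of `q c` exceeds that of `a q`, which by
concavity exceeds all slopes from `q` onwards. The tangent is at least as steep as `q c`. -/
lemma under_of_tan (h : PT P A B z) {y : Fin n} (hq : q ∈ A) (hv : v ∈ B)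
    (hqa : A.head? ≠ some q) (tan : ∀ v' ∈ B, v' ≠ v → Under P q v v') (hy : y ∈ A ++ [z])
    (hqy : (P q).1 < (P y).1) : Under P q v y := by
  obtain ⟨a, c, ha, hc, haA, hcB, hamin, hcmax⟩ := h.exists_head
  have haq : (P a).1 < (P q).1 := by
    rcases hamin q hq with rfl | h'
    · exact absurd ha hqa
    · exact h'
  rw [under_left (h.lt hq hv) hqy]
  by_contra hcon
  push Not at hcon
  have s := h.slA (List.mem_append_left _ haA) (List.mem_append_left _ hq) hy haq hqy
  have hqc := h.lt hq hcB
  have k : sl P q c ≤ sl P q v := by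
    by_cases e : c = v
    · rw [e]
    · exact ((under_left (h.lt hq hv) hqc).1 (tan c hcB e)).le
  have hb := h.base a c ha hc q (by simp [hq]) (by rintro rfl; exact lt_irrefl _ haq)
    (by rintro rfl; exact lt_irrefl _ hqc)
  rw [orient_neg_left (h.lt haA hcB) haq] at hb
  rcases sl_tri haq hqc with t | t | t <;> linarith

lemma head_ne_of_pick (h : PT P A B z) (hp : Pick P π A B A₁ q A₂ B₁ v B₂) :
    A.head? ≠ some q := by
  obtain ⟨a, A', ha⟩ := List.exists_cons_of_ne_nil hp.ne
  have hA := hp.hA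
  have hs := h.pairA
  rw [hA, ha] at hs
  have : (P a).1 < (P q).1 := (List.pairwise_cons.1 hs).1 q (by simp)
  rw [hA, ha]
  simp only [List.cons_append, List.head?_cons, ne_eq, Option.some.injEq]
  rintro rfl
  exact lt_irrefl _ this

/-- The upper part keeps the base, has `q` as its apex, and its right chain now ends with the chord
from `v` to `q`. -/
lemma up (h : PT P A B z) (hp : Pick P π A B A₁ q A₂ B₁ v B₂) : PT P A₁ (B₁ ++ [v]) q := by
  have hA := hp.hA
  have hB := hp.hB
  have sA : ∀ y ∈ A₁ ++ [q], y ∈ A := by intro y hy; rw [hA]; simp at hy ⊢; tauto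
  have sB : ∀ y ∈ B₁ ++ [v], y ∈ B := by intro y hy; rw [hB]; simp at hy ⊢; tauto
  have pA : (A₁ ++ [q]).Pairwise (fun i j => (P i).1 < (P j).1) := by
    have := h.pairA
    rw [hA] at this
    exact this.sublist (List.Sublist.append_left (List.singleton_sublist.2 (by simp)) _)
  have pB : (B₁ ++ [v]).Pairwise (fun i j => (P j).1 < (P i).1) := by
    have := h.pairB
    rw [hB] at this
    exact this.sublist (List.Sublist.append_left (List.singleton_sublist.2 (by simp)) _)
  have hqB : ∀ y ∈ B₁ ++ [v], (P q).1 < (P y).1 := fun y hy => h.lt hp.mem (sB y hy)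
  refine ⟨hp.ne, by simp, pA, ?_, ?_, ?_, ?_⟩
  · rw [List.pairwise_append]
    exact ⟨pB, by simp, by simpa using hqB⟩
  · intro i hi j hj k hk
    exact h.concA i (List.mem_append_left _ (sA i hi)) j (List.mem_append_left _ (sA j hj)) k
      (List.mem_append_left _ (sA k hk))
  · intro i hi j hj k hk hij hjk
    have ne_q : ∀ y ∈ B₁ ++ [v] ++ [q], y = q ∨ y ∈ B₁ ++ [v] := by
      intro y hy; simp at hy ⊢; tauto
    have hj' : j ∈ B₁ ++ [v] := by
      rcases ne_q j hj with rfl | h'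
      · rcases ne_q i hi with rfl | h''
        · exact absurd hij (lt_irrefl _)
        · have := hqB i h''; linarith
      · exact h'
    have hk' : k ∈ B₁ ++ [v] := by
      rcases ne_q k hk with rfl | h'
      · have := hqB j hj'; linarith
      · exact h'
    -- Only triples with leftmost point `q` are new. At `v` the chain bends correctly by tangency;
    -- above `v` the slope from `q` exceeds the slope from `v`, and concavity of the old chain does
    -- the rest.
    rcases ne_q i hi with rfl | hi'
    · have hqv := h.lt hp.mem hp.mem'
      by_cases hjv : j = v
      · subst hjv
        rw [orient_neg_left hij (hij.trans hjk), ← under_left hij (hij.trans hjk)]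
        exact hp.tan k (sB k hk') (by rintro rfl; exact lt_irrefl _ hjk)
      · have hvj : (P v).1 < (P j).1 := by
          have : j ∈ B₁ := by simp at hj'; tauto
          exact (List.pairwise_append.1 pB).2.2 j this v (by simp)
        rw [orient_neg_mid hij hjk]
        have t := (under_left hqv hij).1 (hp.tan j (sB j hj') hjv)
        have s := h.slB (List.mem_append_left _ hp.mem') (List.mem_append_left _ (sB j hj'))
          (List.mem_append_left _ (sB k hk')) hvj hjk
        rcases sl_tri hqv hvj with t' | t' | t' <;> linarith
    · exact h.concB i (List.mem_append_left _ (sB i hi')) j (List.mem_append_left _ (sB j hj')) k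
        (List.mem_append_left _ (sB k hk')) hij hjk
  · intro a c ha hc y hy hya hyc
    refine h.base a c ?_ ?_ y ?_ hya hyc
    · rw [hA, List.head?_append_of_ne_nil _ hp.ne, ha]
    · rw [hB]
      cases B₁ <;> simpa using hc
    · simp only [List.mem_append, List.mem_singleton] at hy ⊢
      rcases hy with (hy | hy) | rfl
      · exact Or.inl (Or.inl (sA y (by simp [hy])))
      · exact Or.inl (Or.inr (sB y (by simpa using hy)))
      · exact Or.inl (Or.inl hp.mem)

/-- The chord becomes the base. Tangency puts the rest of the right chain below it, and
`under_of_tan` the rest of the left chain. -/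
lemma low (h : PT P A B z) (hp : Pick P π A B A₁ q A₂ B₁ v B₂) : PT P (q :: A₂) (v :: B₂) z := by
  have hA := hp.hA
  have hB := hp.hB
  have sA : ∀ y ∈ q :: A₂, y ∈ A := by intro y hy; rw [hA]; simp at hy ⊢; tauto
  have sB : ∀ y ∈ v :: B₂, y ∈ B := by intro y hy; rw [hB]; simp at hy ⊢; tauto
  have sA' : ∀ y ∈ q :: A₂ ++ [z], y ∈ A ++ [z] := by
    intro y hy; rw [hA]; simp at hy ⊢; tauto
  have sB' : ∀ y ∈ v :: B₂ ++ [z], y ∈ B ++ [z] := by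
    intro y hy; rw [hB]; simp at hy ⊢; tauto
  have pA : (q :: A₂ ++ [z]).Pairwise (fun i j => (P i).1 < (P j).1) := by
    have := h.sortA
    rw [hA, List.append_assoc] at this
    exact (List.pairwise_append.1 this).2.1
  have pB : (v :: B₂ ++ [z]).Pairwise (fun i j => (P j).1 < (P i).1) := by
    have := h.sortB
    rw [hB, List.append_assoc] at this
    exact (List.pairwise_append.1 this).2.1
  refine ⟨by simp, by simp, pA, pB, ?_, ?_, ?_⟩
  · intro i hi j hj k hk
    exact h.concA i (sA' i hi) j (sA' j hj) k (sA' k hk)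
  · intro i hi j hj k hk
    exact h.concB i (sB' i hi) j (sB' j hj) k (sB' k hk)
  · intro a c ha hc y hy hya hyc
    obtain rfl : q = a := by simpa using ha
    obtain rfl : v = c := by simpa using hc
    have hqv := h.lt hp.mem hp.mem'
    have hqy : (P q).1 < (P y).1 := by
      rw [List.cons_append] at pA
      simp only [List.mem_append] at hy
      rcases hy with (hy | hy) | hy
      · exact (List.pairwise_cons.1 pA).1 y (by simp at hy ⊢; tauto)
      · exact h.lt hp.mem (sB y hy)
      · exact (List.pairwise_cons.1 pA).1 y (by simp at hy ⊢; tauto)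
    rw [orient_neg_left hqv hqy, ← under_left hqv hqy]
    by_cases hyB : y ∈ v :: B₂
    · exact hp.tan y (sB y hyB) hyc
    · exact h.under_of_tan hp.mem hp.mem' (h.head_ne_of_pick hp) hp.tan
        (sA' y (by simp only [List.mem_append] at hy ⊢; tauto)) hqy

lemma rightUp (h : PT P A B z) (hp : Pick P π B A B₁ q B₂ A₁ v A₂) : PT P (A₁ ++ [v]) B₁ q := by
  simpa using (h.mirror.up (pick_mirror hp)).mirror

lemma rightLow (h : PT P A B z) (hp : Pick P π B A B₁ q B₂ A₁ v A₂) :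
    PT P (v :: A₂) (q :: B₂) z := by
  simpa using (h.mirror.low (pick_mirror hp)).mirror

/-- The point of tangency maximises the slope seen from `q`; genericity makes the maximum strict. -/
lemma exists_tan (h : PT P A B z) (g : Generic P) (hq : q ∈ A) :
    ∃ v ∈ B, ∀ v' ∈ B, v' ≠ v → Under P q v v' := by
  obtain ⟨v, hv, hmax⟩ := B.toFinset.exists_max_image (fun v => sl P q v)
    (by simpa using h.neB)
  simp only [List.mem_toFinset] at hv hmax
  refine ⟨v, hv, fun v' hv' hne => ?_⟩
  rw [under_left (h.lt hq hv) (h.lt hq hv')]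
  refine lt_of_le_of_ne (hmax v' hv') fun e => ?_
  refine g.ncol q v v' ?_ hne.symm ?_ ?_
  · rintro rfl; exact h.disj hq hv
  · rintro rfl; exact h.disj hq hv'
  · rw [orient_eq_sl (h.lt hq hv).ne' (h.lt hq hv').ne', e]; ring

lemma exists_pick_of_mem (h : PT P A B z) (g : Generic P) (hq : q ∈ A.tail)
    (hmin : ∀ y ∈ A.tail ++ B.tail, π q ≤ π y) :
    ∃ A₁ A₂ B₁ v B₂, Pick P π A B A₁ q A₂ B₁ v B₂ := by
  obtain ⟨v, hv, tan⟩ := h.exists_tan g (List.mem_of_mem_tail hq)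
  obtain ⟨B₁, B₂, hB⟩ := List.append_of_mem hv
  obtain ⟨a, A', rfl⟩ := List.exists_cons_of_ne_nil h.neA
  obtain ⟨X, Y, hXY⟩ := List.append_of_mem hq
  simp only [List.tail_cons] at hXY
  exact ⟨a :: X, Y, B₁, v, B₂, by simp [hXY], hB, by simp, hmin, tan⟩

lemma exists_pick (h : PT P A B z) (g : Generic P) (π : Equiv.Perm (Fin n))
    (hne : A.tail ++ B.tail ≠ []) :
    (∃ A₁ q A₂ B₁ v B₂, Pick P π A B A₁ q A₂ B₁ v B₂) ∨
      (∃ B₁ q B₂ A₁ v A₂, Pick P π B A B₁ q B₂ A₁ v A₂) := by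
  obtain ⟨q, hq, hmin⟩ := (A.tail ++ B.tail).toFinset.exists_min_image π (by
    rw [← List.toFinset_nonempty_iff] at hne; exact hne)
  simp only [List.mem_toFinset] at hq hmin
  rcases List.mem_append.1 hq with hq | hq
  · left
    obtain ⟨A₁, A₂, B₁, v, B₂, hp⟩ := h.exists_pick_of_mem g hq hmin
    exact ⟨A₁, q, A₂, B₁, v, B₂, hp⟩
  · right
    obtain ⟨B₁, B₂, A₁, v, A₂, hp⟩ := h.mirror.exists_pick_of_mem g.mirror (π := π) hq (by
      intro y hy; exact hmin y (by simp at hy ⊢; tauto))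
    exact ⟨B₁, q, B₂, A₁, v, A₂, pick_of_mirror hp⟩

/-- Priorities are injective and a tangent is unique, so the recursion is deterministic. -/
lemma pick_unique (h : PT P A B z) (hp : Pick P π A B A₁ q A₂ B₁ v B₂)
    {A₁' A₂' B₁' B₂' : List (Fin n)} {q' v' : Fin n}
    (hp' : Pick P π A B A₁' q' A₂' B₁' v' B₂') :
    A₁ = A₁' ∧ q = q' ∧ A₂ = A₂' ∧ B₁ = B₁' ∧ v = v' ∧ B₂ = B₂' := by
  have hq : q = q' := π.injective (le_antisymm
    (hp.first q' (List.mem_append_left _ hp'.mem_tail))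
    (hp'.first q (List.mem_append_left _ hp.mem_tail)))
  subst hq
  have hv : v = v' := by
    by_contra hne
    have h1 := hp.tan v' hp'.mem' (Ne.symm hne)
    have h2 := hp'.tan v hp.mem' hne
    rw [under_left (h.lt hp.mem hp.mem') (h.lt hp.mem hp'.mem')] at h1
    rw [under_left (h.lt hp.mem hp'.mem') (h.lt hp.mem hp.mem')] at h2
    linarith
  subst hv
  obtain ⟨e1, e2⟩ := split_unique h.nodupA hp.hA hp'.hA
  obtain ⟨e3, e4⟩ := split_unique h.nodupB hp.hB hp'.hB
  exact ⟨e1, rfl, e2, e3, rfl, e4⟩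

/-- Determinism turns the rules of `InTri` into the recursive equation used by all later inductions.
The old base passes to the upper part, and every chain edge lies in one of the two parts. -/
lemma tri_left (h : PT P A B z) (hp : Pick P π A B A₁ q A₂ B₁ v B₂) :
    tri P π A B z = tri P π A₁ (B₁ ++ [v]) q ∪ tri P π (q :: A₂) (v :: B₂) z := by
  have hdis : ∀ {B₁' q' B₂' A₁' v' A₂'}, ¬ Pick P π B A B₁' q' B₂' A₁' v' A₂' := by
    intro B₁' q' B₂' A₁' v' A₂' hp'
    have hq : q = q' := π.injective (le_antisymm
      (hp.first q' (List.mem_append_right _ hp'.mem_tail))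
      (hp'.first q (List.mem_append_right _ hp.mem_tail)))
    subst hq
    exact h.disj hp.mem hp'.mem
  ext e
  constructor
  · intro he
    rcases he with he | ⟨hp', he⟩ | ⟨hp', he⟩ | ⟨hp', he⟩ | ⟨hp', he⟩
    · rename_i i j
      have hA := hp.hA
      have hB := hp.hB
      rcases he with he | he | ⟨he1, he2⟩
      · rw [hA, List.append_assoc, List.cons_append] at he
        rcases infix_split he with he | he
        · exact Or.inl (.edge (Or.inl he))
        · exact Or.inr (.edge (Or.inl he))
      · rw [hB, List.append_assoc, List.cons_append] at he
        rcases infix_split he with he | he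
        · exact Or.inl (.edge (Or.inr (Or.inl (he.trans (List.prefix_append _ _).isInfix))))
        · exact Or.inr (.edge (Or.inr (Or.inl he)))
      · refine Or.inl (.edge (Or.inr (Or.inr ⟨?_, ?_⟩)))
        · rw [hA, List.head?_append_of_ne_nil _ hp.ne] at he1; exact he1
        · rw [hB] at he2; cases B₁ <;> simpa using he2
    · obtain ⟨rfl, rfl, rfl, rfl, rfl, rfl⟩ := h.pick_unique hp hp'
      exact Or.inl he
    · obtain ⟨rfl, rfl, rfl, rfl, rfl, rfl⟩ := h.pick_unique hp hp'
      exact Or.inr he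
    · exact absurd hp' hdis
    · exact absurd hp' hdis
  · rintro (he | he)
    · exact .leftUp hp he
    · exact .leftLow hp he

lemma tri_right (h : PT P A B z) (hp : Pick P π B A B₁ q B₂ A₁ v A₂) :
    tri P π A B z = tri P π (A₁ ++ [v]) B₁ q ∪ tri P π (v :: A₂) (q :: B₂) z := by
  have := h.mirror.tri_left (pick_mirror hp)
  rwa [tri_mirror, tri_mirror, tri_mirror] at this

lemma tri_leaf {a c : Fin n} : tri P π [a] [c] z = {s(a, z), s(c, z), s(a, c)} := by
  have two : ∀ {i j x y : Fin n}, [i, j] <:+: [x, y] → i = x ∧ j = y := by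
    intro i j x y h
    have := h.eq_of_length (by simp)
    simpa using this
  ext e
  constructor
  · intro he
    rcases he with he | ⟨hp', he⟩ | ⟨hp', he⟩ | ⟨hp', he⟩ | ⟨hp', he⟩
    · rcases he with he | he | ⟨he1, he2⟩
      · obtain ⟨rfl, rfl⟩ := two he; simp
      · obtain ⟨rfl, rfl⟩ := two he
        simp [Sym2.eq_swap]
      · simp at he1 he2; subst he1 he2; simp
    all_goals exact absurd hp'.mem_tail (by simp)
  · rintro (rfl | rfl | rfl)
    · exact .edge (Or.inl List.infix_rfl)
    · rw [Sym2.eq_swap]; exact .edge (Or.inr (Or.inl List.infix_rfl))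
    · exact .edge (Or.inr (Or.inr ⟨rfl, rfl⟩))

lemma eq_leaf (h : PT P A B z) (hne : ¬ (A.tail ++ B.tail ≠ [])) : ∃ a c, A = [a] ∧ B = [c] := by
  push Not at hne
  obtain ⟨a, A', rfl⟩ := List.exists_cons_of_ne_nil h.neA
  obtain ⟨c, B', rfl⟩ := List.exists_cons_of_ne_nil h.neB
  simp only [List.tail_cons, List.append_eq_nil_iff] at hne
  exact ⟨a, c, by rw [hne.1], by rw [hne.2]⟩

end PT

lemma Pick.length_up {P : Config n} {π : Equiv.Perm (Fin n)} {A B A₁ A₂ B₁ B₂ : List (Fin n)}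
    {q v : Fin n} (h : Pick P π A B A₁ q A₂ B₁ v B₂) :
    A₁.length + (B₁ ++ [v]).length < A.length + B.length := by
  rw [h.hA, h.hB]; simp; omega

lemma Pick.length_low {P : Config n} {π : Equiv.Perm (Fin n)} {A B A₁ A₂ B₁ B₂ : List (Fin n)}
    {q v : Fin n} (h : Pick P π A B A₁ q A₂ B₁ v B₂) :
    (q :: A₂).length + (v :: B₂).length < A.length + B.length := by
  have := List.length_pos_of_ne_nil h.ne
  rw [h.hA, h.hB]; simp; omega

lemma Pick.length_add {P : Config n} {π : Equiv.Perm (Fin n)} {A B A₁ A₂ B₁ B₂ : List (Fin n)}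
    {q v : Fin n} (h : Pick P π A B A₁ q A₂ B₁ v B₂) :
    A₁.length + (B₁ ++ [v]).length + ((q :: A₂).length + (v :: B₂).length) =
      A.length + B.length + 1 := by
  rw [h.hA, h.hB]; simp; omega

/-- A triangulation with `m` vertices other than the apex has at most `3 (m - 1)` edges. -/
lemma PT.ncard_tri_le {P : Config n} (g : Generic P) (π : Equiv.Perm (Fin n)) (N : ℕ) :
    ∀ {A B : List (Fin n)} {z : Fin n}, A.length + B.length ≤ N → PT P A B z →
      (tri P π A B z).ncard + 3 ≤ 3 * (A.length + B.length) := by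
  induction N with
  | zero =>
    intro A B z hN h
    have := List.length_pos_of_ne_nil h.neA
    omega
  | succ N ih =>
    intro A B z hN h
    by_cases hne : A.tail ++ B.tail ≠ []
    · rcases h.exists_pick g π hne with ⟨A₁, q, A₂, B₁, v, B₂, hp⟩ | ⟨B₁, q, B₂, A₁, v, A₂, hp⟩
      · have h1 := ih (by have := hp.length_up; omega) (h.up hp)
        have h2 := ih (by have := hp.length_low; omega) (h.low hp)
        -- The numbers of non-apex vertices of the two parts add up to one more than that of the
        -- whole, so the bounds `3 (m - 1)` add up exactly.
        have h3 := hp.length_add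
        rw [h.tri_left hp]
        have := Set.ncard_union_le (tri P π A₁ (B₁ ++ [v]) q) (tri P π (q :: A₂) (v :: B₂) z)
        omega
      · have h1 := ih (by have := hp.length_up; omega) (h.rightUp hp)
        have h2 := ih (by have := hp.length_low; omega) (h.rightLow hp)
        have h3 := hp.length_add
        rw [h.tri_right hp]
        have := Set.ncard_union_le (tri P π (A₁ ++ [v]) B₁ q) (tri P π (v :: A₂) (q :: B₂) z)
        omega
    · obtain ⟨a, c, rfl, rfl⟩ := h.eq_leaf hne
      rw [PT.tri_leaf]
      have : ({s(a, z), s(c, z), s(a, c)} : Set (Sym2 (Fin n))).ncard ≤ 3 := by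
        refine (Set.ncard_insert_le _ _).trans ?_
        have := Set.ncard_insert_le s(c, z) ({s(a, c)} : Set (Sym2 (Fin n)))
        rw [Set.ncard_singleton] at this
        omega
      simp; omega

/-- The triangulation depends only on the tangents from non-corner vertices to pieces of the
opposite chain. -/
lemma tri_subset_of_tan {P P' : Config n} {π : Equiv.Perm (Fin n)} {A B : List (Fin n)} {z : Fin n}
    (h1 : ∀ q ∈ A.tail, ∀ B', B' <:+: B → ∀ v ∈ B', (∀ v' ∈ B', v' ≠ v → Under P q v v') →
      ∀ v' ∈ B', v' ≠ v → Under P' q v v')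
    (h2 : ∀ q ∈ B.tail, ∀ A', A' <:+: A → ∀ v ∈ A', (∀ v' ∈ A', v' ≠ v → Under P q v v') →
      ∀ v' ∈ A', v' ≠ v → Under P' q v v') :
    tri P π A B z ⊆ tri P' π A B z := by
  intro e he
  -- In each part the chains are contiguous pieces of the old chains, and no corner becomes a
  -- non-corner vertex; so the hypotheses pass to the parts.
  have up : ∀ {L L₁ L₂ : List (Fin n)} {x : Fin n}, L = L₁ ++ x :: L₂ → L₁ ≠ [] →
      L₁ <:+: L ∧ L₁.tail ⊆ L.tail := by
    rintro L L₁ L₂ x rfl hne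
    refine ⟨(List.prefix_append _ _).isInfix, ?_⟩
    obtain ⟨a, A', rfl⟩ := List.exists_cons_of_ne_nil hne
    simp
  have up' : ∀ {L L₁ L₂ : List (Fin n)} {x : Fin n}, L = L₁ ++ x :: L₂ →
      L₁ ++ [x] <:+: L ∧ (L₁ ++ [x]).tail ⊆ L.tail := by
    rintro L L₁ L₂ x rfl
    refine ⟨?_, ?_⟩
    · exact ⟨[], L₂, by simp⟩
    · intro y hy; cases L₁ <;> simp at hy ⊢; tauto
  have low : ∀ {L L₁ L₂ : List (Fin n)} {x : Fin n}, L = L₁ ++ x :: L₂ →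
      x :: L₂ <:+: L ∧ (x :: L₂).tail ⊆ L.tail := by
    rintro L L₁ L₂ x rfl
    refine ⟨(List.suffix_append _ _).isInfix, ?_⟩
    intro y hy; cases L₁ <;> simp at hy ⊢ <;> tauto
  induction he with
  | edge h => exact .edge h
  | @leftUp A B z e A₁ q A₂ B₁ v B₂ hp _ ih =>
    have hp' : Pick P' π A B A₁ q A₂ B₁ v B₂ := ⟨hp.hA, hp.hB, hp.ne, hp.first,
      h1 q hp.mem_tail B List.infix_rfl v hp.mem' hp.tan⟩
    exact .leftUp hp' (ih
      (fun q' hq' B' hB' => h1 q' ((up hp.hA hp.ne).2 hq') B' (hB'.trans (up' hp.hB).1))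
      (fun q' hq' A' hA' => h2 q' ((up' hp.hB).2 hq') A' (hA'.trans (up hp.hA hp.ne).1)))
  | @leftLow A B z e A₁ q A₂ B₁ v B₂ hp _ ih =>
    have hp' : Pick P' π A B A₁ q A₂ B₁ v B₂ := ⟨hp.hA, hp.hB, hp.ne, hp.first,
      h1 q hp.mem_tail B List.infix_rfl v hp.mem' hp.tan⟩
    exact .leftLow hp' (ih
      (fun q' hq' B' hB' => h1 q' ((low hp.hA).2 hq') B' (hB'.trans (low hp.hB).1))
      (fun q' hq' A' hA' => h2 q' ((low hp.hB).2 hq') A' (hA'.trans (low hp.hA).1)))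
  | @rightUp A B z e A₁ q A₂ B₁ v B₂ hp _ ih =>
    have hp' : Pick P' π B A B₁ q B₂ A₁ v A₂ := ⟨hp.hA, hp.hB, hp.ne, hp.first,
      h2 q hp.mem_tail A List.infix_rfl v hp.mem' hp.tan⟩
    exact .rightUp hp' (ih
      (fun q' hq' B' hB' => h1 q' ((up' hp.hB).2 hq') B' (hB'.trans (up hp.hA hp.ne).1))
      (fun q' hq' A' hA' => h2 q' ((up hp.hA hp.ne).2 hq') A' (hA'.trans (up' hp.hB).1)))
  | @rightLow A B z e A₁ q A₂ B₁ v B₂ hp _ ih =>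
    have hp' : Pick P' π B A B₁ q B₂ A₁ v A₂ := ⟨hp.hA, hp.hB, hp.ne, hp.first,
      h2 q hp.mem_tail A List.infix_rfl v hp.mem' hp.tan⟩
    exact .rightLow hp' (ih
      (fun q' hq' B' hB' => h1 q' ((low hp.hB).2 hq') B' (hB'.trans (low hp.hA).1))
      (fun q' hq' A' hA' => h2 q' ((low hp.hA).2 hq') A' (hA'.trans (low hp.hB).1)))

lemma tri_subset_of_agree {P P' : Config n} {π : Equiv.Perm (Fin n)} {A B : List (Fin n)}
    {z : Fin n}
    (h1 : ∀ q ∈ A.tail, ∀ v ∈ B, ∀ v' ∈ B, v ≠ v' → (Under P q v v' → Under P' q v v'))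
    (h2 : ∀ q ∈ B.tail, ∀ v ∈ A, ∀ v' ∈ A, v ≠ v' → (Under P q v v' → Under P' q v v')) :
    tri P π A B z ⊆ tri P' π A B z :=
  tri_subset_of_tan
    (fun q hq _ hB' v hv h v' hv' hne =>
      h1 q hq v (hB'.subset hv) v' (hB'.subset hv') (Ne.symm hne) (h v' hv' hne))
    (fun q hq _ hA' v hv h v' hv' hne =>
      h2 q hq v (hA'.subset hv) v' (hA'.subset hv') (Ne.symm hne) (h v' hv' hne))

lemma tri_congr {P P' : Config n} {π : Equiv.Perm (Fin n)} {A B : List (Fin n)} {z : Fin n}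
    (h1 : ∀ q ∈ A.tail, ∀ v ∈ B, ∀ v' ∈ B, v ≠ v' → (Under P q v v' ↔ Under P' q v v'))
    (h2 : ∀ q ∈ B.tail, ∀ v ∈ A, ∀ v' ∈ A, v ≠ v' → (Under P q v v' ↔ Under P' q v v')) :
    tri P π A B z = tri P' π A B z :=
  (tri_subset_of_agree (fun q hq v hv v' hv' hn => (h1 q hq v hv v' hv' hn).1)
    (fun q hq v hv v' hv' hn => (h2 q hq v hv v' hv' hn).1)).antisymm
  (tri_subset_of_agree (fun q hq v hv v' hv' hn => (h1 q hq v hv v' hv' hn).2)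
    (fun q hq v hv v' hv' hn => (h2 q hq v hv v' hv' hn).2))

end KineticTriangulation

/-! ### Configurations just before and after a collinearity; moving the base past a vertex. -/

namespace KineticTriangulation

variable {n : ℕ}

lemma under_iff_of_lt {P : Config n} {q v w : Fin n} (h : (P q).1 < (P v).1) :
    Under P q v w ↔ orient (P q) (P v) (P w) < 0 := by
  have := sub_pos.2 h
  unfold Under
  constructor <;> intro h' <;> nlinarith

lemma under_iff_of_gt {P : Config n} {q v w : Fin n} (h : (P v).1 < (P q).1) :
    Under P q v w ↔ 0 < orient (P q) (P v) (P w) := by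
  have : (P v).1 - (P q).1 < 0 := by linarith
  unfold Under
  constructor <;> intro h' <;> nlinarith

/-- Two configurations `PA` and `PB` right after and right before (or before and after) the
passage of the point `m` through the segment `ik`: the order of the points and the
orientations of all other triples agree. -/
structure Flip (PA PB : Config n) (i m k : Fin n) : Prop where
  gA : Generic PA
  gB : Generic PB
  ord : ∀ x y, (PA x).1 < (PA y).1 ↔ (PB x).1 < (PB y).1
  him : (PA i).1 < (PA m).1
  hmk : (PA m).1 < (PA k).1
  agree : ∀ x y w, x ≠ y → y ≠ w → x ≠ w →
    ¬ ((x = i ∨ x = m ∨ x = k) ∧ (y = i ∨ y = m ∨ y = k) ∧ (w = i ∨ w = m ∨ w = k)) →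
    (orient (PA x) (PA y) (PA w) < 0 ↔ orient (PB x) (PB y) (PB w) < 0)
  negA : orient (PA i) (PA m) (PA k) < 0
  posB : 0 < orient (PB i) (PB m) (PB k)
  -- The three lines nearly coincide, so every further point is on the same side of all of them.
  compat : ∀ r, r ≠ i → r ≠ m → r ≠ k →
    (orient (PA i) (PA m) (PA r) < 0 ↔ orient (PA i) (PA k) (PA r) < 0) ∧
    (orient (PA i) (PA m) (PA r) < 0 ↔ orient (PA m) (PA k) (PA r) < 0)

namespace Flip

variable {PA PB : Config n} {i m k : Fin n}

lemma ne_im (F : Flip PA PB i m k) : i ≠ m := by rintro rfl; exact lt_irrefl _ F.him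

lemma ne_mk (F : Flip PA PB i m k) : m ≠ k := by rintro rfl; exact lt_irrefl _ F.hmk

lemma ne_ik (F : Flip PA PB i m k) : i ≠ k := by
  rintro rfl; exact lt_irrefl _ (F.him.trans F.hmk)

lemma under (F : Flip PA PB i m k) {q v w : Fin n} (h1 : q ≠ v) (h2 : v ≠ w) (h3 : q ≠ w)
    (h : ¬ ((q = i ∨ q = m ∨ q = k) ∧ (v = i ∨ v = m ∨ v = k) ∧ (w = i ∨ w = m ∨ w = k))) :
    Under PA q v w ↔ Under PB q v w := by
  have ag := F.agree q v w h1 h2 h3 h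
  have a0 := F.gA.ncol q v w h1 h2 h3
  have b0 := F.gB.ncol q v w h1 h2 h3
  rcases lt_or_gt_of_ne (F.gA.inj q v h1) with hlt | hlt
  · rw [under_iff_of_lt hlt, under_iff_of_lt ((F.ord _ _).1 hlt), ag]
  · rw [under_iff_of_gt hlt, under_iff_of_gt ((F.ord _ _).1 hlt)]
    rcases lt_or_gt_of_ne a0 with h | h <;> rcases lt_or_gt_of_ne b0 with h' | h'
    · constructor <;> intro <;> linarith
    · have := ag.1 h; linarith
    · have := ag.2 h'; linarith
    · exact ⟨fun _ => h', fun _ => h⟩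

lemma tri_same (F : Flip PA PB i m k) {A B : List (Fin n)} {z : Fin n} (h : PT PA A B z)
    (h1 : ∀ q ∈ A.tail, ∀ v ∈ B, ∀ v' ∈ B, v ≠ v' →
      ¬ ((q = i ∨ q = m ∨ q = k) ∧ (v = i ∨ v = m ∨ v = k) ∧ (v' = i ∨ v' = m ∨ v' = k)))
    (h2 : ∀ q ∈ B.tail, ∀ v ∈ A, ∀ v' ∈ A, v ≠ v' →
      ¬ ((q = i ∨ q = m ∨ q = k) ∧ (v = i ∨ v = m ∨ v = k) ∧ (v' = i ∨ v' = m ∨ v' = k)))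
    (π : Equiv.Perm (Fin n)) : tri PA π A B z = tri PB π A B z := by
  refine tri_congr ?_ ?_
  · intro q hq v hv v' hv' hne
    exact F.under (h.ne (List.mem_of_mem_tail hq) hv) hne (h.ne (List.mem_of_mem_tail hq) hv')
      (h1 q hq v hv v' hv' hne)
  · intro q hq v hv v' hv' hne
    exact F.under (Ne.symm (h.ne hv (List.mem_of_mem_tail hq))) hne
      (Ne.symm (h.ne hv' (List.mem_of_mem_tail hq))) (h2 q hq v hv v' hv' hne)

/-- A test of the recursion compares a vertex of one chain with two of the other and never involves
the apex. Only a test on all of `i`, `m`, `k` can change, so nothing changes if one of them is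
missing from the chains. -/
lemma tri_same_of_notMem (F : Flip PA PB i m k) {A B : List (Fin n)} {z x : Fin n}
    (h : PT PA A B z) (hx : x = i ∨ x = m ∨ x = k) (hA : x ∉ A) (hB : x ∉ B)
    (π : Equiv.Perm (Fin n)) : tri PA π A B z = tri PB π A B z := by
  have key : ∀ q v v' : Fin n, q ≠ x → v ≠ x → v' ≠ x → q ≠ v → v ≠ v' → q ≠ v' →
      ¬ ((q = i ∨ q = m ∨ q = k) ∧ (v = i ∨ v = m ∨ v = k) ∧ (v' = i ∨ v' = m ∨ v' = k)) := by
    intro q v v' a1 a2 a3 b1 b2 b3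
    rcases hx with rfl | rfl | rfl <;> grind
  refine F.tri_same h ?_ ?_ π
  · intro q hq v hv v' hv' hne
    have hq := List.mem_of_mem_tail hq
    exact key q v v' (by rintro rfl; exact hA hq) (by rintro rfl; exact hB hv)
      (by rintro rfl; exact hB hv') (h.ne hq hv) hne (h.ne hq hv')
  · intro q hq v hv v' hv' hne
    have hq := List.mem_of_mem_tail hq
    exact key q v v' (by rintro rfl; exact hB hq) (by rintro rfl; exact hA hv)
      (by rintro rfl; exact hA hv') (Ne.symm (h.ne hv hq)) hne (Ne.symm (h.ne hv' hq))

/-- Rotating the base about one of its ends past the first vertex of the chain at the other end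
only adds a triangle. -/
lemma tri_base (F : Flip PA PB i m k) (π : Equiv.Perm (Fin n)) (N : ℕ) :
    ∀ {K B : List (Fin n)} {z : Fin n}, K.length + B.length ≤ N → PT PA (m :: K) (k :: B) z →
      PT PB (i :: m :: K) (k :: B) z →
      tri PB π (i :: m :: K) (k :: B) z = tri PA π (m :: K) (k :: B) z ∪ {s(i, k), s(i, m)} := by
  induction N using Nat.strong_induction_on with
  | _ N ih =>
  intro K B z hN hA hB
  have iA : ∀ {x}, x ∈ k :: B → x ≠ i := by
    rintro x hx rfl; exact hB.disj (by simp) hx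
  have iK : i ∉ m :: K := (List.nodup_cons.1 hB.nodupA).1
  have mB : ∀ {x}, x ∈ k :: B → x ≠ m := by
    rintro x hx rfl; exact hA.disj (by simp) hx
  have kA : ∀ {x}, x ∈ m :: K → x ≠ k := by
    rintro x hx rfl; exact hA.disj hx (by simp)
  have kB : k ∉ B := (List.nodup_cons.1 hA.nodupB).1
  have mK : m ∉ K := (List.nodup_cons.1 hA.nodupA).1
  have fin : ∀ {x : Fin n}, x ∈ B → orient (PA m) (PA k) (PA x) < 0 := by
    intro x hx
    exact hA.base m k rfl rfl x (by simp [hx]) (mB (by simp [hx])) (by rintro rfl; exact kB hx)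
  rcases hB.exists_pick F.gB π (by simp) with ⟨A₁, q, A₂, B₁, v, B₂, hp⟩ | ⟨B₁, q, B₂, A₁, v, A₂, hp⟩
  · have e := hp.hA
    have eB := hp.hB
    obtain ⟨_, A₁', rfl⟩ := List.exists_cons_of_ne_nil hp.ne
    simp only [List.cons_append, List.cons.injEq] at e
    obtain ⟨rfl, e⟩ := e
    -- If `m` itself is chosen, its chord is the old base `m k`. It cuts off the triangle `i m k`,
    -- and below it lies the pseudo-triangle of `PA`.
    rcases A₁' with _ | ⟨_, A₁''⟩
    · simp only [List.nil_append, List.cons.injEq] at e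
      obtain ⟨rfl, rfl⟩ := e
      -- In `PA` the right chain lies below the base `m k`. The tests from `m` that show this do not
      -- involve `i`, so they hold in `PB` too, and `k` is the point of tangency.
      have hvk : v = k := by
        by_contra hne
        have h1 := hp.tan k (by simp) (Ne.symm hne)
        have hvB : v ∈ B := by
          have := hp.mem'; simp at this; tauto
        have h2 : Under PA m k v := (under_iff_of_lt F.hmk).2 (fin hvB)
        have hv := hp.mem'
        rw [F.under F.ne_mk (Ne.symm hne) (mB hv).symm
          (by rintro ⟨-, -, h | h | h⟩; exacts [iA hv h, mB hv h, hne h])] at h2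
        have l1 := hB.lt (x := m) (by simp) hv
        have l2 := hB.lt (x := m) (y := k) (by simp) (by simp)
        rw [under_left l1 l2] at h1
        rw [under_left l2 l1] at h2
        linarith
      subst hvk
      obtain ⟨rfl, rfl⟩ := split_unique (L₁ := []) hA.nodupB rfl eB
      rw [hB.tri_left hp, List.nil_append, PT.tri_leaf, ← F.tri_same_of_notMem hA (x := i)
        (Or.inl rfl) iK (fun h => iA h rfl)]
      have : s(v, m) ∈ tri PA π (m :: K) (v :: B) z := by
        rw [Sym2.eq_swap]
        exact .edge (Or.inr (Or.inr ⟨rfl, rfl⟩))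
      ext x
      simp only [Set.mem_union, Set.mem_insert_iff, Set.mem_singleton_iff]
      constructor
      · rintro ((h | rfl | h) | h) <;> tauto
      · tauto
    · simp only [List.cons_append, List.cons.injEq] at e
      obtain ⟨rfl, e⟩ := e
      have hqK : q ∈ K := by rw [e]; simp
      have hqm : q ≠ m := by rintro rfl; exact mK hqK
      have hqi : q ≠ i := by rintro rfl; exact iK (by simp [hqK])
      have hqk : q ≠ k := kA (by simp [hqK])
      -- Any other vertex makes the same choice in both configurations. The base is in the upper
      -- part, which the induction handles, and the lower part does not contain `i`.
      have hpA : Pick PA π (m :: K) (k :: B) (m :: A₁'') q A₂ B₁ v B₂ := by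
        refine ⟨by rw [e]; rfl, eB, by simp, ?_, ?_⟩
        · intro y hy; exact hp.first y (by simp at hy ⊢; tauto)
        · intro v' hv' hne
          rw [F.under (hA.ne (by simp [hqK]) hp.mem') (Ne.symm hne)
            (hA.ne (by simp [hqK]) hv') (by tauto)]
          exact hp.tan v' hv' hne
      have u1 := hA.up hpA
      have u2 := hB.up hp
      have l1 := hA.low hpA
      have hlen := hpA.length_up
      rw [hB.tri_left hp, hA.tri_left hpA, ← F.tri_same_of_notMem l1 (x := i) (Or.inl rfl)
        (by intro h; apply iK; rw [e]; simp at h ⊢; tauto)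
        (by intro h; apply iA (x := i) _ rfl; rw [eB]; simp at h ⊢; tauto)]
      obtain ⟨B', hB'⟩ : ∃ B', B₁ ++ [v] = k :: B' := by
        rcases B₁ with _ | ⟨b, B₁⟩
        · simp at eB; exact ⟨[], by simp [eB.1]⟩
        · simp at eB; exact ⟨B₁ ++ [v], by simp [eB.1]⟩
      rw [hB'] at u1 u2 hlen ⊢
      rw [ih (A₁''.length + B'.length) (by simp at hlen; omega) le_rfl u1 u2]
      ext; simp only [Set.mem_union]; tauto
  · have eB := hp.hA
    have e := hp.hB
    obtain ⟨_, B₁', rfl⟩ := List.exists_cons_of_ne_nil hp.ne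
    simp only [List.cons_append, List.cons.injEq] at eB
    obtain ⟨rfl, eB⟩ := eB
    have hqB : q ∈ B := by rw [eB]; simp
    have hqB' : q ∈ k :: B := by simp [hqB]
    have hqk : q ≠ k := by rintro rfl; exact kB hqB
    have hqm := mB hqB'
    have hqi := iA hqB'
    -- A vertex `q` of the right chain is below the base `m k` of `PA`, hence below the line `i m`.
    -- From there `m` appears above `i`, so the tangent cannot touch `i`.
    have hvi : v ≠ i := by
      rintro rfl
      have h1 := hp.tan m (by simp) F.ne_im.symm
      rw [under_iff_of_gt (hB.lt (x := v) (by simp) hqB'), orient_rot] at h1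
      have h2 := ((F.compat q hqi hqm hqk).2).2 (fin hqB)
      rw [F.agree v m q F.ne_im hqm.symm hqi.symm (by tauto)] at h2
      linarith
    obtain ⟨A₁', rfl⟩ : ∃ A₁', A₁ = i :: A₁' := by
      rcases A₁ with _ | ⟨a, A₁⟩
      · simp at e; exact absurd e.1.symm hvi
      · simp at e; exact ⟨A₁, by rw [e.1]⟩
    simp only [List.cons_append, List.cons.injEq, true_and] at e
    have hpA : Pick PA π (k :: B) (m :: K) (k :: B₁') q B₂ A₁' v A₂ := by
      refine ⟨by rw [eB]; rfl, e, by simp, ?_, ?_⟩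
      · intro y hy; exact hp.first y (by simp at hy ⊢; tauto)
      · intro v' hv' hne
        have hvm : v ∈ m :: K := by rw [e]; simp
        rw [F.under (hA.ne hvm hqB').symm (Ne.symm hne) (hA.ne hv' hqB').symm (by tauto)]
        exact hp.tan v' (by simp at hv' ⊢; tauto) hne
    have u1 := hA.rightUp hpA
    have u2 := hB.rightUp hp
    have l1 := hA.rightLow hpA
    have hlen := hpA.length_up
    rw [hB.tri_right hp, hA.tri_right hpA, ← F.tri_same_of_notMem l1 (x := i) (Or.inl rfl)
        (by intro h; apply iK; rw [e]; simp at h ⊢; tauto)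
        (by intro h; apply iA (x := i) _ rfl; rw [eB]; simp at h ⊢; tauto)]
    obtain ⟨K', hK'⟩ : ∃ K', A₁' ++ [v] = m :: K' := by
      rcases A₁' with _ | ⟨b, A₁'⟩
      · simp at e; exact ⟨[], by simp [e.1]⟩
      · simp at e; exact ⟨A₁' ++ [v], by simp [e.1]⟩
    rw [List.cons_append] at u2 ⊢
    rw [hK'] at u1 u2 hlen ⊢
    rw [ih (K'.length + B₁'.length) (by simp at hlen; omega) le_rfl u1 u2]
    ext; simp only [Set.mem_union]; tauto

end Flip

end KineticTriangulation

/-! ### Late vertices, the five selection rules and the invariant of the recursion. -/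

namespace KineticTriangulation

variable {n : ℕ}

open scoped symmDiff

/-- Rules that select at most one point from a set `G`, given the two chains `A₀` and `B₀` of a
funnel and two adjacent vertices `i` and `m` of `A₀`. -/
def Sel (P : Config n) (A₀ B₀ : List (Fin n)) (i m : Fin n) :
    Fin 5 → Set (Fin n) → Fin n → Prop
  | 0, G, y => y ∈ G ∧ y ∈ A₀ ∧ (P y).1 < (P m).1 ∧
      ∀ x ∈ G, x ∈ A₀ → (P x).1 < (P m).1 → (P x).1 ≤ (P y).1
  | 1, G, y => y ∈ G ∧ y ∈ A₀ ∧ (P m).1 < (P y).1 ∧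
      ∀ x ∈ G, x ∈ A₀ → (P m).1 < (P x).1 → (P y).1 ≤ (P x).1
  -- `Under P y i m` says that `y` is above the line `i m`. Such vertices form the part of the right
  -- chain next to the base, and rules 2 and 3 choose the selectable vertex nearest to the crossing
  -- from below and from above.
  | 2, G, y => y ∈ G ∧ y ∈ B₀ ∧ ¬ Under P y i m ∧
      ∀ x ∈ G, x ∈ B₀ → ¬ Under P x i m → (P x).1 ≤ (P y).1
  | 3, G, y => y ∈ G ∧ y ∈ B₀ ∧ Under P y i m ∧
      ∀ x ∈ G, x ∈ B₀ → Under P x i m → (P y).1 ≤ (P x).1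
  -- Here `w` is the first point of `G` after `m` on the left chain, and `v` its point of tangency
  -- on the whole right chain. The vertex nearest to `v` on the side of the base is chosen.
  | 4, G, y => y ∈ G ∧ y ∈ B₀ ∧ ∃ w v, (w ∈ G ∧ w ∈ A₀ ∧ (P m).1 < (P w).1 ∧
      ∀ x ∈ G, x ∈ A₀ → (P m).1 < (P x).1 → (P w).1 ≤ (P x).1) ∧
      v ∈ B₀ ∧ (∀ v' ∈ B₀, v' ≠ v → Under P w v v') ∧ (P v).1 ≤ (P y).1 ∧
      ∀ x ∈ G, x ∈ B₀ → (P v).1 ≤ (P x).1 → (P y).1 ≤ (P x).1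

/-- The points that may still be non-corner vertices, together with `m`, when `m` is inserted. -/
def Late (P : Config n) (A₀ B₀ : List (Fin n)) (i m : Fin n) (I : Set (Fin n))
    (π : Equiv.Perm (Fin n)) : Set (Fin n) :=
  {y | y ∈ I ∧ π m < π y ∧ ∃ c, Sel P A₀ B₀ i m c (insert y {x | x ∈ I ∧ π x < π m}) y}

/-- Each rule asks for an extreme x-coordinate, and those are distinct. In rule 4 the auxiliary `w`
and `v` are also determined. Uniqueness is the only property of the rules that the counting needs.
-/
lemma sel_unique {P : Config n} (g : Generic P) {A₀ B₀ : List (Fin n)} {z i m : Fin n}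
    (h : PT P A₀ B₀ z) {c : Fin 5} {G : Set (Fin n)} {y y' : Fin n}
    (h1 : Sel P A₀ B₀ i m c G y) (h2 : Sel P A₀ B₀ i m c G y') : y = y' := by
  have inj : ∀ {a b : Fin n}, (P a).1 ≤ (P b).1 → (P b).1 ≤ (P a).1 → a = b := by
    intro a b hab hba
    by_contra hne
    exact g.inj a b hne (le_antisymm hab hba)
  match c, h1, h2 with
  | 0, ⟨a1, a2, a3, a4⟩, ⟨b1, b2, b3, b4⟩ => exact inj (b4 y a1 a2 a3) (a4 y' b1 b2 b3)
  | 1, ⟨a1, a2, a3, a4⟩, ⟨b1, b2, b3, b4⟩ => exact inj (a4 y' b1 b2 b3) (b4 y a1 a2 a3)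
  | 2, ⟨a1, a2, a3, a4⟩, ⟨b1, b2, b3, b4⟩ => exact inj (b4 y a1 a2 a3) (a4 y' b1 b2 b3)
  | 3, ⟨a1, a2, a3, a4⟩, ⟨b1, b2, b3, b4⟩ => exact inj (a4 y' b1 b2 b3) (b4 y a1 a2 a3)
  | 4, ⟨a1, a2, w, v, ⟨p1, p2, p3, p4⟩, hv, tv, a3, a4⟩,
      ⟨b1, b2, w', v', ⟨q1, q2, q3, q4⟩, hv', tv', b3, b4⟩ =>
    obtain rfl : w = w' := inj (p4 w' q1 q2 q3) (q4 w p1 p2 p3)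
    obtain rfl : v = v' := by
      by_contra hne
      have u1 := tv v' hv' (Ne.symm hne)
      have u2 := tv' v hv hne
      rw [under_left (h.lt p2 hv) (h.lt p2 hv')] at u1
      rw [under_left (h.lt p2 hv') (h.lt p2 hv)] at u2
      linarith
    exact inj (a4 y' b1 b2 b3) (b4 y a1 a2 a3)

lemma mem_of_between {f : Fin n → ℝ} {L L₀ : List (Fin n)} (h : L <:+: L₀)
    (hs : L₀.Pairwise (fun a b => f a < f b)) {x y w : Fin n} (hx : x ∈ L) (hy : y ∈ L)
    (hw : w ∈ L₀) (h1 : f x ≤ f w) (h2 : f w ≤ f y) : w ∈ L := by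
  obtain ⟨s, t, rfl⟩ := h
  simp only [List.pairwise_append, List.mem_append] at hs hw
  rcases hw with (hw | hw) | hw
  · have := hs.1.2.2 w hw x hx; linarith
  · exact hw
  · have := hs.2.2 y (Or.inr hy) w hw; linarith

lemma infix_append_left {α : Type*} {L L' L₀ : List α} (h : L ++ L' <:+: L₀) : L <:+: L₀ :=
  (List.prefix_append L L').isInfix.trans h

lemma infix_append_right {α : Type*} {L L' L₀ : List α} (h : L ++ L' <:+: L₀) : L' <:+: L₀ :=
  (List.suffix_append L L').isInfix.trans h

namespace PT

variable {P : Config n} {A B A₀ B₀ : List (Fin n)} {z z₀ : Fin n}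

lemma betweenA (h : PT P A₀ B₀ z₀) (hi : A <:+: A₀) {x y w : Fin n} (hx : x ∈ A) (hy : y ∈ A)
    (hw : w ∈ A₀) (h1 : (P x).1 ≤ (P w).1) (h2 : (P w).1 ≤ (P y).1) : w ∈ A :=
  mem_of_between (f := fun a => (P a).1) hi h.pairA hx hy hw h1 h2

lemma betweenB (h : PT P A₀ B₀ z₀) (hi : B <:+: B₀) {x y w : Fin n} (hx : x ∈ B) (hy : y ∈ B)
    (hw : w ∈ B₀) (h1 : (P x).1 ≤ (P w).1) (h2 : (P w).1 ≤ (P y).1) : w ∈ B :=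
  h.mirror.betweenA hi hy hx hw (by simpa using h2) (by simpa using h1)

lemma mem_tailA (h : PT P A B z) {x w : Fin n} (hx : x ∈ A) (hw : w ∈ A)
    (hxw : (P x).1 < (P w).1) : w ∈ A.tail := by
  obtain ⟨a, A', rfl⟩ := List.exists_cons_of_ne_nil h.neA
  rcases List.mem_cons.1 hw with rfl | hw
  · rcases List.mem_cons.1 hx with rfl | hx
    · exact absurd hxw (lt_irrefl _)
    · have := (List.pairwise_cons.1 h.pairA).1 x hx; linarith
  · exact hw

lemma mem_tailB (h : PT P A B z) {x w : Fin n} (hx : x ∈ B) (hw : w ∈ B)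
    (hxw : (P w).1 < (P x).1) : w ∈ B.tail :=
  h.mirror.mem_tailA hx hw (by simpa using hxw)

/-- The vertices of the right chain that lie above the line through two vertices of the left chain
form an initial part of the right chain. -/
lemma monoB (h : PT P A B z) {r r' i m : Fin n} (hr : r ∈ B) (hr' : r' ∈ B) (hi : i ∈ A)
    (hm : m ∈ A) (him : (P i).1 < (P m).1) (hrr : (P r').1 ≤ (P r).1) (hu : Under P r' i m)
    (g : Generic P) : Under P r i m := by
  rcases hrr.lt_or_eq with hlt | heq
  · exact (under_mirror _ _ _ _).1 (h.mirror.mono hr hr' hi hm (by simpa using hlt)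
      (by simpa using him) ((under_mirror _ _ _ _).2 hu))
  · obtain rfl : r' = r := by
      by_contra hne
      exact g.inj r' r hne heq
    exact hu

lemma head_aboveB (h : PT P A B z) {c i m : Fin n} (hc : B.head? = some c) (hi : i ∈ A)
    (hm : m ∈ A) (him : (P i).1 < (P m).1) : Under P c i m :=
  (under_mirror _ _ _ _).1 (h.mirror.head_above hc hm hi (by simpa using him))

end PT

/-- The invariant of the recursion around the vertex `m`. -/
structure Inv (P : Config n) (π : Equiv.Perm (Fin n)) (A₀ B₀ : List (Fin n)) (i m : Fin n)
    (A B : List (Fin n)) (z : Fin n) : Prop where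
  infA : A <:+: A₀
  infB : B <:+: B₀
  -- Either the right chain has no non-corner vertex, or two things hold. First, either `B` reaches
  -- down past all vertices above the line `i m` (this leads to rule 3), or the apex is an earlier
  -- vertex of the same chain `A₀` and `B` ends at its global point of tangency (rule 4). Second,
  -- the last vertex of `B` hides the remaining lower part of `B₀` from all of `A`, so tangents to
  -- `B` are not spoilt from below.
  alt : B.tail = [] ∨
    (((∀ y ∈ B₀, Under P y i m → (∀ c, B.head? = some c → (P y).1 < (P c).1) → y ∈ B) ∨
      (A ++ [z] <:+: A₀ ∧ π z < π m ∧
        ∃ v, B.getLast? = some v ∧ ∀ v' ∈ B₀, v' ≠ v → Under P z v v')) ∧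
    (∀ q ∈ A, ∀ v, B.getLast? = some v → ∀ r ∈ B₀, (P r).1 < (P v).1 → Under P q v r))

/-- Descending to a lower part keeps the apex and the last vertex of the right chain; only the end
at the base moves, and the invariant allows for that. -/
lemma Inv.suffix {P : Config n} {π : Equiv.Perm (Fin n)} {A₀ B₀ A B : List (Fin n)}
    {i m z z₀ : Fin n} (h : Inv P π A₀ B₀ i m A B z) (h0 : PT P A₀ B₀ z₀)
    {A₁ A' B₁ B' : List (Fin n)} {v : Fin n} (hA : A = A₁ ++ A') (hB : B = B₁ ++ v :: B') :
    Inv P π A₀ B₀ i m A' (v :: B') z := by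
  subst hA hB
  refine ⟨infix_append_right h.infA, infix_append_right h.infB, ?_⟩
  have last : (B₁ ++ v :: B').getLast? = (v :: B').getLast? := by
    rw [List.getLast?_append_of_ne_nil _ (by simp)]
  have dec : (B₁ ++ v :: B').Pairwise (fun i j => (P j).1 < (P i).1) :=
    h0.pairB.sublist h.infB.sublist
  rw [List.pairwise_append] at dec
  rcases h.alt with h' | ⟨h', e⟩
  · left
    cases B₁ <;> simp_all
  · right
    constructor
    · rcases h' with h' | ⟨h1, h2, h3⟩
      · left
        intro y hy hu hlt
        have hyv := hlt v rfl
        have hyB : y ∈ B₁ ++ v :: B' := h' y hy hu (by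
          intro c hc
          rcases B₁ with _ | ⟨b, B₁⟩
          · simp at hc; subst hc; exact hyv
          · simp at hc; subst hc
            exact hyv.trans (dec.2.2 b (by simp) v (by simp)))
        rcases List.mem_append.1 hyB with h1 | h1
        · have := dec.2.2 y h1 v (by simp); linarith
        · exact h1
      · right
        rw [List.append_assoc] at h1
        rw [last] at h3
        exact ⟨infix_append_right h1, h2, h3⟩
    · rw [last] at e
      exact fun q hq => e q (List.mem_append_right _ hq)

/-- All non-corner vertices that are present when `m` has minimum priority are late. -/
lemma Inv.mem_late {P : Config n} (g : Generic P) {π : Equiv.Perm (Fin n)}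
    {A₀ B₀ A B : List (Fin n)} {i m z z₀ : Fin n} {I : Set (Fin n)}
    (h : Inv P π A₀ B₀ i m A B z) (h0 : PT P A₀ B₀ z₀) (hP : PT P A B z)
    (hI : ∀ y ∈ A₀.tail ++ B₀.tail, y ∈ I) (hi : i ∈ A) (hm : m ∈ A)
    (him : (P i).1 < (P m).1) (hmin : ∀ y ∈ A.tail ++ B.tail, π m ≤ π y) {y : Fin n}
    (hy : y ∈ A.tail ++ B.tail) (hym : y ≠ m) : y ∈ Late P A₀ B₀ i m I π := by
  have sA : ∀ {x}, x ∈ A → x ∈ A₀ := fun hx => h.infA.subset hx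
  have sB : ∀ {x}, x ∈ B → x ∈ B₀ := fun hx => h.infB.subset hx
  obtain ⟨a, c, ha, hc, haA, hcB, hamin, hcmax⟩ := hP.exists_head
  have tailA : ∀ {x}, x ∈ A.tail → (P a).1 < (P x).1 := by
    intro x hx
    obtain ⟨a', A', rfl⟩ := List.exists_cons_of_ne_nil hP.neA
    obtain rfl : a' = a := by simpa using ha
    exact (List.pairwise_cons.1 hP.pairA).1 x hx
  have tailB : ∀ {x}, x ∈ B.tail → (P x).1 < (P c).1 := by
    intro x hx
    obtain ⟨c', B', rfl⟩ := List.exists_cons_of_ne_nil hP.neB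
    obtain rfl : c' = c := by simpa using hc
    exact (List.pairwise_cons.1 hP.pairB).1 x hx
  have hlt : π m < π y := lt_of_le_of_ne (hmin y hy) (fun e => hym (π.injective e).symm)
  have hyI : y ∈ I := by
    apply hI
    rcases List.mem_append.1 hy with hy | hy
    · exact List.mem_append_left _ (h0.mem_tailA (sA haA) (sA (List.mem_of_mem_tail hy)) (tailA hy))
    · exact List.mem_append_right _
        (h0.mem_tailB (sB hcB) (sB (List.mem_of_mem_tail hy)) (tailB hy))
  refine ⟨hyI, hlt, ?_⟩
  have mG : y ∈ insert y {x | x ∈ I ∧ π x < π m} := Set.mem_insert _ _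
  -- All non-corner vertices have priority at least that of `m`, so among them the set from which
  -- the rules select contains only `y`. A better candidate than `y` would lie between two vertices
  -- of a chain, hence be such a vertex: a contradiction.
  have cG : ∀ {x}, x ∈ insert y {x | x ∈ I ∧ π x < π m} → x ∈ A.tail ++ B.tail → x = y := by
    intro x hx hx'
    rcases hx with rfl | hx
    · rfl
    · exact absurd hx.2 (not_lt.2 (hmin x hx'))
  rcases List.mem_append.1 hy with hyA | hyB
  · have hyA' := List.mem_of_mem_tail hyA
    rcases lt_or_gt_of_ne (g.inj y m hym) with hl | hl
    · refine ⟨0, mG, sA hyA', hl, fun x hx hxA hxm => ?_⟩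
      by_contra hcon
      push Not at hcon
      have hxA' := h0.betweenA h.infA hyA' hm hxA hcon.le hxm.le
      have := cG hx (List.mem_append_left _ (hP.mem_tailA hyA' hxA' hcon))
      subst this; exact lt_irrefl _ hcon
    · refine ⟨1, mG, sA hyA', hl, fun x hx hxA hxm => ?_⟩
      by_contra hcon
      push Not at hcon
      have hxA' := h0.betweenA h.infA hm hyA' hxA hxm.le hcon.le
      have := cG hx (List.mem_append_left _ (hP.mem_tailA hm hxA' hxm))
      subst this; exact lt_irrefl _ hcon
  · have hyB' := List.mem_of_mem_tail hyB
    have hcu := hP.head_aboveB hc hi hm him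
    by_cases hup : Under P y i m
    · rcases h.alt with h' | ⟨h', -⟩
      · rw [h'] at hyB; simp at hyB
      rcases h' with h' | ⟨h1, h2, v, hv, tan⟩
      -- A competitor above the line `i m` and nearer to the apex than `y` belongs to `B` by the
      -- first alternative of the invariant.
      · refine ⟨3, mG, sB hyB', hup, fun x hx hxB hxu => ?_⟩
        by_contra hcon
        push Not at hcon
        have hxB' := h' x hxB hxu (fun c' hc' => by
          rw [hc] at hc'; cases hc'
          exact hcon.trans (tailB hyB))
        have := cG hx (List.mem_append_right _ (hP.mem_tailB hyB' hxB' hcon))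
        subst this; exact lt_irrefl _ hcon
      · have hzA : z ∈ A₀ := h1.subset (by simp)
        have hvB : v ∈ B := List.mem_of_getLast? hv
        have hmz := hP.ltA hm
        have hvy : (P v).1 ≤ (P y).1 := by
          obtain ⟨B', rfl⟩ := List.getLast?_eq_some_iff.1 hv
          rcases List.mem_append.1 hyB' with h' | h'
          · exact ((List.pairwise_append.1 hP.pairB).2.2 y h' v (by simp)).le
          · simp at h'; rw [h']
        -- The apex `z` plays the role of `w`: it is earlier than `m`, and anything between `m` and
        -- `z` is a non-corner vertex of `A`.
        refine ⟨4, mG, sB hyB', z, v, ⟨?_, hzA, hmz, ?_⟩, sB hvB, tan, hvy, ?_⟩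
        · exact Set.mem_insert_of_mem _ ⟨hI z (List.mem_append_left _
            (h0.mem_tailA (sA hm) hzA hmz)), h2⟩
        · intro x hx hxA hxm
          by_contra hcon
          push Not at hcon
          have hxA' : x ∈ A := by
            have := h0.betweenA h1 (x := m) (y := z) (by simp [hm]) (by simp) hxA hxm.le hcon.le
            rcases List.mem_append.1 this with h' | h'
            · exact h'
            · simp at h'; subst h'; exact absurd hcon (lt_irrefl _)
          have := cG hx (List.mem_append_left _ (hP.mem_tailA hm hxA' hxm))
          subst this
          exact hP.disj hxA' hyB'
        · intro x hx hxB hvx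
          by_contra hcon
          push Not at hcon
          have hxB' := h0.betweenB h.infB hvB hyB' hxB hvx hcon.le
          have := cG hx (List.mem_append_right _ (hP.mem_tailB hyB' hxB' hcon))
          subst this; exact lt_irrefl _ hcon
    -- The base end `c` is above the line `i m`, and so is everything beyond it; a competitor not
    -- above the line is therefore closer to the apex than `c` and lies in `B`.
    · refine ⟨2, mG, sB hyB', hup, fun x hx hxB hxu => ?_⟩
      by_contra hcon
      push Not at hcon
      have hxc : (P x).1 < (P c).1 := by
        by_contra hc'
        push Not at hc'
        exact hxu (h0.monoB hxB (sB hcB) (sA hi) (sA hm) him hc' hcu g)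
      have hxB' := h0.betweenB h.infB hyB' hcB hxB hcon.le hxc.le
      have := cG hx (List.mem_append_right _ (hP.mem_tailB hcB hxB' hxc))
      subst this; exact lt_irrefl _ hcon

/-- The lowest vertex of the upper part of the right chain hides everything below. -/
lemma under_last {P : Config n} {π : Equiv.Perm (Fin n)} {A₀ B₀ A B : List (Fin n)}
    {z z₀ q v l : Fin n} {A₁ A₂ B₁ B₂ : List (Fin n)} (h0 : PT P A₀ B₀ z₀) (hP : PT P A B z)
    (infA : A <:+: A₀) (infB : B <:+: B₀) (hp : Pick P π B A B₁ q B₂ A₁ v A₂) {x r : Fin n}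
    (hx : x ∈ A₁ ++ [v]) (hl : B₁.getLast? = some l) (hr : r ∈ B₀) (hrl : (P r).1 < (P l).1) :
    Under P x l r := by
  have up := hP.rightUp hp
  have hlB : l ∈ B₁ := List.mem_of_getLast? hl
  -- The apex `q` of the upper part is below the line `x l`, and `q` is the right-chain vertex that
  -- follows `l`. Concavity carries this on to all vertices beyond `q`.
  have hq := up.apex_under hx hlB
  have hxA : x ∈ A₀ := infA.subset (by rw [hp.hB]; simp at hx ⊢; tauto)
  have hqB : q ∈ B₀ := infB.subset hp.mem
  have hlB0 : l ∈ B₀ := infB.subset (by rw [hp.hA]; simp [hlB])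
  have hql := up.ltB hlB
  by_cases hrq : (P r).1 < (P q).1
  · rw [under_left (h0.lt hxA hlB0) (h0.lt hxA hqB)] at hq
    rw [under_left (h0.lt hxA hlB0) (h0.lt hxA hr)]
    have s := h0.slB (List.mem_append_left _ hr) (List.mem_append_left _ hqB)
      (List.mem_append_left _ hlB0) hrq hql
    rcases sl_tri (h0.lt hxA hqB) hql with t | t | t <;>
      rcases sl_tri hrq hql with t' | t' | t' <;>
      rcases sl_tri (h0.lt hxA hr) hrl with t'' | t'' | t'' <;> linarith
  · push Not at hrq
    have hrB : r ∈ B := h0.betweenB infB hp.mem (by rw [hp.hA]; simp [hlB]) hr hrq hrl.le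
    have hdec := hP.pairB
    rw [hp.hA] at hrB hdec
    rw [List.pairwise_append] at hdec
    rcases List.mem_append.1 hrB with h | h
    · obtain ⟨B', rfl⟩ := List.getLast?_eq_some_iff.1 hl
      rcases List.mem_append.1 h with h' | h'
      · have := (List.pairwise_append.1 hdec.1).2.2 r h' l (by simp); linarith
      · simp at h'; subst h'; exact absurd hrl (lt_irrefl _)
    · rcases List.mem_cons.1 h with rfl | h
      · exact hq
      · have := (List.pairwise_cons.1 hdec.2.1).1 r h; linarith

/-- A cut at `q ≠ m` falls at or before `i`, or after `m`, because `i` and `m` are adjacent.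
Deleting `m` gives the corresponding cut of the shorter list. -/
lemma insert_split {α : Type*} {P' K A₁ A₂ : List α} {i m q : α}
    (h : P' ++ i :: m :: K = A₁ ++ q :: A₂) (hq : q ≠ m) :
    (∃ P'' A₂', q :: A₂ = P'' ++ i :: m :: K ∧ P'' ++ i :: K = q :: A₂' ∧
      P' ++ i :: K = A₁ ++ q :: A₂') ∨
    (∃ K₁, A₁ = P' ++ i :: m :: K₁ ∧ K = K₁ ++ q :: A₂) := by
  have h' : (P' ++ [i]) ++ (m :: K) = A₁ ++ q :: A₂ := by simpa using h
  rcases List.append_eq_append_iff.1 h' with ⟨c, h1, h2⟩ | ⟨c, h1, h2⟩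
  · right
    rcases c with _ | ⟨x, c⟩
    · simp at h2; exact absurd h2.1.symm hq
    · simp at h2
      obtain ⟨rfl, h2⟩ := h2
      exact ⟨c, by simp [h1], h2⟩
  · left
    rcases List.eq_nil_or_concat c with rfl | ⟨P'', x, rfl⟩
    · simp at h2; exact absurd h2.1 hq
    · rw [List.concat_eq_append] at h1 h2
      rw [← List.append_assoc] at h1
      have := List.append_inj' h1 rfl
      obtain ⟨h3, h4⟩ := this
      obtain rfl : i = x := by simpa using h4
      have e : q :: A₂ = P'' ++ i :: m :: K := by simpa using h2
      obtain ⟨A₂', hA₂'⟩ : ∃ A₂', P'' ++ i :: K = q :: A₂' := by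
        rcases P'' with _ | ⟨x, P''⟩
        · simp at e; exact ⟨K, by simp [e.1]⟩
        · simp at e; exact ⟨P'' ++ i :: K, by simp [e.1]⟩
      refine ⟨P'', A₂', e, hA₂', ?_⟩
      rw [← hA₂', h3]; simp

lemma ncard_symmDiff_union_le {α : Type*} [Finite α] (a b c d : Set α) :
    ((a ∪ b) ∆ (c ∪ d)).ncard ≤ (a ∆ c).ncard + (b ∆ d).ncard := by
  refine (Set.ncard_le_ncard ?_ (Set.toFinite _)).trans (Set.ncard_union_le _ _)
  intro x hx
  simp only [Set.mem_symmDiff, Set.mem_union] at hx ⊢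
  tauto

end KineticTriangulation

/-! ### Cost of inserting a vertex into a chain. -/

namespace KineticTriangulation

variable {n : ℕ}

open scoped symmDiff

namespace Flip

variable {PA PB : Config n} {i m k : Fin n}

/-- The number of edges that change when the vertex `m` is inserted into the left chain between
its neighbours `i` and `k`. -/
lemma ncard_insert_le (F : Flip PA PB i m k) (π : Equiv.Perm (Fin n)) {A₀ B₀ : List (Fin n)}
    {z₀ : Fin n} (h0 : PT PA A₀ B₀ z₀) {I : Set (Fin n)}
    (hI : ∀ y ∈ A₀.tail ++ B₀.tail, y ∈ I) (N : ℕ) :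
    ∀ {P' K B : List (Fin n)} {z : Fin n}, (P' ++ i :: m :: K).length + B.length ≤ N →
      PT PA (P' ++ i :: m :: K) B z → PT PB (P' ++ i :: K) B z → (K ++ [z]).head? = some k →
      Inv PA π A₀ B₀ i m (P' ++ i :: m :: K) B z →
      (tri PA π (P' ++ i :: m :: K) B z ∆ tri PB π (P' ++ i :: K) B z).ncard ≤
        6 * (Late PA A₀ B₀ i m I π).ncard + 9 := by
  induction N using Nat.strong_induction_on with
  | _ N ih =>
  intro P' K B z hN hA hB hk inv
  have iA : i ∈ P' ++ i :: m :: K := by simp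
  have mA : m ∈ P' ++ i :: m :: K := by simp
  have mT : m ∈ (P' ++ i :: m :: K).tail := hA.mem_tailA iA mA F.him
  have kA : k ∈ K ∨ k = z := by
    rcases K with _ | ⟨x, K⟩
    · simp at hk; exact Or.inr hk.symm
    · simp at hk; left; simp [hk]
  have kB : k ∉ B := by
    rcases kA with h | rfl
    · exact hA.disj (by simp [h])
    · intro h; exact lt_irrefl _ (hA.ltB h)
  have iB : i ∉ B := hA.disj iA
  have mB : m ∉ B := hA.disj mA
  have sAB : ∀ {x}, x ∈ P' ++ i :: K → x ∈ P' ++ i :: m :: K := by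
    intro x hx; simp at hx ⊢; tauto
  have tAB : ∀ {x}, x ∈ (P' ++ i :: K).tail → x ∈ (P' ++ i :: m :: K).tail := by
    intro x hx; cases P' <;> simp at hx ⊢ <;> tauto
  have nS : ∀ {x}, x ∈ B → ¬ (x = i ∨ x = m ∨ x = k) := by
    rintro x hx (rfl | rfl | rfl)
    exacts [iB hx, mB hx, kB hx]
  -- Once `m` has minimum priority, all edges may change. There are at most `Late + 3` non-apex
  -- vertices with `m` and one fewer without it; the two edge bounds add up to `6 * Late + 9`.
  by_cases hmin : ∀ y ∈ (P' ++ i :: m :: K).tail ++ B.tail, π m ≤ π y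
  · have c1 := PT.ncard_tri_le F.gA π _ le_rfl hA
    have c2 := PT.ncard_tri_le F.gB π _ le_rfl hB
    have c3 : ((P' ++ i :: m :: K).tail ++ B.tail).length ≤ (Late PA A₀ B₀ i m I π).ncard + 1 := by
      have nd : ((P' ++ i :: m :: K).tail ++ B.tail).Nodup := by
        rw [List.nodup_append]
        refine ⟨hA.nodupA.sublist (List.tail_sublist _), hA.nodupB.sublist (List.tail_sublist _), ?_⟩
        intro x hx y hy
        exact hA.ne (List.mem_of_mem_tail hx) (List.mem_of_mem_tail hy)
      rw [← List.toFinset_card_of_nodup nd]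
      have sub : (((P' ++ i :: m :: K).tail ++ B.tail).toFinset.erase m : Set (Fin n)) ⊆
          Late PA A₀ B₀ i m I π := by
        intro y hy
        simp only [Finset.coe_erase, Set.mem_sdiff, Set.mem_singleton_iff, Finset.mem_coe,
          List.mem_toFinset] at hy
        exact inv.mem_late F.gA h0 hA hI iA mA F.him hmin hy.1 hy.2
      have := Set.ncard_le_ncard sub (Set.toFinite _)
      rw [Set.ncard_coe_finset] at this
      have := Finset.pred_card_le_card_erase
        (s := ((P' ++ i :: m :: K).tail ++ B.tail).toFinset) (a := m)
      omega
    have c4 : (tri PA π (P' ++ i :: m :: K) B z ∆ tri PB π (P' ++ i :: K) B z).ncard ≤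
        (tri PA π (P' ++ i :: m :: K) B z).ncard + (tri PB π (P' ++ i :: K) B z).ncard := by
      refine (Set.ncard_le_ncard ?_ (Set.toFinite _)).trans (Set.ncard_union_le _ _)
      exact symmDiff_le_sup
    have := List.length_pos_of_ne_nil hA.neB
    simp at c1 c2 c3
    omega
  push Not at hmin
  obtain ⟨y₀, hy₀, hy₀m⟩ := hmin
  rcases hA.exists_pick F.gA π (List.ne_nil_of_mem hy₀) with
    ⟨A₁, q, A₂, B₁, v, B₂, hp⟩ | ⟨B₁, q, B₂, A₁, v, A₂, hp⟩
  · have hqm : q ≠ m := by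
      rintro rfl
      exact absurd (hp.first y₀ hy₀) (not_le.2 hy₀m)
    have hπ : π q < π m := lt_of_le_of_ne (hp.first m (List.mem_append_left _ mT))
      (fun e => hqm (π.injective e))
    have tanB : ∀ v' ∈ B, v' ≠ v → Under PB q v v' := by
      intro v' hv' hne
      rw [← F.under (hA.ne hp.mem hp.mem') (Ne.symm hne) (hA.ne hp.mem hv')
        (fun h => nS hv' h.2.2)]
      exact hp.tan v' hv' hne
    have firstB : ∀ y ∈ (P' ++ i :: K).tail ++ B.tail, π q ≤ π y := by
      intro y hy
      apply hp.first
      rcases List.mem_append.1 hy with h | h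
      · exact List.mem_append_left _ (tAB h)
      · exact List.mem_append_right _ h
    -- If `q` is at or before `i`, then `m` goes to the lower part; otherwise it goes to the upper
    -- part, whose apex is the earlier vertex `q` of the same chain. The part without `m` does not
    -- change.
    rcases insert_split hp.hA hqm with ⟨P'', A₂', e1, e2, e3⟩ | ⟨K₁, e1, e2⟩
    · have hpB : Pick PB π (P' ++ i :: K) B A₁ q A₂' B₁ v B₂ :=
        ⟨e3, hp.hB, hp.ne, firstB, tanB⟩
      have u := hA.up hp
      have l1 := hA.low hp
      have l2 := hB.low hpB
      have hlen := hp.length_low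
      have inv' := inv.suffix h0 hp.hA hp.hB
      have mA₁ : m ∉ A₁ := by
        intro h
        have hn := hA.nodupA
        rw [hp.hA, e1] at hn
        exact (List.nodup_append.1 hn).2.2 m h m (by simp) rfl
      have mB₁ : m ∉ B₁ ++ [v] := by
        intro h; apply mB; rw [hp.hB]; simp at h ⊢; tauto
      rw [hA.tri_left hp, hB.tri_left hpB, F.tri_same_of_notMem u (x := m) (by tauto) mA₁ mB₁]
      rw [e1] at l1 hlen inv' ⊢
      rw [← e2] at l2 ⊢
      refine (ncard_symmDiff_union_le _ _ _ _).trans ?_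
      rw [symmDiff_self]
      simpa using ih _ (lt_of_lt_of_le hlen hN) le_rfl l1 l2 hk inv'
    · have hpB : Pick PB π (P' ++ i :: K) B (P' ++ i :: K₁) q A₂ B₁ v B₂ :=
        ⟨by rw [e2]; simp, hp.hB, by simp, firstB, tanB⟩
      have u1 := hA.up hp
      have u2 := hB.up hpB
      have l := hA.low hp
      have hlen := hp.length_up
      have hA' : P' ++ i :: m :: K = (A₁ ++ [q]) ++ A₂ := by rw [hp.hA]; simp
      have inv' : Inv PA π A₀ B₀ i m A₁ (B₁ ++ [v]) q := by
        refine ⟨?_, ?_, ?_⟩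
        · have := inv.infA
          rw [hp.hA] at this
          exact infix_append_left this
        · have := inv.infB
          rw [hp.hB, List.append_cons] at this
          exact infix_append_left this
        · by_cases hB₁ : B₁ = []
          · left; simp [hB₁]
          right
          have qA₀ : q ∈ A₀ := inv.infA.subset hp.mem
          have vB₀ : v ∈ B₀ := inv.infB.subset hp.mem'
          -- The chosen point `v` is the point of tangency from `q` on the whole right chain, not
          -- only on `B`; this establishes the rule 4 alternative of the invariant.
          have full : ∀ v' ∈ B₀, v' ≠ v → Under PA q v v' := by
            intro v' hv' hne
            by_cases hv'B : v' ∈ B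
            · exact hp.tan v' hv'B hne
            obtain ⟨a, c, ha, hc, haA, hcB, hamin, hcmax⟩ := hA.exists_head
            have hcB₁ : c ∈ B₁ := by
              obtain ⟨b, B₁', rfl⟩ := List.exists_cons_of_ne_nil hB₁
              rw [hp.hB] at hc
              simp at hc; simp [hc]
            have hvc : (PA v).1 < (PA c).1 := by
              have := hA.pairB
              rw [hp.hB] at this
              exact (List.pairwise_append.1 this).2.2 c hcB₁ v (by simp)
            have hcv : c ≠ v := by rintro rfl; exact lt_irrefl _ hvc
            rcases inv.alt with h' | ⟨-, e⟩
            · rw [hp.hB] at h'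
              obtain ⟨b, B₁', rfl⟩ := List.exists_cons_of_ne_nil hB₁
              simp at h'
            rw [under_left (hA.lt hp.mem hp.mem') (h0.lt qA₀ hv')]
            -- A vertex outside `B` is either nearer to the apex than `B`, and hidden by the last
            -- vertex of `B`, or beyond the base end `c`. In the latter case concavity excludes it,
            -- as the line from `q` already touches at `v` before `c`.
            by_cases hv'c : (PA v').1 ≤ (PA c).1
            · obtain ⟨B', l, hl⟩ := (List.eq_nil_or_concat B).resolve_left hA.neB
              have hl' : B.getLast? = some l := by rw [hl]; simp
              have hlB : l ∈ B := List.mem_of_getLast? hl'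
              have hv'l : (PA v').1 < (PA l).1 := by
                by_contra hcon
                push Not at hcon
                exact hv'B (h0.betweenB inv.infB hlB hcB hv' hcon hv'c)
              have := e q hp.mem l hl' v' hv' hv'l
              rw [under_left (hA.lt hp.mem hlB) (h0.lt qA₀ hv')] at this
              by_cases hlv : l = v
              · rw [hlv] at this; exact this
              · have h3 := hp.tan l hlB hlv
                rw [under_left (hA.lt hp.mem hp.mem') (hA.lt hp.mem hlB)] at h3
                linarith
            · push Not at hv'c
              have h3 := hp.tan c hcB hcv
              rw [under_left (hA.lt hp.mem hp.mem') (hA.lt hp.mem hcB)] at h3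
              have s := h0.slB (List.mem_append_left _ vB₀)
                (List.mem_append_left _ (inv.infB.subset hcB)) (List.mem_append_left _ hv')
                hvc hv'c
              rcases sl_tri (hA.lt hp.mem hp.mem') hvc with t | t | t <;>
                rcases sl_tri (hA.lt hp.mem hcB) hv'c with t' | t' | t' <;> linarith
          refine ⟨Or.inr ⟨?_, hπ, v, by simp, full⟩, ?_⟩
          · have := inv.infA
            rw [hA'] at this
            exact infix_append_left this
          · intro q' hq' v' hv' r hr hrv
            obtain rfl : v = v' := by simpa using hv'
            have hne : r ≠ v := by rintro rfl; exact lt_irrefl _ hrv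
            refine h0.mono ?_ qA₀ vB₀ hr ?_ hrv (full r hr hne)
            · apply inv.infA.subset; rw [hp.hA]; simp [hq']
            · have := hA.pairA
              rw [hp.hA] at this
              exact (List.pairwise_append.1 this).2.2 q' hq' q (by simp)
      have mA₂ : m ∉ q :: A₂ := by
        intro h
        have hn := hA.nodupA
        rw [hp.hA] at hn
        exact (List.nodup_append.1 hn).2.2 m (by rw [e1]; simp) m h rfl
      have mB₂ : m ∉ v :: B₂ := by
        intro h; apply mB; rw [hp.hB]; simp at h ⊢; tauto
      rw [hA.tri_left hp, hB.tri_left hpB, F.tri_same_of_notMem l (x := m) (by tauto) mA₂ mB₂]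
      rw [e1] at u1 hlen inv' ⊢
      have hk' : (K₁ ++ [q]).head? = some k := by
        rw [e2] at hk
        cases K₁ <;> simpa using hk
      refine (ncard_symmDiff_union_le _ _ _ _).trans ?_
      rw [symmDiff_self]
      simpa using ih _ (lt_of_lt_of_le hlen hN) le_rfl u1 u2 hk' inv'
  · have hqT := hp.mem_tail
    have tanB : ∀ v' ∈ P' ++ i :: K, v ∈ P' ++ i :: K → v' ≠ v → Under PB q v v' := by
      intro v' hv' hv hne
      rw [← F.under (hA.ne hp.mem' hp.mem).symm (Ne.symm hne) (hA.ne (sAB hv') hp.mem).symm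
        (fun h => nS hp.mem h.1)]
      exact hp.tan v' (sAB hv') hne
    have firstB : ∀ y ∈ B.tail ++ (P' ++ i :: K).tail, π q ≤ π y := by
      intro y hy
      apply hp.first
      rcases List.mem_append.1 hy with h | h
      · exact List.mem_append_left _ h
      · exact List.mem_append_right _ (tAB h)
    have hiq := hA.lt iA hp.mem
    have hmq := hA.lt mA hp.mem
    have hq3 := nS hp.mem
    -- The tangent never touches `m`: since `q` is on the same side of the lines `i m` and `m k`,
    -- the points `i` and `k` cannot both lie under the line `q m`. The neighbour `k` may be the
    -- apex, hence two cases. So the chord exists in both configurations.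
    have hvm : v ≠ m := by
      rintro rfl
      have h1 := hp.tan i iA F.ne_im
      rw [under_iff_of_gt hmq, orient_rev] at h1
      have h2 := (F.compat q (by tauto) (by tauto) (by tauto)).2.1 (by linarith)
      rcases kA with h | rfl
      · have h3 := hp.tan k (by simp [h]) F.ne_mk.symm
        rw [under_iff_of_gt hmq, orient_rot] at h3
        linarith
      · have h3 := hA.apex_under mA hp.mem
        rw [under_iff_of_lt hmq, orient_swap] at h3
        linarith
    rcases insert_split hp.hB hvm with ⟨P'', A₂', e1, e2, e3⟩ | ⟨K₁, e1, e2⟩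
    · have hpB : Pick PB π B (P' ++ i :: K) B₁ q B₂ A₁ v A₂' :=
        ⟨hp.hA, e3, hp.ne, firstB, fun v' hv' => tanB v' hv' (by rw [e3]; simp)⟩
      have u := hA.rightUp hp
      have l1 := hA.rightLow hp
      have l2 := hB.rightLow hpB
      have hlen := hp.length_low
      have inv' := inv.suffix h0 hp.hB hp.hA
      have mA₁ : m ∉ A₁ ++ [v] := by
        intro h
        have hn := hA.nodupA
        rw [hp.hB, e1] at hn
        rcases List.mem_append.1 h with h | h
        · exact (List.nodup_append.1 hn).2.2 m h m (by simp) rfl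
        · simp at h; exact hvm h.symm
      have mB₁ : m ∉ B₁ := by
        intro h; apply mB; rw [hp.hA]; simp [h]
      rw [hA.tri_right hp, hB.tri_right hpB, F.tri_same_of_notMem u (x := m) (by tauto) mA₁ mB₁]
      rw [e1] at l1 hlen inv' ⊢
      rw [← e2] at l2 ⊢
      refine (ncard_symmDiff_union_le _ _ _ _).trans ?_
      rw [symmDiff_self]
      have hlen' : (P'' ++ i :: m :: K).length + (q :: B₂).length < N := by omega
      simpa using ih _ hlen' le_rfl l1 l2 hk inv'
    · have hpB : Pick PB π B (P' ++ i :: K) B₁ q B₂ (P' ++ i :: K₁) v A₂ :=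
        ⟨hp.hA, by rw [e2]; simp, hp.ne, firstB, fun v' hv' => tanB v' hv' (by rw [e2]; simp)⟩
      have u1 := hA.rightUp hp
      have u2 := hB.rightUp hpB
      have l := hA.rightLow hp
      have hlen := hp.length_up
      have hvK : v ∈ K := by rw [e2]; simp
      have hvA : v ∈ P' ++ i :: m :: K := by simp [hvK]
      have hmv : (PA m).1 < (PA v).1 := by
        have := hA.pairA
        rw [List.pairwise_append, List.pairwise_cons, List.pairwise_cons] at this
        exact this.2.1.2.1 v hvK
      -- A tangent from `q` that touches beyond `m` shows that `q` is not above the line `i m`. All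
      -- vertices above this line therefore lie on the base side of `q`, which yields the rule 3
      -- alternative of the invariant.
      have hlow : ¬ Under PA q i m := by
        intro hu
        have h1 := hp.tan i iA (by rintro rfl; have := F.him; linarith)
        have h3 := hA.slA (List.mem_append_left _ iA) (List.mem_append_left _ mA)
          (List.mem_append_left _ hvA) F.him hmv
        have hvq := hA.lt hvA hp.mem
        rw [under_right hiq hmq] at hu
        rw [under_right hvq hiq] at h1
        rcases sl_tri F.him hmq with t | t | t <;> rcases sl_tri hmv hvq with t' | t' | t' <;>
          linarith
      have qB₀ : q ∈ B₀ := inv.infB.subset hp.mem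
      have iA₀ : i ∈ A₀ := inv.infA.subset iA
      have mA₀ : m ∈ A₀ := inv.infA.subset mA
      have abv : ∀ {y}, y ∈ B₀ → Under PA y i m → (PA q).1 < (PA y).1 := by
        intro y hy hu
        by_contra hcon
        push Not at hcon
        exact hlow (h0.monoB qB₀ hy iA₀ mA₀ F.him hcon hu F.gA)
      have hdec := hA.pairB
      rw [hp.hA, List.pairwise_append] at hdec
      have inv' : Inv PA π A₀ B₀ i m (A₁ ++ [v]) B₁ q := by
        refine ⟨?_, ?_, Or.inr ⟨Or.inl ?_, ?_⟩⟩
        · have := inv.infA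
          rw [hp.hB, List.append_cons] at this
          exact infix_append_left this
        · have := inv.infB
          rw [hp.hA] at this
          exact infix_append_left this
        · intro y hy hu hlt
          have hqy := abv hy hu
          have hhead : B.head? = B₁.head? := by
            rw [hp.hA, List.head?_append_of_ne_nil _ hp.ne]
          have hyB : y ∈ B := by
            rcases inv.alt with h' | ⟨h' | ⟨h1, h2, w, hw, tan⟩, -⟩
            · rw [h'] at hqT; simp at hqT
            · exact h' y hy hu (by rw [hhead]; exact hlt)
            · obtain ⟨a, c, ha, hc, haA, hcB, hamin, hcmax⟩ := hA.exists_head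
              exact h0.betweenB inv.infB hp.mem hcB hy hqy.le (hlt c (by rw [← hhead, hc])).le
          rw [hp.hA] at hyB
          rcases List.mem_append.1 hyB with h | h
          · exact h
          · rcases List.mem_cons.1 h with rfl | h
            · exact absurd hqy (lt_irrefl _)
            · have := (List.pairwise_cons.1 hdec.2.1).1 y h; linarith
        · intro x hx l hl r hr hrl
          exact under_last h0 hA inv.infA inv.infB hp hx hl hr hrl
      have mA₂ : m ∉ v :: A₂ := by
        intro h
        have hn := hA.nodupA
        rw [hp.hB] at hn
        exact (List.nodup_append.1 hn).2.2 m (by rw [e1]; simp) m h rfl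
      have mB₂ : m ∉ q :: B₂ := by
        intro h; apply mB; rw [hp.hA]; simp at h ⊢; tauto
      rw [hA.tri_right hp, hB.tri_right hpB, F.tri_same_of_notMem l (x := m) (by tauto) mA₂ mB₂]
      have e1' : A₁ ++ [v] = P' ++ i :: m :: (K₁ ++ [v]) := by rw [e1]; simp
      have e1'' : P' ++ i :: K₁ ++ [v] = P' ++ i :: (K₁ ++ [v]) := by simp
      rw [e1'] at u1 hlen inv' ⊢
      rw [e1''] at u2 ⊢
      have hk' : (K₁ ++ [v] ++ [q]).head? = some k := by
        rw [e2] at hk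
        cases K₁ <;> simpa using hk
      refine (ncard_symmDiff_union_le _ _ _ _).trans ?_
      rw [symmDiff_self]
      have hlen' : (P' ++ i :: m :: (K₁ ++ [v])).length + B₁.length < N := by omega
      simpa using ih _ hlen' le_rfl u1 u2 hk' inv'

end Flip

end KineticTriangulation

/-! ### Cost of a visibility event inside the funnel. -/

namespace KineticTriangulation

variable {n : ℕ}

open scoped symmDiff

lemma adjacent_of_infix {P : Config n} {A A₀ X Y : List (Fin n)} {i m : Fin n}
    (hs : A₀.Pairwise (fun a b => (P a).1 < (P b).1)) (h : A <:+: A₀)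
    (h0 : A₀ = X ++ i :: m :: Y) (hi : i ∈ A) (hm : m ∈ A) : ∃ P' K, A = P' ++ i :: m :: K := by
  have nd : A₀.Nodup := hs.imp (by intro a b hab e; subst e; exact lt_irrefl _ hab)
  have him : (P i).1 < (P m).1 := by
    rw [h0, List.pairwise_append, List.pairwise_cons] at hs
    exact hs.2.1.1 m (by simp)
  obtain ⟨P', R, rfl⟩ := List.append_of_mem hi
  obtain ⟨s, t, hst⟩ := h
  have e : A₀ = (s ++ P') ++ i :: (R ++ t) := by rw [← hst]; simp
  obtain ⟨-, e2⟩ := split_unique nd h0 e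
  have hR : m ∈ R := by
    rw [e, List.pairwise_append] at hs
    rcases List.mem_append.1 hm with h' | h'
    · have := hs.2.2 m (by simp [h']) i (by simp); linarith
    · rcases List.mem_cons.1 h' with rfl | h'
      · exact absurd him (lt_irrefl _)
      · exact h'
  rcases R with _ | ⟨x, R⟩
  · simp at hR
  · simp at e2
    exact ⟨P', R, by rw [e2.1]⟩

namespace Flip

variable {PA PB : Config n} {i m k : Fin n}

/-- The number of edges that change when the vertex `k` of the right chain passes through the
line that contains the edge `im` of the left chain. -/
lemma ncard_flip_le (F : Flip PA PB i m k) (π : Equiv.Perm (Fin n)) {A₀ B₀ X Y : List (Fin n)}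
    {z₀ : Fin n} (h0 : PT PA A₀ B₀ z₀) (hX : A₀ = X ++ i :: m :: Y) {I : Set (Fin n)}
    (hI : ∀ y ∈ A₀.tail ++ B₀.tail, y ∈ I) (N : ℕ) :
    ∀ {A B : List (Fin n)} {z : Fin n}, A.length + B.length ≤ N →
      PT PA A B z → PT PB A B z → A <:+: A₀ → B <:+: B₀ →
      (tri PA π A B z ∆ tri PB π A B z).ncard ≤ 6 * (Late PA A₀ B₀ i m I π).ncard + 11 := by
  induction N using Nat.strong_induction_on with
  | _ N ih =>
  intro A B z hN hA hB infA infB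
  have iA₀ : i ∈ A₀ := by rw [hX]; simp
  have mA₀ : m ∈ A₀ := by rw [hX]; simp
  have iB : ∀ {x}, x ∈ B → x ≠ i := fun hx => (h0.ne iA₀ (infB.subset hx)).symm
  have mB : ∀ {x}, x ∈ B → x ≠ m := fun hx => (h0.ne mA₀ (infB.subset hx)).symm
  -- Since `i` and `m` are on the left chain, the only test that can change is the one of `k`, as a
  -- non-corner vertex of the right chain, against `i` and `m`.
  have same : ∀ {A' B' : List (Fin n)} {z' : Fin n}, PT PA A' B' z' → B' <:+: B₀ →
      ¬ (k ∈ B'.tail ∧ i ∈ A' ∧ m ∈ A') →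
      (tri PA π A' B' z' ∆ tri PB π A' B' z').ncard = 0 := by
    intro A' B' z' h infB' hnot
    have iB : ∀ {x}, x ∈ B' → x ≠ i := fun hx => (h0.ne iA₀ (infB'.subset hx)).symm
    have mB : ∀ {x}, x ∈ B' → x ≠ m := fun hx => (h0.ne mA₀ (infB'.subset hx)).symm
    rw [F.tri_same h ?_ ?_ π, symmDiff_self]
    · simp
    · intro q hq v hv v' hv' hne
      have := iB hv; have := iB hv'; have := mB hv; have := mB hv'
      rintro ⟨-, h1, h2⟩
      apply hne
      rw [show v = k by tauto, show v' = k by tauto]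
    · intro q hq v hv v' hv' hne
      have hq' := List.mem_of_mem_tail hq
      have := iB hq'; have := mB hq'
      rintro ⟨h1, h2, h3⟩
      obtain rfl : q = k := by tauto
      have n1 := h.ne hv hq'
      have n2 := h.ne hv' hq'
      apply hnot
      rcases h2 with rfl | rfl | h2
      · rcases h3 with rfl | rfl | h3
        · exact absurd rfl hne
        · exact ⟨hq, hv, hv'⟩
        · exact absurd h3 n2
      · rcases h3 with rfl | rfl | h3
        · exact ⟨hq, hv', hv⟩
        · exact absurd rfl hne
        · exact absurd h3 n2
      · exact absurd h2 n1
  by_cases hyp : k ∈ B.tail ∧ i ∈ A ∧ m ∈ A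
  swap
  · rw [same hA infB hyp]; omega
  obtain ⟨hkT, hi, hm⟩ := hyp
  have hkB := List.mem_of_mem_tail hkT
  rcases hA.exists_pick F.gA π (List.ne_nil_of_mem (List.mem_append_right _ hkT)) with
    ⟨A₁, q, A₂, B₁, v, B₂, hp⟩ | ⟨B₁, q, B₂, A₁, v, A₂, hp⟩
  · have hpB : Pick PB π A B A₁ q A₂ B₁ v B₂ := by
      refine ⟨hp.hA, hp.hB, hp.ne, hp.first, fun v' hv' hne => ?_⟩
      rw [← F.under (hA.ne hp.mem hp.mem') (Ne.symm hne) (hA.ne hp.mem hv') ?_]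
      · exact hp.tan v' hv' hne
      · have := iB hv'; have := mB hv'; have := iB hp.mem'; have := mB hp.mem'
        rintro ⟨-, h1, h2⟩
        apply hne
        rw [show v = k by tauto, show v' = k by tauto]
    rw [hA.tri_left hp, hB.tri_left hpB]
    refine (ncard_symmDiff_union_le _ _ _ _).trans ?_
    have iA₁ : A₁ <:+: A₀ := by rw [hp.hA] at infA; exact infix_append_left infA
    have iA₂ : q :: A₂ <:+: A₀ := by rw [hp.hA] at infA; exact infix_append_right infA
    have iB₁ : B₁ ++ [v] <:+: B₀ := by
      rw [hp.hB, List.append_cons] at infB; exact infix_append_left infB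
    have iB₂ : v :: B₂ <:+: B₀ := by rw [hp.hB] at infB; exact infix_append_right infB
    by_cases hk : k ∈ B₂
    · rw [same (hA.up hp) iB₁ ?_, zero_add]
      · exact ih _ (lt_of_lt_of_le hp.length_low hN) le_rfl (hA.low hp) (hB.low hpB) iA₂ iB₂
      · rintro ⟨h, -⟩
        have hn := hA.nodupB
        rw [hp.hB, List.append_cons] at hn
        exact (List.nodup_append.1 hn).2.2 k (List.mem_of_mem_tail h) k hk rfl
    · rw [same (hA.low hp) iB₂ (fun h => hk h.1), add_zero]
      exact ih _ (lt_of_lt_of_le hp.length_up hN) le_rfl (hA.up hp) (hB.up hpB) iA₁ iB₁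
  · have iA₁ : A₁ ++ [v] <:+: A₀ := by
      rw [hp.hB, List.append_cons] at infA; exact infix_append_left infA
    have iA₂ : v :: A₂ <:+: A₀ := by rw [hp.hB] at infA; exact infix_append_right infA
    have iB₁ : B₁ <:+: B₀ := by rw [hp.hA] at infB; exact infix_append_left infB
    have iB₂ : q :: B₂ <:+: B₀ := by rw [hp.hA] at infB; exact infix_append_right infB
    have hn := hA.nodupB
    rw [hp.hA] at hn
    -- As long as another vertex is chosen, both configurations agree and the critical test survives
    -- in at most one part. The choice of `k` is the decisive step.
    by_cases hqk : q = k
    · subst hqk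
      have hmq := hA.lt hm hp.mem
      have hiq := hA.lt hi hp.mem
      have hlow : ¬ Under PA q i m := by
        rw [under_iff_of_gt hiq, orient_rot]
        have := F.negA
        intro h; linarith
      -- `k` is below the line `i m` in `PA` and above it in `PB`. A tangent touching at `m` in `PA`
      -- touches at `i` in `PB`; any other point of tangency stays.
      by_cases hvm : v = m
      · subst hvm
        obtain ⟨P', K, hPK⟩ := adjacent_of_infix h0.pairA infA hX hi hm
        obtain ⟨e1, e2⟩ := split_unique hA.nodupA hp.hB
          (show A = (P' ++ [i]) ++ v :: K by rw [hPK]; simp)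
        subst e1 e2
        have hiqB := (F.ord _ _).1 hiq
        have hpB : Pick PB π B A B₁ q B₂ P' i (v :: A₂) := by
          refine ⟨hp.hA, hPK, hp.ne, hp.first, fun v' hv' hne => ?_⟩
          have h1 : Under PB q i v := by
            rw [under_iff_of_gt hiqB, orient_rot]; exact F.posB
          by_cases hv'v : v' = v
          · rw [hv'v]; exact h1
          · have h2 := hp.tan v' hv' hv'v
            have n3 := hA.ne hv' hp.mem
            rw [F.under (hA.ne hm hp.mem).symm (Ne.symm hv'v) n3.symm (by tauto)] at h2
            have hv'q := hB.lt hv' hp.mem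
            have hvq := hB.lt hm hp.mem
            rw [under_right hiqB hvq] at h1
            rw [under_right hvq hv'q] at h2
            rw [under_right hiqB hv'q]
            linarith
        have u1 := hA.rightUp hp
        have u2 := hB.rightUp hpB
        have l1 := hA.rightLow hp
        have l2 := hB.rightLow hpB
        -- In the lower parts the base moves past `m`, which costs two edges. The upper parts differ
        -- by the insertion of `m` between `i` and the new apex `q = k`, which costs `6 * Late + 9`.
        rw [hA.tri_right hp, hB.tri_right hpB, F.tri_base π _ le_rfl l1 l2]
        refine (ncard_symmDiff_union_le _ _ _ _).trans ?_
        have inv : Inv PA π A₀ B₀ i v (P' ++ [i] ++ [v]) B₁ q := by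
          refine ⟨iA₁, iB₁, Or.inr ⟨Or.inl ?_, ?_⟩⟩
          · intro y hy hu hlt
            have hqy : (PA q).1 < (PA y).1 := by
              by_contra hcon
              push Not at hcon
              exact hlow (h0.monoB (infB.subset hp.mem) hy iA₀ mA₀ F.him hcon hu F.gA)
            obtain ⟨c, B', rfl⟩ := List.exists_cons_of_ne_nil hp.ne
            have hyB := h0.betweenB infB hp.mem (y := c) (by rw [hp.hA]; simp) hy hqy.le
              (hlt c rfl).le
            have hdec := hA.pairB
            rw [hp.hA] at hyB hdec
            rw [List.pairwise_append] at hdec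
            rcases List.mem_append.1 hyB with h | h
            · exact h
            · rcases List.mem_cons.1 h with rfl | h
              · exact absurd hqy (lt_irrefl _)
              · have := (List.pairwise_cons.1 hdec.2.1).1 y h; linarith
          · intro x hx l hl r hr hrl
            exact under_last h0 hA infA infB hp hx hl hr hrl
        have e : P' ++ [i] ++ [v] = P' ++ i :: v :: [] := by simp
        rw [e] at u1 inv ⊢
        have c1 := F.ncard_insert_le π h0 hI _ le_rfl u1 u2 (by simp) inv
        have c2 : (tri PA π (v :: A₂) (q :: B₂) z ∆
            (tri PA π (v :: A₂) (q :: B₂) z ∪ {s(i, q), s(i, v)})).ncard ≤ 2 := by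
          refine (Set.ncard_le_ncard (t := {s(i, q), s(i, v)}) ?_ (Set.toFinite _)).trans ?_
          · intro x hx
            rcases Set.mem_symmDiff.1 hx with ⟨h1, h2⟩ | ⟨h1 | h1, h2⟩
            · exact absurd (Or.inl h1) h2
            · exact absurd h1 h2
            · exact h1
          · refine (Set.ncard_insert_le _ _).trans ?_
            rw [Set.ncard_singleton]
        omega
      · have hvi : v ≠ i := by
          rintro rfl
          exact hlow (hp.tan m hm (Ne.symm hvm))
        have hpB : Pick PB π B A B₁ q B₂ A₁ v A₂ := by
          refine ⟨hp.hA, hp.hB, hp.ne, hp.first, fun v' hv' hne => ?_⟩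
          have n1 := hA.ne hp.mem' hp.mem
          rw [← F.under n1.symm (Ne.symm hne) (hA.ne hv' hp.mem).symm (by tauto)]
          exact hp.tan v' hv' hne
        rw [hA.tri_right hp, hB.tri_right hpB]
        refine (ncard_symmDiff_union_le _ _ _ _).trans ?_
        rw [same (hA.rightUp hp) iB₁ ?_, same (hA.rightLow hp) iB₂ ?_]
        · omega
        · rintro ⟨h, -⟩
          exact (List.nodup_cons.1 (List.nodup_append.1 hn).2.1).1 h
        · rintro ⟨h, -⟩
          exact (List.nodup_append.1 hn).2.2 q (List.mem_of_mem_tail h) q (by simp) rfl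
    · have hpB : Pick PB π B A B₁ q B₂ A₁ v A₂ := by
        refine ⟨hp.hA, hp.hB, hp.ne, hp.first, fun v' hv' hne => ?_⟩
        have n1 := hA.ne hp.mem' hp.mem
        have := iB hp.mem
        have := mB hp.mem
        rw [← F.under n1.symm (Ne.symm hne) (hA.ne hv' hp.mem).symm (by tauto)]
        exact hp.tan v' hv' hne
      rw [hA.tri_right hp, hB.tri_right hpB]
      refine (ncard_symmDiff_union_le _ _ _ _).trans ?_
      by_cases hk : k ∈ B₂
      · rw [same (hA.rightUp hp) iB₁ ?_, zero_add]
        · exact ih _ (by have := hp.length_low; omega) le_rfl (hA.rightLow hp) (hB.rightLow hpB)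
            iA₂ iB₂
        · rintro ⟨h, -⟩
          exact (List.nodup_append.1 hn).2.2 k (List.mem_of_mem_tail h) k
            (List.mem_cons_of_mem _ hk) rfl
      · rw [same (hA.rightLow hp) iB₂ (fun h => hk h.1), add_zero]
        exact ih _ (by have := hp.length_up; omega) le_rfl (hA.rightUp hp) (hB.rightUp hpB)
          iA₁ iB₁

end Flip

end KineticTriangulation

/-! ### Hulls, bridges and the funnel of a static configuration. -/

namespace KineticTriangulation

variable {n : ℕ}

/-- `j` is a vertex of the upper hull of `S`. -/
def Hull (P : Config n) (S : Set (Fin n)) (j : Fin n) : Prop :=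
  j ∈ S ∧ ∀ i ∈ S, ∀ k ∈ S, (P i).1 < (P j).1 → (P j).1 < (P k).1 →
    orient (P i) (P j) (P k) < 0

/-- `wu` is the bridge between `SL` and `SR`. -/
def Bridge (P : Config n) (SL SR : Set (Fin n)) (b w u : Fin n) : Prop :=
  w ∈ SL ∧ w ≠ b ∧ u ∈ SR ∧ u ≠ b ∧ (P w).1 < (P u).1 ∧
    ∀ x ∈ SL ∪ SR, orient (P w) (P u) (P x) ≤ 0

/-- The sets `SL` and `SR` are separated by the vertical line through their common point `b`. -/
structure Sides (P : Config n) (SL SR : Set (Fin n)) (b : Fin n) : Prop where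
  bL : b ∈ SL
  bR : b ∈ SR
  ltL : ∀ x ∈ SL, x ≠ b → (P x).1 < (P b).1
  ltR : ∀ x ∈ SR, x ≠ b → (P b).1 < (P x).1

/-- The lists `A` and `B` contain the vertices of the chains of the funnel, without the apex. -/
def Funnel (P : Config n) (SL SR : Set (Fin n)) (b : Fin n) (A B : List (Fin n)) : Prop :=
  ∃ w u, Bridge P SL SR b w u ∧ (A ++ [b]).Pairwise (fun i j => (P i).1 < (P j).1) ∧
    (B ++ [b]).Pairwise (fun i j => (P j).1 < (P i).1) ∧
    (∀ j, j ∈ A ++ [b] ↔ Hull P SL j ∧ (j = w ∨ (P w).1 < (P j).1)) ∧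
    (∀ j, j ∈ B ++ [b] ↔ Hull P SR j ∧ (j = u ∨ (P j).1 < (P u).1))

/-- The edges of the triangulation of the funnel. -/
def funnelTri (P : Config n) (SL SR : Set (Fin n)) (b : Fin n) (π : Equiv.Perm (Fin n)) :
    Set (Sym2 (Fin n)) := {e | ∃ A B, Funnel P SL SR b A B ∧ e ∈ tri P π A B b}

variable {P : Config n} {SL SR : Set (Fin n)} {b : Fin n}

lemma hull_mirror {S : Set (Fin n)} {j : Fin n} : Hull (mirror P) S j ↔ Hull P S j := by
  have key : ∀ {P : Config n}, Hull P S j → Hull (mirror P) S j := by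
    intro P h
    refine ⟨h.1, fun i hi k hk h1 h2 => ?_⟩
    rw [orient_mirror, ← orient_rev]
    exact h.2 k hk i hi (by simpa using h2) (by simpa using h1)
  exact ⟨fun h => by simpa using key h, key⟩

lemma Bridge.mirror {w u : Fin n} (h : Bridge P SL SR b w u) :
    Bridge (mirror P) SR SL b u w := by
  obtain ⟨h1, h2, h3, h4, h5, h6⟩ := h
  refine ⟨h3, h4, h1, h2, by simpa using h5, fun x hx => ?_⟩
  rw [orient_mirror]
  have := h6 x (by simpa [or_comm] using hx)
  unfold orient at *
  linarith

lemma Sides.mirror (h : Sides P SL SR b) : Sides (mirror P) SR SL b :=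
  ⟨h.bR, h.bL, fun x hx hb => by simpa using h.ltR x hx hb,
    fun x hx hb => by simpa using h.ltL x hx hb⟩

lemma Funnel.mirror {A B : List (Fin n)} (h : Funnel P SL SR b A B) :
    Funnel (mirror P) SR SL b B A := by
  obtain ⟨w, u, h1, h2, h3, h4, h5⟩ := h
  refine ⟨u, w, h1.mirror, h3.imp (by intro a b; simp), h2.imp (by intro a b; simp), ?_, ?_⟩
  · intro j; rw [h5, hull_mirror]; simp
  · intro j; rw [h4, hull_mirror]; simp

lemma funnelTri_mirror (π : Equiv.Perm (Fin n)) :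
    funnelTri (mirror P) SR SL b π = funnelTri P SL SR b π := by
  ext e
  constructor
  · rintro ⟨A, B, h, he⟩
    rw [tri_mirror] at he
    exact ⟨B, A, by simpa using h.mirror, he⟩
  · rintro ⟨A, B, h, he⟩
    exact ⟨B, A, h.mirror, by rwa [tri_mirror]⟩

lemma Sides.lt (h : Sides P SL SR b) {x y : Fin n} (hx : x ∈ SL) (hy : y ∈ SR) (hyb : y ≠ b) :
    (P x).1 < (P y).1 := by
  by_cases hxb : x = b
  · rw [hxb]; exact h.ltR y hy hyb
  · exact (h.ltL x hx hxb).trans (h.ltR y hy hyb)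

lemma Sides.ne (h : Sides P SL SR b) {x y : Fin n} (hx : x ∈ SL) (hy : y ∈ SR) (hyb : y ≠ b) :
    x ≠ y := by
  rintro rfl; exact lt_irrefl _ (h.lt hx hy hyb)

lemma Bridge.strict (g : Generic P) {w u x : Fin n} (h : Bridge P SL SR b w u)
    (hx : x ∈ SL ∪ SR) (hw : x ≠ w) (hu : x ≠ u) : orient (P w) (P u) (P x) < 0 := by
  have hwu : w ≠ u := by
    rintro rfl; exact lt_irrefl _ h.2.2.2.2.1
  exact lt_of_le_of_ne (h.2.2.2.2.2 x hx) (g.ncol w u x hwu (Ne.symm hu) (Ne.symm hw))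

lemma Bridge.hullL (g : Generic P) (hs : Sides P SL SR b) {w u : Fin n}
    (h : Bridge P SL SR b w u) : Hull P SL w := by
  refine ⟨h.1, fun i hi k hk h1 h2 => ?_⟩
  have hku := hs.lt hk h.2.2.1 h.2.2.2.1
  have o1 := h.strict g (x := i) (Or.inl hi) (by rintro rfl; exact lt_irrefl _ h1)
    (hs.ne hi h.2.2.1 h.2.2.2.1)
  have o2 := h.strict g (x := k) (Or.inl hk) (by rintro rfl; exact lt_irrefl _ h2)
    (hs.ne hk h.2.2.1 h.2.2.2.1)
  rw [← orient_rot, orient_neg_mid h1 (h2.trans hku)] at o1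
  rw [orient_neg_left (h2.trans hku) h2] at o2
  rw [orient_neg_mid h1 h2]
  linarith

lemma Bridge.hullR (g : Generic P) (hs : Sides P SL SR b) {w u : Fin n}
    (h : Bridge P SL SR b w u) : Hull P SR u :=
  hull_mirror.1 (h.mirror.hullL g.mirror hs.mirror)

/-- Each of two bridges passes on or above the ends of the other, strictly so at a different end.
Comparing slopes shows that this is impossible. -/
lemma Bridge.unique (g : Generic P) (hs : Sides P SL SR b) {w u w' u' : Fin n}
    (h : Bridge P SL SR b w u) (h' : Bridge P SL SR b w' u') : w = w' ∧ u = u' := by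
  have a1 := hs.lt h.1 h.2.2.1 h.2.2.2.1
  have a2 := hs.lt h'.1 h.2.2.1 h.2.2.2.1
  have a3 := hs.lt h.1 h'.2.2.1 h'.2.2.2.1
  have a4 := hs.lt h'.1 h'.2.2.1 h'.2.2.2.1
  have n1 := hs.ne h.1 h.2.2.1 h.2.2.2.1
  have n2 := hs.ne h'.1 h.2.2.1 h.2.2.2.1
  have n3 := hs.ne h.1 h'.2.2.1 h'.2.2.2.1
  have n4 := hs.ne h'.1 h'.2.2.1 h'.2.2.2.1
  by_cases hw : w = w'
  · subst hw
    refine ⟨rfl, ?_⟩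
    by_contra hu
    have o1 := h.strict g (Or.inr h'.2.2.1) n3.symm (Ne.symm hu)
    have o2 := h'.strict g (Or.inr h.2.2.1) n1.symm hu
    rw [orient_neg_left a1 a3] at o1
    rw [orient_neg_left a3 a1] at o2
    linarith
  · exfalso
    by_cases hu : u = u'
    · subst hu
      have o1 := h.strict g (Or.inl h'.1) (Ne.symm hw) n2
      have o2 := h'.strict g (Or.inl h.1) hw n1
      unfold orient at *
      linarith
    · have o1 := h.strict g (Or.inl h'.1) (Ne.symm hw) n2
      have o2 := h'.strict g (Or.inl h.1) hw n3
      have o3 := h.strict g (Or.inr h'.2.2.1) n3.symm (Ne.symm hu)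
      have o4 := h'.strict g (Or.inr h.2.2.1) n2.symm hu
      rw [orient_neg_left a1 a3] at o3
      rw [orient_neg_left a4 a2] at o4
      rcases lt_or_gt_of_ne (g.inj w w' hw) with hl | hl
      · rw [orient_neg_left a1 hl] at o1
        rw [← orient_rot, orient_neg_mid hl a4] at o2
        rcases sl_tri hl a2 with t | t | t <;> rcases sl_tri hl a4 with t' | t' | t' <;> linarith
      · rw [orient_neg_left a4 hl] at o2
        rw [← orient_rot, orient_neg_mid hl a1] at o1
        rcases sl_tri hl a3 with t | t | t <;> rcases sl_tri hl a1 with t' | t' | t' <;> linarith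

lemma exists_sorted {f : Fin n → ℝ} (hf : ∀ i j, i ≠ j → f i ≠ f j) (S : Set (Fin n)) :
    ∃ l : List (Fin n), l.Pairwise (fun a b => f a < f b) ∧ ∀ x, x ∈ l ↔ x ∈ S := by
  classical
  have key : ∀ T : Finset (Fin n),
      ∃ l : List (Fin n), l.Pairwise (fun a b => f a < f b) ∧ ∀ x, x ∈ l ↔ x ∈ T := by
    intro T
    induction T using Finset.induction_on_max_value f with
    | empty => exact ⟨[], by simp, by simp⟩
    | insert a s ha hmax ih =>
      obtain ⟨l, hl, hmem⟩ := ih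
      refine ⟨l ++ [a], ?_, ?_⟩
      · rw [List.pairwise_append]
        refine ⟨hl, by simp, ?_⟩
        intro x hx y hy
        obtain rfl : y = a := by simpa using hy
        have hx' := (hmem x).1 hx
        exact lt_of_le_of_ne (hmax x hx') (hf x y (by rintro rfl; exact ha hx'))
      · intro x; simp [hmem, or_comm]
  obtain ⟨l, hl, hm⟩ := key (Set.toFinite S).toFinset
  exact ⟨l, hl, by simpa using hm⟩

lemma sorted_unique {f : Fin n → ℝ} {l l' : List (Fin n)}
    (h : l.Pairwise (fun a b => f a < f b)) (h' : l'.Pairwise (fun a b => f a < f b))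
    (hm : ∀ x, x ∈ l ↔ x ∈ l') : l = l' := by
  have n1 : l.Nodup := h.imp (by intro a b hab e; subst e; exact lt_irrefl _ hab)
  have n2 : l'.Nodup := h'.imp (by intro a b hab e; subst e; exact lt_irrefl _ hab)
  refine ((List.perm_ext_iff_of_nodup n1 n2).2 hm).eq_of_pairwise ?_ h h'
  intro a b _ _ hab hba
  exact absurd hab (not_lt.2 hba.le)

/-- The ends of the bridge are hull vertices and come first in the lists. Hull membership gives
concavity, and the bridge gives the condition on the base. -/
lemma Funnel.spec {A B : List (Fin n)} (g : Generic P) (hs : Sides P SL SR b)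
    (h : Funnel P SL SR b A B) : ∃ w u A' B', A = w :: A' ∧ B = u :: B' ∧
      Bridge P SL SR b w u ∧ PT P A B b ∧
      (∀ j, j ∈ A ++ [b] ↔ Hull P SL j ∧ (j = w ∨ (P w).1 < (P j).1)) ∧
      (∀ j, j ∈ B ++ [b] ↔ Hull P SR j ∧ (j = u ∨ (P j).1 < (P u).1)) := by
  obtain ⟨w, u, h1, h2, h3, h4, h5⟩ := h
  have hw : w ∈ A := by
    have := (h4 w).2 ⟨h1.hullL g hs, Or.inl rfl⟩
    have hb := h1.2.1
    simp at this; tauto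
  have hu : u ∈ B := by
    have := (h5 u).2 ⟨h1.hullR g hs, Or.inl rfl⟩
    have hb := h1.2.2.2.1
    simp at this; tauto
  obtain ⟨a, A', rfl⟩ := List.exists_cons_of_ne_nil (List.ne_nil_of_mem hw)
  obtain ⟨c, B', rfl⟩ := List.exists_cons_of_ne_nil (List.ne_nil_of_mem hu)
  obtain rfl : a = w := by
    by_contra hne
    have := (List.pairwise_cons.1 h2).1 w (by simp at hw ⊢; tauto)
    rcases ((h4 a).1 (by simp)).2 with e | e
    · exact hne e
    · linarith
  obtain rfl : c = u := by
    by_contra hne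
    have := (List.pairwise_cons.1 h3).1 u (by simp at hu ⊢; tauto)
    rcases ((h5 c).1 (by simp)).2 with e | e
    · exact hne e
    · linarith
  refine ⟨a, c, A', B', rfl, rfl, h1, ?_, h4, h5⟩
  refine ⟨by simp, by simp, h2, h3, ?_, ?_, ?_⟩
  · intro i hi j hj k hk
    exact ((h4 j).1 hj).1.2 i ((h4 i).1 hi).1.1 k ((h4 k).1 hk).1.1
  · intro i hi j hj k hk
    exact ((h5 j).1 hj).1.2 i ((h5 i).1 hi).1.1 k ((h5 k).1 hk).1.1
  · intro a' c' ha hc y hy hya hyc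
    obtain rfl : a = a' := by simpa using ha
    obtain rfl : c = c' := by simpa using hc
    refine h1.strict g ?_ hya hyc
    simp only [List.mem_append] at hy
    rcases hy with (hy | hy) | hy
    · exact Or.inl ((h4 y).1 (List.mem_append_left _ hy)).1.1
    · exact Or.inr ((h5 y).1 (List.mem_append_left _ hy)).1.1
    · exact Or.inl ((h4 y).1 (List.mem_append_right _ hy)).1.1

lemma Funnel.pt {A B : List (Fin n)} (g : Generic P) (hs : Sides P SL SR b)
    (h : Funnel P SL SR b A B) : PT P A B b := by
  obtain ⟨_, _, _, _, _, _, _, h, _⟩ := h.spec g hs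
  exact h

lemma Funnel.unique {A B A' B' : List (Fin n)} (g : Generic P) (hs : Sides P SL SR b)
    (h : Funnel P SL SR b A B) (h' : Funnel P SL SR b A' B') : A = A' ∧ B = B' := by
  obtain ⟨w, u, h1, h2, h3, h4, h5⟩ := h
  obtain ⟨w', u', h1', h2', h3', h4', h5'⟩ := h'
  obtain ⟨rfl, rfl⟩ := h1.unique g hs h1'
  have e1 := sorted_unique (f := fun i => (P i).1) h2 h2' (fun x => by rw [h4, h4'])
  have e2 := sorted_unique (f := fun i => - (P i).1) (l := B ++ [b]) (l' := B' ++ [b])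
    (h3.imp (by intro a b; simp)) (h3'.imp (by intro a b; simp)) (fun x => by rw [h5, h5'])
  exact ⟨(List.append_inj' e1 rfl).1, (List.append_inj' e2 rfl).1⟩

/-- The apex is the rightmost point of its left part, so it is a hull vertex automatically and the
sorted list of the chain ends with it. -/
lemma exists_chain (g : Generic P) (hs : Sides P SL SR b) {w : Fin n} (hw : w ∈ SL) (hwb : w ≠ b) :
    ∃ A : List (Fin n), (A ++ [b]).Pairwise (fun i j => (P i).1 < (P j).1) ∧
      ∀ j, j ∈ A ++ [b] ↔ Hull P SL j ∧ (j = w ∨ (P w).1 < (P j).1) := by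
  obtain ⟨A, hA, hm⟩ := exists_sorted (f := fun i => (P i).1) g.inj
    {j | (Hull P SL j ∧ (j = w ∨ (P w).1 < (P j).1)) ∧ j ≠ b}
  have hb : Hull P SL b := by
    refine ⟨hs.bL, fun i hi k hk h1 h2 => ?_⟩
    have := hs.ltL k hk (by rintro rfl; exact lt_irrefl _ h2)
    linarith
  refine ⟨A, ?_, ?_⟩
  · rw [List.pairwise_append]
    refine ⟨hA, by simp, ?_⟩
    intro x hx y hy
    obtain rfl : y = b := by simpa using hy
    have := (hm x).1 hx
    exact hs.ltL x this.1.1.1 this.2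
  · intro j
    rw [List.mem_append, hm, List.mem_singleton]
    constructor
    · rintro (h | rfl)
      · exact h.1
      · exact ⟨hb, Or.inr (hs.ltL w hw hwb)⟩
    · intro h
      by_cases hj : j = b
      · exact Or.inr hj
      · exact Or.inl ⟨h, hj⟩

lemma Bridge.exists_funnel (g : Generic P) (hs : Sides P SL SR b) {w u : Fin n}
    (h : Bridge P SL SR b w u) : ∃ A B, Funnel P SL SR b A B := by
  obtain ⟨A, hA, hA'⟩ := exists_chain g hs h.1 h.2.1
  obtain ⟨B, hB, hB'⟩ := exists_chain g.mirror hs.mirror h.2.2.1 h.2.2.2.1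
  refine ⟨A, B, w, u, h, hA, hB.imp (by intro a b; simp), hA', ?_⟩
  intro j; rw [hB', hull_mirror]; simp

lemma Funnel.tri_eq {A B : List (Fin n)} (g : Generic P) (hs : Sides P SL SR b)
    (h : Funnel P SL SR b A B) (π : Equiv.Perm (Fin n)) :
    funnelTri P SL SR b π = tri P π A B b := by
  ext e
  constructor
  · rintro ⟨A', B', h', he⟩
    obtain ⟨rfl, rfl⟩ := h.unique g hs h'
    exact he
  · intro he; exact ⟨A, B, h, he⟩

lemma funnelTri_eq_empty (h : ∀ w u, ¬ Bridge P SL SR b w u) (π : Equiv.Perm (Fin n)) :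
    funnelTri P SL SR b π = ∅ := by
  ext e
  simp only [funnelTri, Set.mem_ofPred_eq, Set.mem_empty_iff_false, iff_false]
  rintro ⟨A, B, ⟨w, u, h', -⟩, -⟩
  exact h w u h'

lemma sorted_adjacent {f : Fin n → ℝ} {L : List (Fin n)} {i m : Fin n}
    (h : L.Pairwise (fun a b => f a < f b)) (hi : i ∈ L) (hm : m ∈ L) (him : f i < f m)
    (hno : ∀ x ∈ L, f i < f x → ¬ f x < f m) : ∃ X Y, L = X ++ i :: m :: Y := by
  obtain ⟨X, R, rfl⟩ := List.append_of_mem hi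
  rw [List.pairwise_append, List.pairwise_cons] at h
  have hmR : m ∈ R := by
    rcases List.mem_append.1 hm with h' | h'
    · have := h.2.2 m h' i (by simp); linarith
    · rcases List.mem_cons.1 h' with rfl | h'
      · exact absurd him (lt_irrefl _)
      · exact h'
  rcases R with _ | ⟨r, R⟩
  · simp at hmR
  · rcases List.mem_cons.1 hmR with rfl | hmR
    · exact ⟨X, R, rfl⟩
    · exact absurd ((List.pairwise_cons.1 h.2.1.2).1 m hmR)
        (hno r (by simp) (h.2.1.1 r (by simp)))

end KineticTriangulation

/-! ### Effect of a collinearity on the funnel: three points on one side. -/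

namespace KineticTriangulation

variable {n : ℕ}

open scoped symmDiff

lemma orient_swap_left (u v w : ℝ × ℝ) : orient u v w = - orient v u w := by
  unfold orient; ring

lemma orient_mirror_swap (P : Config n) (i j k : Fin n) :
    orient (mirror P j) (mirror P i) (mirror P k) = orient (P i) (P j) (P k) := by
  rw [orient_mirror, ← orient_swap_left]

lemma orient_self_left (u v : ℝ × ℝ) : orient u v u = 0 := by unfold orient; ring

lemma orient_self_right (u v : ℝ × ℝ) : orient u v v = 0 := by unfold orient; ring

namespace Flip

variable {PA PB : Config n} {i m k : Fin n}

lemma mirror (F : Flip PA PB i m k) : Flip (mirror PA) (mirror PB) k m i where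
  gA := F.gA.mirror
  gB := F.gB.mirror
  ord x y := by simpa using F.ord y x
  him := by simpa using F.hmk
  hmk := by simpa using F.him
  agree x y w h1 h2 h3 h := by
    have := F.agree y x w h1.symm h3 h2 (by tauto)
    rwa [orient_mirror_swap, orient_mirror_swap]
  negA := by
    rw [orient_mirror, ← orient_rev]; exact F.negA
  posB := by
    rw [orient_mirror, ← orient_rev]; exact F.posB
  compat r h1 h2 h3 := by
    rw [orient_mirror_swap, orient_mirror_swap, orient_mirror_swap]
    have := F.compat r h3 h2 h1
    tauto

lemma eq_of_lt (F : Flip PA PB i m k) {x y w : Fin n} (hx : x = i ∨ x = m ∨ x = k)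
    (hy : y = i ∨ y = m ∨ y = k) (hw : w = i ∨ w = m ∨ w = k) (h1 : (PA x).1 < (PA y).1)
    (h2 : (PA y).1 < (PA w).1) : x = i ∧ y = m ∧ w = k := by
  have a := F.him
  have b := F.hmk
  rcases hx with rfl | rfl | rfl <;> rcases hy with rfl | rfl | rfl <;>
    rcases hw with rfl | rfl | rfl <;> first | exact ⟨rfl, rfl, rfl⟩ | (exfalso; linarith)

lemma le_iff (F : Flip PA PB i m k) {x y w : Fin n} (hxy : x ≠ y)
    (h : ¬ ((x = i ∨ x = m ∨ x = k) ∧ (y = i ∨ y = m ∨ y = k) ∧ (w = i ∨ w = m ∨ w = k))) :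
    orient (PA x) (PA y) (PA w) ≤ 0 ↔ orient (PB x) (PB y) (PB w) ≤ 0 := by
  by_cases h1 : w = x
  · subst h1; simp [orient_self_left]
  by_cases h2 : w = y
  · subst h2; simp [orient_self_right]
  have a := F.gA.ncol x y w hxy (Ne.symm h2) (Ne.symm h1)
  have b := F.gB.ncol x y w hxy (Ne.symm h2) (Ne.symm h1)
  have := F.agree x y w hxy (Ne.symm h2) (Ne.symm h1) h
  rw [le_iff_lt_or_eq, le_iff_lt_or_eq]
  tauto

/-- The only hull test that can change has `m` in the middle and `i`, `k` as its outer points. -/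
lemma hull_iff (F : Flip PA PB i m k) {S : Set (Fin n)} {j : Fin n}
    (h : j ≠ m ∨ ¬ (i ∈ S ∧ k ∈ S)) : Hull PA S j ↔ Hull PB S j := by
  unfold Hull
  refine and_congr_right fun _ => forall₂_congr fun x hx => forall₂_congr fun y hy => ?_
  rw [F.ord, F.ord]
  refine imp_congr_right fun h1 => imp_congr_right fun h2 => ?_
  have h1' := (F.ord _ _).2 h1
  have h2' := (F.ord _ _).2 h2
  refine F.agree x j y ?_ ?_ ?_ ?_
  · rintro rfl; exact lt_irrefl _ h1
  · rintro rfl; exact lt_irrefl _ h2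
  · rintro rfl; exact lt_irrefl _ (h1.trans h2)
  · rintro ⟨a, b, c⟩
    obtain ⟨rfl, rfl, rfl⟩ := F.eq_of_lt a b c h1' h2'
    tauto

lemma bridge_iff (F : Flip PA PB i m k) {SL SR : Set (Fin n)} {b w u : Fin n}
    (h : ∀ x ∈ SL ∪ SR, x ≠ w → x ≠ u →
      ¬ ((w = i ∨ w = m ∨ w = k) ∧ (u = i ∨ u = m ∨ u = k) ∧ (x = i ∨ x = m ∨ x = k))) :
    Bridge PA SL SR b w u ↔ Bridge PB SL SR b w u := by
  unfold Bridge
  rw [F.ord]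
  refine and_congr_right fun _ => and_congr_right fun _ => and_congr_right fun _ =>
    and_congr_right fun _ => and_congr_right fun hlt => forall₂_congr fun x hx => ?_
  by_cases h1 : x = w
  · subst h1; simp [orient_self_left]
  by_cases h2 : x = u
  · subst h2; simp [orient_self_right]
  exact F.le_iff (by rintro rfl; exact lt_irrefl _ hlt) (h x hx h1 h2)

lemma sides (F : Flip PA PB i m k) {SL SR : Set (Fin n)} {b : Fin n} (h : Sides PA SL SR b) :
    Sides PB SL SR b :=
  ⟨h.bL, h.bR, fun x hx hb => (F.ord _ _).1 (h.ltL x hx hb),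
    fun x hx hb => (F.ord _ _).1 (h.ltR x hx hb)⟩

lemma funnel_iff (F : Flip PA PB i m k) {SL SR : Set (Fin n)} {b : Fin n}
    (hb : ∀ w u, Bridge PA SL SR b w u ↔ Bridge PB SL SR b w u)
    (hL : ∀ w u, Bridge PA SL SR b w u → ∀ j, (j = w ∨ (PA w).1 < (PA j).1) →
      (Hull PA SL j ↔ Hull PB SL j))
    (hR : ∀ j, Hull PA SR j ↔ Hull PB SR j) (A B : List (Fin n)) :
    Funnel PA SL SR b A B ↔ Funnel PB SL SR b A B := by
  unfold Funnel
  refine exists₂_congr fun w u => ?_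
  rw [← hb]
  refine and_congr_right fun hw => ?_
  simp only [F.ord, hR]
  refine and_congr_right fun _ => and_congr_right fun _ => and_congr_left fun _ =>
    forall_congr' fun j => ?_
  have := hL w u hw j
  rw [F.ord] at this
  tauto

/-- The lists of vertices of the funnel agree and so do the triangulations. -/
lemma funnelTri_eq {SL SR : Set (Fin n)} {b : Fin n}
    (h : ∀ A B, Funnel PA SL SR b A B ↔ Funnel PB SL SR b A B)
    (ht : ∀ A B, Funnel PA SL SR b A B → ∀ π, tri PA π A B b = tri PB π A B b)
    (π : Equiv.Perm (Fin n)) : funnelTri PA SL SR b π = funnelTri PB SL SR b π := by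
  ext e
  constructor
  · rintro ⟨A, B, hF, he⟩
    exact ⟨A, B, (h A B).1 hF, by rwa [← ht A B hF]⟩
  · rintro ⟨A, B, hF, he⟩
    exact ⟨A, B, (h A B).2 hF, by rwa [ht A B ((h A B).2 hF)]⟩

end Flip

/-- The configuration `P0` at the moment when `m` lies on the segment `ik`. -/
structure FlipAt (P0 PA PB : Config n) (i m k : Fin n) : Prop extends Flip PA PB i m k where
  ord0 : ∀ x y, (P0 x).1 < (P0 y).1 ↔ (PA x).1 < (PA y).1
  sign0 : ∀ x y w, x ≠ y → y ≠ w → x ≠ w →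
    ¬ ((x = i ∨ x = m ∨ x = k) ∧ (y = i ∨ y = m ∨ y = k) ∧ (w = i ∨ w = m ∨ w = k)) →
    orient (P0 x) (P0 y) (P0 w) ≠ 0 ∧
    (orient (P0 x) (P0 y) (P0 w) < 0 ↔ orient (PA x) (PA y) (PA w) < 0)
  col : orient (P0 i) (P0 m) (P0 k) = 0

/-- A chain of the left side contains three collinear points. -/
def EnvL (P : Config n) (SL SR : Set (Fin n)) (b : Fin n) : Prop :=
  ∃ w u, Bridge P SL SR b w u ∧ ∃ i ∈ SL, ∃ j ∈ SL, ∃ k ∈ SL, (i = w ∨ (P w).1 < (P i).1) ∧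
    (P i).1 < (P j).1 ∧ (P j).1 < (P k).1 ∧ orient (P i) (P j) (P k) = 0 ∧
    ∀ x ∈ SL, orient (P i) (P k) (P x) ≤ 0

/-- A vertex of the right chain is collinear with an edge of the left hull. -/
def VisL (P : Config n) (SL SR : Set (Fin n)) (b : Fin n) : Prop :=
  ∃ w u, Bridge P SL SR b w u ∧ ∃ q, Hull P SR q ∧ q ≠ b ∧ (q = u ∨ (P q).1 < (P u).1) ∧
    ∃ i ∈ SL, ∃ j ∈ SL, (P i).1 < (P j).1 ∧ (∀ x ∈ SL, orient (P i) (P j) (P x) ≤ 0) ∧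
      orient (P i) (P j) (P q) = 0

/-- An envelope or visibility event. -/
def Ev (P : Config n) (SL SR : Set (Fin n)) (b : Fin n) : Prop :=
  (EnvL P SL SR b ∨ VisL P SL SR b) ∨ EnvL (mirror P) SR SL b ∨ VisL (mirror P) SR SL b

lemma Ev.of_mirror {P : Config n} {SL SR : Set (Fin n)} {b : Fin n}
    (h : Ev (mirror P) SR SL b) : Ev P SL SR b := by
  unfold Ev at *
  rw [mirror_mirror] at h
  tauto

/-- The set `I` contains all points of `SL` and `SR` except for `b` and the extreme points. -/
structure InnerSet (P : Config n) (SL SR : Set (Fin n)) (b : Fin n) (I : Set (Fin n)) : Prop where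
  left : ∀ y ∈ SL, y ≠ b → ∀ x ∈ SL, (P x).1 < (P y).1 → y ∈ I
  right : ∀ y ∈ SR, y ≠ b → ∀ x ∈ SR, (P y).1 < (P x).1 → y ∈ I

lemma InnerSet.mirror {P : Config n} {SL SR : Set (Fin n)} {b : Fin n} {I : Set (Fin n)}
    (h : InnerSet P SL SR b I) : InnerSet (mirror P) SR SL b I :=
  ⟨fun y hy hb x hx hlt => h.right y hy hb x hx (by simpa using hlt),
    fun y hy hb x hx hlt => h.left y hy hb x hx (by simpa using hlt)⟩

lemma InnerSet.tail {P : Config n} {SL SR : Set (Fin n)} {b : Fin n} {I : Set (Fin n)}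
    (h : InnerSet P SL SR b I) (g : Generic P) (hs : Sides P SL SR b) {A B : List (Fin n)}
    (hF : Funnel P SL SR b A B) : ∀ y ∈ A.tail ++ B.tail, y ∈ I := by
  obtain ⟨w, u, A', B', rfl, rfl, hb, hP, hA, hB⟩ := hF.spec g hs
  intro y hy
  rcases List.mem_append.1 hy with hy | hy
  · have hy' := (hA y).1 (by simp at hy; simp [hy])
    refine h.left y hy'.1.1 ?_ w hb.1 ((List.pairwise_cons.1 hP.pairA).1 y hy)
    rintro rfl; exact lt_irrefl _ (hP.ltA (List.mem_of_mem_tail hy))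
  · have hy' := (hB y).1 (by simp at hy; simp [hy])
    refine h.right y hy'.1.1 ?_ u hb.2.2.1 ((List.pairwise_cons.1 hP.pairB).1 y hy)
    rintro rfl; exact lt_irrefl _ (hP.ltB (List.mem_of_mem_tail hy))

/-- The function `f` of the priorities is bounded in terms of the number of late points. -/
def Cost (I : Set (Fin n)) (f : Equiv.Perm (Fin n) → ℕ) : Prop :=
  (∀ π, f π ≤ 11) ∨ ∃ (P : Config n) (A₀ B₀ : List (Fin n)) (z₀ i m : Fin n), Generic P ∧
    PT P A₀ B₀ z₀ ∧ m ∈ I ∧ ∀ π, f π ≤ 6 * (Late P A₀ B₀ i m I π).ncard + 11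

namespace FlipAt

variable {P0 PA PB : Config n} {i m k : Fin n}

lemma mirror (F : FlipAt P0 PA PB i m k) :
    FlipAt (mirror P0) (mirror PA) (mirror PB) k m i where
  toFlip := F.toFlip.mirror
  ord0 x y := by simpa using F.ord0 y x
  sign0 x y w h1 h2 h3 h := by
    rw [orient_mirror_swap, orient_mirror_swap]
    exact F.sign0 y x w h1.symm h3 h2 (by tauto)
  col := by rw [orient_mirror, ← orient_rev]; exact F.col

lemma le0_iff (F : FlipAt P0 PA PB i m k) {x y w : Fin n} (hxy : x ≠ y)
    (h : ¬ ((x = i ∨ x = m ∨ x = k) ∧ (y = i ∨ y = m ∨ y = k) ∧ (w = i ∨ w = m ∨ w = k))) :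
    orient (P0 x) (P0 y) (P0 w) ≤ 0 ↔ orient (PA x) (PA y) (PA w) ≤ 0 := by
  by_cases h1 : w = x
  · subst h1; simp [orient_self_left]
  by_cases h2 : w = y
  · subst h2; simp [orient_self_right]
  have a := F.gA.ncol x y w hxy (Ne.symm h2) (Ne.symm h1)
  have := F.sign0 x y w hxy (Ne.symm h2) (Ne.symm h1) h
  rw [le_iff_lt_or_eq, le_iff_lt_or_eq]
  tauto

lemma bridge0_iff (F : FlipAt P0 PA PB i m k) {SL SR : Set (Fin n)} {b w u : Fin n}
    (h : ∀ x ∈ SL ∪ SR, x ≠ w → x ≠ u →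
      ¬ ((w = i ∨ w = m ∨ w = k) ∧ (u = i ∨ u = m ∨ u = k) ∧ (x = i ∨ x = m ∨ x = k))) :
    Bridge P0 SL SR b w u ↔ Bridge PA SL SR b w u := by
  unfold Bridge
  rw [F.ord0]
  refine and_congr_right fun _ => and_congr_right fun _ => and_congr_right fun _ =>
    and_congr_right fun _ => and_congr_right fun hlt => forall₂_congr fun x hx => ?_
  by_cases h1 : x = w
  · subst h1; simp [orient_self_left]
  by_cases h2 : x = u
  · subst h2; simp [orient_self_right]
  exact F.le0_iff (by rintro rfl; exact lt_irrefl _ hlt) (h x hx h1 h2)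

lemma hull0_iff (F : FlipAt P0 PA PB i m k) {S : Set (Fin n)} {j : Fin n}
    (h : j ≠ m ∨ ¬ (i ∈ S ∧ k ∈ S)) : Hull P0 S j ↔ Hull PA S j := by
  unfold Hull
  refine and_congr_right fun _ => forall₂_congr fun x hx => forall₂_congr fun y hy => ?_
  rw [F.ord0, F.ord0]
  refine imp_congr_right fun h1 => imp_congr_right fun h2 => ?_
  refine (F.sign0 x j y ?_ ?_ ?_ ?_).2
  · rintro rfl; exact lt_irrefl _ h1
  · rintro rfl; exact lt_irrefl _ h2
  · rintro rfl; exact lt_irrefl _ (h1.trans h2)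
  · rintro ⟨a, b, c⟩
    obtain ⟨rfl, rfl, rfl⟩ := F.eq_of_lt a b c h1 h2
    tauto

/-- If all other points of `S` lie under the line `im`, then the three lines through `i`, `m`, `k`
support `S` at the moment of collinearity. -/
lemma supports0 (F : FlipAt P0 PA PB i m k) {S : Set (Fin n)}
    (h : ∀ x ∈ S, x ≠ i → x ≠ m → x ≠ k → orient (PA i) (PA m) (PA x) < 0) :
    (∀ x ∈ S, orient (P0 i) (P0 k) (P0 x) ≤ 0) ∧ (∀ x ∈ S, orient (P0 i) (P0 m) (P0 x) ≤ 0) := by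
  refine ⟨fun x hx => ?_, fun x hx => ?_⟩
  · by_cases h1 : x = i
    · subst h1; rw [orient_self_left]
    by_cases h2 : x = m
    · subst h2; rw [orient_swap, F.col, neg_zero]
    by_cases h3 : x = k
    · subst h3; rw [orient_self_right]
    have := h x hx h1 h2 h3
    rw [(F.compat x h1 h2 h3).1] at this
    exact ((F.sign0 i k x F.ne_ik (Ne.symm h3) (Ne.symm h1) (by tauto)).2.2 this).le
  · by_cases h1 : x = i
    · subst h1; rw [orient_self_left]
    by_cases h2 : x = m
    · subst h2; rw [orient_self_right]
    by_cases h3 : x = k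
    · subst h3; rw [F.col]
    have := h x hx h1 h2 h3
    exact ((F.sign0 i m x F.ne_im (Ne.symm h2) (Ne.symm h1) (by tauto)).2.2 this).le

variable {SL SR I : Set (Fin n)} {b : Fin n}

/-- The dichotomy for the passage of a point through a segment. -/
def Dichotomy (P0 PA PB : Config n) (SL SR : Set (Fin n)) (b : Fin n) (I : Set (Fin n)) : Prop :=
  (∀ π, funnelTri PA SL SR b π = funnelTri PB SL SR b π) ∨
    (Ev P0 SL SR b ∧
      Cost I (fun π => (funnelTri PA SL SR b π ∆ funnelTri PB SL SR b π).ncard))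

lemma Dichotomy.of_mirror
    (h : Dichotomy (KineticTriangulation.mirror P0) (KineticTriangulation.mirror PA)
      (KineticTriangulation.mirror PB) SR SL b I) : Dichotomy P0 PA PB SL SR b I := by
  unfold Dichotomy at *
  simp only [funnelTri_mirror] at h
  rcases h with h | ⟨h1, h2⟩
  · exact Or.inl h
  · exact Or.inr ⟨h1.of_mirror, h2⟩

/-- The case of three collinear points on the left side. -/
lemma dichotomy_left (F : FlipAt P0 PA PB i m k) (hs : Sides PA SL SR b)
    (hI : InnerSet PA SL SR b I) (hi : i ∈ SL) (hm : m ∈ SL) (hk : k ∈ SL) :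
    Dichotomy P0 PA PB SL SR b I := by
  have hsB := F.toFlip.sides hs
  have hmb : m ≠ b := by
    rintro rfl
    have := F.hmk
    have := hs.ltL k hk F.ne_mk.symm
    linarith
  have hib : i ≠ b := by
    rintro rfl
    have := F.him
    have := hs.ltL m hm F.ne_im.symm
    linarith
  have notS : ∀ {x}, x ∈ SR → x ≠ b → ¬ (x = i ∨ x = m ∨ x = k) := by
    rintro x hx hxb (rfl | rfl | rfl)
    · exact hs.ne hi hx hxb rfl
    · exact hs.ne hm hx hxb rfl
    · exact hs.ne hk hx hxb rfl
  have hbr : ∀ w u, Bridge PA SL SR b w u ↔ Bridge PB SL SR b w u := by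
    intro w u
    constructor
    · intro h
      exact (F.toFlip.bridge_iff (fun x _ _ _ hx => notS h.2.2.1 h.2.2.2.1 hx.2.1)).1 h
    · intro h
      exact (F.toFlip.bridge_iff (fun x _ _ _ hx => notS h.2.2.1 h.2.2.2.1 hx.2.1)).2 h
  have hiR : i ∉ SR := fun h => notS h hib (Or.inl rfl)
  have hR : ∀ j, Hull PA SR j ↔ Hull PB SR j := fun j =>
    F.toFlip.hull_iff (Or.inr (fun h => hiR h.1))
  have same : ∀ A B, Funnel PA SL SR b A B → ∀ π, tri PA π A B b = tri PB π A B b := by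
    intro A B hF π
    obtain ⟨w, u, A', B', -, -, hb, hP, hA, hB⟩ := hF.spec F.gA hs
    have nB : ∀ x ∈ B, ¬ (x = i ∨ x = m ∨ x = k) := fun x hx =>
      notS ((hB x).1 (List.mem_append_left _ hx)).1.1
        (by rintro rfl; exact lt_irrefl _ (hP.ltB hx))
    exact F.toFlip.tri_same hP (fun q _ v hv v' hv' _ h => nB v hv h.2.1)
      (fun q hq v hv v' hv' _ h => nB q (List.mem_of_mem_tail hq) h.1) π
  -- In `PB` the point `m` is below the segment `i k`. So the event is visible only if `m` is a hull
  -- vertex in `PA`, on the chain and not on the tail.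
  have mHB : ¬ Hull PB SL m := by
    intro h
    have := h.2 i hi k hk ((F.ord _ _).1 F.him) ((F.ord _ _).1 F.hmk)
    have := F.posB
    linarith
  by_cases mHA : Hull PA SL m
  swap
  · left
    refine Flip.funnelTri_eq (F.toFlip.funnel_iff hbr (fun w u _ j _ => ?_) hR) same
    by_cases hj : j = m
    · subst hj; tauto
    · exact F.toFlip.hull_iff (Or.inl hj)
  -- If `m` is a hull vertex, points to its right are below `i m`, and points to its left are below
  -- `m k`, hence below `i m` by compatibility.
  have supp : ∀ x ∈ SL, x ≠ i → x ≠ m → x ≠ k → orient (PA i) (PA m) (PA x) < 0 := by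
    intro x hx h1 h2 h3
    rcases lt_or_gt_of_ne (F.gA.inj x m h2) with hlt | hlt
    · rw [(F.compat x h1 h2 h3).2, ← orient_rot]
      exact mHA.2 x hx k hk hlt F.hmk
    · exact mHA.2 i hi x hx F.him hlt
  by_cases hex : ∃ w u, Bridge PA SL SR b w u
  swap
  · left
    push Not at hex
    intro π
    rw [funnelTri_eq_empty hex, funnelTri_eq_empty (fun w u h => hex w u ((hbr w u).2 h))]
  obtain ⟨w, u, hwu⟩ := hex
  obtain ⟨A, B, hF⟩ := hwu.exists_funnel F.gA hs
  obtain ⟨w', u', A', B', hAw, hBu, hb', hP, hA, hB⟩ := hF.spec F.gA hs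
  obtain ⟨rfl, rfl⟩ := hwu.unique F.gA hs hb'
  have hwm : w ≠ m := by
    rintro rfl
    exact mHB (((hbr _ _).1 hwu).hullL F.gB hsB)
  by_cases hmw : (PA m).1 < (PA w).1
  · left
    refine Flip.funnelTri_eq (F.toFlip.funnel_iff hbr (fun w' u' hb' j hj => ?_) hR) same
    obtain ⟨rfl, rfl⟩ := hwu.unique F.gA hs hb'
    refine F.toFlip.hull_iff (Or.inl ?_)
    rintro rfl
    rcases hj with rfl | hj
    · exact hwm rfl
    · linarith
  have hwm' : (PA w).1 < (PA m).1 := by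
    rcases lt_or_gt_of_ne (F.gA.inj w m hwm) with h | h
    · exact h
    · exact absurd h hmw
  right
  -- All other points are under the lines `i m` and `m k`, so no hull vertex lies between `i` and
  -- `m` or between `m` and `k`: the three are consecutive on the chain.
  have noim : ∀ x, Hull PA SL x → (PA i).1 < (PA x).1 → ¬ (PA x).1 < (PA m).1 := by
    intro x hx h1 h2
    have o1 := hx.2 i hi m hm h1 h2
    have o2 := supp x hx.1 (by rintro rfl; exact lt_irrefl _ h1)
      (by rintro rfl; exact lt_irrefl _ h2) (by rintro rfl; have := F.hmk; linarith)
    rw [orient_swap] at o1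
    linarith
  have nomk : ∀ x, Hull PA SL x → (PA m).1 < (PA x).1 → ¬ (PA x).1 < (PA k).1 := by
    intro x hx h1 h2
    have o1 := hx.2 m hm k hk h1 h2
    have hxi : x ≠ i := by rintro rfl; have := F.him; linarith
    have hxm : x ≠ m := by rintro rfl; exact lt_irrefl _ h1
    have hxk : x ≠ k := by rintro rfl; exact lt_irrefl _ h2
    have o2 := (F.compat x hxi hxm hxk).2.1 (supp x hx.1 hxi hxm hxk)
    rw [orient_swap] at o1
    linarith
  have hneg := F.negA
  have hik := F.him.trans F.hmk
  have iH : Hull PA SL i := by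
    refine ⟨hi, fun x hx y hy h1 h2 => ?_⟩
    rw [orient_neg_mid h1 h2]
    have o1 := supp x hx (by rintro rfl; exact lt_irrefl _ h1)
      (by rintro rfl; have := F.him; linarith) (by rintro rfl; linarith)
    rw [← orient_rot, orient_neg_mid h1 F.him] at o1
    have o2 : sl PA i y ≤ sl PA i m := by
      by_cases hym : y = m
      · rw [hym]
      by_cases hyk : y = k
      · rw [hyk]; rw [orient_neg_left F.him hik] at hneg; exact hneg.le
      · have := supp y hy (by rintro rfl; exact lt_irrefl _ h2) hym hyk
        rw [orient_neg_left F.him h2] at this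
        exact this.le
    linarith
  have kH : Hull PA SL k := by
    refine ⟨hk, fun x hx y hy h1 h2 => ?_⟩
    rw [orient_neg_mid h1 h2]
    have yi : y ≠ i := by rintro rfl; linarith
    have ym : y ≠ m := by rintro rfl; have := F.hmk; linarith
    have yk : y ≠ k := by rintro rfl; exact lt_irrefl _ h2
    have o1 := (F.compat y yi ym yk).2.1 (supp y hy yi ym yk)
    rw [orient_neg_mid F.hmk h2] at o1
    have o2 : sl PA m k ≤ sl PA x k := by
      by_cases hxm : x = m
      · rw [hxm]
      by_cases hxi : x = i
      · rw [hxi]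
        rw [orient_neg_mid F.him F.hmk] at hneg
        rcases sl_tri F.him F.hmk with t | t | t <;> linarith
      have hxk : x ≠ k := by rintro rfl; exact lt_irrefl _ h1
      have o3 := (F.compat x hxi hxm hxk).2.1 (supp x hx hxi hxm hxk)
      rcases lt_or_gt_of_ne (F.gA.inj x m hxm) with hlt | hlt
      · rw [← orient_rot, orient_neg_mid hlt F.hmk] at o3
        rcases sl_tri hlt F.hmk with t | t | t <;> linarith
      · rw [orient_neg_left F.hmk hlt] at o3
        rcases sl_tri hlt h1 with t | t | t <;> linarith
    linarith
  have hwi : i = w ∨ (PA w).1 < (PA i).1 := by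
    by_cases hiw : i = w
    · exact Or.inl hiw
    · right
      rcases lt_or_gt_of_ne (F.gA.inj i w hiw) with h | h
      · exact absurd hwm' (noim w (hwu.hullL F.gA hs) h)
      · exact h
  have iA : i ∈ A ++ [b] := (hA i).2 ⟨iH, hwi⟩
  have mA : m ∈ A ++ [b] := (hA m).2 ⟨mHA, Or.inr hwm'⟩
  have kA : k ∈ A ++ [b] := (hA k).2 ⟨kH, Or.inr (hwm'.trans F.hmk)⟩
  obtain ⟨X, Y, hXY⟩ := sorted_adjacent (f := fun x => (PA x).1) hP.sortA iA mA F.him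
    (fun x hx => noim x ((hA x).1 hx).1)
  obtain ⟨X', Y', hXY'⟩ := sorted_adjacent (f := fun x => (PA x).1) hP.sortA mA kA F.hmk
    (fun x hx => nomk x ((hA x).1 hx).1)
  have nd : (A ++ [b]).Nodup := hP.sortA.imp
    (by intro a b hab e; subst e; exact lt_irrefl _ hab)
  obtain ⟨-, eY⟩ := split_unique nd hXY' (show A ++ [b] = (X ++ [i]) ++ m :: Y by simp [hXY])
  obtain ⟨K, hK⟩ : ∃ K, Y = K ++ [b] := by
    obtain ⟨K, y, hy⟩ := (List.eq_nil_or_concat Y).resolve_left (by rw [← eY]; simp)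
    rw [List.concat_eq_append] at hy
    refine ⟨K, ?_⟩
    rw [hy, show X ++ i :: m :: (K ++ [y]) = (X ++ i :: m :: K) ++ [y] by simp] at hXY
    have := (List.append_inj' hXY rfl).2
    rw [hy, ← this]
  obtain rfl : A = X ++ i :: m :: K := by
    rw [hK, show X ++ i :: m :: (K ++ [b]) = (X ++ i :: m :: K) ++ [b] by simp] at hXY
    exact (List.append_inj' hXY rfl).1
  have hkhead : (K ++ [b]).head? = some k := by rw [← hK, ← eY]; rfl
  have memB : ∀ j, j ∈ X ++ i :: K ++ [b] ↔ j ∈ X ++ i :: m :: K ++ [b] ∧ j ≠ m := by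
    intro j
    have hn : m ∉ X ++ i :: K ++ [b] := by
      have : (X ++ i :: m :: K ++ [b]) = (X ++ [i]) ++ m :: (K ++ [b]) := by simp
      rw [this, List.nodup_append, List.nodup_cons] at nd
      intro h
      have h' : m ∈ X ++ [i] ∨ m ∈ K ++ [b] := by simp at h ⊢; tauto
      rcases h' with h' | h'
      · exact nd.2.2 m h' m (by simp) rfl
      · exact nd.2.1.1 h'
    constructor
    · intro h
      exact ⟨by simp at h ⊢; tauto, by rintro rfl; exact hn h⟩
    · rintro ⟨h, hj⟩
      simp at h ⊢; tauto
  have hFB : Funnel PB SL SR b (X ++ i :: K) B := by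
    refine ⟨w, u, (hbr w u).1 hwu, ?_, ?_, ?_, ?_⟩
    · refine (hP.sortA.sublist ?_).imp (fun h => (F.ord _ _).1 h)
      refine List.Sublist.append_right (List.Sublist.append_left ?_ _) _
      exact List.Sublist.cons_cons _ (List.sublist_cons_self _ _)
    · exact hP.sortB.imp (fun h => (F.ord _ _).1 h)
    · intro j
      rw [memB, hA, F.ord]
      constructor
      · rintro ⟨⟨h1, h2⟩, hj⟩
        exact ⟨(F.toFlip.hull_iff (Or.inl hj)).1 h1, h2⟩
      · rintro ⟨h1, h2⟩
        have hj : j ≠ m := by rintro rfl; exact mHB h1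
        exact ⟨⟨(F.toFlip.hull_iff (Or.inl hj)).2 h1, h2⟩, hj⟩
    · intro j
      rw [hB, hR, F.ord]
  refine ⟨Or.inl (Or.inl ?_), Or.inr ?_⟩
  · refine ⟨w, u, (F.bridge0_iff (fun x _ _ _ hx => notS hwu.2.2.1 hwu.2.2.2.1 hx.2.1)).2 hwu,
      i, hi, m, hm, k, hk, ?_, (F.ord0 _ _).2 F.him, (F.ord0 _ _).2 F.hmk, F.col,
      (F.supports0 supp).1⟩
    rw [F.ord0]; exact hwi
  · refine ⟨PA, X ++ i :: m :: K, B, b, i, m, F.gA, hP, hI.left m hm hmb i hi F.him, fun π => ?_⟩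
    beta_reduce
    rw [hF.tri_eq F.gA hs, hFB.tri_eq F.gB hsB]
    -- At the start the right chain is complete, so it contains all vertices above the line `i m`,
    -- and nothing lies below its last vertex.
    have inv : Inv PA π (X ++ i :: m :: K) B i m (X ++ i :: m :: K) B b := by
      refine ⟨List.infix_rfl, List.infix_rfl, Or.inr ⟨Or.inl (fun y hy _ _ => hy), ?_⟩⟩
      intro q hq v hv r hr hrv
      obtain ⟨B'', rfl⟩ := List.getLast?_eq_some_iff.1 hv
      rcases List.mem_append.1 hr with h | h
      · have := (List.pairwise_append.1 hP.pairB).2.2 r h v (by simp); linarith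
      · simp at h; subst h; exact absurd hrv (lt_irrefl _)
    have := F.toFlip.ncard_insert_le π hP (hI.tail F.gA hs hF) _ le_rfl hP (hFB.pt F.gB hsB)
      hkhead inv
    omega

end FlipAt

end KineticTriangulation

/-! ### Effect of a collinearity that involves both sides or the apex. -/

namespace KineticTriangulation

variable {n : ℕ}

open scoped symmDiff

/-- A point of `S` that is extreme above the line `im` is a vertex of the upper hull. -/
lemma exists_hull_above {P : Config n} (g : Generic P) {S : Set (Fin n)} {i m x : Fin n}
    (him : (P i).1 < (P m).1) (hx : x ∈ S) :
    ∃ y, Hull P S y ∧ orient (P i) (P m) (P x) ≤ orient (P i) (P m) (P y) := by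
  -- Take a point at maximal height above the line `i m`. Orientation is affine in each point, so a
  -- segment above `y` would have an end that is higher; the identity `key` expresses this.
  obtain ⟨y, hy, hmax⟩ := Set.exists_max_image S (fun x => orient (P i) (P m) (P x))
    (Set.toFinite S) ⟨x, hx⟩
  refine ⟨y, ⟨hy, fun a ha c hc h1 h2 => ?_⟩, hmax x hx⟩
  have ne := g.ncol a y c (by rintro rfl; exact lt_irrefl _ h1)
    (by rintro rfl; exact lt_irrefl _ h2) (by rintro rfl; linarith)
  refine lt_of_le_of_ne ?_ ne
  have o1 := hmax a ha
  have o2 := hmax c hc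
  have key : ((P m).1 - (P i).1) * orient (P a) (P y) (P c) =
      ((P y).1 - (P a).1) * (orient (P i) (P m) (P c) - orient (P i) (P m) (P y)) +
      ((P c).1 - (P y).1) * (orient (P i) (P m) (P a) - orient (P i) (P m) (P y)) := by
    unfold orient; ring
  have a1 : ((P y).1 - (P a).1) * (orient (P i) (P m) (P c) - orient (P i) (P m) (P y)) ≤ 0 :=
    mul_nonpos_of_nonneg_of_nonpos (by linarith) (by linarith)
  have a2 : ((P c).1 - (P y).1) * (orient (P i) (P m) (P a) - orient (P i) (P m) (P y)) ≤ 0 :=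
    mul_nonpos_of_nonneg_of_nonpos (by linarith) (by linarith)
  by_contra hcon
  push Not at hcon
  have := mul_pos (sub_pos.2 him) hcon
  linarith

namespace FlipAt

variable {P0 PA PB : Config n} {i m k : Fin n} {SL SR I : Set (Fin n)} {b : Fin n}

/-- The case in which the apex passes through the segment between two points on different sides. -/
lemma dichotomy_apex (F : FlipAt P0 PA PB i b k) (hs : Sides PA SL SR b)
    (hi : i ∈ SL) (hk : k ∈ SR) : Dichotomy P0 PA PB SL SR b I := by
  have hsB := F.toFlip.sides hs
  have hib := F.ne_im
  have hkb := F.ne_mk.symm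
  have hkL : k ∉ SL := fun h => hs.ne h hk hkb rfl
  have hiR : i ∉ SR := fun h => hs.ne hi h hib rfl
  have hL : ∀ j, Hull PA SL j ↔ Hull PB SL j := fun j =>
    F.toFlip.hull_iff (Or.inr (fun h => hkL h.2))
  have hR : ∀ j, Hull PA SR j ↔ Hull PB SR j := fun j =>
    F.toFlip.hull_iff (Or.inr (fun h => hiR h.1))
  have nA : ¬ Bridge PA SL SR b i k := by
    intro h
    have := h.2.2.2.2.2 b (Or.inl hs.bL)
    have := F.negA
    rw [orient_swap] at this
    linarith
  have oth : ∀ w u, ¬ (w = i ∧ u = k) → (Bridge PA SL SR b w u ↔ Bridge PB SL SR b w u) := by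
    intro w u hne
    by_cases hm : w ∈ SL ∧ w ≠ b ∧ u ∈ SR ∧ u ≠ b
    · refine F.toFlip.bridge_iff (fun x _ _ _ hx => hne ⟨?_, ?_⟩)
      · rcases hx.1 with rfl | rfl | rfl
        · rfl
        · exact absurd rfl hm.2.1
        · exact absurd hm.1 hkL
      · rcases hx.2.1 with rfl | rfl | rfl
        · exact absurd hm.2.2.1 hiR
        · exact absurd rfl hm.2.2.2
        · rfl
    · constructor <;> intro h <;> exact absurd ⟨h.1, h.2.1, h.2.2.1, h.2.2.2.1⟩ hm
  by_cases hB : Bridge PB SL SR b i k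
  swap
  · left
    refine Flip.funnelTri_eq (F.toFlip.funnel_iff (fun w u => ?_) (fun _ _ _ j _ => hL j) hR) ?_
    · by_cases h : w = i ∧ u = k
      · obtain ⟨rfl, rfl⟩ := h; tauto
      · exact oth w u h
    · intro A B hF π
      have hP := hF.pt F.gA hs
      exact F.toFlip.tri_same_of_notMem hP (x := b) (by tauto)
        (fun h => lt_irrefl _ (hP.ltA h)) (fun h => lt_irrefl _ (hP.ltB h)) π
  right
  have emp : ∀ w u, ¬ Bridge PA SL SR b w u := by
    intro w u h
    by_cases hne : w = i ∧ u = k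
    · obtain ⟨rfl, rfl⟩ := hne; exact nA h
    · exact hne (((oth w u hne).1 h).unique F.gB hsB hB)
  have supp : ∀ x ∈ SL ∪ SR, x ≠ i → x ≠ b → x ≠ k → orient (PA i) (PA k) (PA x) < 0 := by
    intro x hx h1 h2 h3
    rw [F.agree i k x F.ne_ik (Ne.symm h3) (Ne.symm h1) (by tauto)]
    exact hB.strict F.gB hx h1 h3
  obtain ⟨A, B, hF⟩ := hB.exists_funnel F.gB hsB
  obtain ⟨w', u', A', B', rfl, rfl, hb', hP, hA, hBm⟩ := hF.spec F.gB hsB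
  obtain ⟨rfl, rfl⟩ := hB.unique F.gB hsB hb'
  -- In `PB` all other points are still under the lines `i b` and `b k`, as these nearly coincide
  -- with `i k`. So neither chain has an inner vertex, and the new funnel is the single triangle `i
  -- b k`.
  have hA' : A' = [] := by
    rcases A' with _ | ⟨x, A'⟩
    · rfl
    have h1 := (List.pairwise_cons.1 hP.pairA).1 x (by simp)
    have h2 := hP.ltA (x := x) (by simp)
    have hx := (hA x).1 (by simp)
    have o1 := hx.1.2 i hi b hs.bL h1 h2
    have xi : x ≠ i := by rintro rfl; exact lt_irrefl _ h1
    have xb : x ≠ b := by rintro rfl; exact lt_irrefl _ h2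
    have xk : x ≠ k := by rintro rfl; exact hkL hx.1.1
    have o2 := supp x (Or.inl hx.1.1) xi xb xk
    rw [← (F.compat x xi xb xk).1, F.agree i b x F.ne_im xb.symm xi.symm (by tauto),
      orient_swap] at o2
    linarith
  have hB' : B' = [] := by
    rcases B' with _ | ⟨x, B'⟩
    · rfl
    have h1 := (List.pairwise_cons.1 hP.pairB).1 x (by simp)
    have h2 := hP.ltB (x := x) (by simp)
    have hx := (hBm x).1 (by simp)
    have o1 := hx.1.2 b hs.bR k hk h2 h1
    have xi : x ≠ i := by rintro rfl; exact hiR hx.1.1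
    have xb : x ≠ b := by rintro rfl; exact lt_irrefl _ h2
    have xk : x ≠ k := by rintro rfl; exact lt_irrefl _ h1
    have o2 := supp x (Or.inr hx.1.1) xi xb xk
    rw [← (F.compat x xi xb xk).1, (F.compat x xi xb xk).2,
      F.agree b k x F.ne_mk xk.symm xb.symm (by tauto), orient_swap] at o2
    linarith
  subst hA' hB'
  refine ⟨Or.inl (Or.inr ?_), Or.inl fun π => ?_⟩
  · refine ⟨i, k, ⟨hi, hib, hk, hkb, (F.ord0 _ _).2 (F.him.trans F.hmk), fun x hx => ?_⟩, k,
      (F.hull0_iff (Or.inl hkb)).2 ((hR k).2 (hB.hullR F.gB hsB)), hkb, Or.inl rfl, i, hi, b, hs.bL,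
      (F.ord0 _ _).2 F.him, (F.supports0 fun x hx h1 h2 h3 => ?_).2, F.col⟩
    · exact (F.supports0 (S := SL ∪ SR) (fun y hy h1 h2 h3 => by
        rw [(F.compat y h1 h2 h3).1]; exact supp y hy h1 h2 h3)).1 x hx
    · rw [(F.compat x h1 h2 h3).1]; exact supp x (Or.inl hx) h1 h2 h3
  · beta_reduce
    rw [funnelTri_eq_empty emp, hF.tri_eq F.gB hsB, Set.bot_eq_empty.symm, bot_symmDiff]
    have := hP.ncard_tri_le F.gB π _ le_rfl
    simp at this
    omega

/-- A vertex of the right chain passes through the line spanned by two vertices of the left chain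
that are not neighbours: this does not affect the triangulation. -/
lemma tri_eq_of_between (F : Flip PA PB i m k) {A B : List (Fin n)} (hA : PT PA A B b)
    (hi : i ∈ A) (hm : m ∈ A) (hk : k ∈ B) {l : Fin n} (hl : l ∈ A)
    (hil : (PA i).1 < (PA l).1) (hlm : (PA l).1 < (PA m).1) (π : Equiv.Perm (Fin n)) :
    tri PA π A B b = tri PB π A B b := by
  have li : l ≠ i := by rintro rfl; exact lt_irrefl _ hil
  have lm : l ≠ m := by rintro rfl; exact lt_irrefl _ hlm
  have lk : l ≠ k := hA.ne hl hk
  have notA : ∀ {x}, x ∈ A → x ≠ k := fun hx => hA.ne hx hk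
  have notB : ∀ {x}, x ∈ B → x ≠ i ∧ x ≠ m := fun hx => ⟨(hA.ne hi hx).symm, (hA.ne hm hx).symm⟩
  -- the vertex `l` lies above the line `im`, and hence above all three lines
  have o := hA.concA i (by simp [hi]) l (by simp [hl]) m (by simp [hm]) hil hlm
  rw [orient_swap] at o
  have oim : 0 < orient (PA i) (PA m) (PA l) := by linarith
  have oik : ¬ orient (PA i) (PA k) (PA l) < 0 := by
    rw [← (F.compat l li lm lk).1]; exact not_lt.2 oim.le
  have omk : ¬ orient (PA m) (PA k) (PA l) < 0 := by
    rw [← (F.compat l li lm lk).2]; exact not_lt.2 oim.le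
  have lik := F.him.trans F.hmk
  have uk : ∀ {P : Config n} {x y}, (P x).1 < (P k).1 → (Under P k x y ↔
      orient (P x) (P k) (P y) < 0) := by
    intro P x y h
    rw [under_iff_of_gt h, orient_swap_left]
    constructor <;> intro h <;> linarith
  have U1 : ¬ Under PA k i l := by rw [uk lik]; exact oik
  have U2 : ¬ Under PA k m l := by rw [uk F.hmk]; exact omk
  have U1B : ¬ Under PB k i l := by
    rwa [← F.under F.ne_ik.symm li.symm lk.symm (by tauto)]
  have U2B : ¬ Under PB k m l := by
    rwa [← F.under F.ne_mk.symm lm.symm lk.symm (by tauto)]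
  -- Only tests of `k` against `i` and `m` can flip, and any contiguous piece of the chain that
  -- contains both also contains `l`. The vertex `l` is above the line from `k` in both
  -- configurations, so neither `i` nor `m` is a point of tangency there. Individual tests may
  -- change, but no tangency does; `tri_subset_of_tan` needs no more.
  have main : ∀ q ∈ B.tail, ∀ A', A' <:+: A → ∀ v ∈ A', ∀ v' ∈ A', v' ≠ v →
      ¬ (q ≠ v ∧ v ≠ v' ∧ q ≠ v' ∧ ¬ ((q = i ∨ q = m ∨ q = k) ∧ (v = i ∨ v = m ∨ v = k) ∧
        (v' = i ∨ v' = m ∨ v' = k))) → q = k ∧ l ∈ A' ∧ (v = i ∨ v = m) := by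
    intro q hq A' hA' v hv v' hv' hne h
    have hq' := List.mem_of_mem_tail hq
    have nv := notA (hA'.subset hv)
    have nv' := notA (hA'.subset hv')
    have n1 := hA.ne (hA'.subset hv) hq'
    have n2 := hA.ne (hA'.subset hv') hq'
    have := notB hq'
    have hT : (q = i ∨ q = m ∨ q = k) ∧ (v = i ∨ v = m ∨ v = k) ∧
        (v' = i ∨ v' = m ∨ v' = k) := by
      by_contra hc; exact h ⟨n1.symm, Ne.symm hne, n2.symm, hc⟩
    have hl' : l ∈ A' := by
      rcases hT.2.1 with rfl | rfl | e
      · rcases hT.2.2 with e | rfl | e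
        · exact absurd e hne
        · exact hA.betweenA hA' hv hv' hl hil.le hlm.le
        · exact absurd e nv'
      · rcases hT.2.2 with rfl | e | e
        · exact hA.betweenA hA' hv' hv hl hil.le hlm.le
        · exact absurd e hne
        · exact absurd e nv'
      · exact absurd e nv
    tauto
  have side : ∀ q ∈ A.tail, ∀ v ∈ B, ∀ v' ∈ B, v ≠ v' → (Under PA q v v' ↔ Under PB q v v') := by
    intro q hq v hv v' hv' hne
    have hq' := List.mem_of_mem_tail hq
    refine F.under (hA.ne hq' hv) hne (hA.ne hq' hv') ?_
    rintro ⟨-, h2, h3⟩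
    have := notB hv
    have := notB hv'
    grind
  refine (tri_subset_of_tan ?_ ?_).antisymm (tri_subset_of_tan ?_ ?_)
  · intro q hq B' hB' v hv h v' hv' hne
    exact (side q hq v (hB'.subset hv) v' (hB'.subset hv') hne.symm).1 (h v' hv' hne)
  · intro q hq A' hA' v hv h v' hv' hne
    by_cases hc : q ≠ v ∧ v ≠ v' ∧ q ≠ v' ∧ ¬ ((q = i ∨ q = m ∨ q = k) ∧
        (v = i ∨ v = m ∨ v = k) ∧ (v' = i ∨ v' = m ∨ v' = k))
    · exact (F.under hc.1 hc.2.1 hc.2.2.1 hc.2.2.2).1 (h v' hv' hne)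
    · obtain ⟨rfl, hl', rfl | rfl⟩ := main q hq A' hA' v hv v' hv' hne hc
      · exact absurd (h l hl' li) U1
      · exact absurd (h l hl' lm) U2
  · intro q hq B' hB' v hv h v' hv' hne
    exact (side q hq v (hB'.subset hv) v' (hB'.subset hv') hne.symm).2 (h v' hv' hne)
  · intro q hq A' hA' v hv h v' hv' hne
    by_cases hc : q ≠ v ∧ v ≠ v' ∧ q ≠ v' ∧ ¬ ((q = i ∨ q = m ∨ q = k) ∧
        (v = i ∨ v = m ∨ v = k) ∧ (v' = i ∨ v' = m ∨ v' = k))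
    · exact (F.under hc.1 hc.2.1 hc.2.2.1 hc.2.2.2).2 (h v' hv' hne)
    · obtain ⟨rfl, hl', rfl | rfl⟩ := main q hq A' hA' v hv v' hv' hne hc
      · exact absurd (h l hl' li) U1B
      · exact absurd (h l hl' lm) U2B

/-- The case of two collinear points on the left side and one on the right side. -/
lemma dichotomy_mixed (F : FlipAt P0 PA PB i m k) (hs : Sides PA SL SR b)
    (hI : InnerSet PA SL SR b I) (hi : i ∈ SL) (hm : m ∈ SL) (hmb : m ≠ b) (hk : k ∈ SR)
    (hkb : k ≠ b) : Dichotomy P0 PA PB SL SR b I := by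
  have hsB := F.toFlip.sides hs
  have hib : i ≠ b := by
    rintro rfl
    have := F.him
    have := hs.ltL m hm F.ne_im.symm
    linarith
  have hkL : k ∉ SL := fun h => hs.ne h hk hkb rfl
  have hiR : i ∉ SR := fun h => hs.ne hi h hib rfl
  have hmR : m ∉ SR := fun h => hs.ne hm h hmb rfl
  have hL : ∀ j, Hull PA SL j ↔ Hull PB SL j := fun j =>
    F.toFlip.hull_iff (Or.inr (fun h => hkL h.2))
  have hR : ∀ j, Hull PA SR j ↔ Hull PB SR j := fun j =>
    F.toFlip.hull_iff (Or.inr (fun h => hiR h.1))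
  have hR0 : ∀ j, Hull P0 SR j ↔ Hull PA SR j := fun j =>
    F.hull0_iff (Or.inr (fun h => hiR h.1))
  have posB := F.posB
  have negA := F.negA
  have nA : ¬ Bridge PA SL SR b i k := by
    intro h
    have := h.2.2.2.2.2 m (Or.inl hm)
    rw [orient_swap] at negA
    linarith
  have nB : ¬ Bridge PB SL SR b m k := by
    intro h
    have := h.2.2.2.2.2 i (Or.inl hi)
    rw [orient_rot] at posB
    linarith
  have notT : ∀ {w u}, w ∈ SL → u ∈ SR → ¬ (w = i ∧ u = k) → ¬ (w = m ∧ u = k) →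
      (w = i ∨ w = m ∨ w = k) → (u = i ∨ u = m ∨ u = k) → False := by
    intro w u hw hu h1 h2 h3 h4
    have : u = k := by
      rcases h4 with rfl | rfl | rfl
      · exact absurd hu hiR
      · exact absurd hu hmR
      · rfl
    subst this
    rcases h3 with rfl | rfl | rfl
    · exact h1 ⟨rfl, rfl⟩
    · exact h2 ⟨rfl, rfl⟩
    · exact hkL hw
  -- If `m k` is the bridge before, then `i k` is the bridge after: the base moves past `m` and the
  -- funnel gains the triangle `i m k`. Otherwise the bridge, and hence the funnel, is unchanged.
  by_cases hmk : Bridge PA SL SR b m k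
  · right
    have suppk : ∀ x ∈ SL ∪ SR, x ≠ i → x ≠ m → x ≠ k → orient (PA i) (PA m) (PA x) < 0 := by
      intro x hx h1 h2 h3
      rw [(F.compat x h1 h2 h3).2]
      exact hmk.strict F.gA hx h2 h3
    have hik : Bridge PB SL SR b i k := by
      refine ⟨hi, hib, hk, hkb, (F.ord _ _).1 (F.him.trans F.hmk), fun x hx => ?_⟩
      by_cases h1 : x = i
      · subst h1; rw [orient_self_left]
      by_cases h3 : x = k
      · subst h3; rw [orient_self_right]
      by_cases h2 : x = m
      · subst h2; rw [orient_swap]; linarith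
      rw [← F.toFlip.le_iff F.ne_ik (by tauto)]
      exact ((F.compat x h1 h2 h3).1.1 (suppk x hx h1 h2 h3)).le
    obtain ⟨A, B, hF⟩ := hmk.exists_funnel F.gA hs
    obtain ⟨w', u', K, B', rfl, rfl, hb', hP, hA, hBm⟩ := hF.spec F.gA hs
    obtain ⟨rfl, rfl⟩ := hmk.unique F.gA hs hb'
    have hFB : Funnel PB SL SR b (i :: m :: K) (k :: B') := by
      refine ⟨i, k, hik, ?_, hP.sortB.imp (fun h => (F.ord _ _).1 h), ?_, ?_⟩
      · rw [List.cons_append, List.pairwise_cons]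
        refine ⟨fun x hx => (F.ord _ _).1 ?_, hP.sortA.imp (fun h => (F.ord _ _).1 h)⟩
        rcases ((hA x).1 hx).2 with rfl | h
        · exact F.him
        · exact F.him.trans h
      · intro j
        rw [List.cons_append, List.mem_cons, hA, ← hL, ← F.ord]
        constructor
        · rintro (rfl | ⟨h1, rfl | h2⟩)
          · exact ⟨(hL _).2 (hik.hullL F.gB hsB), Or.inl rfl⟩
          · exact ⟨h1, Or.inr F.him⟩
          · exact ⟨h1, Or.inr (F.him.trans h2)⟩
        · rintro ⟨h1, rfl | h2⟩
          · exact Or.inl rfl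
          · right
            refine ⟨h1, ?_⟩
            by_contra hc
            push Not at hc
            have h3 : (PA j).1 < (PA m).1 := lt_of_le_of_ne hc.2 (F.gA.inj j m hc.1)
            have o1 := h1.2 i hi m hm h2 h3
            have o2 := suppk j (Or.inl h1.1) (by rintro rfl; exact lt_irrefl _ h2) hc.1
              (by rintro rfl; exact hkL h1.1)
            rw [orient_swap] at o2
            linarith
      · intro j
        rw [hBm, hR, F.ord]
    refine ⟨Or.inl (Or.inr ?_), Or.inl fun π => ?_⟩
    · refine ⟨i, k, ⟨hi, hib, hk, hkb, (F.ord0 _ _).2 (F.him.trans F.hmk), ?_⟩, k,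
        (hR0 k).2 (hmk.hullR F.gA hs), hkb, Or.inl rfl, i, hi, m, hm, (F.ord0 _ _).2 F.him,
        (F.supports0 fun x hx => suppk x (Or.inl hx)).2, F.col⟩
      exact (F.supports0 suppk).1
    · beta_reduce
      rw [hF.tri_eq F.gA hs, hFB.tri_eq F.gB hsB,
        F.toFlip.tri_base π _ le_rfl hP (hFB.pt F.gB hsB)]
      have hsub : tri PA π (m :: K) (k :: B') b ∆
          (tri PA π (m :: K) (k :: B') b ∪ {s(i, k), s(i, m)}) ⊆ {s(i, k), s(i, m)} := by
        intro e he
        rw [Set.mem_symmDiff, Set.mem_union] at he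
        rcases he with ⟨h1, h2⟩ | ⟨h1 | h1, h2⟩
        · exact absurd (Or.inl h1) h2
        · exact absurd h1 h2
        · exact h1
      refine (Set.ncard_le_ncard hsub (Set.toFinite _)).trans ?_
      have := Set.ncard_insert_le s(i, k) ({s(i, m)} : Set (Sym2 (Fin n)))
      rw [Set.ncard_singleton] at this
      omega
  have nBi : ¬ Bridge PB SL SR b i k := by
    intro h
    refine hmk ⟨hm, hmb, hk, hkb, F.hmk, fun x hx => ?_⟩
    by_cases h2 : x = m
    · subst h2; rw [orient_self_left]
    by_cases h3 : x = k
    · subst h3; rw [orient_self_right]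
    by_cases h1 : x = i
    · subst h1; rw [← orient_rot]; exact negA.le
    have := h.strict F.gB hx h1 h3
    rw [← F.agree i k x F.ne_ik (Ne.symm h3) (Ne.symm h1) (by tauto), ← (F.compat x h1 h2 h3).1,
      (F.compat x h1 h2 h3).2] at this
    exact this.le
  have hbr : ∀ w u, Bridge PA SL SR b w u ↔ Bridge PB SL SR b w u := by
    intro w u
    by_cases c1 : w = i ∧ u = k
    · obtain ⟨rfl, rfl⟩ := c1; tauto
    by_cases c2 : w = m ∧ u = k
    · obtain ⟨rfl, rfl⟩ := c2; tauto
    constructor <;> intro h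
    · exact (F.toFlip.bridge_iff
        (fun x _ _ _ hx => notT h.1 h.2.2.1 c1 c2 hx.1 hx.2.1)).1 h
    · exact (F.toFlip.bridge_iff
        (fun x _ _ _ hx => notT h.1 h.2.2.1 c1 c2 hx.1 hx.2.1)).2 h
  have hFun := F.toFlip.funnel_iff hbr (fun _ _ _ j _ => hL j) hR
  by_cases hex : ∃ w u, Bridge PA SL SR b w u
  swap
  · left
    push Not at hex
    intro π
    rw [funnelTri_eq_empty hex, funnelTri_eq_empty (fun w u h => hex w u ((hbr w u).2 h))]
  obtain ⟨w, u, hwu⟩ := hex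
  obtain ⟨A, B, hF⟩ := hwu.exists_funnel F.gA hs
  obtain ⟨w', u', A', B', -, -, hb', hP, hA, hB⟩ := hF.spec F.gA hs
  obtain ⟨rfl, rfl⟩ := hwu.unique F.gA hs hb'
  have hFB := (hFun A B).1 hF
  have hPB := hFB.pt F.gB hsB
  have iB : i ∉ B := fun h => hiR ((hB i).1 (by simp [h])).1.1
  have mB : m ∉ B := fun h => hmR ((hB m).1 (by simp [h])).1.1
  have kA : k ∉ A := fun h => hkL ((hA k).1 (by simp [h])).1.1
  by_cases hall : i ∈ A ∧ m ∈ A ∧ k ∈ B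
  swap
  · left
    intro π
    rw [hF.tri_eq F.gA hs, hFB.tri_eq F.gB hsB]
    by_cases h1 : i ∈ A
    · by_cases h2 : m ∈ A
      · exact F.toFlip.tri_same_of_notMem hP (x := k) (by tauto) kA (by tauto) π
      · exact F.toFlip.tri_same_of_notMem hP (x := m) (by tauto) h2 mB π
    · exact F.toFlip.tri_same_of_notMem hP (x := i) (by tauto) h1 iB π
  obtain ⟨iA, mA, kB⟩ := hall
  by_cases hbt : ∃ l ∈ A, (PA i).1 < (PA l).1 ∧ (PA l).1 < (PA m).1
  · left
    obtain ⟨l, hl, h1, h2⟩ := hbt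
    intro π
    rw [hF.tri_eq F.gA hs, hFB.tri_eq F.gB hsB]
    exact tri_eq_of_between F.toFlip hP iA mA kB hl h1 h2 π
  right
  push Not at hbt
  obtain ⟨X, Y, hXY⟩ := sorted_adjacent (f := fun x => (PA x).1) hP.pairA iA mA F.him
    (fun x hx h => not_lt.2 (hbt x hx h))
  have iH := (hA i).1 (by simp [iA])
  have mH := (hA m).1 (by simp [mA])
  have kH := (hB k).1 (by simp [kB])
  -- A point above `i m` would give a hull vertex above that line. It could not lie left of `i` or
  -- right of `m`, as these are hull vertices, nor between them, as they are adjacent. So `i m` is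
  -- an edge of the hull.
  have supp : ∀ x ∈ SL, x ≠ i → x ≠ m → x ≠ k → orient (PA i) (PA m) (PA x) < 0 := by
    intro x hx h1 h2 h3
    by_contra hcon
    push Not at hcon
    have hpos : 0 < orient (PA i) (PA m) (PA x) :=
      lt_of_le_of_ne hcon (F.gA.ncol i m x F.ne_im (Ne.symm h2) (Ne.symm h1)).symm
    obtain ⟨y, hy, hle⟩ := exists_hull_above F.gA F.him hx
    have hyp : 0 < orient (PA i) (PA m) (PA y) := hpos.trans_le hle
    have yi : y ≠ i := by rintro rfl; rw [orient_self_left] at hyp; exact lt_irrefl _ hyp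
    have ym : y ≠ m := by rintro rfl; rw [orient_self_right] at hyp; exact lt_irrefl _ hyp
    rcases lt_or_gt_of_ne (F.gA.inj y i yi) with l1 | l1
    · have := iH.1.2 y hy.1 m hm l1 F.him
      rw [orient_rot] at this
      linarith
    · rcases lt_or_gt_of_ne (F.gA.inj y m ym) with l2 | l2
      · have hyA : y ∈ A ++ [b] := (hA y).2 ⟨hy, Or.inr (by
          rcases iH.2 with rfl | h
          · exact l1
          · exact h.trans l1)⟩
        have hyb : y ≠ b := by
          rintro rfl
          have := hP.ltA mA
          linarith
        have := hbt y (by simpa [hyb] using hyA) l1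
        linarith
      · have := mH.1.2 i hi y hy.1 F.him l2
        linarith
  refine ⟨Or.inl (Or.inr ?_), Or.inr ?_⟩
  · refine ⟨w, u, ?_, k, (hR0 k).2 kH.1, hkb, ?_, i, hi, m, hm, (F.ord0 _ _).2 F.him,
      (F.supports0 supp).2, F.col⟩
    · refine (F.bridge0_iff (fun x _ _ _ hx => notT hwu.1 hwu.2.2.1 ?_ ?_ hx.1 hx.2.1)).2 hwu
      · rintro ⟨rfl, rfl⟩; exact nA hwu
      · rintro ⟨rfl, rfl⟩; exact hmk hwu
    · rw [F.ord0]; exact kH.2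
  · refine ⟨PA, A, B, b, i, m, F.gA, hP, hI.left m hm hmb i hi F.him, fun π => ?_⟩
    beta_reduce
    rw [hF.tri_eq F.gA hs, hFB.tri_eq F.gB hsB]
    exact F.toFlip.ncard_flip_le π hP hXY (hI.tail F.gA hs hF) _ le_rfl hP hPB
      List.infix_rfl List.infix_rfl

/-- If one of the three points does not belong to the pseudo-triangle, then nothing happens. -/
lemma funnelTri_eq_of_notMem (F : Flip PA PB i m k) (hs : Sides PA SL SR b) {x : Fin n}
    (hx : x = i ∨ x = m ∨ x = k) (hxS : x ∉ SL ∪ SR) (π : Equiv.Perm (Fin n)) :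
    funnelTri PA SL SR b π = funnelTri PB SL SR b π := by
  have hull : ∀ S ⊆ SL ∪ SR, ∀ j, Hull PA S j ↔ Hull PB S j := by
    intro S hS j
    by_cases hc : j ≠ m ∨ ¬ (i ∈ S ∧ k ∈ S)
    · exact F.hull_iff hc
    · push Not at hc
      obtain ⟨rfl, h1, h2⟩ := hc
      have hm : j ∉ S := by
        rcases hx with rfl | rfl | rfl
        · exact absurd (hS h1) hxS
        · exact fun h => hxS (hS h)
        · exact absurd (hS h2) hxS
      constructor <;> intro h <;> exact absurd h.1 hm
  have hbr : ∀ w u, Bridge PA SL SR b w u ↔ Bridge PB SL SR b w u := by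
    intro w u
    by_cases hm : w ∈ SL ∧ u ∈ SR ∧ w ≠ u
    · refine F.bridge_iff (fun y hy h1 h2 hT => ?_)
      have n1 : w ≠ x := by rintro rfl; exact hxS (Or.inl hm.1)
      have n2 : u ≠ x := by rintro rfl; exact hxS (Or.inr hm.2.1)
      have n3 : y ≠ x := by rintro rfl; exact hxS hy
      have n4 := hm.2.2
      grind
    · constructor <;> intro h <;> refine absurd ⟨h.1, h.2.2.1, ?_⟩ hm <;>
      · rintro rfl; exact lt_irrefl _ h.2.2.2.2.1
  refine Flip.funnelTri_eq (F.funnel_iff hbr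
    (fun _ _ _ j _ => hull SL Set.subset_union_left j)
    (fun j => hull SR Set.subset_union_right j)) ?_ π
  intro A B hF π
  obtain ⟨w, u, A', B', -, -, hb', hP, hA, hB⟩ := hF.spec F.gA hs
  exact F.tri_same_of_notMem hP hx
    (fun h => hxS (Or.inl ((hA x).1 (by simp [h])).1.1))
    (fun h => hxS (Or.inr ((hB x).1 (by simp [h])).1.1)) π

/-- The passage of a point through a segment either leaves the triangulation unchanged, or is an
event whose cost is controlled by the number of late points. -/
theorem dichotomy (F : FlipAt P0 PA PB i m k) (hs : Sides PA SL SR b)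
    (hI : InnerSet PA SL SR b I) :
    (∀ π, funnelTri PA SL SR b π = funnelTri PB SL SR b π) ∨
      ((i ∈ SL ∪ SR ∧ m ∈ SL ∪ SR ∧ k ∈ SL ∪ SR) ∧ Ev P0 SL SR b ∧
        Cost I (fun π => (funnelTri PA SL SR b π ∆ funnelTri PB SL SR b π).ncard)) := by
  by_cases hi : i ∈ SL ∪ SR
  swap
  · exact Or.inl (funnelTri_eq_of_notMem F.toFlip hs (Or.inl rfl) hi)
  by_cases hm : m ∈ SL ∪ SR
  swap
  · exact Or.inl (funnelTri_eq_of_notMem F.toFlip hs (Or.inr (Or.inl rfl)) hm)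
  by_cases hk : k ∈ SL ∪ SR
  swap
  · exact Or.inl (funnelTri_eq_of_notMem F.toFlip hs (Or.inr (Or.inr rfl)) hk)
  suffices h : Dichotomy P0 PA PB SL SR b I from
    Or.imp_right (fun h => ⟨⟨hi, hm, hk⟩, h⟩) h
  have him := F.him
  have hmk := F.hmk
  -- Membership in a side follows the x-order, so three points in order can only be all on one side,
  -- have the apex in the middle, or be split two to one; reflection halves the cases.
  have left : ∀ {x y}, x ∈ SL ∪ SR → y ∈ SL → (PA x).1 < (PA y).1 → x ∈ SL := by
    intro x y hx hy hlt
    rcases hx with hx | hx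
    · exact hx
    · by_cases hxb : x = b
      · rw [hxb]; exact hs.bL
      · have := hs.lt hy hx hxb; linarith
  have right : ∀ {x y}, y ∈ SL ∪ SR → x ∈ SR → (PA x).1 < (PA y).1 → y ∈ SR := by
    intro x y hy hx hlt
    rcases hy with hy | hy
    · by_cases hxb : x = b
      · subst hxb
        by_cases hyb : y = x
        · rw [hyb]; exact hs.bR
        · have := hs.ltL y hy hyb; linarith
      · have := hs.lt hy hx hxb; linarith
    · exact hy
  rcases hk with hk | hk
  · have hm' := left hm hk hmk
    exact F.dichotomy_left hs hI (left hi hm' him) hm' hk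
  by_cases hkb : k = b
  · subst hkb
    have hm' := left hm hs.bL hmk
    exact F.dichotomy_left hs hI (left hi hm' him) hm' hs.bL
  by_cases hmb : m = b
  · subst hmb
    exact F.dichotomy_apex hs (left hi hs.bL him) hk
  rcases hm with hm | hm
  · exact F.dichotomy_mixed hs hI (left hi hm him) hm hmb hk hkb
  rcases hi with hi | hi
  · by_cases hib : i = b
    · subst hib
      exact Dichotomy.of_mirror (F.mirror.dichotomy_left hs.mirror hI.mirror hk hm hs.bR)
    · exact Dichotomy.of_mirror (F.mirror.dichotomy_mixed hs.mirror hI.mirror hk hm hmb hi hib)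
  · exact Dichotomy.of_mirror (F.mirror.dichotomy_left hs.mirror hI.mirror hk hm hi)

end FlipAt

end KineticTriangulation

/-! ### Visibility within a pseudo-triangle is tangency. -/

namespace KineticTriangulation

variable {n : ℕ}

/-- The vertices `q` and `v` see each other within the sub-pseudo-triangle. -/
def Sees (P : Config n) (A B : List (Fin n)) (z q v : Fin n) : Prop :=
  ∀ i j, BdEdge A B z i j → ∀ x ∈ segment ℝ (P q) (P v), x ∈ segment ℝ (P i) (P j) →
    x = P q ∨ x = P v

lemma orient_combo {a b : ℝ} (hab : a + b = 1) (o w u v : ℝ × ℝ) :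
    orient o w (a • u + b • v) = a * orient o w u + b * orient o w v := by
  obtain rfl : b = 1 - a := by linarith
  simp only [orient, Prod.fst_add, Prod.snd_add, Prod.smul_fst, Prod.smul_snd, smul_eq_mul]
  ring

/-- Orientation is affine along a segment: a segment from strictly below a line to a point on or
below it can meet the line only at the latter end. -/
lemma eq_of_orient_eq_zero {o w u v x : ℝ × ℝ} (hx : x ∈ segment ℝ u v)
    (h0 : orient o w x = 0) (hu : orient o w u < 0) (hv : orient o w v ≤ 0) : x = v := by
  obtain ⟨a, b, ha, hb, hab, rfl⟩ := hx
  rw [orient_combo hab] at h0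
  obtain rfl : a = 0 := by
    by_contra hne
    have : 0 < a := lt_of_le_of_ne ha (Ne.symm hne)
    nlinarith [mul_nonneg hb (neg_nonneg.2 hv)]
  obtain rfl : b = 1 := by linarith
  simp

lemma orient_of_mem_segment {u v x : ℝ × ℝ} (hx : x ∈ segment ℝ u v) : orient u v x = 0 := by
  obtain ⟨a, b, ha, hb, hab, rfl⟩ := hx
  rw [orient_combo hab, orient_self_left, orient_self_right]; ring

lemma exists_crossing {o w u v : ℝ × ℝ} (hu : orient o w u < 0) (hv : 0 < orient o w v) :
    ∃ x ∈ segment ℝ u v, orient o w x = 0 := by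
  have hd : 0 < orient o w v - orient o w u := by linarith
  have hab : orient o w v / (orient o w v - orient o w u) +
      -orient o w u / (orient o w v - orient o w u) = 1 := by field_simp; ring
  refine ⟨_, ⟨_, _, ?_, ?_, hab, rfl⟩, ?_⟩
  · positivity
  · exact div_nonneg (by linarith) hd.le
  · rw [orient_combo hab]; field_simp; ring

lemma mem_segment_of_orient {u v x : ℝ × ℝ} (h0 : orient u v x = 0) (h1 : u.1 < x.1)
    (h2 : x.1 < v.1) : x ∈ segment ℝ u v := by
  have hd : 0 < v.1 - u.1 := by linarith
  have hab : (v.1 - x.1) / (v.1 - u.1) + (x.1 - u.1) / (v.1 - u.1) = 1 := by field_simp; ring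
  refine ⟨_, _, div_nonneg (by linarith) hd.le, div_nonneg (by linarith) hd.le, hab, ?_⟩
  unfold orient at h0
  ext
  · simp; field_simp; ring
  · simp; field_simp; linarith

lemma fst_le_of_mem_segment {u v x : ℝ × ℝ} (hx : x ∈ segment ℝ u v) {c : ℝ} (hu : u.1 ≤ c)
    (hv : v.1 ≤ c) : x.1 ≤ c := by
  obtain ⟨a, b, ha, hb, hab, rfl⟩ := hx
  simp only [Prod.fst_add, Prod.smul_fst, smul_eq_mul]
  obtain rfl : b = 1 - a := by linarith
  nlinarith

lemma le_fst_of_mem_segment {u v x : ℝ × ℝ} (hx : x ∈ segment ℝ u v) {c : ℝ} (hu : c ≤ u.1)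
    (hv : c ≤ v.1) : c ≤ x.1 := by
  obtain ⟨a, b, ha, hb, hab, rfl⟩ := hx
  simp only [Prod.fst_add, Prod.smul_fst, smul_eq_mul]
  obtain rfl : b = 1 - a := by linarith
  nlinarith

lemma eq_left_of_mem_segment {u v x : ℝ × ℝ} (hx : x ∈ segment ℝ u v) (h : u.1 < v.1)
    (hxu : x.1 ≤ u.1) : x = u := by
  obtain ⟨a, b, ha, hb, hab, rfl⟩ := hx
  simp only [Prod.fst_add, Prod.smul_fst, smul_eq_mul] at hxu
  obtain rfl : a = 1 - b := by linarith
  obtain rfl : b = 0 := by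
    by_contra hne
    have : 0 < b := lt_of_le_of_ne hb (Ne.symm hne)
    nlinarith
  simp

/-- A list on which a function changes sign contains neighbours with different signs. -/
lemma exists_sign_change {α : Type*} {f : α → ℝ} : ∀ {L : List α} {x y : α},
    (∀ w ∈ x :: L ++ [y], f w ≠ 0) → 0 < f x → f y < 0 →
    ∃ i j, [i, j] <:+: x :: L ++ [y] ∧ 0 < f i ∧ f j < 0
  | [], x, y, _, hx, hy => ⟨x, y, List.infix_rfl, hx, hy⟩
  | w :: L, x, y, h, hx, hy => by
    rcases lt_or_gt_of_ne (h w (by simp)) with hw | hw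
    · exact ⟨x, w, ⟨[], L ++ [y], by simp⟩, hx, hw⟩
    · obtain ⟨i, j, hij, h1, h2⟩ := exists_sign_change (L := L) (x := w) (y := y)
        (fun v hv => h v (by simp at hv ⊢; tauto)) hw hy
      refine ⟨i, j, hij.trans ⟨[x], [], by simp⟩, h1, h2⟩

namespace PT

variable {P : Config n} {A B : List (Fin n)} {z q v : Fin n}

lemma edge_lt (h : PT P A B z) {i j : Fin n} (hij : [i, j] <:+: A ++ [z]) :
    i ∈ A ++ [z] ∧ j ∈ A ++ [z] ∧ (P i).1 < (P j).1 ∧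
      ∀ x ∈ A ++ [z], (P x).1 ≤ (P i).1 ∨ (P j).1 ≤ (P x).1 := by
  obtain ⟨X, Y, hXY⟩ := hij
  have hs := h.sortA
  rw [← hXY] at hs ⊢
  refine ⟨by simp, by simp, ?_, ?_⟩
  · rw [List.pairwise_append, List.pairwise_append, List.pairwise_cons] at hs
    exact hs.1.2.1.1 j (by simp)
  · have e : X ++ [i, j] ++ Y = X ++ i :: j :: Y := by simp
    rw [e, List.pairwise_append, List.pairwise_cons, List.pairwise_cons] at hs
    intro x hx
    rw [e] at hx
    simp only [List.mem_append, List.mem_cons] at hx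
    rcases hx with hx | rfl | rfl | hx
    · exact Or.inl (hs.2.2 x hx i (by simp)).le
    · exact Or.inl le_rfl
    · exact Or.inr le_rfl
    · exact Or.inr (hs.2.1.2.1 x hx).le

/-- The vertices of the left chain beyond `q` lie below the tangent from `q`. -/
lemma under_tan_left (h : PT P A B z) (hq : q ∈ A.tail) (hv : v ∈ B)
    (tan : ∀ v' ∈ B, v' ≠ v → Under P q v v') {y : Fin n} (hy : y ∈ A ++ [z])
    (hqy : (P q).1 < (P y).1) : orient (P q) (P v) (P y) < 0 := by
  have hqA := List.mem_of_mem_tail hq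
  have hqv := h.lt hqA hv
  obtain ⟨a, c, ha, hc, haA, hcB, hamin, -⟩ := h.exists_head
  have hqa : q ≠ a := by
    obtain ⟨a', A', rfl⟩ := List.exists_cons_of_ne_nil h.neA
    obtain rfl : a' = a := by simpa using ha
    rintro rfl
    exact (List.nodup_cons.1 h.nodupA).1 (by simpa using hq)
  have haq := (hamin q hqA).resolve_left hqa
  have hqc := h.lt hqA hcB
  have hbase := h.base a c ha hc q (by simp [hqA]) hqa (h.ne hqA hcB)
  rw [orient_neg_left (haq.trans hqc) haq] at hbase
  rw [orient_neg_left hqv hqy]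
  have s := h.slA (List.mem_append_left _ haA) (List.mem_append_left _ hqA) hy haq hqy
  have hle : sl P q c ≤ sl P q v := by
    by_cases hcv : c = v
    · rw [hcv]
    · exact ((under_left hqv hqc).1 (tan c hcB hcv)).le
  rcases sl_tri haq hqc with t | t | t <;> linarith

/-- Edges of the left chain before `q` are to the left of the segment, and those after `q` are below
the tangent. Edges of the right chain are below the tangent except where they touch it at `v`, and
the segment is below the base. -/
lemma sees_of_tan (h : PT P A B z) (g : Generic P) (hq : q ∈ A.tail) (hv : v ∈ B)
    (tan : ∀ v' ∈ B, v' ≠ v → Under P q v v') : Sees P A B z q v := by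
  have hqA := List.mem_of_mem_tail hq
  have hqv := h.lt hqA hv
  have neg : ∀ y ∈ B ++ [z], y ≠ v → orient (P q) (P v) (P y) < 0 := by
    intro y hy hyv
    rw [← under_iff_of_lt hqv]
    rcases List.mem_append.1 hy with hy | hy
    · exact tan y hy hyv
    · obtain rfl : y = z := by simpa using hy
      exact h.apex_under hqA hv
  intro i j hij x hx hx'
  have hx0 := orient_of_mem_segment hx
  rcases hij with hij | hij | ⟨hi, hj⟩
  · left
    obtain ⟨iA, jA, hlt, hno⟩ := h.edge_lt hij
    rcases hno q (by simp [hqA]) with hle | hle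
    · have hj := h.under_tan_left hq hv tan jA (hle.trans_lt hlt)
      rcases eq_or_ne i q with rfl | hne
      · rw [segment_symm] at hx'
        exact eq_of_orient_eq_zero hx' hx0 hj (by rw [orient_self_left])
      · have hiq := g.inj q i hne.symm
        have hi := h.under_tan_left hq hv tan iA (lt_of_le_of_ne hle hiq)
        have := eq_of_orient_eq_zero hx' hx0 hi hj.le
        rw [this] at hx0
        linarith
    · refine eq_left_of_mem_segment hx hqv ?_
      exact fst_le_of_mem_segment hx' (hlt.le.trans hle) hle
  · right
    have hjm : j ∈ B ++ [z] := hij.subset (by simp)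
    have him : i ∈ B ++ [z] := hij.subset (by simp)
    have hne : i ≠ j := by
      rintro rfl
      obtain ⟨X, Y, e⟩ := hij
      have hs := h.sortB
      rw [← e, List.pairwise_append, List.pairwise_append, List.pairwise_cons] at hs
      exact lt_irrefl _ (hs.1.2.1.1 i (by simp))
    by_cases hiv : i = v
    · subst hiv
      rw [segment_symm] at hx'
      exact eq_of_orient_eq_zero hx' hx0 (neg j hjm hne.symm) (by rw [orient_self_right])
    · by_cases hjv : j = v
      · subst hjv
        exact eq_of_orient_eq_zero hx' hx0 (neg i him hiv) (by rw [orient_self_right])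
      · have := eq_of_orient_eq_zero hx' hx0 (neg i him hiv) (neg j hjm hjv).le
        rw [this] at hx0
        have := neg j hjm hjv
        linarith
  · right
    have hx0' := orient_of_mem_segment hx'
    have hqi : q ≠ i := by
      obtain ⟨a', A', rfl⟩ := List.exists_cons_of_ne_nil h.neA
      obtain rfl : a' = i := by simpa using hi
      rintro rfl
      exact (List.nodup_cons.1 h.nodupA).1 (by simpa using hq)
    have hjB : j ∈ B := List.mem_of_mem_head? hj
    have hiA : i ∈ A := List.mem_of_mem_head? hi
    refine eq_of_orient_eq_zero hx hx0' (h.base i j hi hj q (by simp [hqA]) hqi (h.ne hqA hjB)) ?_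
    by_cases hvj : v = j
    · rw [hvj, orient_self_right]
    · exact (h.base i j hi hj v (by simp [hv]) (h.ne hiA hv).symm hvj).le

/-- The vertices beyond the point of tangency are not visible. -/
lemma not_sees (h : PT P A B z) (g : Generic P) (hq : q ∈ A) (hv : v ∈ B) {v' : Fin n}
    (hv' : v' ∈ B) (hlt : (P v).1 < (P v').1) (hu : Under P q v v') : ¬ Sees P A B z q v' := by
  intro hsee
  have hqv := h.lt hq hv
  have hqv' := h.lt hq hv'
  obtain ⟨B₁, B₂, rfl⟩ := List.append_of_mem hv
  have hle : ∀ w ∈ v :: B₂ ++ [z], (P w).1 ≤ (P v).1 := by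
    intro w hw
    have hs := h.sortB
    rw [List.append_assoc, List.pairwise_append, List.cons_append, List.pairwise_cons] at hs
    rw [List.cons_append] at hw
    rcases List.mem_cons.1 hw with rfl | hw
    · exact le_rfl
    · exact (hs.2.1.1 w hw).le
  have hge : ∀ w ∈ v :: B₂ ++ [z], (P q).1 < (P w).1 := by
    intro w hw
    rcases List.mem_append.1 hw with hw | hw
    · exact h.lt hq (List.mem_append_right _ hw)
    · obtain rfl : w = z := by simpa using hw
      exact h.ltA hq
  have hpos : 0 < orient (P q) (P v') (P v) := by
    rw [under_iff_of_lt hqv, orient_swap] at hu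
    linarith
  have hneg : orient (P q) (P v') (P z) < 0 :=
    (under_iff_of_lt hqv').1 (h.apex_under hq hv')
  -- `v` is above the line `q v'` and the apex is below it, so some edge of the right chain between
  -- them crosses it. The crossing point has its x-coordinate between `q` and `v'` and thus blocks
  -- the segment.
  obtain ⟨j, i, hij, h1, h2⟩ := exists_sign_change
    (f := fun w => orient (P q) (P v') (P w)) (L := B₂) (x := v) (y := z) (by
      intro w hw
      refine g.ncol q v' w (h.ne hq hv') ?_ ?_
      · rintro rfl; have := hle _ hw; linarith
      · rintro rfl; exact lt_irrefl _ (hge _ hw)) hpos hneg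
  have hjm : j ∈ v :: B₂ ++ [z] := hij.subset (by simp)
  have him : i ∈ v :: B₂ ++ [z] := hij.subset (by simp)
  obtain ⟨x, hx, hx0⟩ := exists_crossing h2 h1
  have hx1 : (P q).1 < x.1 :=
    (lt_min (hge _ him) (hge _ hjm)).trans_le
      (le_fst_of_mem_segment hx (min_le_left _ _) (min_le_right _ _))
  have hx2 : x.1 < (P v').1 := (fst_le_of_mem_segment hx (hle _ him) (hle _ hjm)).trans_lt hlt
  have hinf : [j, i] <:+: B₁ ++ v :: B₂ ++ [z] := hij.trans ⟨B₁, [], by simp⟩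
  rcases hsee i j (Or.inr (Or.inl hinf)) x (mem_segment_of_orient hx0 hx1 hx2) hx with rfl | rfl
  · exact lt_irrefl _ hx1
  · exact lt_irrefl _ hx2

lemma sees_mirror (h : Sees P A B z q v) : Sees (KineticTriangulation.mirror P) B A z q v := by
  intro i j hij x hx hx'
  have key : ∀ {u w : Fin n} {x : ℝ × ℝ},
      x ∈ segment ℝ (KineticTriangulation.mirror P u) (KineticTriangulation.mirror P w) →
      (-x.1, x.2) ∈ segment ℝ (P u) (P w) := by
    rintro u w x ⟨a, b, ha, hb, hab, rfl⟩
    refine ⟨a, b, ha, hb, hab, ?_⟩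
    ext <;> simp; ring
  have h' := h j i (bdEdge_swap.1 hij) _ (key hx) (by rw [segment_symm]; exact key hx')
  refine h'.imp ?_ ?_ <;>
  · intro e
    ext
    · have := congrArg Prod.fst e; simp at this ⊢; linarith
    · have := congrArg Prod.snd e; simpa using this

/-- The farthest visible vertex is the point of tangency. -/
lemma farthest_iff (h : PT P A B z) (g : Generic P) (hq : q ∈ A.tail) {B₁ B₂ : List (Fin n)}
    (hB : B = B₁ ++ v :: B₂) :
    (Sees P A B z q v ∧ ∀ v' ∈ B₁, ¬ Sees P A B z q v') ↔ ∀ v' ∈ B, v' ≠ v → Under P q v v' := by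
  have hqA := List.mem_of_mem_tail hq
  have hv : v ∈ B := by rw [hB]; simp
  have hlt : ∀ x ∈ B₁, (P v).1 < (P x).1 := by
    have := h.pairB
    rw [hB, List.pairwise_append] at this
    exact fun x hx => this.2.2 x hx v (by simp)
  have hgt : ∀ x ∈ B₂, (P x).1 < (P v).1 := by
    have := h.pairB
    rw [hB, List.pairwise_append, List.pairwise_cons] at this
    exact fun x hx => this.2.1.1 x hx
  constructor
  · rintro ⟨h1, h2⟩
    obtain ⟨v₀, hv₀, htan⟩ := h.exists_tan g hqA
    have hsee := h.sees_of_tan g hq hv₀ htan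
    -- Suppose that the point of tangency `v₀` differs from `v`. If it is farther from the apex, it
    -- is a forbidden visible vertex; if it is nearer, it hides `v`.
    by_cases he : v₀ = v
    · rwa [he] at htan
    exfalso
    rw [hB] at hv₀
    simp only [List.mem_append, List.mem_cons] at hv₀
    rcases hv₀ with h' | h' | h'
    · exact h2 v₀ h' hsee
    · exact he h'
    · exact h.not_sees g hqA (by rw [hB]; simp [h']) hv (hgt v₀ h') (htan v hv (Ne.symm he)) h1
  · intro htan
    refine ⟨h.sees_of_tan g hq hv htan, fun v' hv' => ?_⟩
    have hv'B : v' ∈ B := by rw [hB]; simp [hv']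
    have := hlt v' hv'
    exact h.not_sees g hqA hv hv'B this (htan v' hv'B (by rintro rfl; exact lt_irrefl _ this))

end PT

end KineticTriangulation

/-! ### The triangulation at a generic time equals the recursion on lists. -/

namespace KineticTriangulation

variable {n : ℕ}

/-- The configuration at time `t`. -/
def cfg (p : Motion n) (t : ℝ) : Config n := fun i => p i t

/-- The chains of a sub-pseudo-triangle, listed from left to right. -/
def chains (A B : List (Fin n)) (z : Fin n) : Chains n := ⟨A ++ [z], z :: B.reverse⟩

lemma isEdge_chains {A B : List (Fin n)} {z i j : Fin n} (hA : A ≠ []) (hB : B ≠ []) :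
    (chains A B z).IsEdge i j ↔ BdEdge A B z i j := by
  obtain ⟨a, A', rfl⟩ := List.exists_cons_of_ne_nil hA
  obtain ⟨c, B', rfl⟩ := List.exists_cons_of_ne_nil hB
  unfold Chains.IsEdge BdEdge chains
  have e : ([i, j] <:+: z :: (c :: B').reverse) ↔ [j, i] <:+: c :: B' ++ [z] := by
    rw [← List.reverse_infix]; simp
  rw [e]
  have e' : (z :: (c :: B').reverse).getLast? = some c := by
    rw [List.reverse_cons, ← List.cons_append, List.getLast?_concat]
  rw [e']
  simp

lemma nonCorner_chains {A B : List (Fin n)} {z q : Fin n} (hA : A ≠ []) (hB : B ≠ []) :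
    (chains A B z).NonCorner q ↔ q ∈ A.tail ++ B.tail := by
  obtain ⟨a, A', rfl⟩ := List.exists_cons_of_ne_nil hA
  obtain ⟨c, B', rfl⟩ := List.exists_cons_of_ne_nil hB
  unfold Chains.NonCorner chains
  simp

lemma visible_chains {p : Motion n} {t : ℝ} {A B : List (Fin n)} {z q v : Fin n} (hA : A ≠ [])
    (hB : B ≠ []) :
    (chains A B z).Visible p t q v ↔ Sees (cfg p t) A B z q v := by
  unfold Chains.Visible Chains.boundary Sees
  constructor
  · intro h i j hij x hx hx'
    exact h ⟨hx, i, j, (isEdge_chains hA hB).2 hij, hx'⟩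
  · rintro h x ⟨hx, i, j, hij, hx'⟩
    exact h i j ((isEdge_chains hA hB).1 hij) x hx hx'

variable {p : Motion n} {t : ℝ} {π : Equiv.Perm (Fin n)} {A B : List (Fin n)} {z : Fin n}

namespace PT

lemma pick_of_left (h : PT (cfg p t) A B z) (g : Generic (cfg p t)) {L₁ L₂ R₁ R₂ : List (Fin n)}
    {q v : Fin n} (e : (⟨L₁ ++ q :: L₂, R₁ ++ v :: R₂⟩ : Chains n) = chains A B z)
    (hL₁ : L₁ ≠ []) (hL₂ : L₂ ≠ []) (hR₁ : R₁ ≠ [])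
    (hf : (chains A B z).IsFirst π q) (hv : (chains A B z).Visible p t q v)
    (hnv : ∀ v' ∈ R₂, ¬ (chains A B z).Visible p t q v') :
    ∃ A₂ B₂, Pick (cfg p t) π A B L₁ q A₂ R₂.reverse v B₂ ∧ L₂ = A₂ ++ [z] ∧
      R₁ = z :: B₂.reverse := by
  obtain ⟨e1, e2⟩ : L₁ ++ q :: L₂ = A ++ [z] ∧ R₁ ++ v :: R₂ = z :: B.reverse := by
    simpa [chains] using e
  obtain ⟨A₂, y, rfl⟩ := (List.eq_nil_or_concat L₂).resolve_left hL₂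
  rw [List.concat_eq_append] at e1 ⊢
  rw [show L₁ ++ q :: (A₂ ++ [y]) = (L₁ ++ q :: A₂) ++ [y] by simp] at e1
  obtain ⟨rfl, e1'⟩ := List.append_inj' e1 rfl
  obtain rfl : y = z := by simpa using e1'
  obtain ⟨r, R₁', rfl⟩ := List.exists_cons_of_ne_nil hR₁
  simp only [List.cons_append, List.cons.injEq] at e2
  obtain ⟨rfl, e2⟩ := e2
  have hB : B = R₂.reverse ++ v :: R₁'.reverse := by
    have := congrArg List.reverse e2
    rw [List.reverse_reverse] at this
    rw [← this]; simp
  have hq : q ∈ (L₁ ++ q :: A₂).tail := by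
    obtain ⟨a, A', rfl⟩ := List.exists_cons_of_ne_nil hL₁
    simp
  refine ⟨A₂, R₁'.reverse, ⟨rfl, hB, hL₁, ?_, ?_⟩, rfl, by simp⟩
  · intro y hy
    exact hf.2 y ((nonCorner_chains h.neA h.neB).2 hy)
  · refine (h.farthest_iff g hq hB).1 ⟨(visible_chains h.neA h.neB).1 hv, ?_⟩
    intro v' hv' hs
    exact hnv v' (by simpa using hv') ((visible_chains h.neA h.neB).2 hs)

lemma pick_of_right (h : PT (cfg p t) A B z) (g : Generic (cfg p t)) {L₁ L₂ R₁ R₂ : List (Fin n)}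
    {q v : Fin n} (e : (⟨L₁ ++ v :: L₂, R₁ ++ q :: R₂⟩ : Chains n) = chains A B z)
    (hR₁ : R₁ ≠ []) (hR₂ : R₂ ≠ []) (hL₂ : L₂ ≠ [])
    (hf : (chains A B z).IsFirst π q) (hv : (chains A B z).Visible p t q v)
    (hnv : ∀ v' ∈ L₁, ¬ (chains A B z).Visible p t q v') :
    ∃ A₂ B₂, Pick (cfg p t) π B A R₂.reverse q B₂ L₁ v A₂ ∧ L₂ = A₂ ++ [z] ∧
      R₁ = z :: B₂.reverse := by
  obtain ⟨e1, e2⟩ : L₁ ++ v :: L₂ = A ++ [z] ∧ R₁ ++ q :: R₂ = z :: B.reverse := by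
    simpa [chains] using e
  obtain ⟨A₂, y, rfl⟩ := (List.eq_nil_or_concat L₂).resolve_left hL₂
  rw [List.concat_eq_append] at e1 ⊢
  rw [show L₁ ++ v :: (A₂ ++ [y]) = (L₁ ++ v :: A₂) ++ [y] by simp] at e1
  obtain ⟨rfl, e1'⟩ := List.append_inj' e1 rfl
  obtain rfl : y = z := by simpa using e1'
  obtain ⟨r, R₁', rfl⟩ := List.exists_cons_of_ne_nil hR₁
  simp only [List.cons_append, List.cons.injEq] at e2
  obtain ⟨rfl, e2⟩ := e2
  have hB : B = R₂.reverse ++ q :: R₁'.reverse := by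
    have := congrArg List.reverse e2
    rw [List.reverse_reverse] at this
    rw [← this]; simp
  have hne : R₂.reverse ≠ [] := by simpa using hR₂
  have hq : q ∈ B.tail := by
    obtain ⟨a, A', h'⟩ := List.exists_cons_of_ne_nil hne
    rw [hB, h']; simp
  refine ⟨A₂, R₁'.reverse, ⟨hB, rfl, hne, ?_, ?_⟩, rfl, by simp⟩
  · intro y hy
    refine hf.2 y ((nonCorner_chains h.neA h.neB).2 ?_)
    simp at hy ⊢; tauto
  · intro v' hv' hvne
    rw [← under_mirror]
    refine (h.mirror.farthest_iff g.mirror hq rfl).1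
      ⟨sees_mirror ((visible_chains h.neA h.neB).1 hv), ?_⟩ v' hv' hvne
    intro w hw hs
    refine hnv w hw ((visible_chains h.neA h.neB).2 ?_)
    simpa using sees_mirror hs

end PT

/-- `SubChains` descends from the funnel whereas `InTri` is built up from the parts, so the
induction carries the inclusion of the edges of the current piece in those of the whole. -/
lemma subChains_spec {A₀ B₀ : List (Fin n)} {z₀ : Fin n} (g : Generic (cfg p t))
    (h₀ : PT (cfg p t) A₀ B₀ z₀) {σ : Chains n} (h : SubChains p π t (chains A₀ B₀ z₀) σ) :
    ∃ A B z, σ = chains A B z ∧ PT (cfg p t) A B z ∧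
      ∀ e, InTri (cfg p t) π A B z e → InTri (cfg p t) π A₀ B₀ z₀ e := by
  induction h with
  | self => exact ⟨A₀, B₀, z₀, rfl, h₀, fun _ h => h⟩
  | leftUpper _ hL₁ hL₂ hR₁ hf hv hnv ih =>
    obtain ⟨A, B, z, e, hP, hsub⟩ := ih
    rw [e] at hf hv hnv
    obtain ⟨A₂, B₂, hp, rfl, rfl⟩ := hP.pick_of_left g e hL₁ hL₂ hR₁ hf hv hnv
    exact ⟨_, _, _, by simp [chains], hP.up hp, fun e he => hsub e (.leftUp hp he)⟩
  | leftLower _ hL₁ hL₂ hR₁ hf hv hnv ih =>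
    obtain ⟨A, B, z, e, hP, hsub⟩ := ih
    rw [e] at hf hv hnv
    obtain ⟨A₂, B₂, hp, rfl, rfl⟩ := hP.pick_of_left g e hL₁ hL₂ hR₁ hf hv hnv
    exact ⟨_, _, _, by simp [chains], hP.low hp, fun e he => hsub e (.leftLow hp he)⟩
  | rightUpper _ hR₁ hR₂ hL₂ hf hv hnv ih =>
    obtain ⟨A, B, z, e, hP, hsub⟩ := ih
    rw [e] at hf hv hnv
    obtain ⟨A₂, B₂, hp, rfl, rfl⟩ := hP.pick_of_right g e hR₁ hR₂ hL₂ hf hv hnv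
    exact ⟨_, _, _, by simp [chains], hP.rightUp hp, fun e he => hsub e (.rightUp hp he)⟩
  | rightLower _ hR₁ hR₂ hL₂ hf hv hnv ih =>
    obtain ⟨A, B, z, e, hP, hsub⟩ := ih
    rw [e] at hf hv hnv
    obtain ⟨A₂, B₂, hp, rfl, rfl⟩ := hP.pick_of_right g e hR₁ hR₂ hL₂ hf hv hnv
    exact ⟨_, _, _, by simp [chains], hP.rightLow hp, fun e he => hsub e (.rightLow hp he)⟩

lemma Pick.chains_eq {P : Config n} {A₁ A₂ B₁ B₂ : List (Fin n)} {q v : Fin n}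
    (hp : Pick P π A B A₁ q A₂ B₁ v B₂) :
    chains A B z = ⟨A₁ ++ q :: (A₂ ++ [z]), (z :: B₂.reverse) ++ v :: B₁.reverse⟩ := by
  rw [hp.hA, hp.hB]; simp [chains]

lemma Pick.chains_eq_right {P : Config n} {A₁ A₂ B₁ B₂ : List (Fin n)} {q v : Fin n}
    (hp : Pick P π B A B₁ q B₂ A₁ v A₂) :
    chains A B z = ⟨A₁ ++ v :: (A₂ ++ [z]), (z :: B₂.reverse) ++ q :: B₁.reverse⟩ := by
  rw [hp.hA, hp.hB]; simp [chains]

lemma Pick.isFirst {P : Config n} {A₁ A₂ B₁ B₂ : List (Fin n)} {q v : Fin n}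
    (h : PT P A B z) (hp : Pick P π A B A₁ q A₂ B₁ v B₂) : (chains A B z).IsFirst π q :=
  ⟨(nonCorner_chains h.neA h.neB).2 (List.mem_append_left _ hp.mem_tail),
    fun q' hq' => hp.first q' ((nonCorner_chains h.neA h.neB).1 hq')⟩

lemma Pick.isFirst_right {P : Config n} {A₁ A₂ B₁ B₂ : List (Fin n)} {q v : Fin n}
    (h : PT P A B z) (hp : Pick P π B A B₁ q B₂ A₁ v A₂) : (chains A B z).IsFirst π q :=
  ⟨(nonCorner_chains h.neA h.neB).2 (List.mem_append_right _ hp.mem_tail),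
    fun q' hq' => hp.first q' (by
      have := (nonCorner_chains h.neA h.neB).1 hq'
      simp at this ⊢; tauto)⟩

lemma Pick.visible (g : Generic (cfg p t)) {A₁ A₂ B₁ B₂ : List (Fin n)} {q v : Fin n}
    (h : PT (cfg p t) A B z) (hp : Pick (cfg p t) π A B A₁ q A₂ B₁ v B₂) :
    (chains A B z).Visible p t q v ∧ ∀ v' ∈ B₁.reverse, ¬ (chains A B z).Visible p t q v' := by
  have := (h.farthest_iff g hp.mem_tail hp.hB).2 hp.tan
  refine ⟨(visible_chains h.neA h.neB).2 this.1, fun v' hv' hs => ?_⟩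
  exact this.2 v' (by simpa using hv') ((visible_chains h.neA h.neB).1 hs)

lemma Pick.visible_right (g : Generic (cfg p t)) {A₁ A₂ B₁ B₂ : List (Fin n)} {q v : Fin n}
    (h : PT (cfg p t) A B z) (hp : Pick (cfg p t) π B A B₁ q B₂ A₁ v A₂) :
    (chains A B z).Visible p t q v ∧ ∀ v' ∈ A₁, ¬ (chains A B z).Visible p t q v' := by
  have := (h.mirror.farthest_iff g.mirror hp.mem_tail hp.hB).2 (pick_mirror hp).tan
  refine ⟨(visible_chains h.neA h.neB).2 (by simpa using PT.sees_mirror this.1),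
    fun v' hv' hs => ?_⟩
  exact this.2 v' hv' (PT.sees_mirror ((visible_chains h.neA h.neB).1 hs))

lemma exists_subChains (g : Generic (cfg p t)) {e : Sym2 (Fin n)}
    (h : InTri (cfg p t) π A B z e) (hP : PT (cfg p t) A B z) {σ₀ : Chains n}
    (hσ : SubChains p π t σ₀ (chains A B z)) :
    ∃ σ i j, SubChains p π t σ₀ σ ∧ σ.IsEdge i j ∧ e = s(i, j) := by
  induction h with
  | edge h => exact ⟨_, _, _, hσ, (isEdge_chains hP.neA hP.neB).2 h, rfl⟩
  | leftUp hp _ ih =>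
    refine ih (hP.up hp) ?_
    have h1 := hp.isFirst hP
    have h2 := hp.visible g hP
    rw [hp.chains_eq] at hσ h1 h2
    have := SubChains.leftUpper hσ hp.ne (by simp) (by simp) h1 h2.1 h2.2
    simpa [chains] using this
  | leftLow hp _ ih =>
    refine ih (hP.low hp) ?_
    have h1 := hp.isFirst hP
    have h2 := hp.visible g hP
    rw [hp.chains_eq] at hσ h1 h2
    have := SubChains.leftLower hσ hp.ne (by simp) (by simp) h1 h2.1 h2.2
    simpa [chains] using this
  | rightUp hp _ ih =>
    refine ih (hP.rightUp hp) ?_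
    have h1 := hp.isFirst_right hP
    have h2 := hp.visible_right g hP
    rw [hp.chains_eq_right] at hσ h1 h2
    have := SubChains.rightUpper hσ (by simp) (by simpa using hp.ne) (by simp) h1 h2.1 h2.2
    simpa [chains] using this
  | rightLow hp _ ih =>
    refine ih (hP.rightLow hp) ?_
    have h1 := hp.isFirst_right hP
    have h2 := hp.visible_right g hP
    rw [hp.chains_eq_right] at hσ h1 h2
    have := SubChains.rightLower hσ (by simp) (by simpa using hp.ne) (by simp) h1 h2.1 h2.2
    simpa [chains] using this

lemma pair_mem_degeneracies {i j : Fin n} (hij : i ≠ j) (e : (p i t).1 = (p j t).1) :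
    ({i, j} : Finset (Fin n)) ∈ degeneracies p t := by
  left
  refine ⟨Finset.card_pair hij, ?_⟩
  intro x hx y hy
  simp only [Finset.mem_insert, Finset.mem_singleton] at hx hy
  rcases hx with rfl | rfl <;> rcases hy with rfl | rfl <;> simp [e]

lemma triple_mem_degeneracies {i j k : Fin n} (h1 : i ≠ j) (h2 : j ≠ k) (h3 : i ≠ k)
    (e : turn p t i j k = 0) : ({i, j, k} : Finset (Fin n)) ∈ degeneracies p t := by
  right
  refine ⟨Finset.card_eq_three.2 ⟨i, j, k, h1, h3, h2, rfl⟩, ?_⟩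
  unfold turn orient at *
  intro x hx y hy w hw
  simp only [Finset.mem_insert, Finset.mem_singleton] at hx hy hw
  rcases hx with rfl | rfl | rfl <;> rcases hy with rfl | rfl | rfl <;>
    rcases hw with rfl | rfl | rfl <;> linarith

lemma generic_of_mem (h : t ∈ genericTimes p) : Generic (cfg p t) where
  inj i j hij e := by
    have := pair_mem_degeneracies hij e
    rw [show degeneracies p t = ∅ from h] at this
    exact this
  ncol i j k h1 h2 h3 e := by
    have := triple_mem_degeneracies h1 h2 h3 e
    rw [show degeneracies p t = ∅ from h] at this
    exact this

/-- At times at which no two points have the same `x`-coordinate, the left-to-right order is the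
order of the `x`-coordinates. -/
lemma lt_iff {p : Motion n} {t : ℝ} (h : ∀ i j, i ≠ j → (cfg p t i).1 ≠ (cfg p t j).1)
    {i j : Fin n} : Lt p t i j ↔ (cfg p t i).1 < (cfg p t j).1 := by
  unfold Lt Before cfg
  constructor
  · rintro (h' | ⟨h1, h2⟩)
    · exact h'
    · by_cases hij : i = j
      · subst hij; exact absurd h2 (lt_irrefl _)
      · exact absurd h1 (h i j hij)
  · exact Or.inl

section Translation

variable {τ : PseudoTriangle n}

lemma sides_of_between (h : ∀ i j, i ≠ j → (cfg p t i).1 ≠ (cfg p t j).1)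
    (hb : τ.apex ∈ Between p t τ.left τ.right) :
    Sides (cfg p t) (leftPart p τ t) (rightPart p τ t) τ.apex where
  bL := ⟨Or.inr hb.1, Or.inl rfl⟩
  bR := ⟨Or.inl rfl, Or.inr hb.2⟩
  ltL _ hx hxb := (lt_iff h).1 (hx.2.resolve_left hxb)
  ltR _ hx hxb := (lt_iff h).1 (hx.1.resolve_left hxb)

lemma isHullVertex_iff (h : ∀ i j, i ≠ j → (cfg p t i).1 ≠ (cfg p t j).1) {S : Set (Fin n)}
    {j : Fin n} : IsHullVertex p t S j ↔ Hull (cfg p t) S j := by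
  unfold IsHullVertex Hull
  simp only [lt_iff h]
  rfl

lemma isBridge_iff (h : ∀ i j, i ≠ j → (cfg p t i).1 ≠ (cfg p t j).1) {w u : Fin n} :
    IsBridge p τ t w u ↔
      Bridge (cfg p t) (leftPart p τ t) (rightPart p τ t) τ.apex w u := by
  unfold IsBridge Supports Bridge
  rw [lt_iff h]
  rfl

/-- The apex is the last vertex of the left list and the first of the right one; removing it and
reversing the right list gives chains from the base to the apex. -/
lemma isFunnel_iff (h : ∀ i j, i ≠ j → (cfg p t i).1 ≠ (cfg p t j).1)
    (hb : τ.apex ∈ Between p t τ.left τ.right) {σ : Chains n} :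
    IsFunnel p τ t σ ↔ ∃ A B, σ = chains A B τ.apex ∧
      Funnel (cfg p t) (leftPart p τ t) (rightPart p τ t) τ.apex A B := by
  have hs := sides_of_between h hb
  have hlt : ∀ i j, Lt p t i j ↔ (cfg p t i).1 < (cfg p t j).1 := fun i j => lt_iff h
  have hltf : Lt p t = fun i j => (cfg p t i).1 < (cfg p t j).1 := by
    funext i j; exact propext (hlt i j)
  have hullL : Hull (cfg p t) (leftPart p τ t) τ.apex := by
    refine ⟨hs.bL, fun _ _ k hk _ h2 => ?_⟩
    have := hs.ltL k hk (by rintro rfl; exact lt_irrefl _ h2)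
    linarith
  have hullR : Hull (cfg p t) (rightPart p τ t) τ.apex := by
    refine ⟨hs.bR, fun i hi _ _ h1 _ => ?_⟩
    have := hs.ltR i hi (by rintro rfl; exact lt_irrefl _ h1)
    linarith
  constructor
  · rintro ⟨w, u, hwu, h1, h2, h3, h4⟩
    rw [isBridge_iff h] at hwu
    simp only [isHullVertex_iff h, hltf] at h1 h2 h3 h4
    obtain ⟨L, R⟩ := σ
    dsimp only at h1 h2 h3 h4
    have bL : τ.apex ∈ L := (h3 _).2 ⟨hullL, Or.inr (hs.ltL w hwu.1 hwu.2.1)⟩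
    have bR : τ.apex ∈ R := (h4 _).2 ⟨hullR, Or.inr (hs.ltR u hwu.2.2.1 hwu.2.2.2.1)⟩
    obtain ⟨A, A', rfl⟩ := List.append_of_mem bL
    obtain ⟨B', B, rfl⟩ := List.append_of_mem bR
    have hA' : A' = [] := by
      rcases A' with _ | ⟨x, A'⟩
      · rfl
      exfalso
      rw [List.pairwise_append, List.pairwise_cons] at h1
      have l1 := h1.2.1.1 x (by simp)
      have l2 := hs.ltL x ((h3 x).1 (by simp)).1.1 (by rintro rfl; exact lt_irrefl _ l1)
      linarith
    have hB' : B' = [] := by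
      rcases B' with _ | ⟨x, B'⟩
      · rfl
      exfalso
      rw [List.pairwise_append] at h2
      have l1 := h2.2.2 x (by simp) τ.apex (by simp)
      have l2 := hs.ltR x ((h4 x).1 (by simp)).1.1 (by rintro rfl; exact lt_irrefl _ l1)
      linarith
    subst hA' hB'
    refine ⟨A, B.reverse, by simp [chains], w, u, hwu, h1, ?_, h3, ?_⟩
    · rw [← List.pairwise_reverse]
      simpa using h2
    · intro j
      rw [← h4]; simp [or_comm]
  · rintro ⟨A, B, rfl, w, u, hwu, h1, h2, h3, h4⟩
    refine ⟨w, u, (isBridge_iff h).2 hwu, ?_, ?_, ?_, ?_⟩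
    · rw [hltf]; exact h1
    · rw [hltf, ← List.pairwise_reverse]
      simpa [chains] using h2
    · simp only [isHullVertex_iff h, hlt]; exact h3
    · intro j
      simp only [isHullVertex_iff h, hlt]
      rw [← h4]; simp [chains, or_comm]

theorem triEdges_eq (ht : t ∈ genericTimes p) (hb : τ.apex ∈ Between p t τ.left τ.right)
    (π : Equiv.Perm (Fin n)) :
    triEdges p τ π t =
      funnelTri (cfg p t) (leftPart p τ t) (rightPart p τ t) τ.apex π := by
  have g := generic_of_mem ht
  have hs := sides_of_between g.inj hb
  ext e
  constructor
  · rintro ⟨σ₀, σ, i, j, hF, hσ, hij, rfl⟩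
    obtain ⟨A₀, B₀, rfl, hF'⟩ := (isFunnel_iff g.inj hb).1 hF
    obtain ⟨A, B, z, rfl, hP, hsub⟩ := subChains_spec g (hF'.pt g hs) hσ
    exact ⟨A₀, B₀, hF', hsub _ (.edge ((isEdge_chains hP.neA hP.neB).1 hij))⟩
  · rintro ⟨A, B, hF, he⟩
    obtain ⟨σ, i, j, hσ, hij, rfl⟩ := exists_subChains g he (hF.pt g hs) .self
    exact ⟨_, σ, i, j, (isFunnel_iff g.inj hb).2 ⟨A, B, rfl, hF⟩, hσ, hij, rfl⟩

/-- It suffices here that x-coordinates are distinct: the statement is applied at the moment of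
collinearity, which is not generic. -/
lemma event_of_ev (h : ∀ i j, i ≠ j → (cfg p t i).1 ≠ (cfg p t j).1)
    (hev : Ev (cfg p t) (leftPart p τ t) (rightPart p τ t) τ.apex) :
    EnvelopeEvent p τ t ∨ VisibilityEvent p τ t := by
  have hlt : ∀ i j, Lt p t i j ↔ (cfg p t i).1 < (cfg p t j).1 := fun i j => lt_iff h
  have hturn : ∀ i j k, turn p t i j k = orient (cfg p t i) (cfg p t j) (cfg p t k) :=
    fun _ _ _ => rfl
  rcases hev with (hev | hev) | (hev | hev)
  · left
    obtain ⟨w, u, hb, i, hi, j, hj, k, hk, h1, h2, h3, h4, h5⟩ := hev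
    refine ⟨w, u, (isBridge_iff h).2 hb, Or.inl ⟨i, hi, j, hj, k, hk, ?_⟩⟩
    simp only [Supports, hlt, hturn]
    exact ⟨h1, h2, h3, h4, h2.trans h3, h5⟩
  · right
    obtain ⟨w, u, hb, q, hq, hqb, hqu, i, hi, j, hj, h1, h2, h3⟩ := hev
    refine ⟨w, u, (isBridge_iff h).2 hb, Or.inl ⟨q, (isHullVertex_iff h).2 hq, hqb, ?_,
      i, hi, j, hj, ?_⟩⟩
    · simpa only [hlt] using hqu
    · simp only [Supports, hlt, hturn]
      exact ⟨⟨h1, h2⟩, h3⟩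
  · left
    obtain ⟨w, u, hb, i, hi, j, hj, k, hk, h1, h2, h3, h4, h5⟩ := hev
    refine ⟨u, w, (isBridge_iff h).2 (by simpa using hb.mirror),
      Or.inr ⟨k, hk, j, hj, i, hi, ?_⟩⟩
    simp only [Supports, hlt, hturn]
    simp only [mirror_fst, neg_lt_neg_iff] at h1 h2 h3
    refine ⟨h1, h3, h2, ?_, h3.trans h2, fun x hx => ?_⟩
    · rw [orient_mirror, ← orient_rev] at h4; exact h4
    · rw [← orient_mirror_swap]; exact h5 x hx
  · right
    obtain ⟨w, u, hb, q, hq, hqb, hqu, i, hi, j, hj, h1, h2, h3⟩ := hev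
    refine ⟨u, w, (isBridge_iff h).2 (by simpa using hb.mirror),
      Or.inr ⟨q, (isHullVertex_iff h).2 (hull_mirror.1 hq), hqb, ?_, j, hj, i, hi, ?_⟩⟩
    · simpa only [hlt, mirror_fst, neg_lt_neg_iff] using hqu
    · simp only [Supports, hlt, hturn]
      simp only [mirror_fst, neg_lt_neg_iff] at h1
      refine ⟨⟨h1, fun x hx => ?_⟩, ?_⟩
      · rw [← orient_mirror_swap]; exact h2 x hx
      · rw [← orient_mirror_swap]; exact h3

end Translation

end KineticTriangulation

/-! ### Exchanging priorities of inner points, and backwards analysis. -/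

namespace KineticTriangulation

variable {n : ℕ}

section Appears

variable {p : Motion n} {t : ℝ} {π π' : Equiv.Perm (Fin n)} {b : Fin n}

lemma before_trans : ∀ {x y z : APoint n}, Before p t x y → Before p t y z → Before p t x z
  | .negInf, .negInf, _, h, _ => h.elim
  | .negInf, .pt _, .negInf, _, h => h.elim
  | .negInf, .pt _, .pt _, _, _ => trivial
  | .negInf, .pt _, .posInf, _, _ => trivial
  | _, .posInf, _, _, h => h.elim
  | .pt _, .negInf, _, h, _ => h.elim
  | .pt _, .pt _, .negInf, _, h => h.elim
  | .pt _, .pt _, .posInf, _, _ => trivial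
  | .pt i, .pt j, .pt k, h1, h2 => by
    simp only [Before] at *
    rcases h1 with h1 | ⟨h1, h1'⟩ <;> rcases h2 with h2 | ⟨h2, h2'⟩
    · exact Or.inl (h1.trans h2)
    · exact Or.inl (h1.trans_eq h2)
    · exact Or.inl (h1.trans_lt h2)
    · exact Or.inr ⟨h1.trans h2, h1'.trans h2'⟩
  | .posInf, _, _, h, _ => h.elim

/-- The presence of a pseudo-triangle depends only on the priorities up to that of its apex. -/
lemma inPT_congr (h1 : ∀ i, π i ≤ π b → π' i = π i) (h2 : ∀ i, π b < π i → π b < π' i)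
    {a c : APoint n} (h : InPT p π t a b c) : InPT p π' t a b c := by
  have mid : ∀ {a c : APoint n} {m : Fin n}, IsMid p π t a c m → b ∈ Between p t a c →
      IsMid p π' t a c m := by
    intro a c m hm hb
    have hmb := hm.2 b hb
    refine ⟨hm.1, fun i hi => ?_⟩
    rw [h1 m hmb]
    rcases le_or_gt (π i) (π b) with h | h
    · rw [h1 i h]; exact hm.2 i hi
    · exact hmb.trans (h2 i h).le
  have vis : ∀ {a c : APoint n}, Visits p π t a c → b ∈ Between p t a c → Visits p π' t a c := by
    intro a c hv
    induction hv with
    | root => exact fun _ => .root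
    | left _ hm ih =>
      intro hb
      have hb' : b ∈ Between p t _ _ := ⟨hb.1, before_trans hb.2 hm.1.2⟩
      exact .left (ih hb') (mid hm hb')
    | right _ hm ih =>
      intro hb
      have hb' : b ∈ Between p t _ _ := ⟨before_trans hm.1.1 hb.1, hb.2⟩
      exact .right (ih hb') (mid hm hb')
  exact ⟨vis h.1 h.2.1, mid h.2 h.2.1⟩

lemma inPT_swap {x y : Fin n} (hx : π b < π x) (hy : π b < π y) {a c : APoint n}
    (h : InPT p π t a b c) : InPT p (π * Equiv.swap x y) t a b c := by
  refine inPT_congr (fun i hi => ?_) (fun i hi => ?_) h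
  · rw [Equiv.Perm.mul_apply, Equiv.swap_apply_of_ne_of_ne]
    · rintro rfl; exact absurd hx (not_lt.2 hi)
    · rintro rfl; exact absurd hy (not_lt.2 hi)
  · rw [Equiv.Perm.mul_apply]
    rcases eq_or_ne i x with rfl | h1
    · rwa [Equiv.swap_apply_left]
    · rcases eq_or_ne i y with rfl | h2
      · rwa [Equiv.swap_apply_right]
      · rwa [Equiv.swap_apply_of_ne_of_ne h1 h2]

lemma Appears.apex_lt {τ : PseudoTriangle n} (h : Appears p τ π) {x : Fin n}
    (hx : x ∈ innerPoints p τ) : π τ.apex < π x := by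
  obtain ⟨hne, t, ht, hb⟩ := hx
  exact lt_of_le_of_ne ((h.1.2 t ht).2.2 x hb) (fun e => hne (π.injective e).symm)

/-- All inner points come after the apex, and presence depends only on the priorities up to that of
the apex. -/
lemma Appears.swap {τ : PseudoTriangle n} (h : Appears p τ π) {x y : Fin n}
    (hx : x ∈ innerPoints p τ) (hy : y ∈ innerPoints p τ) :
    Appears p τ (π * Equiv.swap x y) := by
  have hx' := h.apex_lt hx
  have hy' := h.apex_lt hy
  have hb : Equiv.swap x y τ.apex = τ.apex :=
    Equiv.swap_apply_of_ne_of_ne hx.1.symm hy.1.symm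
  refine ⟨⟨h.1.1, fun t ht => inPT_swap hx' hy' (h.1.2 t ht)⟩, fun J hJ hle => h.2 ⟨hJ.1, ?_⟩ hle⟩
  intro t ht
  -- For maximality the exchange is undone: a longer life span for the new priorities would be one
  -- for the old ones.
  have := inPT_swap (x := x) (y := y) (by simpa [hb] using hy') (by simpa [hb] using hx') (hJ.2 t ht)
  simpa [mul_assoc] using this

end Appears

section Counting

variable {𝒜 : Finset (Equiv.Perm (Fin n))} {J : Finset (Fin n)}

/-- The points of `J` up to `y` in the order of the priorities. -/
def initial (J : Finset (Fin n)) (π : Equiv.Perm (Fin n)) (y : Fin n) : Finset (Fin n) :=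
  J.filter (fun x => π x ≤ π y)

/-- Exchanging the last point of an initial segment with another of its points keeps the segment as
a set and makes the other point its last one. -/
lemma initial_swap {π : Equiv.Perm (Fin n)} {y z : Fin n} (hy : y ∈ J) (hz : z ∈ initial J π y) :
    initial J (π * Equiv.swap y z) z = initial J π y := by
  simp only [initial, Finset.mem_filter] at hz
  ext x
  simp only [initial, Finset.mem_filter, Equiv.Perm.mul_apply, Equiv.swap_apply_right]
  refine and_congr_right fun _ => ?_
  rcases eq_or_ne x y with rfl | h1
  · simp [hz.2]
  · rcases eq_or_ne x z with rfl | h2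
    · simp [hz.2]
    · rw [Equiv.swap_apply_of_ne_of_ne h1 h2]

lemma eq_of_card_initial {π : Equiv.Perm (Fin n)} {y z : Fin n} (hy : y ∈ J) (hz : z ∈ J)
    (h : (initial J π y).card = (initial J π z).card) : y = z := by
  have key : ∀ {y z : Fin n}, z ∈ J → (initial J π y).card = (initial J π z).card →
      ¬ π y < π z := by
    intro y z hz h hlt
    have hsub : initial J π y ⊆ initial J π z := by
      intro x hx
      simp only [initial, Finset.mem_filter] at hx ⊢
      exact ⟨hx.1, hx.2.trans hlt.le⟩
    have hzz : z ∈ initial J π y := by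
      rw [Finset.eq_of_subset_of_card_le hsub h.ge]
      simp [initial, hz]
    simp only [initial, Finset.mem_filter] at hzz
    exact absurd hlt (not_lt.2 hzz.2)
  have h1 := key hz h
  have h2 := key hy h.symm
  exact π.injective (le_antisymm (not_lt.1 h2) (not_lt.1 h1))

-- In an initial segment of size `s` every point is equally likely to be last, and only one is
-- selected. The proof is a double count without probabilities.
open Classical in
lemma mul_card_rank_le {S : Set (Fin n) → Fin n → Prop}
    (hS : ∀ G y y', S G y → S G y' → y = y')
    (hcl : ∀ π ∈ 𝒜, ∀ x ∈ J, ∀ y ∈ J, π * Equiv.swap x y ∈ 𝒜) (s : ℕ) :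
    s * ((𝒜 ×ˢ J).filter (fun a => S (initial J a.1 a.2) a.2 ∧
      (initial J a.1 a.2).card = s)).card ≤ 𝒜.card := by
  set T := (𝒜 ×ˢ J).filter (fun a => S (initial J a.1 a.2) a.2 ∧ (initial J a.1 a.2).card = s)
    with hT
  have hmem : ∀ a ∈ T, a.1 ∈ 𝒜 ∧ a.2 ∈ J ∧ S (initial J a.1 a.2) a.2 ∧
      (initial J a.1 a.2).card = s := by
    intro a ha
    rw [hT, Finset.mem_filter, Finset.mem_product] at ha
    exact ⟨ha.1.1, ha.1.2, ha.2⟩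
  have hcard : (T.sigma (fun a => initial J a.1 a.2)).card = s * T.card := by
    rw [Finset.card_sigma, Finset.sum_congr rfl (fun a ha => (hmem a ha).2.2.2), Finset.sum_const,
      smul_eq_mul, mul_comm]
  rw [← hcard]
  -- A permutation, its selected point `y` of rank `s` and a point `z` of the segment are sent to
  -- the permutation in which `y` and `z` are exchanged.
  refine Finset.card_le_card_of_injOn (fun a => a.1.1 * Equiv.swap a.1.2 a.2) ?_ ?_
  · rintro ⟨a, z⟩ ha
    rw [Finset.mem_coe, Finset.mem_sigma] at ha
    obtain ⟨h1, h2, -⟩ := hmem a ha.1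
    exact hcl _ h1 _ h2 _ (Finset.mem_filter.1 ha.2).1
  · rintro ⟨⟨π₁, y₁⟩, z₁⟩ h1 ⟨⟨π₂, y₂⟩, z₂⟩ h2 he
    rw [Finset.mem_coe, Finset.mem_sigma] at h1 h2
    dsimp only at h1 h2 he
    obtain ⟨-, a1, a2, a3⟩ := hmem _ h1.1
    obtain ⟨-, b1, b2, b3⟩ := hmem _ h2.1
    dsimp only at a1 a2 a3 b1 b2 b3
    have e1 := initial_swap a1 h1.2
    have e2 := initial_swap b1 h2.2
    rw [← he] at e2
    -- The image determines `z` as its point of rank `s`, then the initial segment, then `y` as the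
    -- point selected from it, and finally the permutation.
    obtain rfl : z₁ = z₂ := eq_of_card_initial (Finset.mem_filter.1 h1.2).1
      (Finset.mem_filter.1 h2.2).1 (by rw [e1, e2, a3, b3])
    rw [e1] at e2
    rw [← e2] at b2
    obtain rfl := hS _ _ _ a2 b2
    obtain rfl := mul_right_cancel he
    rfl

open Classical in
/-- The expected number of points that a rule selects from the initial segments of a random order
is at most the harmonic number. -/
lemma card_selected_le {S : Set (Fin n) → Fin n → Prop}
    (hS : ∀ G y y', S G y → S G y' → y = y')
    (hcl : ∀ π ∈ 𝒜, ∀ x ∈ J, ∀ y ∈ J, π * Equiv.swap x y ∈ 𝒜) :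
    (((𝒜 ×ˢ J).filter (fun a => S (initial J a.1 a.2) a.2)).card : ℝ) ≤
      𝒜.card * (harmonic J.card : ℝ) := by
  set T := (𝒜 ×ˢ J).filter (fun a => S (initial J a.1 a.2) a.2) with hT
  have hfib : T.card = ∑ s ∈ Finset.Icc 1 J.card,
      (T.filter (fun a => (initial J a.1 a.2).card = s)).card := by
    refine Finset.card_eq_sum_card_fiberwise ?_
    intro a ha
    rw [Finset.mem_coe, hT, Finset.mem_filter, Finset.mem_product] at ha
    rw [Finset.mem_coe, Finset.mem_Icc]
    refine ⟨Finset.card_pos.2 ⟨a.2, by simp [initial, ha.1.2]⟩, Finset.card_filter_le _ _⟩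
  have hharm : (harmonic J.card : ℝ) = ∑ s ∈ Finset.Icc 1 J.card, ((s : ℝ))⁻¹ := by
    rw [harmonic_eq_sum_Icc]; push_cast; rfl
  rw [hfib, hharm, Finset.mul_sum]
  push_cast
  refine Finset.sum_le_sum fun s hs => ?_
  have hs1 := (Finset.mem_Icc.1 hs).1
  have := mul_card_rank_le hS hcl s
  rw [hT, Finset.filter_filter]
  rw [← div_eq_mul_inv, le_div_iff₀ (by exact_mod_cast hs1), mul_comm]
  exact_mod_cast this

-- The condition uses the points earlier than `m` together with `y`. If `m` and `y` exchange their
-- priorities, this set becomes the initial segment of `y`, so the previous bound applies.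
open Classical in
lemma sum_card_late_le {S : Set (Fin n) → Fin n → Prop}
    (hS : ∀ G y y', S G y → S G y' → y = y')
    (hcl : ∀ π ∈ 𝒜, ∀ x ∈ J, ∀ y ∈ J, π * Equiv.swap x y ∈ 𝒜) {m : Fin n} (hm : m ∈ J) :
    ∑ π ∈ 𝒜, (((J.filter (fun y => π m < π y ∧
      S (insert y {x | x ∈ J ∧ π x < π m}) y)).card : ℕ) : ℝ) ≤
      𝒜.card * (harmonic J.card : ℝ) := by
  refine le_trans ?_ (card_selected_le hS hcl)
  rw [← Nat.cast_sum, ← Finset.card_sigma]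
  refine Nat.cast_le.2 ?_
  -- Since `y` is kept as second component, the exchange can be undone and the map is injective.
  refine Finset.card_le_card_of_injOn (fun a => (a.1 * Equiv.swap m a.2, a.2)) ?_ ?_
  · rintro ⟨π, y⟩ ha
    rw [Finset.mem_coe, Finset.mem_sigma, Finset.mem_filter] at ha
    obtain ⟨h1, h2, h3, h4⟩ := ha
    dsimp only at h1 h2 h3 h4
    rw [Finset.mem_coe, Finset.mem_filter, Finset.mem_product]
    refine ⟨⟨hcl _ h1 _ hm _ h2, h2⟩, ?_⟩
    dsimp only
    convert h4 using 1
    ext x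
    simp only [initial, Finset.coe_filter, Set.mem_ofPred_eq, Set.mem_insert_iff,
      Equiv.Perm.mul_apply, Equiv.swap_apply_right]
    rcases eq_or_ne x y with rfl | hxy
    · simp [h2]
    · rcases eq_or_ne x m with rfl | hxm
      · simp [hxy, h3]
      · rw [Equiv.swap_apply_of_ne_of_ne hxm hxy]
        have : π x ≠ π m := fun e => hxm (π.injective e)
        simp only [hxy, false_or]
        exact and_congr_right fun _ => ⟨fun h => lt_of_le_of_ne h this, le_of_lt⟩
  · rintro ⟨π₁, y₁⟩ _ ⟨π₂, y₂⟩ _ he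
    simp only [Prod.mk.injEq] at he
    obtain ⟨he, rfl⟩ := he
    obtain rfl := mul_right_cancel he
    rfl

open Classical in
lemma sum_ncard_late_le {P : Config n} (g : Generic P) {A₀ B₀ : List (Fin n)} {z i m : Fin n}
    (h : PT P A₀ B₀ z) (hcl : ∀ π ∈ 𝒜, ∀ x ∈ J, ∀ y ∈ J, π * Equiv.swap x y ∈ 𝒜) (hm : m ∈ J) :
    ∑ π ∈ 𝒜, ((Late P A₀ B₀ i m J π).ncard : ℝ) ≤ 5 * (𝒜.card * (harmonic J.card : ℝ)) := by
  have key : ∀ π, ((Late P A₀ B₀ i m J π).ncard : ℝ) ≤ ∑ c : Fin 5,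
      (((J.filter (fun y => π m < π y ∧
        Sel P A₀ B₀ i m c (insert y {x | x ∈ J ∧ π x < π m}) y)).card : ℕ) : ℝ) := by
    intro π
    rw [← Nat.cast_sum]
    refine Nat.cast_le.2 ?_
    refine le_trans ?_ Finset.card_biUnion_le
    rw [← Set.ncard_coe_finset]
    refine Set.ncard_le_ncard ?_ (Set.toFinite _)
    rintro y ⟨h1, h2, c, hc⟩
    rw [Finset.mem_coe, Finset.mem_biUnion]
    exact ⟨c, Finset.mem_univ _, Finset.mem_filter.2 ⟨by simpa using h1, h2, by simpa using hc⟩⟩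
  refine (Finset.sum_le_sum fun π _ => key π).trans ?_
  rw [Finset.sum_comm]
  have bound : ∀ c : Fin 5, _ := fun c =>
    sum_card_late_le (S := Sel P A₀ B₀ i m c) (fun _ _ _ h1 h2 => sel_unique g h h1 h2) hcl hm
  refine (Finset.sum_le_sum fun c _ => bound c).trans ?_
  rw [Finset.sum_const, Finset.card_univ, Fintype.card_fin, nsmul_eq_mul]
  norm_num

/-- Five rules, each selecting at most a harmonic number of points on average, at six edges per late
point, give the factor 30. -/
lemma Cost.sum_le {I : Set (Fin n)} {f : Equiv.Perm (Fin n) → ℕ} (hf : Cost I f)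
    (hcl : ∀ π ∈ 𝒜, ∀ x ∈ I, ∀ y ∈ I, π * Equiv.swap x y ∈ 𝒜) :
    ∑ π ∈ 𝒜, (f π : ℝ) ≤ 𝒜.card * (11 + 30 * (harmonic I.ncard : ℝ)) := by
  classical
  have hpos : (0 : ℝ) ≤ harmonic I.ncard := by
    unfold harmonic
    push_cast
    exact Finset.sum_nonneg fun i _ => by positivity
  rcases hf with hf | ⟨P, A₀, B₀, z₀, i, m, g, h, hm, hf⟩
  · calc ∑ π ∈ 𝒜, (f π : ℝ) ≤ ∑ π ∈ 𝒜, (11 : ℝ) :=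
          Finset.sum_le_sum fun π _ => by exact_mod_cast hf π
      _ = 𝒜.card * 11 := by simp
      _ ≤ _ := by gcongr; linarith
  · have hJ : ((Set.toFinite I).toFinset : Set (Fin n)) = I := by simp
    have h1 := sum_ncard_late_le (𝒜 := 𝒜) (J := (Set.toFinite I).toFinset) (i := i) g h
      (by simpa using hcl) (by simpa using hm)
    rw [hJ, ← Set.ncard_eq_toFinset_card] at h1
    calc ∑ π ∈ 𝒜, (f π : ℝ)
        ≤ ∑ π ∈ 𝒜, (6 * ((Late P A₀ B₀ i m I π).ncard : ℝ) + 11) :=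
          Finset.sum_le_sum fun π _ => by exact_mod_cast hf π
      _ = 6 * ∑ π ∈ 𝒜, ((Late P A₀ B₀ i m I π).ncard : ℝ) + 𝒜.card * 11 := by
          rw [Finset.sum_add_distrib, ← Finset.mul_sum]; simp
      _ ≤ _ := by linarith

end Counting

end KineticTriangulation

/-! ### Variation as a sum of jumps; invariance of the triangulation of the funnel. -/

namespace KineticTriangulation

variable {n : ℕ}

section Variation

variable {E : Type*} [PseudoEMetricSpace E] {L : Set ℝ} {D : Finset ℝ} {f : ℝ → E}
  {c : ℝ → ENNReal}

/-- Induction on the number of exceptional times between `x` and `y`; the endpoints themselves are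
not exceptional. -/
lemma edist_le_sum_jumps (hL : L.OrdConnected)
    (h0 : ∀ x ∈ L, x ∉ D → ∀ y ∈ L, y ∉ D → x < y → (∀ t ∈ D, ¬ (x < t ∧ t < y)) → f x = f y)
    (h1 : ∀ x ∈ L, x ∉ D → ∀ y ∈ L, y ∉ D → ∀ t₀ ∈ D, x < t₀ → t₀ < y →
      (∀ t ∈ D, x < t → t < y → t = t₀) → edist (f x) (f y) ≤ c t₀) (k : ℕ) :
    ∀ x ∈ L, x ∉ D → ∀ y ∈ L, y ∉ D → x ≤ y → (D.filter fun t => x < t ∧ t < y).card ≤ k →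
      edist (f x) (f y) ≤ ∑ t ∈ D with x < t ∧ t < y, c t := by
  induction k with
  | zero =>
    intro x hx hxD y hy hyD hxy hk
    rcases hxy.eq_or_lt with rfl | hlt
    · simp
    rw [Nat.le_zero, Finset.card_eq_zero, Finset.filter_eq_empty_iff] at hk
    rw [h0 x hx hxD y hy hyD hlt (fun t ht => hk ht), edist_self]
    exact bot_le
  | succ k ih =>
    intro x hx hxD y hy hyD hxy hk
    set F := D.filter fun t => x < t ∧ t < y with hF
    rcases F.eq_empty_or_nonempty with he | hne
    · refine (ih x hx hxD y hy hyD hxy ?_)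
      rw [← hF, he]; simp
    have hmF : ∀ {t}, t ∈ F ↔ t ∈ D ∧ x < t ∧ t < y := by
      intro t; rw [hF, Finset.mem_filter]
    set t₀ := F.min' hne with ht₀
    have h₀ : t₀ ∈ F := F.min'_mem hne
    rcases (F.erase t₀).eq_empty_or_nonempty with he | hne'
    · have hsing : F = {t₀} := by
        rw [← Finset.insert_erase h₀, he]
        rfl
      rw [hsing, Finset.sum_singleton]
      obtain ⟨a1, a2, a3⟩ := hmF.1 h₀
      refine h1 x hx hxD y hy hyD t₀ a1 a2 a3 (fun t ht h h' => ?_)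
      have : t ∈ F := hmF.2 ⟨ht, h, h'⟩
      rw [hsing] at this
      simpa using this
    set t₁ := (F.erase t₀).min' hne' with ht₁
    have h₁ : t₁ ∈ F.erase t₀ := Finset.min'_mem _ hne'
    have h₁F := Finset.mem_of_mem_erase h₁
    have hlt : t₀ < t₁ := lt_of_le_of_ne (F.min'_le _ h₁F) (Finset.ne_of_mem_erase h₁).symm
    obtain ⟨a1, a2, a3⟩ := hmF.1 h₀
    obtain ⟨b1, b2, b3⟩ := hmF.1 h₁F
    -- A point between the first two exceptional times isolates one jump; it lies in `L` by
    -- convexity.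
    obtain ⟨z, hz1, hz2⟩ := exists_between hlt
    have hno : ∀ t ∈ D, x < t → t < y → t = t₀ ∨ t₁ ≤ t := by
      intro t ht h h'
      by_cases e : t = t₀
      · exact Or.inl e
      · exact Or.inr (Finset.min'_le _ _ (Finset.mem_erase.2 ⟨e, hmF.2 ⟨ht, h, h'⟩⟩))
    have hxz : x < z := a2.trans hz1
    have hzy : z < y := hz2.trans b3
    have hzL : z ∈ L := hL.out hx hy ⟨hxz.le, hzy.le⟩
    have hzD : z ∉ D := by
      intro h
      rcases hno z h hxz hzy with e | e <;> linarith
    have hfz : (D.filter fun t => z < t ∧ t < y) = F.erase t₀ := by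
      ext t
      rw [Finset.mem_filter, Finset.mem_erase, hmF]
      constructor
      · rintro ⟨h, h', h''⟩
        exact ⟨(hz1.trans h').ne', h, hxz.trans h', h''⟩
      · rintro ⟨h, h', h'', h'''⟩
        rcases hno t h' h'' h''' with e | e
        · exact absurd e h
        · exact ⟨h', hz2.trans_le e, h'''⟩
    have e1 : edist (f x) (f z) ≤ c t₀ := by
      refine h1 x hx hxD z hzL hzD t₀ a1 a2 hz1 (fun t ht h h' => ?_)
      rcases hno t ht h (h'.trans hzy) with e | e
      · exact e
      · linarith
    have e2 := ih z hzL hzD y hy hyD hzy.le (by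
      rw [hfz, Finset.card_erase_of_mem h₀]; omega)
    rw [hfz] at e2
    calc edist (f x) (f y) ≤ edist (f x) (f z) + edist (f z) (f y) := edist_triangle _ _ _
      _ ≤ c t₀ + ∑ t ∈ F.erase t₀, c t := add_le_add e1 e2
      _ = ∑ t ∈ F, c t := Finset.add_sum_erase _ _ h₀

/-- The variation of a piecewise constant function is bounded by the sum of its jumps. -/
lemma eVariationOn_le_sum_jumps (hL : L.OrdConnected)
    (h0 : ∀ x ∈ L, x ∉ D → ∀ y ∈ L, y ∉ D → x < y → (∀ t ∈ D, ¬ (x < t ∧ t < y)) → f x = f y)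
    (h1 : ∀ x ∈ L, x ∉ D → ∀ y ∈ L, y ∉ D → ∀ t₀ ∈ D, x < t₀ → t₀ < y →
      (∀ t ∈ D, x < t → t < y → t = t₀) → edist (f x) (f y) ≤ c t₀) :
    eVariationOn f (L \ D) ≤ ∑ t ∈ D, c t := by
  refine iSup_le ?_
  rintro ⟨N, ⟨u, hu, hus⟩⟩
  dsimp only
  -- The steps of a monotone sequence span disjoint open intervals, so every jump is counted at most
  -- once.
  have key : ∀ N : ℕ, ∑ i ∈ Finset.range N, edist (f (u (i + 1))) (f (u i)) ≤
      ∑ t ∈ D with u 0 < t ∧ t < u N, c t := by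
    intro N
    induction N with
    | zero => simp
    | succ N ih =>
      rw [Finset.sum_range_succ]
      have e := edist_le_sum_jumps hL h0 h1 _ (u N) (hus N).1 (hus N).2 (u (N + 1))
        (hus (N + 1)).1 (hus (N + 1)).2 (hu (Nat.le_succ N)) le_rfl
      rw [edist_comm]
      refine (add_le_add ih e).trans ?_
      rw [← Finset.sum_union]
      · refine Finset.sum_le_sum_of_subset ?_
        intro t ht
        have m1 := hu (Nat.zero_le N)
        have m2 := hu (Nat.le_succ N)
        simp only [Finset.mem_union, Finset.mem_filter] at ht ⊢
        rcases ht with ⟨h, h', h''⟩ | ⟨h, h', h''⟩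
        · exact ⟨h, h', h''.trans_le m2⟩
        · exact ⟨h, m1.trans_lt h', h''⟩
      · rw [Finset.disjoint_left]
        intro t ht ht'
        simp only [Finset.mem_filter] at ht ht'
        linarith [ht.2.2, ht'.2.1]
  exact (key N).trans (Finset.sum_le_sum_of_subset (Finset.filter_subset _ _))

end Variation

section Congruence

variable {P Q : Config n} {SL SR : Set (Fin n)} {b : Fin n}

lemma orient_le_congr (gP : Generic P) (gQ : Generic Q)
    (agree : ∀ x y w, x ≠ y → y ≠ w → x ≠ w →
      (orient (P x) (P y) (P w) < 0 ↔ orient (Q x) (Q y) (Q w) < 0)) (x y w : Fin n) :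
    orient (P x) (P y) (P w) ≤ 0 ↔ orient (Q x) (Q y) (Q w) ≤ 0 := by
  by_cases h1 : x = y
  · subst h1; simp [orient]
  by_cases h2 : y = w
  · subst h2; simp [orient_self_right]
  by_cases h3 : x = w
  · subst h3; simp [orient_self_left]
  have a := gP.ncol x y w h1 h2 h3
  have b := gQ.ncol x y w h1 h2 h3
  have := agree x y w h1 h2 h3
  rw [le_iff_lt_or_eq, le_iff_lt_or_eq]
  tauto

lemma under_congr (gP : Generic P) (gQ : Generic Q) {q v w : Fin n}
    (agree : ∀ x y w, x ≠ y → y ≠ w → x ≠ w →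
      (orient (P x) (P y) (P w) < 0 ↔ orient (Q x) (Q y) (Q w) < 0))
    (ord : (P q).1 < (P v).1 ↔ (Q q).1 < (Q v).1)
    (ord' : (P v).1 < (P q).1 ↔ (Q v).1 < (Q q).1) (h1 : q ≠ v) :
    Under P q v w ↔ Under Q q v w := by
  rcases lt_or_gt_of_ne (gP.inj q v h1) with h | h
  · rw [under_iff_of_lt h, under_iff_of_lt (ord.1 h), ← not_le, ← not_le, orient_rev,
      orient_rev (Q q)]
    simp only [Left.nonneg_neg_iff]
    rw [orient_le_congr gP gQ agree]
  · rw [under_iff_of_gt h, under_iff_of_gt (ord'.1 h), ← not_le, ← not_le,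
      orient_le_congr gP gQ agree]

/-- The triangulation of the funnel depends only on the order type. -/
lemma funnelTri_congr (gP : Generic P) (gQ : Generic Q) (hs : Sides P SL SR b)
    (ord : ∀ x y, (P x).1 < (P y).1 ↔ (Q x).1 < (Q y).1)
    (agree : ∀ x y w, x ≠ y → y ≠ w → x ≠ w →
      (orient (P x) (P y) (P w) < 0 ↔ orient (Q x) (Q y) (Q w) < 0))
    (π : Equiv.Perm (Fin n)) : funnelTri P SL SR b π = funnelTri Q SL SR b π := by
  have hull : ∀ S j, Hull P S j ↔ Hull Q S j := by
    intro S j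
    unfold Hull
    refine and_congr_right fun _ => forall₂_congr fun x hx => forall₂_congr fun y hy => ?_
    rw [ord, ord]
    refine imp_congr_right fun h1 => imp_congr_right fun h2 => agree x j y ?_ ?_ ?_
    · rintro rfl; exact lt_irrefl _ h1
    · rintro rfl; exact lt_irrefl _ h2
    · rintro rfl; exact lt_irrefl _ (h1.trans h2)
  have hfun : ∀ A B, Funnel P SL SR b A B ↔ Funnel Q SL SR b A B := by
    intro A B
    unfold Funnel Bridge
    simp only [ord, hull, orient_le_congr gP gQ agree]
  refine Flip.funnelTri_eq hfun (fun A B hF π => ?_) π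
  have hP := hF.pt gP hs
  refine tri_congr ?_ ?_
  · intro q hq v hv v' hv' _
    exact under_congr gP gQ agree (ord _ _) (ord _ _) (hP.ne (List.mem_of_mem_tail hq) hv)
  · intro q hq v hv v' hv' _
    exact under_congr gP gQ agree (ord _ _) (ord _ _) (hP.ne hv (List.mem_of_mem_tail hq)).symm

/-- The point `d` lies below the point `h`, and no other point lies between the vertical lines
through them or the lines through one of them and some other point. -/
def Below (P : Config n) (d h : Fin n) : Prop :=
  ∀ k, k ≠ d → k ≠ h → Under P h k d ∧ 0 < orient (P d) (P k) (P h) * ((P k).1 - (P d).1)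

lemma Below.mirror {d h : Fin n} (hb : Below P d h) : Below (mirror P) d h := by
  intro k h1 h2
  obtain ⟨a, b⟩ := hb k h1 h2
  refine ⟨(under_mirror P h k d).2 a, ?_⟩
  rw [orient_mirror, mirror_fst, mirror_fst]
  linarith

/-- A bridge or a supporting line through `d` would pass below `h`, which belongs to the same side.
If `d` is to the left of `h`, the bridge end `w` serves as the third point; if it is to the right,
the apex does. -/
lemma Below.not_chain (gP : Generic P) (hs : Sides P SL SR b) {d h w u : Fin n}
    (hb : Below P d h) (hdh : d ≠ h) (hdb : d ≠ b) (hhb : h ≠ b) (hh : h ∈ SL)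
    (hw : Bridge P SL SR b w u) : ¬ (Hull P SL d ∧ (d = w ∨ (P w).1 < (P d).1)) := by
  rintro ⟨hd, hdw⟩
  have hub : u ≠ d := (hs.ne hd.1 hw.2.2.1 hw.2.2.2.1).symm
  have huh : u ≠ h := (hs.ne hh hw.2.2.1 hw.2.2.2.1).symm
  rcases hdw with rfl | hlt
  · have h1 := (hb u hub huh).2
    have h2 := hw.2.2.2.2.2 h (Or.inl hh)
    have h3 := hw.2.2.2.2.1
    nlinarith
  · rcases lt_or_gt_of_ne (gP.inj d h hdh) with l | l
    · have h1 := hd.2 w hw.1 h hh hlt l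
      have h2 := (hb w (by rintro rfl; exact lt_irrefl _ hlt) (by rintro rfl; linarith)).2
      rw [orient_swap_left] at h1
      nlinarith
    · have hdlt := hs.ltL d hd.1 hdb
      have h1 := hd.2 h hh b hs.bL l hdlt
      have h2 := (hb b (Ne.symm hdb) (Ne.symm hhb)).2
      rw [orient_rot] at h1
      nlinarith

/-- Only `d` and `h` exchange their order. A hull test at `j ≠ d` that this affects has `j = h` in
the middle and `d` outside; it always succeeds, since `d` is below every line through `h`. -/
lemma Below.hull_iff {S : Set (Fin n)} {d h j : Fin n}
    (hP : Below P d h) (hQ : Below Q d h)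
    (ord : ∀ x y, ¬ (x = d ∧ y = h) → ¬ (x = h ∧ y = d) →
      ((P x).1 < (P y).1 ↔ (Q x).1 < (Q y).1))
    (agree : ∀ x y w, x ≠ y → y ≠ w → x ≠ w →
      (orient (P x) (P y) (P w) < 0 ↔ orient (Q x) (Q y) (Q w) < 0))
    (hj : j ≠ d) : Hull P S j ↔ Hull Q S j := by
  have key : ∀ {P Q : Config n}, Below Q d h →
      (∀ x y, ¬ (x = d ∧ y = h) → ¬ (x = h ∧ y = d) →
        ((P x).1 < (P y).1 ↔ (Q x).1 < (Q y).1)) →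
      (∀ x y w, x ≠ y → y ≠ w → x ≠ w →
        (orient (P x) (P y) (P w) < 0 ↔ orient (Q x) (Q y) (Q w) < 0)) →
      Hull P S j → Hull Q S j := by
    intro P Q hQ ord agree hH
    refine ⟨hH.1, fun x hx y hy h1 h2 => ?_⟩
    have xj : x ≠ j := by rintro rfl; exact lt_irrefl _ h1
    have jy : j ≠ y := by rintro rfl; exact lt_irrefl _ h2
    have xy : x ≠ y := by rintro rfl; exact lt_irrefl _ (h1.trans h2)
    by_cases c1 : x = d ∧ j = h
    · obtain ⟨rfl, rfl⟩ := c1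
      have := (hQ y xy.symm jy.symm).1
      rw [under_iff_of_lt h2, ← orient_rot] at this
      exact this
    by_cases c2 : j = h ∧ y = d
    · obtain ⟨rfl, rfl⟩ := c2
      have := (hQ x xy xj).1
      rw [under_iff_of_gt h1, orient_swap_left] at this
      linarith
    rw [← agree x j y xj jy xy]
    refine hH.2 x hx y hy ((ord _ _ c1 ?_).2 h1) ((ord _ _ ?_ c2).2 h2)
    · rintro ⟨-, e⟩; exact hj e
    · rintro ⟨e, -⟩; exact hj e
  exact ⟨key hQ ord agree, key hP (fun x y h1 h2 => (ord x y h1 h2).symm)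
    (fun x y w h1 h2 h3 => (agree x y w h1 h2 h3).symm)⟩

/-- A change of the horizontal order of two points that are not corners of the pseudo-triangle
does not affect the triangulation. -/
lemma funnelTri_swap (gP : Generic P) (gQ : Generic Q) (hsP : Sides P SL SR b)
    (hsQ : Sides Q SL SR b) {d h : Fin n} (hdh : d ≠ h) (hP : Below P d h) (hQ : Below Q d h)
    (ord : ∀ x y, ¬ (x = d ∧ y = h) → ¬ (x = h ∧ y = d) →
      ((P x).1 < (P y).1 ↔ (Q x).1 < (Q y).1))
    (agree : ∀ x y w, x ≠ y → y ≠ w → x ≠ w →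
      (orient (P x) (P y) (P w) < 0 ↔ orient (Q x) (Q y) (Q w) < 0))
    (hdb : d ≠ b) (hhb : h ≠ b) (hL : d ∈ SL → h ∈ SL) (hR : d ∈ SR → h ∈ SR)
    (π : Equiv.Perm (Fin n)) : funnelTri P SL SR b π = funnelTri Q SL SR b π := by
  have notA : ∀ {P : Config n}, Generic P → Sides P SL SR b → Below P d h → ∀ {A B},
      Funnel P SL SR b A B → d ∉ A ++ [b] ∧ d ∉ B ++ [b] := by
    intro P gP hs hb A B hF
    obtain ⟨w, u, -, -, -, -, hw, -, hA, hB⟩ := hF.spec gP hs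
    constructor
    · intro hd
      have := (hA d).1 hd
      exact hb.not_chain gP hs hdh hdb hhb (hL this.1.1) hw this
    · intro hd
      have := (hB d).1 hd
      refine hb.mirror.not_chain gP.mirror hs.mirror hdh hdb hhb (hR this.1.1) hw.mirror ?_
      rw [hull_mirror]
      simpa using this
  have key : ∀ {P Q : Config n}, Generic P → Generic Q → Sides P SL SR b → Sides Q SL SR b →
      Below P d h → Below Q d h →
      (∀ x y, ¬ (x = d ∧ y = h) → ¬ (x = h ∧ y = d) →
        ((P x).1 < (P y).1 ↔ (Q x).1 < (Q y).1)) →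
      (∀ x y w, x ≠ y → y ≠ w → x ≠ w →
        (orient (P x) (P y) (P w) < 0 ↔ orient (Q x) (Q y) (Q w) < 0)) →
      ∀ A B, Funnel P SL SR b A B → Funnel Q SL SR b A B := by
    intro P Q gP gQ hsP hsQ hP hQ ord agree A B hF
    obtain ⟨dA, dB⟩ := notA gP hsP hP hF
    obtain ⟨w, u, hw, h1, h2, h3, h4⟩ := hF
    have hw' : Bridge Q SL SR b w u := by
      refine ⟨hw.1, hw.2.1, hw.2.2.1, hw.2.2.2.1, hsQ.lt hw.1 hw.2.2.1 hw.2.2.2.1, fun x hx => ?_⟩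
      rw [← orient_le_congr gP gQ agree]
      exact hw.2.2.2.2.2 x hx
    have wd : w ≠ d := by
      rintro rfl
      exact dA ((h3 w).2 ⟨hw.hullL gP hsP, Or.inl rfl⟩)
    have ud : u ≠ d := by
      rintro rfl
      exact dB ((h4 u).2 ⟨hw.hullR gP hsP, Or.inl rfl⟩)
    refine ⟨w, u, hw', ?_, ?_, ?_, ?_⟩
    · refine h1.imp_of_mem (fun {x y} hx hy hlt => (ord x y ?_ ?_).1 hlt)
      · rintro ⟨rfl, -⟩; exact dA hx
      · rintro ⟨-, rfl⟩; exact dA hy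
    · refine h2.imp_of_mem (fun {x y} hx hy hlt => (ord y x ?_ ?_).1 hlt)
      · rintro ⟨rfl, -⟩; exact dB hy
      · rintro ⟨-, rfl⟩; exact dB hx
    · intro j
      by_cases hj : j = d
      · subst hj
        refine iff_of_false dA (fun h' => ?_)
        exact hQ.not_chain gQ hsQ hdh hdb hhb (hL h'.1.1) hw' h'
      · rw [h3, hP.hull_iff hQ ord agree hj, ord w j (fun e => wd e.1) (fun e => hj e.2)]
    · intro j
      by_cases hj : j = d
      · subst hj
        refine iff_of_false dB (fun h' => ?_)
        refine hQ.mirror.not_chain gQ.mirror hsQ.mirror hdh hdb hhb (hR h'.1.1) hw'.mirror ?_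
        rw [hull_mirror]
        simpa using h'
      · rw [h4, hP.hull_iff hQ ord agree hj, ord j u (fun e => hj e.1) (fun e => ud e.2)]
  refine Flip.funnelTri_eq (fun A B => ⟨key gP gQ hsP hsQ hP hQ ord agree A B,
    key gQ gP hsQ hsP hQ hP (fun x y h1 h2 => (ord x y h1 h2).symm)
      (fun x y w h1 h2 h3 => (agree x y w h1 h2 h3).symm) A B⟩) (fun A B hF π => ?_) π
  obtain ⟨dA, dB⟩ := notA gP hsP hP hF
  have hPT := hF.pt gP hsP
  have nA : ∀ {x}, x ∈ A → x ≠ d := by rintro x hx rfl; exact dA (by simp [hx])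
  have nB : ∀ {x}, x ∈ B → x ≠ d := by rintro x hx rfl; exact dB (by simp [hx])
  refine tri_congr ?_ ?_
  · intro q hq v hv v' hv' _
    have hq := List.mem_of_mem_tail hq
    exact under_congr gP gQ agree (ord _ _ (fun e => nA hq e.1) (fun e => nB hv e.2))
      (ord _ _ (fun e => nB hv e.1) (fun e => nA hq e.2)) (hPT.ne hq hv)
  · intro q hq v hv v' hv' _
    have hq := List.mem_of_mem_tail hq
    exact under_congr gP gQ agree (ord _ _ (fun e => nB hq e.1) (fun e => nA hv e.2))
      (ord _ _ (fun e => nA hv e.1) (fun e => nB hq e.2)) (hPT.ne hv hq).symm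

end Congruence

end KineticTriangulation

/-! ### Degenerate times and the combinatorial data that they can affect. -/

namespace KineticTriangulation

variable {n : ℕ} {p : Motion n} {τ : PseudoTriangle n}

section Times

/-- The times of degeneracies form a finite set. -/
lemma finite_compl_genericTimes {s : ℕ} (hp : PseudoAlgebraic p s) : (genericTimes p)ᶜ.Finite := by
  have h2 : (⋃ i : Fin n, ⋃ j : Fin n, ⋃ _ : i ≠ j, {t : ℝ | (p i t).1 = (p j t).1}).Finite := by
    refine Set.finite_iUnion fun i => Set.finite_iUnion fun j => Set.finite_iUnion fun hij => ?_
    exact Set.finite_of_encard_le_coe (hp.pair i j hij)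
  have h3 : (⋃ i : Fin n, ⋃ j : Fin n, ⋃ k : Fin n, ⋃ _ : i ≠ j ∧ j ≠ k ∧ i ≠ k,
      {t : ℝ | turn p t i j k = 0}).Finite := by
    refine Set.finite_iUnion fun i => Set.finite_iUnion fun j => Set.finite_iUnion fun k =>
      Set.finite_iUnion fun h => ?_
    exact Set.finite_of_encard_le_coe (hp.triple i j k h.1 h.2.1 h.2.2)
  refine (h2.union h3).subset ?_
  intro t ht
  obtain ⟨S, hS⟩ := Set.nonempty_iff_ne_empty.2 (show degeneracies p t ≠ ∅ from ht)
  rcases hS with ⟨hc, hS⟩ | ⟨hc, hS⟩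
  · obtain ⟨i, j, hij, rfl⟩ := Finset.card_eq_two.1 hc
    left
    simp only [Set.mem_iUnion]
    exact ⟨i, j, hij, hS i (by simp) j (by simp)⟩
  · obtain ⟨i, j, k, hij, hik, hjk, rfl⟩ := Finset.card_eq_three.1 hc
    right
    simp only [Set.mem_iUnion]
    exact ⟨i, j, k, ⟨hij, hjk, hik⟩, hS i (by simp) j (by simp) k (by simp)⟩

/-- By the intermediate value theorem, orders and orientations can change only at degeneracies. -/
lemma neg_iff_of_ne_zero {f : ℝ → ℝ} (hf : Continuous f) {x y t t' : ℝ}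
    (h0 : ∀ r ∈ Set.Icc x y, f r ≠ 0) (ht : t ∈ Set.Icc x y) (ht' : t' ∈ Set.Icc x y) :
    f t < 0 ↔ f t' < 0 := by
  have key : ∀ {t t' : ℝ}, t ∈ Set.Icc x y → t' ∈ Set.Icc x y → f t < 0 → f t' < 0 := by
    intro t t' ht ht' h
    by_contra hc
    push Not at hc
    obtain ⟨r, hr, hr0⟩ := intermediate_value_uIcc (f := f) (a := t) (b := t') hf.continuousOn
      (Set.mem_uIcc.2 (Or.inl ⟨h.le, hc⟩))
    exact h0 r (Set.uIcc_subset_Icc ht ht' hr) hr0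
  exact ⟨key ht ht', key ht' ht⟩

lemma continuous_turn (hc : ∀ i, Continuous (p i)) (i j k : Fin n) :
    Continuous fun t => turn p t i j k := by
  unfold turn orient
  have := hc i
  have := hc j
  have := hc k
  fun_prop

lemma fst_lt_iff (hc : ∀ i, Continuous (p i)) {i j : Fin n} {x y t t' : ℝ}
    (h0 : ∀ r ∈ Set.Icc x y, (p i r).1 ≠ (p j r).1) (ht : t ∈ Set.Icc x y)
    (ht' : t' ∈ Set.Icc x y) : (p i t).1 < (p j t).1 ↔ (p i t').1 < (p j t').1 := by
  have := neg_iff_of_ne_zero (f := fun r => (p i r).1 - (p j r).1)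
    ((continuous_fst.comp (hc i)).sub (continuous_fst.comp (hc j)))
    (fun r hr e => h0 r hr (sub_eq_zero.1 e)) ht ht'
  simpa only [sub_neg] using this

lemma turn_neg_iff (hc : ∀ i, Continuous (p i)) {i j k : Fin n} {x y t t' : ℝ}
    (h0 : ∀ r ∈ Set.Icc x y, turn p r i j k ≠ 0) (ht : t ∈ Set.Icc x y)
    (ht' : t' ∈ Set.Icc x y) :
    orient (cfg p t i) (cfg p t j) (cfg p t k) < 0 ↔
      orient (cfg p t' i) (cfg p t' j) (cfg p t' k) < 0 :=
  neg_iff_of_ne_zero (continuous_turn hc i j k) h0 ht ht'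

end Times

section Parts

/-- The corners of a pseudo-triangle. -/
def corners (τ : PseudoTriangle n) : Set (Fin n) :=
  {z | τ.left = .pt z ∨ z = τ.apex ∨ τ.right = .pt z}

lemma before_iff {t : ℝ} {i j : Fin n} (h : (p i t).1 ≠ (p j t).1) :
    Before p t (.pt i) (.pt j) ↔ (p i t).1 < (p j t).1 := by
  simp [Before, h]

lemma before_irrefl {t : ℝ} {x : APoint n} : ¬ Before p t x x := by
  cases x <;> simp [Before]

/-- The points `i` and `j` have the same strict order at the times `t` and `t'`. -/
def SameOrder (p : Motion n) (t t' : ℝ) (i j : Fin n) : Prop :=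
  (p i t).1 ≠ (p j t).1 ∧ (p i t').1 ≠ (p j t').1 ∧
    ((p i t).1 < (p j t).1 ↔ (p i t').1 < (p j t').1)

lemma SameOrder.symm {t t' : ℝ} {i j : Fin n} (h : SameOrder p t t' i j) :
    SameOrder p t t' j i := by
  obtain ⟨h1, h2, h3⟩ := h
  refine ⟨h1.symm, h2.symm, ?_⟩
  rw [← not_le, ← not_le, le_iff_lt_or_eq, le_iff_lt_or_eq]
  tauto

lemma SameOrder.before_iff {t t' : ℝ} {i j : Fin n} (h : i ≠ j → SameOrder p t t' i j) :
    Before p t (.pt i) (.pt j) ↔ Before p t' (.pt i) (.pt j) := by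
  by_cases hij : i = j
  · subst hij; simp [before_irrefl]
  · obtain ⟨h1, h2, h3⟩ := h hij
    rw [KineticTriangulation.before_iff h1, KineticTriangulation.before_iff h2, h3]

lemma before_left_iff {t t' : ℝ} {a : APoint n} {i : Fin n}
    (h : ∀ z, a = .pt z → z ≠ i → SameOrder p t t' z i) :
    Before p t a (.pt i) ↔ Before p t' a (.pt i) := by
  cases a with
  | negInf => exact Iff.rfl
  | posInf => exact Iff.rfl
  | pt z => exact SameOrder.before_iff (h z rfl)

lemma before_right_iff {t t' : ℝ} {c : APoint n} {i : Fin n}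
    (h : ∀ z, c = .pt z → z ≠ i → SameOrder p t t' z i) :
    Before p t (.pt i) c ↔ Before p t' (.pt i) c := by
  cases c with
  | negInf => exact Iff.rfl
  | posInf => exact Iff.rfl
  | pt z => exact SameOrder.before_iff (fun hne => (h z rfl hne.symm).symm)

/-- The two parts depend only on the order of each point relative to the three corners. -/
lemma parts_congr {t t' : ℝ} (h : ∀ z ∈ corners τ, ∀ i, z ≠ i → SameOrder p t t' z i) :
    leftPart p τ t = leftPart p τ t' ∧ rightPart p τ t = rightPart p τ t' := by
  have hL : ∀ i, Before p t τ.left (.pt i) ↔ Before p t' τ.left (.pt i) := fun i =>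
    before_left_iff (fun z hz => h z (Or.inl hz) i)
  have hR : ∀ i, Before p t (.pt i) τ.right ↔ Before p t' (.pt i) τ.right := fun i =>
    before_right_iff (fun z hz => h z (Or.inr (Or.inr hz)) i)
  have hb : τ.apex ∈ corners τ := Or.inr (Or.inl rfl)
  have h1 : ∀ i, Lt p t i τ.apex ↔ Lt p t' i τ.apex := fun i =>
    SameOrder.before_iff (fun hne => (h _ hb i hne.symm).symm)
  have h2 : ∀ i, Lt p t τ.apex i ↔ Lt p t' τ.apex i := fun i =>
    SameOrder.before_iff (fun hne => h _ hb i hne)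
  constructor
  · ext i; simp only [leftPart, Set.mem_ofPred_eq, hL, h1]
  · ext i; simp only [rightPart, Set.mem_ofPred_eq, hR, h2]

lemma left_subset (hb : ∀ t ∈ τ.life, τ.apex ∈ Between p t τ.left τ.right)
    {t : ℝ} (ht : t ∈ τ.life) :
    leftPart p τ t ⊆ innerPoints p τ ∪ corners τ := by
  intro i hi
  by_cases hib : i = τ.apex
  · exact Or.inr (Or.inr (Or.inl hib))
  rcases hi with ⟨h1 | h1, h2⟩
  · exact Or.inr (Or.inl h1)
  · exact Or.inl ⟨hib, t, ht, h1, before_trans (h2.resolve_left hib) (hb t ht).2⟩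

lemma right_subset (hb : ∀ t ∈ τ.life, τ.apex ∈ Between p t τ.left τ.right)
    {t : ℝ} (ht : t ∈ τ.life) :
    rightPart p τ t ⊆ innerPoints p τ ∪ corners τ := by
  intro i hi
  by_cases hib : i = τ.apex
  · exact Or.inr (Or.inr (Or.inl hib))
  rcases hi with ⟨h1, h2 | h2⟩
  · exact Or.inr (Or.inr (Or.inr h2))
  · exact Or.inl ⟨hib, t, ht, before_trans (hb t ht).1 (h1.resolve_left hib), h2⟩

lemma innerSet (hb : ∀ t ∈ τ.life, τ.apex ∈ Between p t τ.left τ.right)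
    {t : ℝ} (ht : t ∈ τ.life)
    (hinj : ∀ i j, i ≠ j → (cfg p t i).1 ≠ (cfg p t j).1) :
    InnerSet (cfg p t) (leftPart p τ t) (rightPart p τ t) τ.apex (innerPoints p τ) where
  left y hy hyb x hx hlt := by
    have hxy : Before p t (.pt x) (.pt y) := (lt_iff hinj).2 hlt
    refine ⟨hyb, t, ht, ?_, before_trans (hy.2.resolve_left hyb) (hb t ht).2⟩
    rcases hx.1 with h | h
    · rw [h]; exact hxy
    · exact before_trans h hxy
  right y hy hyb x hx hlt := by
    have hxy : Before p t (.pt y) (.pt x) := (lt_iff hinj).2 hlt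
    refine ⟨hyb, t, ht, before_trans (hb t ht).1 (hy.1.resolve_left hyb), ?_⟩
    rcases hx.2 with h | h
    · rw [h]; exact hxy
    · exact before_trans hxy h

/-- The number of edges of the triangulation is linear in the number of inner points. -/
lemma ncard_funnelTri_le (hb : ∀ t ∈ τ.life, τ.apex ∈ Between p t τ.left τ.right)
    {t : ℝ} (ht : t ∈ τ.life) (hg : t ∈ genericTimes p)
    (π : Equiv.Perm (Fin n)) :
    (funnelTri (cfg p t) (leftPart p τ t) (rightPart p τ t) τ.apex π).ncard ≤
      3 * numInner p τ + 3 := by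
  have g := generic_of_mem hg
  have hs := sides_of_between g.inj (hb t ht)
  by_cases hex : ∃ w u, Bridge (cfg p t) (leftPart p τ t) (rightPart p τ t) τ.apex w u
  swap
  · push Not at hex
    rw [funnelTri_eq_empty hex]; simp
  obtain ⟨w, u, hwu⟩ := hex
  obtain ⟨A, B, hF⟩ := hwu.exists_funnel g hs
  obtain ⟨_, _, _, _, -, -, -, hP, hA, hB⟩ := hF.spec g hs
  rw [hF.tri_eq g hs]
  have h1 := hP.ncard_tri_le g π _ le_rfl
  have nd : (A ++ B).Nodup := by
    rw [List.nodup_append]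
    exact ⟨hP.nodupA, hP.nodupB, fun a ha b hb => hP.ne ha hb⟩
  -- Apart from the apex the vertices are inner points or one of at most two other corners: at most
  -- `N + 2` vertices, hence `3 N + 3` edges.
  have hsub : ((A ++ B).toFinset : Set (Fin n)) ⊆
      innerPoints p τ ∪ (corners τ \ {τ.apex}) := by
    intro i hi
    rw [List.coe_toFinset, Set.mem_ofPred_eq, List.mem_append] at hi
    have hib : i ≠ τ.apex := by
      rintro rfl
      rcases hi with hi | hi
      · exact lt_irrefl _ (hP.ltA hi)
      · exact lt_irrefl _ (hP.ltB hi)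
    have : i ∈ innerPoints p τ ∪ corners τ := by
      rcases hi with hi | hi
      · exact left_subset hb ht ((hA i).1 (by simp [hi])).1.1
      · exact right_subset hb ht ((hB i).1 (by simp [hi])).1.1
    rcases this with h | h
    · exact Or.inl h
    · exact Or.inr ⟨h, hib⟩
  have hc : (corners τ \ {τ.apex}).ncard ≤ 2 := by
    have : corners τ \ {τ.apex} ⊆ {z | τ.left = .pt z} ∪ {z | τ.right = .pt z} := by
      rintro z ⟨hz, hz'⟩
      rcases hz with h | h | h
      · exact Or.inl h
      · exact absurd h hz'
      · exact Or.inr h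
    refine (Set.ncard_le_ncard this (Set.toFinite _)).trans ?_
    refine (Set.ncard_union_le _ _).trans ?_
    have one : ∀ a : APoint n, {z | a = .pt z}.ncard ≤ 1 := by
      intro a
      refine (Set.ncard_le_one_iff (Set.toFinite _)).2 ?_
      intro x y hx hy
      have : APoint.pt x = APoint.pt y := (show a = .pt x from hx).symm.trans hy
      exact APoint.pt.inj this
    have := one τ.left
    have := one τ.right
    omega
  have h2 := Set.ncard_le_ncard hsub (Set.toFinite _)
  have h3 := Set.ncard_union_le (innerPoints p τ) (corners τ \ {τ.apex})
  rw [Set.ncard_coe_finset, List.toFinset_card_of_nodup nd, List.length_append] at h2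
  unfold numInner
  omega

end Parts

end KineticTriangulation

/-! ### Change of the triangulation when two x-coordinates coincide. -/

namespace KineticTriangulation

variable {n : ℕ} {p : Motion n} {τ : PseudoTriangle n}

open scoped symmDiff

/-- The edges of the triangulation of the funnel at time `t`. -/
def liveTri (p : Motion n) (τ : PseudoTriangle n) (π : Equiv.Perm (Fin n)) (t : ℝ) :
    Set (Sym2 (Fin n)) :=
  funnelTri (cfg p t) (leftPart p τ t) (rightPart p τ t) τ.apex π

lemma liveTri_congr (hb : ∀ t ∈ τ.life, τ.apex ∈ Between p t τ.left τ.right) {x y : ℝ}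
    (hx : x ∈ τ.life) (gx : x ∈ genericTimes p) (gy : y ∈ genericTimes p)
    (ord : ∀ i j, i ≠ j → SameOrder p x y i j)
    (agree : ∀ i j k, i ≠ j → j ≠ k → i ≠ k → (orient (cfg p x i) (cfg p x j) (cfg p x k) < 0 ↔
      orient (cfg p y i) (cfg p y j) (cfg p y k) < 0)) (π : Equiv.Perm (Fin n)) :
    liveTri p τ π x = liveTri p τ π y := by
  obtain ⟨hL, hR⟩ := parts_congr (τ := τ) (fun z _ i hne => ord z i hne)
  unfold liveTri
  rw [← hL, ← hR]
  refine funnelTri_congr (generic_of_mem gx) (generic_of_mem gy)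
    (sides_of_between (generic_of_mem gx).inj (hb x hx)) (fun i j => ?_) agree π
  by_cases hij : i = j
  · subst hij; simp
  · exact (ord i j hij).2.2

lemma liveTri_const (hc : ∀ i, Continuous (p i))
    (hb : ∀ t ∈ τ.life, τ.apex ∈ Between p t τ.left τ.right) {x y : ℝ} (hxy : x ≤ y)
    (hx : x ∈ τ.life) (hgen : ∀ t ∈ Set.Icc x y, t ∈ genericTimes p) (π : Equiv.Perm (Fin n)) :
    liveTri p τ π x = liveTri p τ π y := by
  have mx : x ∈ Set.Icc x y := Set.left_mem_Icc.2 hxy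
  have my : y ∈ Set.Icc x y := Set.right_mem_Icc.2 hxy
  refine liveTri_congr hb hx (hgen x mx) (hgen y my) (fun i j hij => ?_)
    (fun i j k h1 h2 h3 => ?_) π
  · have h0 : ∀ t ∈ Set.Icc x y, (p i t).1 ≠ (p j t).1 := fun t ht =>
      (generic_of_mem (hgen t ht)).inj i j hij
    exact ⟨h0 x mx, h0 y my, fst_lt_iff hc h0 mx my⟩
  · exact turn_neg_iff hc (fun t ht => (generic_of_mem (hgen t ht)).ncol i j k h1 h2 h3) mx my

/-- The interval from `x` to `y` contains no degenerate time other than `t₀`. -/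
structure Window (p : Motion n) (τ : PseudoTriangle n) (x y t₀ : ℝ) : Prop where
  cont : ∀ i, Continuous (p i)
  pos : GeneralPosition p
  apex : ∀ t ∈ τ.life, τ.apex ∈ Between p t τ.left τ.right
  memx : x ∈ τ.life
  memy : y ∈ τ.life
  mem : t₀ ∈ τ.life
  ltx : x < t₀
  lty : t₀ < y
  gen : ∀ t ∈ Set.Icc x y, t ≠ t₀ → t ∈ genericTimes p

/-- The times at which an inner point and a corner have the same `x`-coordinate. -/
def pairTimes (p : Motion n) (τ : PseudoTriangle n) : Set ℝ :=
  {t | ∃ i ∈ innerPoints p τ, ∃ z ∈ corners τ, i ≠ z ∧ (p i t).1 = (p z t).1}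

/-- The times at which three inner points or corners are collinear. -/
def tripleTimes (p : Motion n) (τ : PseudoTriangle n) : Set ℝ :=
  {t | ∃ i ∈ innerPoints p τ ∪ corners τ, ∃ j ∈ innerPoints p τ ∪ corners τ,
    ∃ k ∈ innerPoints p τ ∪ corners τ, i ≠ j ∧ j ≠ k ∧ i ≠ k ∧ turn p t i j k = 0}

namespace Window

variable {x y t₀ : ℝ}

lemma inx (W : Window p τ x y t₀) : x ∈ Set.Icc x y :=
  Set.left_mem_Icc.2 (W.ltx.trans W.lty).le

lemma iny (W : Window p τ x y t₀) : y ∈ Set.Icc x y :=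
  Set.right_mem_Icc.2 (W.ltx.trans W.lty).le

lemma in0 (W : Window p τ x y t₀) : t₀ ∈ Set.Icc x y := ⟨W.ltx.le, W.lty.le⟩

lemma genx (W : Window p τ x y t₀) : x ∈ genericTimes p := W.gen x W.inx W.ltx.ne

lemma geny (W : Window p τ x y t₀) : y ∈ genericTimes p := W.gen y W.iny W.lty.ne'

lemma sameOrder (W : Window p τ x y t₀) {i j : Fin n} (h0 : (p i t₀).1 ≠ (p j t₀).1) {t t' : ℝ}
    (ht : t ∈ Set.Icc x y) (ht' : t' ∈ Set.Icc x y) : SameOrder p t t' i j := by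
  have hij : i ≠ j := by rintro rfl; exact h0 rfl
  have h : ∀ r ∈ Set.Icc x y, (p i r).1 ≠ (p j r).1 := by
    intro r hr
    by_cases e : r = t₀
    · rw [e]; exact h0
    · exact (generic_of_mem (W.gen r hr e)).inj i j hij
  exact ⟨h t ht, h t' ht', fst_lt_iff W.cont h ht ht'⟩

lemma sameTurn (W : Window p τ x y t₀) {i j k : Fin n} (h0 : turn p t₀ i j k ≠ 0)
    (h1 : i ≠ j) (h2 : j ≠ k) (h3 : i ≠ k) {t t' : ℝ}
    (ht : t ∈ Set.Icc x y) (ht' : t' ∈ Set.Icc x y) :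
    orient (cfg p t i) (cfg p t j) (cfg p t k) < 0 ↔
      orient (cfg p t' i) (cfg p t' j) (cfg p t' k) < 0 := by
  refine turn_neg_iff W.cont (fun r hr => ?_) ht ht'
  by_cases e : r = t₀
  · rw [e]; exact h0
  · exact (generic_of_mem (W.gen r hr e)).ncol i j k h1 h2 h3

/-- A pair of points with a common `x`-coordinate is the only degeneracy. -/
lemma pair_only (W : Window p τ x y t₀) {d h i j : Fin n} (hdh : d ≠ h)
    (e : (p d t₀).1 = (p h t₀).1) (hij : i ≠ j) (n1 : ¬ (i = d ∧ j = h)) (n2 : ¬ (i = h ∧ j = d)) :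
    (p i t₀).1 ≠ (p j t₀).1 := by
  intro e'
  have := W.pos.separate t₀ (pair_mem_degeneracies hdh e) (pair_mem_degeneracies hij e')
  have hi : i ∈ ({d, h} : Finset (Fin n)) := by rw [this]; simp
  have hj : j ∈ ({d, h} : Finset (Fin n)) := by rw [this]; simp
  simp only [Finset.mem_insert, Finset.mem_singleton] at hi hj
  grind

/-- Degeneracies do not coincide in time, so a common x-coordinate excludes any collinear triple;
their index sets have different cardinalities. -/
lemma pair_turn (W : Window p τ x y t₀) {d h i j k : Fin n} (hdh : d ≠ h)
    (e : (p d t₀).1 = (p h t₀).1) (h1 : i ≠ j) (h2 : j ≠ k) (h3 : i ≠ k) :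
    turn p t₀ i j k ≠ 0 := by
  intro e'
  have := W.pos.separate t₀ (pair_mem_degeneracies hdh e) (triple_mem_degeneracies h1 h2 h3 e')
  have c := congrArg Finset.card this
  rw [Finset.card_pair hdh, Finset.card_eq_three.2 ⟨i, j, k, h1, h3, h2, rfl⟩] at c
  omega

/-- At `t₀` the orientations of `d`, `h` with `k` are products of a horizontal and a vertical
difference, so their signs are known. They do not vanish at `t₀`, hence stay the same throughout the
window. -/
lemma below (W : Window p τ x y t₀) {d h : Fin n} (hdh : d ≠ h) (e : (p d t₀).1 = (p h t₀).1)
    (hlt : (p d t₀).2 < (p h t₀).2) {t : ℝ} (ht : t ∈ Set.Icc x y) (htg : t ∈ genericTimes p) :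
    Below (cfg p t) d h := by
  intro k hkd hkh
  have g := generic_of_mem htg
  have hk0 := W.pair_only hdh e hkh (fun c => hkd c.1) (fun c => hkh c.1)
  have hk0' := W.pair_only hdh e hkd (fun c => hkd c.1) (fun c => hkh c.1)
  have o1 := (W.sameOrder hk0 W.in0 ht).2.2
  have o1' := (W.sameOrder hk0.symm W.in0 ht).2.2
  have o2 := (W.sameOrder hk0' W.in0 ht).2.2
  have o2' := (W.sameOrder hk0'.symm W.in0 ht).2.2
  have s1 := W.sameTurn (W.pair_turn hdh e (Ne.symm hkh) hkd hdh.symm) (Ne.symm hkh) hkd hdh.symm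
    W.in0 ht
  have s2 := W.sameTurn (W.pair_turn hdh e (Ne.symm hkd) hkh hdh) (Ne.symm hkd) hkh hdh W.in0 ht
  have n1 := g.ncol h k d (Ne.symm hkh) hkd hdh.symm
  have n2 := g.ncol d k h (Ne.symm hkd) hkh hdh
  have e1 : orient (cfg p t₀ h) (cfg p t₀ k) (cfg p t₀ d) =
      ((p k t₀).1 - (p h t₀).1) * ((p d t₀).2 - (p h t₀).2) := by
    unfold orient cfg; rw [e]; ring
  have e2 : orient (cfg p t₀ d) (cfg p t₀ k) (cfg p t₀ h) =
      ((p k t₀).1 - (p h t₀).1) * ((p h t₀).2 - (p d t₀).2) := by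
    unfold orient cfg; rw [e]; ring
  rw [e1] at s1
  rw [e2] at s2
  rcases lt_or_gt_of_ne hk0 with hl | hl
  · have l1 := o1.1 hl
    have l2 := o2.1 (by rw [e]; exact hl)
    have p1 : ¬ orient (cfg p t h) (cfg p t k) (cfg p t d) < 0 := by
      rw [← s1, not_lt]
      exact mul_nonneg_of_nonpos_of_nonpos (by linarith) (by linarith)
    have p2 : orient (cfg p t d) (cfg p t k) (cfg p t h) < 0 :=
      s2.1 (mul_neg_of_neg_of_pos (by linarith) (by linarith))
    refine ⟨(under_iff_of_gt l1).2 (lt_of_le_of_ne (not_lt.1 p1) (Ne.symm n1)), ?_⟩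
    refine mul_pos_of_neg_of_neg p2 ?_
    unfold cfg; linarith
  · have l1 := o1'.1 hl
    have l2 := o2'.1 (by rw [e]; exact hl)
    have p1 : orient (cfg p t h) (cfg p t k) (cfg p t d) < 0 :=
      s1.1 (mul_neg_of_pos_of_neg (by linarith) (by linarith))
    have p2 : ¬ orient (cfg p t d) (cfg p t k) (cfg p t h) < 0 := by
      rw [← s2, not_lt]
      exact mul_nonneg (by linarith) (by linarith)
    refine ⟨(under_iff_of_lt l1).2 p1, ?_⟩
    refine mul_pos (lt_of_le_of_ne (not_lt.1 p2) (Ne.symm n2)) ?_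
    unfold cfg; linarith

/-- The pairs of corners do not change their order. -/
lemma corners_order (W : Window p τ x y t₀) {t : ℝ} (ht : t ∈ τ.life) :
    (∀ a, τ.left = .pt a → Before p t (.pt a) (.pt τ.apex)) ∧
    (∀ c, τ.right = .pt c → Before p t (.pt τ.apex) (.pt c)) ∧
    (∀ a c, τ.left = .pt a → τ.right = .pt c → Before p t (.pt a) (.pt c)) := by
  have h := W.apex t ht
  refine ⟨fun a ha => ?_, fun c hc => ?_, fun a c ha hc => ?_⟩
  · rw [← ha]; exact h.1
  · rw [← hc]; exact h.2
  · rw [← ha, ← hc]; exact before_trans h.1 h.2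

/-- A point that changes places with a corner is an inner point. -/
lemma inner_of_swap (W : Window p τ x y t₀) {z i : Fin n} (hz : z ∈ corners τ) (hzi : z ≠ i)
    (e : (p z t₀).1 = (p i t₀).1)
    (hsw : ¬ (Before p x (.pt z) (.pt i) ↔ Before p y (.pt z) (.pt i))) :
    i ∈ innerPoints p τ := by
  have gx := generic_of_mem W.genx
  have gy := generic_of_mem W.geny
  have dich : ∀ {t}, Generic (cfg p t) → ∀ {i j}, i ≠ j →
      (¬ Before p t (.pt i) (.pt j) ↔ Before p t (.pt j) (.pt i)) := by
    intro t g i j hij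
    have h1 := g.inj i j hij
    rw [before_iff h1, before_iff h1.symm, not_lt]
    exact ⟨fun h => lt_of_le_of_ne h h1.symm, le_of_lt⟩
  -- The order of `z` and `i` really changes. Corners never change their mutual order during the
  -- life span, so `i` is not a corner.
  have hno : ¬ ((Before p x (.pt z) (.pt i) ∧ Before p y (.pt z) (.pt i)) ∨
      (Before p x (.pt i) (.pt z) ∧ Before p y (.pt i) (.pt z))) := by
    rintro (h | h)
    · exact hsw (iff_of_true h.1 h.2)
    · exact hsw (iff_of_false ((dich gx hzi).2 h.1) ((dich gy hzi).2 h.2))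
  have cx := W.corners_order W.memx
  have cy := W.corners_order W.memy
  have c0 := W.corners_order W.mem
  have lt0 : ∀ {a c}, Before p t₀ (.pt a) (.pt c) → a ≠ c → ¬ (a = z ∧ c = i) →
      ¬ (a = i ∧ c = z) → (p a t₀).1 < (p c t₀).1 := by
    intro a c h hne n1 n2
    exact (before_iff (W.pair_only hzi e hne n1 n2)).1 h
  have ne_of : ∀ {a c}, Before p t₀ (.pt a) (.pt c) → a ≠ c := by
    rintro a c h rfl; exact before_irrefl h
  rcases hz with hz | rfl | hz
  · -- the left corner
    have hib : i ≠ τ.apex := by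
      rintro rfl; exact hno (Or.inl ⟨cx.1 z hz, cy.1 z hz⟩)
    -- On one side of the exchange `i` is to the right of the left corner. As it is near that corner
    -- at `t₀`, and no other order changes, it is also to the left of the right corner.
    have fin : ∀ {t}, t ∈ Set.Icc x y → t ∈ τ.life → Before p t (.pt z) (.pt i) →
        i ∈ innerPoints p τ := by
      intro t ht htl hbef
      refine ⟨hib, t, htl, by rw [hz]; exact hbef, ?_⟩
      rcases hr : τ.right with _ | c | _
      · have := (W.apex t htl).2; rw [hr] at this; exact this
      · have hic : i ≠ c := by
          rintro rfl; exact hno (Or.inl ⟨cx.2.2 z i hz hr, cy.2.2 z i hz hr⟩)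
        have hbc := c0.2.2 z c hz hr
        have hzc := ne_of hbc
        have l := lt0 hbc hzc (fun h => hic h.2.symm) (fun h => hzi h.1)
        rw [e] at l
        have so := W.sameOrder l.ne W.in0 ht
        exact (before_iff so.2.1).2 (so.2.2.1 l)
      · trivial
    by_cases h : Before p x (.pt z) (.pt i)
    · exact fin W.inx W.memx h
    · by_cases h' : Before p y (.pt z) (.pt i)
      · exact fin W.iny W.memy h'
      · exact absurd (iff_of_false h h') hsw
  · -- the apex
    -- At `t₀` the point has the x-coordinate of the apex, and so lies strictly between the
    -- endpoints.
    refine ⟨hzi.symm, t₀, W.mem, ?_, ?_⟩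
    · rcases hl : τ.left with _ | a | _
      · trivial
      · have hia : i ≠ a := by
          rintro rfl; exact hno (Or.inr ⟨cx.1 i hl, cy.1 i hl⟩)
        have hba := c0.1 a hl
        have l := lt0 hba (ne_of hba) (fun h => hzi h.2) (fun h => hia h.1.symm)
        rw [e] at l
        exact (before_iff l.ne).2 l
      · have := (W.apex t₀ W.mem).1; rw [hl] at this; exact this
    · rcases hr : τ.right with _ | c | _
      · have := (W.apex t₀ W.mem).2; rw [hr] at this; exact this
      · have hic : i ≠ c := by
          rintro rfl; exact hno (Or.inl ⟨cx.2.1 i hr, cy.2.1 i hr⟩)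
        have hbc := c0.2.1 c hr
        have l := lt0 hbc (ne_of hbc) (fun h => hic h.2.symm) (fun h => hzi h.1)
        rw [e] at l
        exact (before_iff l.ne).2 l
      · trivial
  · -- the right corner
    have hib : i ≠ τ.apex := by
      rintro rfl; exact hno (Or.inr ⟨cx.2.1 z hz, cy.2.1 z hz⟩)
    have fin : ∀ {t}, t ∈ Set.Icc x y → t ∈ τ.life → Before p t (.pt i) (.pt z) →
        i ∈ innerPoints p τ := by
      intro t ht htl hbef
      refine ⟨hib, t, htl, ?_, by rw [hz]; exact hbef⟩
      rcases hl : τ.left with _ | a | _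
      · trivial
      · have hia : i ≠ a := by
          rintro rfl; exact hno (Or.inr ⟨cx.2.2 i z hl hz, cy.2.2 i z hl hz⟩)
        have hba := c0.2.2 a z hl hz
        have l := lt0 hba (ne_of hba) (fun h => hzi h.2) (fun h => hia h.1.symm)
        rw [e] at l
        have so := W.sameOrder l.ne W.in0 ht
        exact (before_iff so.2.1).2 (so.2.2.1 l)
      · have := (W.apex t htl).1; rw [hl] at this; exact this
    by_cases h : Before p x (.pt z) (.pt i)
    · by_cases h' : Before p y (.pt z) (.pt i)
      · exact absurd (iff_of_true h h') hsw
      · exact fin W.iny W.memy ((dich gy hzi).1 h')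
    · exact fin W.inx W.memx ((dich gx hzi).1 h)

lemma ncard_symmDiff_le (W : Window p τ x y t₀) (π : Equiv.Perm (Fin n)) :
    (liveTri p τ π x ∆ liveTri p τ π y).ncard ≤ 6 * numInner p τ + 6 := by
  have h1 := ncard_funnelTri_le W.apex W.memx W.genx π
  have h2 := ncard_funnelTri_le W.apex W.memy W.geny π
  have h3 : liveTri p τ π x ∆ liveTri p τ π y ⊆ liveTri p τ π x ∪ liveTri p τ π y :=
    symmDiff_le_sup
  have h4 := (Set.ncard_le_ncard h3 (Set.toFinite _)).trans (Set.ncard_union_le _ _)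
  unfold liveTri at *
  omega

/-- The change of the triangulation at a time at which two points have the same `x`-coordinate. -/
lemma jump_pair (W : Window p τ x y t₀) {d h : Fin n} (hdh : d ≠ h)
    (e : (p d t₀).1 = (p h t₀).1) (hlt : (p d t₀).2 < (p h t₀).2) :
    (∀ π, liveTri p τ π x = liveTri p τ π y) ∨ t₀ ∈ pairTimes p τ := by
  have gx := generic_of_mem W.genx
  have gy := generic_of_mem W.geny
  have ord : ∀ i j, i ≠ j → ¬ (i = d ∧ j = h) → ¬ (i = h ∧ j = d) → SameOrder p x y i j :=
    fun i j hij n1 n2 => W.sameOrder (W.pair_only hdh e hij n1 n2) W.inx W.iny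
  have agree : ∀ i j k, i ≠ j → j ≠ k → i ≠ k →
      (orient (cfg p x i) (cfg p x j) (cfg p x k) < 0 ↔
        orient (cfg p y i) (cfg p y j) (cfg p y k) < 0) := fun i j k h1 h2 h3 =>
    W.sameTurn (W.pair_turn hdh e h1 h2 h3) h1 h2 h3 W.inx W.iny
  by_cases hsame : Before p x (.pt d) (.pt h) ↔ Before p y (.pt d) (.pt h)
  · left
    have so : SameOrder p x y d h := by
      refine ⟨gx.inj d h hdh, gy.inj d h hdh, ?_⟩
      rw [← before_iff (gx.inj d h hdh), ← before_iff (gy.inj d h hdh)]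
      exact hsame
    refine fun π => liveTri_congr W.apex W.memx W.genx W.geny (fun i j hij => ?_) agree π
    by_cases n1 : i = d ∧ j = h
    · obtain ⟨rfl, rfl⟩ := n1; exact so
    by_cases n2 : i = h ∧ j = d
    · obtain ⟨rfl, rfl⟩ := n2; exact so.symm
    exact ord i j hij n1 n2
  by_cases hd : d ∈ corners τ
  · right
    exact ⟨h, W.inner_of_swap hd hdh e hsame, d, hd, hdh.symm, e.symm⟩
  by_cases hh : h ∈ corners τ
  · right
    refine ⟨d, W.inner_of_swap hh hdh.symm e.symm (fun hc => hsame ?_), h, hh, hdh, e⟩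
    have h1 := gx.inj d h hdh
    have h2 := gy.inj d h hdh
    rw [before_iff h1.symm, before_iff h2.symm] at hc
    rw [before_iff h1, before_iff h2]
    exact (SameOrder.symm (p := p) ⟨h1.symm, h2.symm, hc⟩).2.2
  left
  intro π
  -- If neither point is a corner, both are on the same side of every corner and the parts do not
  -- change. The upper point hides the lower one, so their order is irrelevant.
  have nz : ∀ z ∈ corners τ, z ≠ d ∧ z ≠ h := fun z hz =>
    ⟨by rintro rfl; exact hd hz, by rintro rfl; exact hh hz⟩
  have hbc : τ.apex ∈ corners τ := Or.inr (Or.inl rfl)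
  obtain ⟨hL, hR⟩ := parts_congr (τ := τ) (p := p) (t := x) (t' := y)
    (fun z hz i hne => ord z i hne (fun c => (nz z hz).1 c.1) (fun c => (nz z hz).2 c.1))
  have trans : ∀ {z}, z ∈ corners τ → ((p z x).1 < (p d x).1 ↔ (p z x).1 < (p h x).1) ∧
      ((p d x).1 < (p z x).1 ↔ (p h x).1 < (p z x).1) := by
    intro z hz
    obtain ⟨z1, z2⟩ := nz z hz
    have s1 := W.sameOrder (W.pair_only hdh e z1 (fun c => z1 c.1) (fun c => z2 c.1)) W.inx W.in0
    have s2 := W.sameOrder (W.pair_only hdh e z2 (fun c => z1 c.1) (fun c => z2 c.1)) W.inx W.in0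
    rw [s1.2.2, s2.2.2, s1.symm.2.2, s2.symm.2.2, e]
    exact ⟨Iff.rfl, Iff.rfl⟩
  have bt : ∀ {z}, z ∈ corners τ → (Before p x (.pt z) (.pt d) → Before p x (.pt z) (.pt h)) ∧
      (Before p x (.pt d) (.pt z) → Before p x (.pt h) (.pt z)) := by
    intro z hz
    obtain ⟨z1, z2⟩ := nz z hz
    have i1 := gx.inj z d z1
    have i2 := gx.inj z h z2
    rw [before_iff i1, before_iff i2, before_iff i1.symm, before_iff i2.symm]
    exact ⟨(trans hz).1.1, (trans hz).2.1⟩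
  have dL : d ∈ leftPart p τ x → h ∈ leftPart p τ x := by
    rintro ⟨h1, h2⟩
    have h1 := h1.resolve_left (fun c => hd (Or.inl c))
    have h2 := h2.resolve_left (fun c => hd (Or.inr (Or.inl c)))
    refine ⟨Or.inr ?_, Or.inr ((bt hbc).2 h2)⟩
    rcases hl : τ.left with _ | a | _
    · trivial
    · rw [hl] at h1; exact (bt (Or.inl hl)).1 h1
    · rw [hl] at h1; exact h1
  have dR : d ∈ rightPart p τ x → h ∈ rightPart p τ x := by
    rintro ⟨h1, h2⟩
    have h1 := h1.resolve_left (fun c => hd (Or.inr (Or.inl c)))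
    have h2 := h2.resolve_left (fun c => hd (Or.inr (Or.inr c)))
    refine ⟨Or.inr ((bt hbc).1 h1), Or.inr ?_⟩
    rcases hr : τ.right with _ | c | _
    · rw [hr] at h2; exact h2
    · rw [hr] at h2; exact (bt (Or.inr (Or.inr hr))).2 h2
    · trivial
  unfold liveTri
  have hsx := sides_of_between gx.inj (W.apex x W.memx)
  have hsy := sides_of_between gy.inj (W.apex y W.memy)
  rw [← hL, ← hR] at hsy ⊢
  refine funnelTri_swap gx gy hsx hsy hdh (W.below hdh e hlt W.inx W.genx)
    (W.below hdh e hlt W.iny W.geny) (fun i j n1 n2 => ?_) agree (nz _ hbc).1.symm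
    (nz _ hbc).2.symm dL dR π
  by_cases hij : i = j
  · subst hij; simp
  · exact (ord i j hij n1 n2).2.2

end Window

end KineticTriangulation

/-! ### Change of the triangulation when three points are collinear. -/

namespace KineticTriangulation

variable {n : ℕ} {p : Motion n} {τ : PseudoTriangle n}

open scoped symmDiff

/-- A perturbation of a configuration with a single collinear triple. -/
lemma FlipAt.of_collinear {P0 PA PB : Config n} {i m k : Fin n} (gA : Generic PA)
    (gB : Generic PB) (ordA : ∀ x y, (P0 x).1 < (P0 y).1 ↔ (PA x).1 < (PA y).1)
    (ordB : ∀ x y, (P0 x).1 < (P0 y).1 ↔ (PB x).1 < (PB y).1)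
    (ne0 : ∀ x y w, x ≠ y → y ≠ w → x ≠ w →
      ¬ ((x = i ∨ x = m ∨ x = k) ∧ (y = i ∨ y = m ∨ y = k) ∧ (w = i ∨ w = m ∨ w = k)) →
      orient (P0 x) (P0 y) (P0 w) ≠ 0)
    (sgA : ∀ x y w, x ≠ y → y ≠ w → x ≠ w → orient (P0 x) (P0 y) (P0 w) ≠ 0 →
      (orient (P0 x) (P0 y) (P0 w) < 0 ↔ orient (PA x) (PA y) (PA w) < 0))
    (sgB : ∀ x y w, x ≠ y → y ≠ w → x ≠ w → orient (P0 x) (P0 y) (P0 w) ≠ 0 →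
      (orient (P0 x) (P0 y) (P0 w) < 0 ↔ orient (PB x) (PB y) (PB w) < 0))
    (him : (P0 i).1 < (P0 m).1) (hmk : (P0 m).1 < (P0 k).1)
    (col : orient (P0 i) (P0 m) (P0 k) = 0)
    (negA : orient (PA i) (PA m) (PA k) < 0) (posB : 0 < orient (PB i) (PB m) (PB k)) :
    FlipAt P0 PA PB i m k where
  gA := gA
  gB := gB
  ord x y := (ordA x y).symm.trans (ordB x y)
  him := (ordA _ _).1 him
  hmk := (ordA _ _).1 hmk
  agree x y w h1 h2 h3 h :=
    (sgA x y w h1 h2 h3 (ne0 x y w h1 h2 h3 h)).symm.trans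
      (sgB x y w h1 h2 h3 (ne0 x y w h1 h2 h3 h))
  negA := negA
  posB := posB
  compat r h1 h2 h3 := by
    have im : i ≠ m := by rintro rfl; exact lt_irrefl _ him
    have mk : m ≠ k := by rintro rfl; exact lt_irrefl _ hmk
    have ik : i ≠ k := by rintro rfl; exact lt_irrefl _ (him.trans hmk)
    rw [← sgA i m r im h2.symm h1.symm (ne0 i m r im h2.symm h1.symm (by tauto)),
      ← sgA i k r ik h3.symm h1.symm (ne0 i k r ik h3.symm h1.symm (by tauto)),
      ← sgA m k r mk h3.symm h2.symm (ne0 m k r mk h3.symm h2.symm (by tauto))]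
    -- At the moment of collinearity the three lines coincide, so the orientations with `r` differ
    -- by positive factors. They are nonzero, hence keep their signs nearby.
    have e1 : orient (P0 i) (P0 k) (P0 r) * ((P0 m).1 - (P0 i).1) =
        orient (P0 i) (P0 m) (P0 r) * ((P0 k).1 - (P0 i).1) := by
      have : orient (P0 i) (P0 k) (P0 r) * ((P0 m).1 - (P0 i).1) -
        orient (P0 i) (P0 m) (P0 r) * ((P0 k).1 - (P0 i).1) =
          - ((P0 r).1 - (P0 i).1) * orient (P0 i) (P0 m) (P0 k) := by unfold orient; ring
      rw [col, mul_zero] at this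
      linarith
    have e2 : orient (P0 m) (P0 k) (P0 r) * ((P0 m).1 - (P0 i).1) =
        orient (P0 i) (P0 m) (P0 r) * ((P0 k).1 - (P0 m).1) := by
      have : orient (P0 m) (P0 k) (P0 r) * ((P0 m).1 - (P0 i).1) -
        orient (P0 i) (P0 m) (P0 r) * ((P0 k).1 - (P0 m).1) =
          - ((P0 r).1 - (P0 m).1) * orient (P0 i) (P0 m) (P0 k) := by unfold orient; ring
      rw [col, mul_zero] at this
      linarith
    have key : ∀ {u v a b : ℝ}, 0 < a → 0 < b → v * a = u * b → (u < 0 ↔ v < 0) := by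
      intro u v a b ha hb he
      constructor <;> intro h
      · have := mul_neg_of_neg_of_pos h hb
        nlinarith
      · have := mul_neg_of_neg_of_pos h ha
        nlinarith
    exact ⟨key (sub_pos.2 him) (sub_pos.2 (him.trans hmk)) e1,
      key (sub_pos.2 him) (sub_pos.2 hmk) e2⟩
  ord0 := ordA
  sign0 x y w h1 h2 h3 h :=
    ⟨ne0 x y w h1 h2 h3 h, sgA x y w h1 h2 h3 (ne0 x y w h1 h2 h3 h)⟩
  col := col

/-- An event at time `t`. -/
def EventAt (p : Motion n) (τ : PseudoTriangle n) (t : ℝ) : Prop :=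
  t ∈ τ.life ∧ (EnvelopeEvent p τ t ∨ VisibilityEvent p τ t) ∧ t ∈ tripleTimes p τ

namespace Window

variable {x y t₀ : ℝ}

/-- The change of the triangulation at a time at which three points are collinear. -/
lemma jump_triple (W : Window p τ x y t₀) {i m k : Fin n}
    (hinj : ∀ a b, a ≠ b → (cfg p t₀ a).1 ≠ (cfg p t₀ b).1)
    (him : (cfg p t₀ i).1 < (cfg p t₀ m).1) (hmk : (cfg p t₀ m).1 < (cfg p t₀ k).1)
    (col : turn p t₀ i m k = 0) :
    (∀ π, liveTri p τ π x = liveTri p τ π y) ∨ (EventAt p τ t₀ ∧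
      Cost (innerPoints p τ) (fun π => (liveTri p τ π x ∆ liveTri p τ π y).ncard)) := by
  have im : i ≠ m := by rintro rfl; exact lt_irrefl _ him
  have mk : m ≠ k := by rintro rfl; exact lt_irrefl _ hmk
  have ik : i ≠ k := by rintro rfl; exact lt_irrefl _ (him.trans hmk)
  have gx := generic_of_mem W.genx
  have gy := generic_of_mem W.geny
  have so : ∀ a b, a ≠ b → ∀ {t t'}, t ∈ Set.Icc x y → t' ∈ Set.Icc x y →
      SameOrder p t t' a b := fun a b hab _ _ ht ht' => W.sameOrder (hinj a b hab) ht ht'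
  have ord : ∀ a b, ∀ {t}, t ∈ Set.Icc x y →
      ((cfg p t₀ a).1 < (cfg p t₀ b).1 ↔ (cfg p t a).1 < (cfg p t b).1) := by
    intro a b t ht
    by_cases hab : a = b
    · subst hab; simp
    · exact (so a b hab W.in0 ht).2.2
  have ne0 : ∀ a b c, a ≠ b → b ≠ c → a ≠ c →
      ¬ ((a = i ∨ a = m ∨ a = k) ∧ (b = i ∨ b = m ∨ b = k) ∧ (c = i ∨ c = m ∨ c = k)) →
      orient (cfg p t₀ a) (cfg p t₀ b) (cfg p t₀ c) ≠ 0 := by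
    intro a b c h1 h2 h3 h e
    have := W.pos.separate t₀ (triple_mem_degeneracies h1 h2 h3 e)
      (triple_mem_degeneracies im mk ik col)
    refine h ⟨?_, ?_, ?_⟩
    · have : a ∈ ({i, m, k} : Finset (Fin n)) := by rw [← this]; simp
      simpa using this
    · have : b ∈ ({i, m, k} : Finset (Fin n)) := by rw [← this]; simp
      simpa using this
    · have : c ∈ ({i, m, k} : Finset (Fin n)) := by rw [← this]; simp
      simpa using this
  have sg : ∀ a b c, a ≠ b → b ≠ c → a ≠ c → ∀ {t}, t ∈ Set.Icc x y →
      orient (cfg p t₀ a) (cfg p t₀ b) (cfg p t₀ c) ≠ 0 →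
      (orient (cfg p t₀ a) (cfg p t₀ b) (cfg p t₀ c) < 0 ↔
        orient (cfg p t a) (cfg p t b) (cfg p t c) < 0) :=
    fun a b c h1 h2 h3 _ ht h0 => W.sameTurn h0 h1 h2 h3 W.in0 ht
  obtain ⟨hL, hR⟩ := parts_congr (τ := τ) (p := p) (fun z _ i hne => so z i hne W.inx W.iny)
  obtain ⟨hL0, hR0⟩ := parts_congr (τ := τ) (p := p) (fun z _ i hne => so z i hne W.inx W.in0)
  -- the two possible directions of the passage
  have main : ∀ {u v : ℝ}, u ∈ Set.Icc x y → v ∈ Set.Icc x y → Generic (cfg p u) →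
      Generic (cfg p v) → u ∈ τ.life → leftPart p τ u = leftPart p τ x →
      rightPart p τ u = rightPart p τ x → leftPart p τ v = leftPart p τ x →
      rightPart p τ v = rightPart p τ x →
      orient (cfg p u i) (cfg p u m) (cfg p u k) < 0 →
      0 < orient (cfg p v i) (cfg p v m) (cfg p v k) →
      (∀ π, liveTri p τ π u = liveTri p τ π v) ∨ (EventAt p τ t₀ ∧
        Cost (innerPoints p τ) (fun π => (liveTri p τ π u ∆ liveTri p τ π v).ncard)) := by
    intro u v hu hv gu gv hul hLu hRu hLv hRv negA posB
    have F := FlipAt.of_collinear gu gv (fun a b => ord a b hu) (fun a b => ord a b hv) ne0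
      (fun a b c h1 h2 h3 => sg a b c h1 h2 h3 hu) (fun a b c h1 h2 h3 => sg a b c h1 h2 h3 hv)
      him hmk col negA posB
    have hs := sides_of_between gu.inj (W.apex u hul)
    have hI := innerSet W.apex hul gu.inj
    have sub : ∀ {a}, a ∈ leftPart p τ u ∪ rightPart p τ u → a ∈ innerPoints p τ ∪ corners τ := by
      rintro a (h | h)
      · exact left_subset W.apex hul h
      · exact right_subset W.apex hul h
    have key := F.dichotomy hs hI
    unfold liveTri
    rw [hLv, hRv, ← hLu, ← hRu]
    refine key.imp_right ?_
    rintro ⟨⟨h1, h2, h3⟩, hev, hcost⟩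
    refine ⟨⟨W.mem, event_of_ev hinj ?_, i, sub h1, m, sub h2, k, sub h3, im, mk, ik, col⟩, hcost⟩
    rw [← hL0, ← hR0, ← hLu, ← hRu]
    exact hev
  have nx := gx.ncol i m k im mk ik
  have ny := gy.ncol i m k im mk ik
  -- If the triple only touches collinearity without crossing it, the order type is the same on both
  -- sides. Otherwise the side on which `m` is above the segment `i k` plays the role of `PA`.
  by_cases hsame : orient (cfg p x i) (cfg p x m) (cfg p x k) < 0 ↔
      orient (cfg p y i) (cfg p y m) (cfg p y k) < 0
  · left
    refine fun π => liveTri_congr W.apex W.memx W.genx W.geny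
      (fun a b hab => so a b hab W.inx W.iny) (fun a b c h1 h2 h3 => ?_) π
    by_cases h : (a = i ∨ a = m ∨ a = k) ∧ (b = i ∨ b = m ∨ b = k) ∧ (c = i ∨ c = m ∨ c = k)
    · have pos : 0 < orient (cfg p x i) (cfg p x m) (cfg p x k) ↔
          0 < orient (cfg p y i) (cfg p y m) (cfg p y k) := by
        rw [← not_le, ← not_le, le_iff_lt_or_eq, le_iff_lt_or_eq]
        tauto
      have r1 : ∀ {P : Config n}, (orient (P m) (P k) (P i) = orient (P i) (P m) (P k)) ∧
          (orient (P k) (P i) (P m) = orient (P i) (P m) (P k)) ∧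
          (orient (P i) (P k) (P m) = - orient (P i) (P m) (P k)) ∧
          (orient (P k) (P m) (P i) = - orient (P i) (P m) (P k)) ∧
          (orient (P m) (P i) (P k) = - orient (P i) (P m) (P k)) := by
        intro P
        unfold orient
        refine ⟨?_, ?_, ?_, ?_, ?_⟩ <;> ring
      obtain ⟨ha, hb, hc⟩ := h
      rcases ha with rfl | rfl | rfl <;> rcases hb with rfl | rfl | rfl <;>
        rcases hc with rfl | rfl | rfl <;>
        first
        | exact absurd rfl h1
        | exact absurd rfl h2
        | exact absurd rfl h3
        | simpa only [r1, Left.neg_neg_iff] using hsame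
        | simpa only [r1, Left.neg_neg_iff] using pos
    · rw [← sg a b c h1 h2 h3 W.inx (ne0 a b c h1 h2 h3 h),
        ← sg a b c h1 h2 h3 W.iny (ne0 a b c h1 h2 h3 h)]
  · rcases lt_or_gt_of_ne nx with hx | hx
    · have hy : 0 < orient (cfg p y i) (cfg p y m) (cfg p y k) := by
        rcases lt_or_gt_of_ne ny with h | h
        · exact absurd (iff_of_true hx h) hsame
        · exact h
      exact main W.inx W.iny gx gy W.memx rfl rfl hL.symm hR.symm hx hy
    · have hy : orient (cfg p y i) (cfg p y m) (cfg p y k) < 0 := by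
        rcases lt_or_gt_of_ne ny with h | h
        · exact h
        · exact absurd (iff_of_false (not_lt.2 hx.le) (not_lt.2 h.le)) hsame
      have := main W.iny W.inx gy gx W.memy hL.symm hR.symm rfl rfl hy hx
      rcases this with h | ⟨h1, h2⟩
      · exact Or.inl fun π => (h π).symm
      · refine Or.inr ⟨h1, ?_⟩
        simpa only [symmDiff_comm] using h2

/-- The change of the triangulation at a degenerate time. -/
theorem jump (W : Window p τ x y t₀) (ht₀ : t₀ ∉ genericTimes p) :
    (∀ π, liveTri p τ π x = liveTri p τ π y) ∨
      (t₀ ∈ pairTimes p τ ∧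
        ∀ π, (liveTri p τ π x ∆ liveTri p τ π y).ncard ≤ 6 * numInner p τ + 6) ∨
      (EventAt p τ t₀ ∧
        Cost (innerPoints p τ) (fun π => (liveTri p τ π x ∆ liveTri p τ π y).ncard)) := by
  obtain ⟨S, hS⟩ := Set.nonempty_iff_ne_empty.2 (show degeneracies p t₀ ≠ ∅ from ht₀)
  have hS' := hS
  rcases hS with ⟨hc, hS⟩ | ⟨hc, hS⟩
  · obtain ⟨i, j, hij, rfl⟩ := Finset.card_eq_two.1 hc
    have e : (p i t₀).1 = (p j t₀).1 := hS i (by simp) j (by simp)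
    have hne : (p i t₀).2 ≠ (p j t₀).2 := fun e' => W.pos.distinct t₀ i j hij (Prod.ext e e')
    have key : (∀ π, liveTri p τ π x = liveTri p τ π y) ∨ t₀ ∈ pairTimes p τ := by
      rcases lt_or_gt_of_ne hne with h | h
      · exact W.jump_pair hij e h
      · exact W.jump_pair hij.symm e.symm h
    exact key.imp_right fun h => Or.inl ⟨h, W.ncard_symmDiff_le⟩
  · have hinj : ∀ a b, a ≠ b → (cfg p t₀ a).1 ≠ (cfg p t₀ b).1 := by
      intro a b hab e
      have := congrArg Finset.card (W.pos.separate t₀ hS' (pair_mem_degeneracies hab e))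
      rw [hc, Finset.card_pair hab] at this
      omega
    obtain ⟨l, hl, hmem⟩ := exists_sorted (f := fun a => (cfg p t₀ a).1) hinj (S : Set (Fin n))
    have nd : l.Nodup := hl.imp (by intro a b hab e; subst e; exact lt_irrefl _ hab)
    have hlS : l.toFinset = S := by
      ext a; rw [List.mem_toFinset, hmem, Finset.mem_coe]
    have hlen : l.length = 3 := by
      rw [← List.toFinset_card_of_nodup nd, hlS, hc]
    obtain ⟨i, m, k, rfl⟩ := List.length_eq_three.1 hlen
    simp only [List.pairwise_cons, List.mem_cons, List.not_mem_nil, or_false, forall_eq_or_imp,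
      forall_eq] at hl
    have mS : ∀ a, a ∈ [i, m, k] → a ∈ S := fun a ha => by
      have := (hmem a).1 ha
      exact_mod_cast this
    have := W.jump_triple hinj hl.1.1 hl.2.1 (hS i (mS i (by simp)) m (mS m (by simp))
      k (mS k (by simp)))
    exact this.imp_right Or.inr

end Window

end KineticTriangulation

/-! ### Summation over all degenerate times, and the final estimate. -/

namespace KineticTriangulation

variable {n : ℕ} {p : Motion n} {τ : PseudoTriangle n}

open scoped symmDiff

section Jumps

/-- The triangulations just before and after `t₀` do not depend on the window, so the set of changed
edges is well defined even though it is given by a choice. -/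
lemma Window.liveTri_eq {x y x' y' t₀ : ℝ} (W : Window p τ x y t₀) (W' : Window p τ x' y' t₀)
    (π : Equiv.Perm (Fin n)) :
    liveTri p τ π x = liveTri p τ π x' ∧ liveTri p τ π y = liveTri p τ π y' := by
  constructor
  · rcases le_total x x' with h | h
    · refine liveTri_const W.cont W.apex h W.memx (fun t ht => W.gen t ⟨ht.1, ?_⟩ ?_) π
      · linarith [ht.2, W'.ltx, W.lty]
      · rintro rfl; linarith [ht.2, W'.ltx]
    · refine (liveTri_const W.cont W.apex h W'.memx (fun t ht => W'.gen t ⟨ht.1, ?_⟩ ?_) π).symm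
      · linarith [ht.2, W.ltx, W'.lty]
      · rintro rfl; linarith [ht.2, W.ltx]
  · rcases le_total y y' with h | h
    · refine liveTri_const W.cont W.apex h W.memy (fun t ht => W'.gen t ⟨?_, ht.2⟩ ?_) π
      · linarith [ht.1, W.lty, W'.ltx]
      · rintro rfl; linarith [ht.1, W.lty]
    · refine (liveTri_const W.cont W.apex h W'.memy (fun t ht => W.gen t ⟨?_, ht.2⟩ ?_) π).symm
      · linarith [ht.1, W'.lty, W.ltx]
      · rintro rfl; linarith [ht.1, W'.lty]

open Classical in
/-- The edges that are inserted or deleted at time `t`. -/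
noncomputable def changedEdges (p : Motion n) (τ : PseudoTriangle n) (π : Equiv.Perm (Fin n))
    (t : ℝ) : Set (Sym2 (Fin n)) :=
  if h : ∃ xy : ℝ × ℝ, Window p τ xy.1 xy.2 t then
    liveTri p τ π h.choose.1 ∆ liveTri p τ π h.choose.2 else ∅

lemma Window.changedEdges_eq {x y t₀ : ℝ} (W : Window p τ x y t₀) (π : Equiv.Perm (Fin n)) :
    changedEdges p τ π t₀ = liveTri p τ π x ∆ liveTri p τ π y := by
  have h : ∃ xy : ℝ × ℝ, Window p τ xy.1 xy.2 t₀ := ⟨(x, y), W⟩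
  rw [changedEdges, dif_pos h, (h.choose_spec.liveTri_eq W π).1, (h.choose_spec.liveTri_eq W π).2]

variable {s : ℕ}

/-- The number of insertions and deletions is the sum of the numbers of changes at the degenerate
times. -/
lemma numChanges_le (hp : PseudoAlgebraic p s) (hg : GeneralPosition p)
    (hL : τ.life.OrdConnected) (hb : ∀ t ∈ τ.life, τ.apex ∈ Between p t τ.left τ.right)
    (π : Equiv.Perm (Fin n)) :
    numChanges p τ π ≤ ∑ t ∈ (finite_compl_genericTimes hp).toFinset,
      ((changedEdges p τ π t).ncard : ENNReal) := by
  classical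
  set D := (finite_compl_genericTimes hp).toFinset with hD
  have memD : ∀ t, t ∈ D ↔ t ∉ genericTimes p := by intro t; simp [hD]
  have gen : ∀ {t}, t ∉ D → t ∈ genericTimes p := by
    intro t ht; by_contra h; exact ht ((memD t).2 h)
  have hset : τ.life ∩ genericTimes p = τ.life \ D := by
    ext t; simp [memD]
  have tri : ∀ {t}, t ∈ τ.life → t ∉ D → triEdges p τ π t = liveTri p τ π t := fun ht h =>
    triEdges_eq (gen h) (hb _ ht) π
  have step : ∀ e : Sym2 (Fin n),
      eVariationOn (fun t => if e ∈ triEdges p τ π t then (1 : ℝ) else 0)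
        (τ.life ∩ genericTimes p) ≤
      ∑ t ∈ D, (if e ∈ changedEdges p τ π t then (1 : ENNReal) else 0) := by
    intro e
    rw [hset]
    refine eVariationOn_le_sum_jumps hL ?_ ?_
    · intro x hx hxD y hy hyD hxy hno
      have : liveTri p τ π x = liveTri p τ π y := by
        refine liveTri_const hp.continuous hb hxy.le hx (fun t ht => gen fun h => ?_) π
        refine hno t h ⟨lt_of_le_of_ne ht.1 ?_, lt_of_le_of_ne ht.2 ?_⟩
        · rintro rfl; exact hxD h
        · rintro rfl; exact hyD h
      simp only [tri hx hxD, tri hy hyD, this]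
    · intro x hx hxD y hy hyD t₀ ht₀ h1 h2 hone
      have W : Window p τ x y t₀ := ⟨hp.continuous, hg, hb, hx, hy,
        hL.out hx hy ⟨h1.le, h2.le⟩, h1, h2, fun t ht hne => gen fun h => hne (hone t h
          (lt_of_le_of_ne ht.1 (by rintro rfl; exact hxD h))
          (lt_of_le_of_ne ht.2 (by rintro rfl; exact hyD h)))⟩
      simp only [tri hx hxD, tri hy hyD, W.changedEdges_eq, Set.mem_symmDiff]
      by_cases c1 : e ∈ liveTri p τ π x <;> by_cases c2 : e ∈ liveTri p τ π y <;>
        simp [c1, c2, edist_dist]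
  unfold numChanges
  refine (Finset.sum_le_sum (g := fun e => ∑ t ∈ D,
    (if e ∈ changedEdges p τ π t then (1 : ENNReal) else 0)) fun e _ => ?_).trans ?_
  · convert step e
  -- Summing over the edges first counts, at each time, the edges that change.
  · rw [Finset.sum_comm]
    refine Finset.sum_le_sum fun t _ => ?_
    rw [Finset.sum_boole, Set.ncard_eq_toFinset_card']
    refine le_of_eq ?_
    congr 2
    ext e; simp

-- The three outcomes of `Window.jump`: no change, a linear change for every permutation, or a
-- change that is logarithmic on average.
open Classical in
lemma sum_changedEdges_le (hg : Set.Finite (genericTimes p)ᶜ)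
    {𝒜 : Finset (Equiv.Perm (Fin n))}
    (hcl : ∀ π ∈ 𝒜, ∀ x ∈ innerPoints p τ, ∀ y ∈ innerPoints p τ, π * Equiv.swap x y ∈ 𝒜)
    {t : ℝ} (ht : t ∈ hg.toFinset) :
    ∑ π ∈ 𝒜, ((changedEdges p τ π t).ncard : ℝ) ≤
      𝒜.card * ((if t ∈ pairTimes p τ then 6 * (numInner p τ : ℝ) + 6 else 0) +
        if EventAt p τ t then 11 + 30 * (harmonic (numInner p τ) : ℝ) else 0) := by
  have hpos : (0 : ℝ) ≤ harmonic (numInner p τ) := by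
    unfold harmonic
    push_cast
    exact Finset.sum_nonneg fun i _ => by positivity
  have hn1 : (0 : ℝ) ≤ if t ∈ pairTimes p τ then 6 * (numInner p τ : ℝ) + 6 else 0 := by
    split_ifs <;> positivity
  have hn2 : (0 : ℝ) ≤ if EventAt p τ t then 11 + 30 * (harmonic (numInner p τ) : ℝ) else 0 := by
    split_ifs <;> linarith
  -- Without a window around `t` the set of changed edges is empty by definition.
  by_cases hW : ∃ xy : ℝ × ℝ, Window p τ xy.1 xy.2 t
  swap
  · have : ∀ π, changedEdges p τ π t = ∅ := fun π => by rw [changedEdges, dif_neg hW]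
    simp only [this, Set.ncard_empty, Nat.cast_zero, Finset.sum_const_zero]
    positivity
  obtain ⟨⟨x, y⟩, W⟩ := hW
  dsimp only at W
  simp only [W.changedEdges_eq]
  rcases W.jump (by simpa using ht) with h | ⟨h1, h2⟩ | ⟨h1, h2⟩
  · simp only [h, symmDiff_self, Set.bot_eq_empty, Set.ncard_empty, Nat.cast_zero,
      Finset.sum_const_zero]
    positivity
  · rw [if_pos h1]
    calc ∑ π ∈ 𝒜, ((liveTri p τ π x ∆ liveTri p τ π y).ncard : ℝ)
        ≤ ∑ π ∈ 𝒜, (6 * (numInner p τ : ℝ) + 6) :=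
          Finset.sum_le_sum fun π _ => by exact_mod_cast h2 π
      _ = 𝒜.card * (6 * (numInner p τ : ℝ) + 6) := by rw [Finset.sum_const, nsmul_eq_mul]
      _ ≤ _ := mul_le_mul_of_nonneg_left (by linarith) (Nat.cast_nonneg _)
  · rw [if_pos h1]
    refine (h2.sum_le hcl).trans ?_
    unfold numInner at *
    exact mul_le_mul_of_nonneg_left (by linarith) (Nat.cast_nonneg _)

end Jumps

section TimeCounts

variable {s : ℕ}

lemma card_le_of_encard_le {X : Set ℝ} {F : Finset ℝ} (hX : X.encard ≤ s) (hF : ∀ t ∈ F, t ∈ X) :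
    F.card ≤ s := by
  have h1 : (F : Set ℝ).encard ≤ X.encard := Set.encard_le_encard fun t ht => hF t ht
  rw [Set.encard_coe_eq_coe_finsetCard] at h1
  exact_mod_cast h1.trans hX

lemma ncard_corners_le (τ : PseudoTriangle n) : (corners τ).ncard ≤ 3 := by
  have one : ∀ a : APoint n, {z | a = .pt z}.ncard ≤ 1 := by
    intro a
    refine (Set.ncard_le_one_iff (Set.toFinite _)).2 ?_
    intro x y hx hy
    have : APoint.pt x = APoint.pt y := (show a = .pt x from hx).symm.trans hy
    exact APoint.pt.inj this
  have hsub : corners τ ⊆ ({z | τ.left = .pt z} ∪ {τ.apex}) ∪ {z | τ.right = .pt z} := by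
    rintro z (h | h | h)
    · exact Or.inl (Or.inl h)
    · exact Or.inl (Or.inr h)
    · exact Or.inr h
  have h0 := Set.ncard_le_ncard hsub (Set.toFinite _)
  have h1 := Set.ncard_union_le ({z | τ.left = .pt z} ∪ {τ.apex}) {z | τ.right = .pt z}
  have h2 := Set.ncard_union_le {z | τ.left = .pt z} {τ.apex}
  have h3 := one τ.left
  have h4 := one τ.right
  rw [Set.ncard_singleton] at h2
  omega

lemma card_pairTimes_le (hp : PseudoAlgebraic p s) {F : Finset ℝ}
    (hF : ∀ t ∈ F, t ∈ pairTimes p τ) : F.card ≤ 3 * numInner p τ * s := by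
  classical
  set I := (Set.toFinite (innerPoints p τ)).toFinset with hI
  set K := (Set.toFinite (corners τ)).toFinset with hK
  have hIc : I.card = numInner p τ := (Set.ncard_eq_toFinset_card _ _).symm
  have hKc : K.card ≤ 3 := by
    rw [← Set.ncard_eq_toFinset_card]; exact ncard_corners_le τ
  have hsub : F ⊆ (I ×ˢ K).biUnion fun a =>
      F.filter fun t => a.1 ≠ a.2 ∧ (p a.1 t).1 = (p a.2 t).1 := by
    intro t ht
    obtain ⟨i, hi, z, hz, hne, e⟩ := hF t ht
    rw [Finset.mem_biUnion]
    exact ⟨(i, z), by simp [hI, hK, hi, hz], by simp [ht, hne, e]⟩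
  have h1 := (Finset.card_le_card hsub).trans (Finset.card_biUnion_le_card_mul _ _ s ?_)
  · rw [Finset.card_product, hIc] at h1
    calc F.card ≤ numInner p τ * K.card * s := h1
      _ ≤ numInner p τ * 3 * s := by gcongr
      _ = 3 * numInner p τ * s := by ring
  · rintro ⟨i, z⟩ -
    by_cases hne : i = z
    · simp [hne]
    · exact card_le_of_encard_le (hp.pair i z hne) (fun t ht => (Finset.mem_filter.1 ht).2.2)

/-- This crude bound on the number of events is needed for `N = 1`, where the logarithm vanishes and
the events must be absorbed into `N ^ 2`. -/
lemma card_tripleTimes_le (hp : PseudoAlgebraic p s) {F : Finset ℝ}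
    (hF : ∀ t ∈ F, t ∈ tripleTimes p τ) : F.card ≤ (numInner p τ + 3) ^ 3 * s := by
  classical
  set K := (Set.toFinite (innerPoints p τ ∪ corners τ)).toFinset with hK
  have hKc : K.card ≤ numInner p τ + 3 := by
    rw [← Set.ncard_eq_toFinset_card]
    have := ncard_corners_le τ
    have := Set.ncard_union_le (innerPoints p τ) (corners τ)
    unfold numInner
    omega
  have hsub : F ⊆ (K ×ˢ K ×ˢ K).biUnion fun a => F.filter fun t =>
      a.1 ≠ a.2.1 ∧ a.2.1 ≠ a.2.2 ∧ a.1 ≠ a.2.2 ∧ turn p t a.1 a.2.1 a.2.2 = 0 := by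
    intro t ht
    obtain ⟨i, hi, j, hj, k, hk, h⟩ := hF t ht
    rw [Finset.mem_biUnion]
    refine ⟨(i, j, k), ?_, Finset.mem_filter.2 ⟨ht, h⟩⟩
    simp only [Finset.mem_product, hK, Set.Finite.mem_toFinset]
    exact ⟨hi, hj, hk⟩
  have h1 := (Finset.card_le_card hsub).trans (Finset.card_biUnion_le_card_mul _ _ s ?_)
  · rw [Finset.card_product, Finset.card_product] at h1
    calc F.card ≤ K.card * (K.card * K.card) * s := h1
      _ ≤ (numInner p τ + 3) * ((numInner p τ + 3) * (numInner p τ + 3)) * s := by gcongr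
      _ = (numInner p τ + 3) ^ 3 * s := by ring
  · rintro ⟨i, j, k⟩ -
    by_cases hne : i ≠ j ∧ j ≠ k ∧ i ≠ k
    · exact card_le_of_encard_le (hp.triple i j k hne.1 hne.2.1 hne.2.2)
        (fun t ht => (Finset.mem_filter.1 ht).2.2.2.2)
    · rw [Finset.filter_false_of_mem]
      · simp
      · exact fun t _ h => hne ⟨h.1, h.2.1, h.2.2.1⟩

lemma notMem_genericTimes_of_collinear {t : ℝ} {i j k : Fin n} (h1 : i ≠ j) (h2 : j ≠ k)
    (h3 : i ≠ k) (h : turn p t i j k = 0) : t ∉ genericTimes p := by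
  intro ht
  have := triple_mem_degeneracies h1 h2 h3 h
  rw [show degeneracies p t = ∅ from ht] at this
  exact this

lemma Lt.ne {t : ℝ} {i j : Fin n} (h : Lt p t i j) : i ≠ j := by
  rintro rfl; exact before_irrefl h

lemma EnvelopeEvent.notMem {t : ℝ} (h : EnvelopeEvent p τ t) : t ∉ genericTimes p := by
  obtain ⟨w, u, -, ⟨i, -, j, -, k, -, -, h1, h2, h3, -⟩ | ⟨i, -, j, -, k, -, -, h1, h2, h3, -⟩⟩ := h
  · exact notMem_genericTimes_of_collinear (Lt.ne h1) (Lt.ne h2)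
      (Lt.ne (p := p) (before_trans h1 h2)) h3
  · exact notMem_genericTimes_of_collinear (Lt.ne h1) (Lt.ne h2)
      (Lt.ne (p := p) (before_trans h1 h2)) h3

lemma ne_of_mem_parts {t : ℝ} {i q : Fin n} (hi : i ∈ leftPart p τ t) (hq : q ∈ rightPart p τ t)
    (h : i ≠ τ.apex ∨ q ≠ τ.apex) : i ≠ q := by
  rintro rfl
  have hne : i ≠ τ.apex := by tauto
  exact Lt.ne (p := p) (before_trans (hi.2.resolve_left hne) (hq.1.resolve_left hne)) rfl

lemma VisibilityEvent.notMem {t : ℝ} (h : VisibilityEvent p τ t) : t ∉ genericTimes p := by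
  obtain ⟨w, u, -, ⟨q, hq, hqb, -, i, hi, j, hj, ⟨h1, -⟩, h2⟩ |
    ⟨q, hq, hqb, -, i, hi, j, hj, ⟨h1, -⟩, h2⟩⟩ := h
  · exact notMem_genericTimes_of_collinear (Lt.ne h1) (ne_of_mem_parts hj hq.1 (Or.inr hqb))
      (ne_of_mem_parts hi hq.1 (Or.inr hqb)) h2
  · exact notMem_genericTimes_of_collinear (Lt.ne h1) (ne_of_mem_parts hq.1 hj (Or.inl hqb)).symm
      (ne_of_mem_parts hq.1 hi (Or.inl hqb)).symm h2

/-- `Set.ncard` of an infinite set is zero, so finiteness of both event sets is essential; it holds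
because all events are degenerate times. -/
lemma card_events_le (hp : PseudoAlgebraic p s) {F : Finset ℝ}
    (hF : ∀ t ∈ F, EventAt p τ t) : F.card ≤ numEnvelope p τ + numVisibility p τ := by
  have fin := finite_compl_genericTimes hp
  have f1 : {t | t ∈ τ.life ∧ EnvelopeEvent p τ t}.Finite := fin.subset fun t ht => ht.2.notMem
  have f2 : {t | t ∈ τ.life ∧ VisibilityEvent p τ t}.Finite := fin.subset fun t ht => ht.2.notMem
  have hsub : (F : Set ℝ) ⊆ {t | t ∈ τ.life ∧ EnvelopeEvent p τ t} ∪
      {t | t ∈ τ.life ∧ VisibilityEvent p τ t} := by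
    intro t ht
    obtain ⟨h1, h2 | h2, -⟩ := hF t ht
    · exact Or.inl ⟨h1, h2⟩
    · exact Or.inr ⟨h1, h2⟩
  have := (Set.ncard_le_ncard hsub (f1.union f2)).trans (Set.ncard_union_le _ _)
  rwa [Set.ncard_coe_finset] at this

end TimeCounts

/-- The expected number of changes, in terms of the numbers of times of the two kinds at which the
triangulation may change. -/
theorem expectedChanges_le {s : ℕ} (hp : PseudoAlgebraic p s) (hg : GeneralPosition p)
    (hτ : ∃ π, Appears p τ π) :
    ∃ a e : ℕ, a ≤ 3 * numInner p τ * s ∧ e ≤ numEnvelope p τ + numVisibility p τ ∧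
      e ≤ (numInner p τ + 3) ^ 3 * s ∧
      expectedChanges p τ ≤ ENNReal.ofReal (a * (6 * (numInner p τ : ℝ) + 6) +
        e * (11 + 30 * (harmonic (numInner p τ) : ℝ))) := by
  classical
  obtain ⟨π₀, h₀⟩ := hτ
  have hL : τ.life.OrdConnected := h₀.1.1.isPreconnected.ordConnected
  have hb : ∀ t ∈ τ.life, τ.apex ∈ Between p t τ.left τ.right := fun t ht => (h₀.1.2 t ht).2.1
  set D := (finite_compl_genericTimes hp).toFinset with hD
  set 𝒜 := Finset.univ.filter fun π : Equiv.Perm (Fin n) => Appears p τ π with h𝒜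
  -- The permutations for which τ appears are closed under exchanges of inner points; this is all
  -- that the averaging needs of the conditioning.
  have hcl : ∀ π ∈ 𝒜, ∀ x ∈ innerPoints p τ, ∀ y ∈ innerPoints p τ, π * Equiv.swap x y ∈ 𝒜 := by
    intro π hπ x hx y hy
    rw [h𝒜, Finset.mem_filter] at hπ ⊢
    exact ⟨Finset.mem_univ _, hπ.2.swap hx hy⟩
  have hpos : 0 < 𝒜.card := Finset.card_pos.2 ⟨π₀, by simp [h𝒜, h₀]⟩
  refine ⟨(D.filter fun t => t ∈ pairTimes p τ).card, (D.filter fun t => EventAt p τ t).card,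
    card_pairTimes_le hp (fun t ht => (Finset.mem_filter.1 ht).2),
    card_events_le hp (fun t ht => (Finset.mem_filter.1 ht).2),
    card_tripleTimes_le hp (fun t ht => (Finset.mem_filter.1 ht).2.2.2), ?_⟩
  have hreal : ∑ π ∈ 𝒜, ∑ t ∈ D, ((changedEdges p τ π t).ncard : ℝ) ≤ 𝒜.card *
      (((D.filter fun t => t ∈ pairTimes p τ).card : ℝ) * (6 * (numInner p τ : ℝ) + 6) +
        ((D.filter fun t => EventAt p τ t).card : ℝ) *
          (11 + 30 * (harmonic (numInner p τ) : ℝ))) := by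
    rw [Finset.sum_comm]
    refine (Finset.sum_le_sum fun t ht =>
      sum_changedEdges_le (finite_compl_genericTimes hp) hcl ht).trans ?_
    rw [← Finset.mul_sum, Finset.sum_add_distrib, ← Finset.sum_filter, ← Finset.sum_filter,
      Finset.sum_const, Finset.sum_const, nsmul_eq_mul, nsmul_eq_mul]
  have hsum : ∑ π ∈ 𝒜, numChanges p τ π ≤ ENNReal.ofReal
      (∑ π ∈ 𝒜, ∑ t ∈ D, ((changedEdges p τ π t).ncard : ℝ)) := by
    refine (Finset.sum_le_sum fun π _ => numChanges_le hp hg hL hb π).trans ?_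
    have : (∑ π ∈ 𝒜, ∑ t ∈ D, ((changedEdges p τ π t).ncard : ℝ)) =
        ((∑ π ∈ 𝒜, ∑ t ∈ D, (changedEdges p τ π t).ncard : ℕ) : ℝ) := by push_cast; rfl
    rw [this, ENNReal.ofReal_natCast]
    push_cast
    exact le_rfl
  unfold expectedChanges
  refine ENNReal.div_le_of_le_mul ?_
  refine (le_trans (le_of_eq ?_) hsum).trans ((ENNReal.ofReal_le_ofReal hreal).trans ?_)
  · rw [h𝒜]
  · rw [mul_comm, ENNReal.ofReal_mul' (by positivity), ENNReal.ofReal_natCast]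

end KineticTriangulation
open KineticTriangulation in
theorem mainTheorem6 (s : ℕ) :
    ∃ C : ℝ, 0 < C ∧
      ∀ (n : ℕ) (p : Motion n), PseudoAlgebraic p s → GeneralPosition p →
      ∀ τ : PseudoTriangle n, (∃ π : Equiv.Perm (Fin n), Appears p τ π) →
        (0 < numInner p τ →
          expectedChanges p τ ≤ ENNReal.ofReal
            (C * (((numEnvelope p τ : ℝ) + numVisibility p τ) * Real.log (numInner p τ)
              + (numInner p τ : ℝ) ^ 2))) ∧
        (numInner p τ = 0 →
          expectedChanges p τ ≤ ENNReal.ofReal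
            (C * ((numEnvelope p τ : ℝ) + numVisibility p τ))) := by
  -- For `N = 1` there are at most `64 s` events of cost `11 + 30` and `3 s` exchanges of cost `12`,
  -- together `2660 s`. The summand `112` is the coefficient of the logarithmic term for `N ≥ 2`.
  refine ⟨2660 * s + 112, by positivity, fun n p hp hg τ hτ => ?_⟩
  obtain ⟨a, e, ha, he, he', hE⟩ := expectedChanges_le hp hg hτ
  have heR : (e : ℝ) ≤ numEnvelope p τ + numVisibility p τ := by exact_mod_cast he
  have haR : (a : ℝ) ≤ 3 * numInner p τ * s := by exact_mod_cast ha
  have heR' : (e : ℝ) ≤ ((numInner p τ : ℝ) + 3) ^ 3 * s := by exact_mod_cast he'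
  have hs : (0 : ℝ) ≤ s := Nat.cast_nonneg s
  have he0 : (0 : ℝ) ≤ e := Nat.cast_nonneg e
  set W : ℝ := (numEnvelope p τ : ℝ) + numVisibility p τ
  refine ⟨fun hN => hE.trans (ENNReal.ofReal_le_ofReal ?_),
    fun hN => hE.trans (ENNReal.ofReal_le_ofReal ?_)⟩
  · obtain h1 | h2 : numInner p τ = 1 ∨ 2 ≤ numInner p τ := by omega
    · simp only [h1, harmonic_succ, harmonic_zero] at haR heR' ⊢
      norm_num at haR heR' ⊢
      linarith
    · have hN2 : (2 : ℝ) ≤ numInner p τ := by exact_mod_cast h2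
      have hharm := harmonic_le_one_add_log (numInner p τ)
      -- This absorbs the constant: `11 + 30 (1 + log N) ≤ 82 log N + 30 log N`.
      have hlog : (1 / 2 : ℝ) ≤ Real.log (numInner p τ) :=
        le_trans (by linarith [Real.log_two_gt_d9]) (Real.log_le_log two_pos hN2)
      have hfst : (a : ℝ) * (6 * (numInner p τ : ℝ) + 6) ≤ 36 * s * (numInner p τ : ℝ) ^ 2 :=
        calc (a : ℝ) * (6 * (numInner p τ : ℝ) + 6)
            ≤ 3 * numInner p τ * s * (12 * numInner p τ) :=
              mul_le_mul haR (by linarith) (by positivity) (by positivity)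
          _ = _ := by ring
      have hsnd : (e : ℝ) * (11 + 30 * (harmonic (numInner p τ) : ℝ)) ≤
          112 * (W * Real.log (numInner p τ)) :=
        calc (e : ℝ) * (11 + 30 * (harmonic (numInner p τ) : ℝ))
            ≤ e * (112 * Real.log (numInner p τ)) :=
              mul_le_mul_of_nonneg_left (by linarith) he0
          _ ≤ W * (112 * Real.log (numInner p τ)) :=
              mul_le_mul_of_nonneg_right heR (by linarith)
          _ = _ := by ring
      have hW : 0 ≤ (s : ℝ) * (W * Real.log (numInner p τ)) :=
        mul_nonneg hs (mul_nonneg (he0.trans heR) (by linarith))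
      have hNs : 0 ≤ (s : ℝ) * (numInner p τ : ℝ) ^ 2 := by positivity
      have hNN : 0 ≤ (numInner p τ : ℝ) ^ 2 := by positivity
      linarith
  -- Without inner points there are no exchanges with corners, and the harmonic number is zero, so
  -- each event costs at most `11`.
  · have ha0 : (a : ℝ) = 0 := by
      have : a = 0 := by simpa [hN] using ha
      simp [this]
    simp only [hN, harmonic_zero, ha0]
    norm_num
    have := mul_nonneg hs (he0.trans heR)
    linarith
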